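/- **Setting.** Let $X$ be a paracompact Hausdorff space and let $\mathfrak g$ be a sheaf of complex Lie algebras on $X$ with a soft resolution $\mathfrak g\to(\mathfrak g^{\cdot},\delta)$ by a sheaf of differential graded Lie algebras (in degrees $\ge 0$). Assume that $H^i(X,\mathfrak g)$ is finite-dimensional for all $i$ and zero for $i\gg0$, and that $H^0(X,\mathfrak g)=0$. Let $E$ be a $\mathfrak g$-module with a soft resolution $E\to (E^{\cdot},\partial)$ by a sheaf of differential graded $\mathfrak g^{\cdot}$-modules compatible with the action of $\mathfrak g$ on $E$ (so $(\mathfrak g,E)$ is an admissible pair). Fix $m\ge 0$. **Notation.** * $\Gamma J_m$ is the Jacobi (Chevalley–Eilenberg) complex of the dg Lie algebra $\Gamma(\mathfrak g^{\cdot})$, truncated at words of length $\le m$: the sum of the graded symmetric powers of length $1,\dots,m$ of $\Gamma(\mathfrak g^{\cdot})[1]$, with its standard coderivation differential. It is augmented to $\mathbb C\oplus\Gamma J_m$ by $\mathbb C$ in degree $0$. * $R_m=R_m(\mathfrak g)=H^0((\mathbb C\oplus\Gamma J_m)^*)$, a commutative $\mathbb C$-algebra with augmentation $R_m\to\mathbb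 C$, whose product is dual to the comultiplication of words; $R_m^*=H^0(\mathbb C\oplus\Gamma J_m)$ is its dual module. * $K_m(\mathfrak g,E)=(\mathbb C\oplus\Gamma J_m)\otimes E^{\cdot}$, with its Chevalley–Eilenberg differential, and ${}^tK_m(\mathfrak g,E)$ is the transposed complex, whose part of degree $r$ consists of the linear maps $\mathbb C\oplus\Gamma J_m\to E^{\cdot}$ of degree $r$. Their cohomology sheaves $\mathcal H^0$ are sheaves of $R_m$-modules. Put $V^m(E)=\mathcal H^0(K_m(\mathfrak g,E))$ and $M_m(\mathfrak g,E)=\mathcal Hom_{R_m}(R_m^*,V^m(E))$. * An element $\varphi\in\mathfrak m_{R_m}\otimes\Gamma(\mathfrak g^1)$, where $\mathfrak m_{R_m}$ is the kernel of the augmentation, is called tautological if $\delta\varphi+\frac12[\varphi,\varphi]=0$ and if its Kodaira–Spencer homomorphism $R_m\to R_m$, which sends the class $[z]$ of a cocycle $z$ to $\sum_{k=0}^m z(\varphi^{\otimes k})$, is the identity. It defines the universal $m$-th order deformation $E_m=E_\varphi=\mathcal H^0(R_m\otimes E^{\cdot},\,\partial+\varphi)$ of $E$. * View ${}^tK_m(\mathfrak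 g,E)$ as a double complex, with the degree in $E^{\cdot}$ as horizontal degree. $L_m(\mathfrak g,E)$ is the complex, with its horizontal differential, of the vertical cohomology in vertical degree $0$. **Theorem.** Tautological elements $\varphi$ exist, and for each of them there are isomorphisms of sheaves of $R_m$-modules, natural in the resolved module $E\to E^{\cdot}$, $$E_m\;\simeq\; M_m(\mathfrak g,E)\;\simeq\;\mathcal H^0\big({}^tK_m(\mathfrak g,E)\big).$$ Moreover 1. $\mathcal H^i(L_m(\mathfrak g,E))=0$ for $i\ne 0$, and $\mathcal H^0(L_m(\mathfrak g,E))\simeq M_m(\mathfrak g,E)$, naturally in $E$ with its resolution; 2. $H^i(X,M_m(\mathfrak g,E))\simeq H^i(\Gamma(L_m(\mathfrak g,E)))$ as $R_m$-modules, for all $i\ge0$. -/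

import Mathlib

open CategoryTheory TopologicalSpace Opposite
open scoped TensorProduct DirectSum

namespace JacobiModuli
noncomputable section

/-! ## Words: the tensor coalgebra with coefficients -/

section Words
variable (V F : Type) [AddCommGroup V] [Module ℂ V] [AddCommGroup F] [Module ℂ F]

/-- `Word V F k` is `V ⊗ (V ⊗ (⋯ ⊗ F))` with `k` factors `V`: words in `k` letters from `V`, with
coefficients in `F`. -/
def Word : ℕ → ModuleCat.{0} ℂ
  | 0 => ModuleCat.of ℂ F
  | k + 1 => ModuleCat.of ℂ (V ⊗[ℂ] Word k)

/-- The direct sum over `k` of the spaces of words in `k` letters, that is `T(V) ⊗ F`. -/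
abbrev Words : Type := ⨁ k, (Word V F k : Type)

variable {V F}
variable {A : Type} [AddCommGroup A] [Module ℂ A]

/-- Put the letter `v` in front of a word. -/
def Word.cons {k : ℕ} : V →ₗ[ℂ] Word V F k →ₗ[ℂ] Word V F (k + 1) :=
  TensorProduct.mk ℂ V (Word V F k)

/-- Linear maps out of words with `k + 1` letters are bilinear in the first letter and the rest. -/
def Word.elim {k : ℕ} (f : V →ₗ[ℂ] Word V F k →ₗ[ℂ] A) : Word V F (k + 1) →ₗ[ℂ] A :=
  TensorProduct.lift f

@[simp] theorem Word.elim_cons {k : ℕ} (f : V →ₗ[ℂ] Word V F k →ₗ[ℂ] A) (v : V)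
    (t : Word V F k) : Word.elim f (Word.cons v t) = f v t :=
  TensorProduct.lift.tmul (f' := f) v t

theorem Word.ext_cons {k : ℕ} {f g : Word V F (k + 1) →ₗ[ℂ] A}
    (h : ∀ v t, f (Word.cons v t) = g (Word.cons v t)) : f = g :=
  TensorProduct.ext' (M := V) (N := Word V F k) h

/-- The inclusion of the words with `k` letters. -/
def ofWord (k : ℕ) : Word V F k →ₗ[ℂ] Words V F :=
  DirectSum.lof ℂ ℕ (fun k => (Word V F k : Type)) k

/-- The words without letters. -/
def base : F →ₗ[ℂ] Words V F := (ofWord 0 : Word V F 0 →ₗ[ℂ] Words V F)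

theorem consAux_ext {f g : Words V F →ₗ[ℂ] A} (h : ∀ k, f ∘ₗ ofWord k = g ∘ₗ ofWord k) : f = g :=
  DirectSum.linearMap_ext ℂ h

/-- Put the letter `v` in front of every word. -/
def consAux (v : V) : Words V F →ₗ[ℂ] Words V F :=
  DirectSum.toModule ℂ ℕ (Words V F) fun k => ofWord (k + 1) ∘ₗ Word.cons v

theorem consAux_of (v : V) (k : ℕ) (t : Word V F k) :
    consAux v (ofWord k t) = ofWord (k + 1) (Word.cons v t) := by
  simp [consAux, ofWord]

/-- `cons v w` puts the letter `v` in front of `w`. -/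
def cons : V →ₗ[ℂ] Words V F →ₗ[ℂ] Words V F where
  toFun := consAux
  map_add' v v' := consAux_ext fun k => LinearMap.ext fun t => by simp [consAux_of]
  map_smul' c v := consAux_ext fun k => LinearMap.ext fun t => by simp [consAux_of]

@[simp] theorem cons_of (v : V) (k : ℕ) (t : Word V F k) :
    cons v (ofWord k t) = ofWord (k + 1) (Word.cons v t) := consAux_of v k t

/-- Linear maps out of `Words V F` by cases: a word has no letter, or it has a first letter. -/
def wcases (f₀ : F →ₗ[ℂ] A) (f₁ : V →ₗ[ℂ] Words V F →ₗ[ℂ] A) : Words V F →ₗ[ℂ] A :=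
  DirectSum.toModule ℂ ℕ A fun k => match k with
    | 0 => (f₀ : (Word V F 0 : Type) →ₗ[ℂ] A)
    | k + 1 => Word.elim (f₁.compl₂ (ofWord k))

@[simp] theorem wcases_base (f₀ : F →ₗ[ℂ] A) (f₁ : V →ₗ[ℂ] Words V F →ₗ[ℂ] A) (e : F) :
    wcases f₀ f₁ (base e) = f₀ e := by
  simp only [wcases, base, ofWord]
  exact DirectSum.toModule_lof (R := ℂ) (ι := ℕ) (M := fun k => (Word V F k : Type)) 0 e

theorem hom_ext_words {f g : Words V F →ₗ[ℂ] A} (h₀ : ∀ e, f (base e) = g (base e))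
    (h₁ : ∀ k v (t : Word V F k), f (cons v (ofWord k t)) = g (cons v (ofWord k t))) : f = g :=
  consAux_ext fun k => match k with
    | 0 => LinearMap.ext h₀
    | k + 1 => Word.ext_cons fun v t => by simpa using h₁ k v t

@[simp] theorem wcases_cons (f₀ : F →ₗ[ℂ] A) (f₁ : V →ₗ[ℂ] Words V F →ₗ[ℂ] A) (v : V)
    (w : Words V F) : wcases f₀ f₁ (cons v w) = f₁ v w := by
  have : wcases f₀ f₁ ∘ₗ cons v = f₁ v := consAux_ext fun k => LinearMap.ext fun t => by
    simp only [LinearMap.comp_apply, cons_of]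
    simp only [wcases, ofWord]
    rw [DirectSum.toModule_lof]
    simp
  exact LinearMap.congr_fun this w

theorem Word.induction {k : ℕ} {p : Word V F (k + 1) → Prop} (t : Word V F (k + 1)) (h0 : p 0)
    (hc : ∀ v s, p (Word.cons v s)) (ha : ∀ x y, p x → p y → p (x + y)) : p t :=
  TensorProduct.induction_on (motive := p) t h0 hc ha

theorem words_induction {p : Words V F → Prop}
    (hb : ∀ e, p (base e)) (hc : ∀ v w, p w → p (cons v w)) (hz : p 0)
    (ha : ∀ w w', p w → p w' → p (w + w')) (w : Words V F) : p w := by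
  have key : ∀ k (t : Word V F k), p (ofWord k t) := by
    intro k
    induction k with
    | zero => exact hb
    | succ k ih =>
      intro t
      refine Word.induction (p := fun t => p (ofWord (k + 1) t)) t (by simpa using hz) ?_ ?_
      · intro v t
        simpa using hc v _ (ih t)
      · intro x y hx hy
        simpa using ha _ _ hx hy
  induction w using DirectSum.induction_on with
  | zero => exact hz
  | of k t => exact key k t
  | add x y hx hy => exact ha _ _ hx hy

theorem hom_ext {f g : Words V F →ₗ[ℂ] A} (h₀ : ∀ e, f (base e) = g (base e))
    (h₁ : ∀ v w, f w = g w → f (cons v w) = g (cons v w)) : f = g := by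
  refine LinearMap.ext fun w => words_induction (p := fun w => f w = g w) h₀ h₁ (by simp) ?_ w
  intro x y hx hy
  simp [hx, hy]

/-- Linear maps out of `Words V F` by recursion: a word without letters is sent to its image under
`f₀`, and `cons v w` is sent to `f₁ v w + f₂ v (image of w)`. -/
def wrecAux (f₀ : F →ₗ[ℂ] A) (f₁ : V →ₗ[ℂ] Words V F →ₗ[ℂ] A) (f₂ : V →ₗ[ℂ] A →ₗ[ℂ] A) :
    ∀ k, Word V F k →ₗ[ℂ] A
  | 0 => (f₀ : (Word V F 0 : Type) →ₗ[ℂ] A)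
  | k + 1 => Word.elim (f₁.compl₂ (ofWord k) + f₂.compl₂ (wrecAux f₀ f₁ f₂ k))

/-- Linear maps out of `Words V F` by recursion: a word without letters is sent to its image under
`f₀`, and `cons v w` is sent to `f₁ v w + f₂ v (image of w)`. -/
def wrec (f₀ : F →ₗ[ℂ] A) (f₁ : V →ₗ[ℂ] Words V F →ₗ[ℂ] A) (f₂ : V →ₗ[ℂ] A →ₗ[ℂ] A) :
    Words V F →ₗ[ℂ] A :=
  DirectSum.toModule ℂ ℕ A (wrecAux f₀ f₁ f₂)

@[simp] theorem wrec_base (f₀ : F →ₗ[ℂ] A) (f₁ : V →ₗ[ℂ] Words V F →ₗ[ℂ] A)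
    (f₂ : V →ₗ[ℂ] A →ₗ[ℂ] A) (e : F) : wrec f₀ f₁ f₂ (base e) = f₀ e :=
  DirectSum.toModule_lof (R := ℂ) (ι := ℕ) (M := fun k => (Word V F k : Type)) 0 e

@[simp] theorem wrec_cons (f₀ : F →ₗ[ℂ] A) (f₁ : V →ₗ[ℂ] Words V F →ₗ[ℂ] A)
    (f₂ : V →ₗ[ℂ] A →ₗ[ℂ] A) (v : V) (w : Words V F) :
    wrec f₀ f₁ f₂ (cons v w) = f₁ v w + f₂ v (wrec f₀ f₁ f₂ w) := by
  have : wrec f₀ f₁ f₂ ∘ₗ cons v = f₁ v + f₂ v ∘ₗ wrec f₀ f₁ f₂ :=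
    consAux_ext fun k => LinearMap.ext fun t => by
      simp only [LinearMap.comp_apply, cons_of, LinearMap.add_apply]
      simp only [wrec, ofWord]
      rw [DirectSum.toModule_lof, DirectSum.toModule_lof]
      simp [ofWord, wrecAux]
  exact LinearMap.congr_fun this w

end Words

section Operators
variable {V F F' : Type} [AddCommGroup V] [Module ℂ V] [AddCommGroup F] [Module ℂ F]
  [AddCommGroup F'] [Module ℂ F']
variable {A : Type} [AddCommGroup A] [Module ℂ A]

/-- The operator induced on words by a map of the coefficients. -/
def mapCoeff (f : F →ₗ[ℂ] F') : Words V F →ₗ[ℂ] Words V F' :=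
  wrec (base ∘ₗ f) 0 cons

/-- The operator applying `p` to each letter. -/
def mapLetters (p : V →ₗ[ℂ] V) : Words V F →ₗ[ℂ] Words V F :=
  wrec base 0 (cons ∘ₗ p)

/-- The extension of operators `n` on letters and `ν` on coefficients to words as a derivation
(without signs). -/
def derivWords (n : V →ₗ[ℂ] V) (ν : F →ₗ[ℂ] F) : Words V F →ₗ[ℂ] Words V F :=
  wrec (base ∘ₗ ν) (cons ∘ₗ n) cons

/-- Combine the letter `v` with what follows it: `v · e = a v e` on coefficients, and the letter
`v` followed by the letter `u` becomes the letter `b v u`. -/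
def combine (b : V →ₗ[ℂ] V →ₗ[ℂ] V) (a : V →ₗ[ℂ] F →ₗ[ℂ] F) :
    V →ₗ[ℂ] Words V F →ₗ[ℂ] Words V F where
  toFun v := wcases (base ∘ₗ a v) (cons ∘ₗ b v)
  map_add' v v' := hom_ext (by simp) (by simp)
  map_smul' c v := hom_ext (by simp) (by simp)

@[simp] theorem combine_base (b : V →ₗ[ℂ] V →ₗ[ℂ] V) (a : V →ₗ[ℂ] F →ₗ[ℂ] F) (v : V) (e : F) :
    combine b a v (base e) = base (a v e) := by simp [combine]

@[simp] theorem combine_cons (b : V →ₗ[ℂ] V →ₗ[ℂ] V) (a : V →ₗ[ℂ] F →ₗ[ℂ] F) (v u : V)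
    (w : Words V F) : combine b a v (cons u w) = cons (b v u) w := by simp [combine]

/-- The differential of the bar construction, with `P` the parity operator on the letters: on
`v₁ v₂ ⋯ v_k e` it is the sum of the terms
`P v₁ ⋯ P v_{i-1} (δ v_i) v_{i+1} ⋯ e` and `P v₁ ⋯ P v_{i-1} (b v_i v_{i+1}) v_{i+2} ⋯ e` and
`P v₁ ⋯ P v_{k-1} (a v_k e)` and `P v₁ ⋯ P v_k (d e)`. -/
def barD (P δ : V →ₗ[ℂ] V) (b : V →ₗ[ℂ] V →ₗ[ℂ] V) (d : F →ₗ[ℂ] F) (a : V →ₗ[ℂ] F →ₗ[ℂ] F) :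
    Words V F →ₗ[ℂ] Words V F :=
  wrec (base ∘ₗ d) (cons ∘ₗ δ + combine b a) (cons ∘ₗ P)

/-- Linear forms on words with trivial coefficients. -/
abbrev Form (V : Type) [AddCommGroup V] [Module ℂ V] : Type := Words V ℂ →ₗ[ℂ] ℂ

/-- For a linear form `z` and a letter `v`, the linear form `w ↦ z (v w)`. -/
def Form.shift (v : V) (z : Form V) : Form V := z ∘ₗ cons v

@[simp] theorem Form.shift_apply (v : V) (z : Form V) (w : Words V ℂ) :
    Form.shift v z w = z (cons v w) := rfl

/-- Auxiliary operator for `contr`. -/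
def shiftAux : V →ₗ[ℂ] (Form V →ₗ[ℂ] A) →ₗ[ℂ] (Form V →ₗ[ℂ] A) :=
  LinearMap.mk₂ ℂ
    (fun v g => g ∘ₗ (LinearMap.lcomp ℂ ℂ (cons v)))
    (fun v v' g => LinearMap.ext fun z => by
      simp only [LinearMap.comp_apply, LinearMap.add_apply, ← map_add]
      exact congrArg g (LinearMap.ext fun w => by simp))
    (fun c v g => LinearMap.ext fun z => by
      simp only [LinearMap.comp_apply, LinearMap.smul_apply, ← map_smul]
      exact congrArg g (LinearMap.ext fun w => by simp))
    (fun v g g' => LinearMap.ext fun z => by simp)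
    (fun c v g => LinearMap.ext fun z => by simp)

/-- `contrAux w z = contr z w`. -/
def contrAux : Words V F →ₗ[ℂ] (Form V →ₗ[ℂ] Words V F) :=
  wrec (LinearMap.smulRightₗ (LinearMap.applyₗ (base 1)) ∘ₗ base)
    (cons.compr₂ (LinearMap.smulRightₗ (LinearMap.applyₗ (base 1)))) shiftAux

/-- Contraction of words with a linear form through deconcatenation:
`v₁ ⋯ v_k e` is sent to the sum over `i` of `z(v₁ ⋯ v_i) v_{i+1} ⋯ v_k e`. -/
def contr (z : Form V) : Words V F →ₗ[ℂ] Words V F := contrAux.flip z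

@[simp] theorem contr_base (z : Form V) (e : F) :
    contr z (base e) = z (base 1) • (base e : Words V F) := by
  simp [contr, contrAux]

@[simp] theorem contr_cons (z : Form V) (v : V) (w : Words V F) :
    contr z (cons v w) = z (base 1) • cons v w + contr (z.shift v) w := by
  simp only [contr, contrAux, LinearMap.flip_apply, wrec_cons]
  simp [shiftAux]
  rfl

theorem contr_add (z z' : Form V) (w : Words V F) : contr (z + z') w = contr z w + contr z' w := by
  simp [contr]

theorem contr_smul (c : ℂ) (z : Form V) (w : Words V F) : contr (c • z) w = c • contr z w := by
  simp [contr]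

theorem contr_zero (w : Words V F) : contr (0 : Form V) w = 0 := by simp [contr]

/-- The convolution product of linear forms: `(z * z')(v₁ ⋯ v_k)` is the sum over `i` of
`z(v₁ ⋯ v_i) z'(v_{i+1} ⋯ v_k)`. -/
def Form.conv (z z' : Form V) : Form V := z' ∘ₗ contr z

/-- The counit, which is the unit for convolution. -/
def Form.unit (V : Type) [AddCommGroup V] [Module ℂ V] : Form V := wcases LinearMap.id 0

/-- The part without letters. -/
def coeff : Words V F →ₗ[ℂ] F := wcases LinearMap.id 0

@[simp] theorem coeff_base (e : F) : coeff (base e : Words V F) = e := by simp [coeff]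
@[simp] theorem coeff_cons (v : V) (w : Words V F) : coeff (cons v w) = 0 := by simp [coeff]

theorem contr_unit (w : Words V F) : contr (Form.unit V) w = w := by
  have : contr (Form.unit V) = (LinearMap.id : Words V F →ₗ[ℂ] Words V F) := by
    refine hom_ext (by simp [Form.unit]) fun v w _ => ?_
    have : (Form.unit V).shift v = 0 := LinearMap.ext fun w => by simp [Form.unit]
    have h1 : Form.unit V (base 1) = 1 := by simp [Form.unit]
    simp [this, contr_zero, h1]
  rw [this]; rfl

theorem contr_conv (z z' : Form V) (w : Words V F) :
    contr (z.conv z') w = contr z' (contr z w) := by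
  revert z z'
  refine words_induction (p := fun w => ∀ z z' : Form V,
    contr (z.conv z') w = contr z' (contr z w)) ?_ ?_ ?_ ?_ w
  · intro e z z'
    simp [Form.conv, smul_smul]
  · intro v w ih z z'
    have h : (z.conv z').shift v = z (base 1) • z'.shift v + (z.shift v).conv z' :=
      LinearMap.ext fun t => by simp [Form.conv]
    simp only [contr_cons, h, contr_add, contr_smul, ih, map_add, map_smul, smul_add]
    simp [Form.conv, smul_smul, add_assoc]
  · simp
  · intro x y hx hy z z'
    simp [hx, hy]

theorem barD_base (P δ : V →ₗ[ℂ] V) (b : V →ₗ[ℂ] V →ₗ[ℂ] V) (d : F →ₗ[ℂ] F)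
    (a : V →ₗ[ℂ] F →ₗ[ℂ] F) (e : F) : barD P δ b d a (base e) = base (d e) := by simp [barD]

theorem barD_cons (P δ : V →ₗ[ℂ] V) (b : V →ₗ[ℂ] V →ₗ[ℂ] V) (d : F →ₗ[ℂ] F)
    (a : V →ₗ[ℂ] F →ₗ[ℂ] F) (v : V) (w : Words V F) : barD P δ b d a (cons v w) =
      cons (δ v) w + combine b a v w + cons (P v) (barD P δ b d a w) := by simp [barD]

/-- The differential of words is a coderivation. -/
theorem contr_barD (P δ : V →ₗ[ℂ] V) (b : V →ₗ[ℂ] V →ₗ[ℂ] V) (d : F →ₗ[ℂ] F)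
    (a : V →ₗ[ℂ] F →ₗ[ℂ] F) (z : Form V) (w : Words V F) :
    contr z (barD P δ b d a w) =
      contr (z ∘ₗ barD P δ b 0 0) w + barD P δ b d a (contr (z ∘ₗ mapLetters P) w) := by
  revert z
  refine words_induction (p := fun w => ∀ z : Form V, contr z (barD P δ b d a w) =
      contr (z ∘ₗ barD P δ b 0 0) w + barD P δ b d a (contr (z ∘ₗ mapLetters P) w)) ?_ ?_ ?_ ?_ w
  · intro e z
    simp [barD_base, mapLetters]
  · intro v w ih z
    have h0 : Form.shift v (z ∘ₗ mapLetters P) = (z.shift (P v)) ∘ₗ mapLetters P :=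
      LinearMap.ext fun t => by simp [mapLetters]
    have h1 : Form.shift v (z ∘ₗ barD P δ b 0 0) = z.shift (δ v) + z ∘ₗ combine b 0 v +
        (z.shift (P v)) ∘ₗ barD P δ b 0 0 := LinearMap.ext fun t => by simp [barD_cons]
    have h2 : contr z (combine b a v w) =
        contr (z ∘ₗ combine b 0 v) w + z (base 1) • combine b a v w := by
      refine words_induction (p := fun w => contr z (combine b a v w) =
        contr (z ∘ₗ combine b 0 v) w + z (base 1) • combine b a v w) ?_ ?_ ?_ ?_ w
      · intro e; simp
      · intro u t _
        have : Form.shift u (z ∘ₗ combine b 0 v) = z.shift (b v u) := LinearMap.ext fun t => by simp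
        simp [this, add_comm]
      · simp
      · intro x y hx hy
        simp only [map_add, hx, hy, smul_add]; abel
    simp only [barD_cons, map_add, contr_cons, h0, h1, h2, contr_add, ih, map_smul, smul_add,
      LinearMap.comp_apply]
    have h3 : z (mapLetters P (base 1)) = z (base 1) := by simp [mapLetters]
    simp only [barD_base, h3, map_zero, LinearMap.zero_apply, zero_smul, zero_add]
    abel
  · simp
  · intro x y hx hy z
    simp only [map_add, hx, hy]; abel

theorem contr_derivWords (n : V →ₗ[ℂ] V) (ν : F →ₗ[ℂ] F) (z : Form V) (w : Words V F) :
    contr z (derivWords n ν w) =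
      contr (z ∘ₗ derivWords n 0) w + derivWords n ν (contr z w) := by
  revert z
  refine words_induction (p := fun w => ∀ z : Form V, contr z (derivWords n ν w) =
      contr (z ∘ₗ derivWords n 0) w + derivWords n ν (contr z w)) ?_ ?_ ?_ ?_ w
  · intro e z
    simp [derivWords]
  · intro v w ih z
    have hd : ∀ (v : V) (w : Words V F), derivWords n ν (cons v w) =
      cons (n v) w + cons v (derivWords n ν w) := fun v w => by simp [derivWords]
    have h1 : Form.shift v (z ∘ₗ derivWords n 0) = z.shift (n v) +
        (z.shift v) ∘ₗ derivWords n 0 := LinearMap.ext fun t => by simp [derivWords]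
    simp only [hd, map_add, contr_cons, h1, contr_add, ih, map_smul, smul_add,
      LinearMap.comp_apply]
    have h3 : z (derivWords n 0 (base 1)) = 0 := by simp [derivWords]
    simp only [h3, zero_smul, zero_add]
    abel
  · simp
  · intro x y hx hy z
    simp only [map_add, hx, hy]; abel

theorem mapCoeff_contr (f : F →ₗ[ℂ] F') (z : Form V) (w : Words V F) :
    mapCoeff f (contr z w) = contr z (mapCoeff f w) := by
  revert z
  refine words_induction (p := fun w => ∀ z : Form V,
    mapCoeff f (contr z w) = contr z (mapCoeff f w)) ?_ ?_ ?_ ?_ w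
  · intro e z; simp [mapCoeff]
  · intro v w ih z
    have hd : ∀ (v : V) (w : Words V F), mapCoeff f (cons v w) = cons v (mapCoeff f w) :=
      fun v w => by simp [mapCoeff]
    simp [hd, ih]
  · simp
  · intro x y hx hy z; simp [hx, hy]

theorem coeff_contr (l : F →ₗ[ℂ] ℂ) (z : Form V) (w : Words V F) :
    l (coeff (contr z w)) = z (mapCoeff l w) := by
  revert z
  refine words_induction (p := fun w => ∀ z : Form V,
    l (coeff (contr z w)) = z (mapCoeff l w)) ?_ ?_ ?_ ?_ w
  · intro e z
    have : (base (l e) : Words V ℂ) = l e • base 1 := by rw [← map_smul]; simp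
    simp [mapCoeff, this, mul_comm]
  · intro v w ih z
    have hd : ∀ (v : V) (w : Words V F), mapCoeff l (cons v w) = cons v (mapCoeff l w) :=
      fun v w => by simp [mapCoeff]
    simp [hd, ih]
  · simp
  · intro x y hx hy z; simp [hx, hy]

end Operators

section Symmetric
variable {V F F' : Type} [AddCommGroup V] [Module ℂ V] [AddCommGroup F] [Module ℂ F]
  [AddCommGroup F'] [Module ℂ F']
variable {A : Type} [AddCommGroup A] [Module ℂ A]

/-- Trilinear maps of the first two letters and the rest, as linear maps on words. -/
def wcases₂ (f : V →ₗ[ℂ] V →ₗ[ℂ] Words V F →ₗ[ℂ] A) : Words V F →ₗ[ℂ] A :=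
  wcases 0
    { toFun := fun v => wcases 0 (f v)
      map_add' := fun v v' => hom_ext (by simp) (by simp)
      map_smul' := fun c v => hom_ext (by simp) (by simp) }

@[simp] theorem wcases₂_base (f : V →ₗ[ℂ] V →ₗ[ℂ] Words V F →ₗ[ℂ] A) (e : F) :
    wcases₂ f (base e) = 0 := by simp [wcases₂]

@[simp] theorem wcases₂_cons_base (f : V →ₗ[ℂ] V →ₗ[ℂ] Words V F →ₗ[ℂ] A) (v : V) (e : F) :
    wcases₂ f (cons v (base e)) = 0 := by simp [wcases₂]

@[simp] theorem wcases₂_cons_cons (f : V →ₗ[ℂ] V →ₗ[ℂ] Words V F →ₗ[ℂ] A) (v u : V)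
    (w : Words V F) : wcases₂ f (cons v (cons u w)) = f v u w := by simp [wcases₂]

/-- For an involution `P` of `V` (the parity operator), the signed exchange of the first two
letters: for `v`, `u` in the `±1`-eigenspaces of `P` it sends `v u w` to `u v w`, with the sign `-1`
if both eigenvalues are `-1`. -/
def swapHead (P : V →ₗ[ℂ] V) : Words V F →ₗ[ℂ] Words V F :=
  wcases₂ <| (1 / 2 : ℂ) • LinearMap.mk₂ ℂ
    (fun v u => cons u ∘ₗ cons v + cons (P u) ∘ₗ cons v + cons u ∘ₗ cons (P v)
      - cons (P u) ∘ₗ cons (P v))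
    (fun v v' u => LinearMap.ext fun w => by simp; abel)
    (fun c v u => LinearMap.ext fun w => by simp [smul_add, smul_sub])
    (fun v u u' => LinearMap.ext fun w => by simp; abel)
    (fun c v u => LinearMap.ext fun w => by simp [smul_add, smul_sub])

theorem swapHead_cons_cons (P : V →ₗ[ℂ] V) (v u : V) (w : Words V F) :
    swapHead P (cons v (cons u w)) = (1 / 2 : ℂ) • (cons u (cons v w) + cons (P u) (cons v w)
      + cons u (cons (P v) w) - cons (P u) (cons (P v) w)) := by
  simp [swapHead]

/-- The words in `k` letters with coefficients in `F` which are invariant under the signed action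
of the symmetric group on the letters, that is the `k`-th graded symmetric power of `V`
(as invariants) tensored with `F`: recursively, the words in `k + 2` letters which are
symmetric in the last `k + 1` letters and invariant under the signed exchange of the first two. -/
def symWords (P : V →ₗ[ℂ] V) : ℕ → Submodule ℂ (Words V F)
  | 0 => LinearMap.range base
  | 1 => Submodule.map₂ cons ⊤ (LinearMap.range base)
  | k + 2 => Submodule.map₂ cons ⊤ (symWords P (k + 1)) ⊓
      LinearMap.ker (swapHead P - LinearMap.id)

/-- The symmetric words with at most `m` letters. -/
def symUpTo (P : V →ₗ[ℂ] V) (m : ℕ) : Submodule ℂ (Words V F) :=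
  ⨆ k : Fin (m + 1), symWords P k

theorem symWords_succ_le (P : V →ₗ[ℂ] V) (k : ℕ) :
    (symWords P (k + 1) : Submodule ℂ (Words V F)) ≤ Submodule.map₂ cons ⊤ (symWords P k) := by
  cases k with
  | zero => exact le_rfl
  | succ k => exact inf_le_left

theorem symWords_swap {P : V →ₗ[ℂ] V} {k : ℕ} {w : Words V F} (h : w ∈ symWords P (k + 2)) :
    swapHead P w = w := by
  have := h.2
  simpa [sub_eq_zero] using this

theorem symWords_le {P : V →ₗ[ℂ] V} {k m : ℕ} (h : k ≤ m) :
    (symWords P k : Submodule ℂ (Words V F)) ≤ symUpTo P m :=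
  le_iSup (fun k : Fin (m + 1) => (symWords P k : Submodule ℂ (Words V F))) ⟨k, by omega⟩

theorem symUpTo_mono {P : V →ₗ[ℂ] V} {k m : ℕ} (h : k ≤ m) :
    (symUpTo P k : Submodule ℂ (Words V F)) ≤ symUpTo P m :=
  iSup_le fun j => symWords_le (by omega)

theorem symUpTo_induction {P : V →ₗ[ℂ] V} {m : ℕ} {p : Submodule ℂ (Words V F)}
    (h : ∀ k ≤ m, ∀ w ∈ symWords P k, w ∈ p) {w : Words V F} (hw : w ∈ symUpTo P m) : w ∈ p := by
  have : (symUpTo P m : Submodule ℂ (Words V F)) ≤ p :=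
    iSup_le fun k w hw => h k (by omega) w hw
  exact this hw

/-- Two linear maps which agree on the words `cons v t` with `t` symmetric agree on symmetric
words. -/
theorem symWords_ext {P : V →ₗ[ℂ] V} {k : ℕ} {f g : Words V F →ₗ[ℂ] A}
    (h : ∀ v, ∀ t ∈ symWords P k, f (cons v t) = g (cons v t)) {w : Words V F}
    (hw : w ∈ symWords P (k + 1)) : f w = g w := by
  have : (symWords P (k + 1) : Submodule ℂ (Words V F)) ≤ LinearMap.eqLocus f g :=
    (symWords_succ_le P k).trans (Submodule.map₂_le.2 fun v _ t ht => h v t ht)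
  exact this hw

theorem contr_mem {P : V →ₗ[ℂ] V} {m : ℕ} (z : Form V) {w : Words V F} (hw : w ∈ symUpTo P m) :
    contr z w ∈ symUpTo P m := by
  have key : ∀ k, ∀ w ∈ (symWords P k : Submodule ℂ (Words V F)), ∀ z : Form V,
      contr z w ∈ symUpTo P k := by
    intro k
    induction k with
    | zero =>
      rintro _ ⟨e, rfl⟩ z
      rw [contr_base]
      exact Submodule.smul_mem _ _ (symWords_le le_rfl ⟨e, rfl⟩)
    | succ k ih =>
      intro w hw z
      set q : Submodule ℂ (Words V F) := symUpTo P (k + 1)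
      have h1 : q.mkQ (contr z w) = q.mkQ (z (base 1) • w) := by
        refine symWords_ext (f := q.mkQ ∘ₗ contr z) (g := q.mkQ ∘ₗ (z (base 1) • LinearMap.id))
          (fun v t ht => ?_) hw
        have : q.mkQ (contr (z.shift v) t) = 0 := by
          simpa using symUpTo_mono (Nat.le_succ k) (ih t ht _)
        simp only [LinearMap.comp_apply, contr_cons, map_add, this]
        simp
      have h2 : z (base 1) • w ∈ q := Submodule.smul_mem _ _ (symWords_le le_rfl hw)
      have h3 : q.mkQ (contr z w) = 0 := by
        rw [h1, Submodule.mkQ_apply, Submodule.Quotient.mk_eq_zero]; exact h2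
      rwa [Submodule.mkQ_apply, Submodule.Quotient.mk_eq_zero] at h3
  refine symUpTo_induction (p := (symUpTo P m).comap (contr z)) (fun k hk w hw => ?_) hw
  exact symUpTo_mono hk (key k w hw z)

/-- A linear form has parity `ε` if changing the words by the parity operator changes its values by
the factor `ε`. -/
theorem shift_parity {P : V →ₗ[ℂ] V} {ε η : ℂ} {z : Form V} (hz : z ∘ₗ mapLetters P = ε • z)
    {v : V} (hv : P v = η • v) (hη : η * η = 1) :
    (z.shift v) ∘ₗ mapLetters P = (ε * η) • z.shift v := by
  refine LinearMap.ext fun t => ?_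
  have h := LinearMap.congr_fun hz (cons v t)
  have h2 : mapLetters P (cons v t) = cons (P v) (mapLetters P t) := by simp [mapLetters]
  simp only [LinearMap.comp_apply, h2, hv, map_smul, LinearMap.smul_apply, smul_eq_mul] at h
  simp only [LinearMap.comp_apply, Form.shift_apply, LinearMap.smul_apply, smul_eq_mul]
  calc z (cons v (mapLetters P t)) = η * (η * z (cons v (mapLetters P t))) := by
        rw [← mul_assoc, hη, one_mul]
    _ = _ := by rw [h]; ring

/-- The identity for `ε = 1`, the parity operator for `ε = -1`. -/
def parityPow (P : V →ₗ[ℂ] V) (ε : ℂ) : V →ₗ[ℂ] V :=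
  ((1 + ε) / 2) • LinearMap.id + ((1 - ε) / 2) • P

@[simp] theorem parityPow_one (P : V →ₗ[ℂ] V) : parityPow P 1 = LinearMap.id := by
  ext v; simp [parityPow]

@[simp] theorem parityPow_neg_one (P : V →ₗ[ℂ] V) : parityPow P (-1) = P := by
  ext v; simp [parityPow]

theorem eigen_split {P : V →ₗ[ℂ] V} (hP : P ∘ₗ P = LinearMap.id) {p : V → Prop}
    (h : ∀ v η, (η = 1 ∨ η = -1) → P v = (η : ℂ) • v → p v) (ha : ∀ v v', p v → p v' → p (v + v'))
    (v : V) : p v := by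
  have hPP : P (P v) = v := LinearMap.congr_fun hP v
  have e : v = (1 / 2 : ℂ) • (v + P v) + (1 / 2 : ℂ) • (v - P v) := by
    rw [← smul_add]; simp [← two_smul ℂ v, smul_smul]
  rw [e]
  refine ha _ _ (h _ 1 (Or.inl rfl) ?_) (h _ (-1) (Or.inr rfl) ?_)
  · simp [hPP, add_comm]
  · simp only [map_smul, map_sub, hPP, neg_smul, one_smul, ← smul_neg, neg_sub]

theorem coeff_wcases (p : V →ₗ[ℂ] V) (g : Words V F →ₗ[ℂ] Words V F) (w : Words V F) :
    coeff (wcases 0 ((cons ∘ₗ p).compl₂ g) w) = 0 := by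
  have : coeff ∘ₗ wcases 0 ((cons ∘ₗ p).compl₂ g) = 0 := hom_ext (by simp) (by simp)
  exact LinearMap.congr_fun this w

/-- On symmetric words the first letter may be kept by a contraction: the contraction is the sum
of the full contraction and of the contraction of the letters after the first one. -/
theorem contr_symWords {P : V →ₗ[ℂ] V} (hP : P ∘ₗ P = LinearMap.id) (k : ℕ) :
    ∀ w ∈ (symWords P k : Submodule ℂ (Words V F)), ∀ (z : Form V) (ε : ℂ), (ε = 1 ∨ ε = -1) →
      z ∘ₗ mapLetters P = ε • z →
      contr z w = base (coeff (contr z w)) +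
        wcases 0 ((cons ∘ₗ parityPow P ε).compl₂ (contr z)) w := by
  have hone : ∀ (z : Form V) (ε : ℂ), (ε = 1 ∨ ε = -1) → z ∘ₗ mapLetters P = ε • z → ∀ (v : V)
      (x : Words V F), z (base 1) • cons (parityPow P ε v) x = z (base 1) • cons v x := by
    rintro z ε (rfl | rfl) hz v x
    · simp
    · have := LinearMap.congr_fun hz (base 1)
      simp [mapLetters] at this
      have h0 : z (base 1) = 0 := by linear_combination this / 2
      simp [h0]
  induction k with
  | zero =>
    rintro _ ⟨e, rfl⟩ z ε hε hz
    simp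
  | succ k ih =>
    intro w hw z ε hε hz
    cases k with
    | zero =>
      refine symWords_ext (f := contr z) (g := base ∘ₗ coeff ∘ₗ contr z +
        wcases 0 ((cons ∘ₗ parityPow P ε).compl₂ (contr z))) (fun v t ht => ?_) hw
      obtain ⟨e, rfl⟩ := ht
      have := hone z ε hε hz v
      simp only [LinearMap.add_apply, LinearMap.comp_apply, contr_cons, contr_base, wcases_cons,
        map_add, map_smul, coeff_cons, coeff_base, LinearMap.compl₂_apply, this]
      simp [add_comm]
    | succ k =>
      -- the part of the contraction where the second letter is kept
      let Θ : Words V F →ₗ[ℂ] Words V F := wcases₂ <| LinearMap.mk₂ ℂ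
        (fun u v => cons (parityPow P ε u) ∘ₗ contr (z.shift v))
        (fun u u' v => LinearMap.ext fun w => by simp)
        (fun c u v => LinearMap.ext fun w => by simp)
        (fun u v v' => LinearMap.ext fun w => by
          have : z.shift (v + v') = z.shift v + z.shift v' := LinearMap.ext fun t => by simp
          simp [this, contr_add])
        (fun c u v => LinearMap.ext fun w => by
          have : z.shift (c • v) = c • z.shift v := LinearMap.ext fun t => by simp
          simp [this, contr_smul])
      have hPP : ∀ v, P (P v) = v := fun v => LinearMap.congr_fun hP v
      have h1 : contr z w = z (base 1) • w + base (coeff (contr z w)) + Θ (swapHead P w) := by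
        refine symWords_ext (f := contr z) (g := z (base 1) • LinearMap.id +
          base ∘ₗ coeff ∘ₗ contr z + Θ ∘ₗ swapHead P) (fun v t ht => ?_) hw
        revert v
        refine eigen_split hP ?_ ?_
        · intro v η hη hv
          have hηη : η * η = 1 := by rcases hη with rfl | rfl <;> norm_num
          have hεη : ε * η = 1 ∨ ε * η = -1 := by
            rcases hη with rfl | rfl <;> rcases hε with rfl | rfl <;> norm_num
          have ih' := ih t ht (z.shift v) (ε * η) hεη (shift_parity hz hv hηη)
          have h2 : wcases 0 ((cons ∘ₗ parityPow P (ε * η)).compl₂ (contr (z.shift v))) t =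
              Θ (swapHead P (cons v t)) := by
            refine symWords_ext (f := wcases 0 ((cons ∘ₗ parityPow P (ε * η)).compl₂
              (contr (z.shift v)))) (g := Θ ∘ₗ swapHead P ∘ₗ cons v) (fun u s _ => ?_) ht
            simp only [wcases_cons, LinearMap.compl₂_apply, LinearMap.comp_apply,
              swapHead_cons_cons, hv, Θ, map_smul, map_add, map_sub, wcases₂_cons_cons,
              LinearMap.mk₂_apply, LinearMap.smul_apply]
            rcases hη with rfl | rfl <;> rcases hε with rfl | rfl
            · simp only [one_smul, mul_one, parityPow_one, LinearMap.id_apply]; module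
            · simp only [one_smul, mul_one, parityPow_neg_one]; module
            · simp only [one_mul, parityPow_one, parityPow_neg_one, LinearMap.id_apply]; module
            · simp only [mul_neg, mul_one, neg_neg, parityPow_one, parityPow_neg_one,
                LinearMap.id_apply, hPP]; module
          simp only [LinearMap.add_apply, LinearMap.comp_apply, contr_cons, map_add, map_smul,
            coeff_cons, smul_zero, zero_add, LinearMap.smul_apply, LinearMap.id_apply, ← h2]
          rw [ih']
          simp [add_assoc, coeff_wcases]
        · intro v v' h h'
          rw [map_add, LinearMap.add_apply, map_add, map_add, h, h']
      rw [symWords_swap hw] at h1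
      have h3 : wcases 0 ((cons ∘ₗ parityPow P ε).compl₂ (contr z)) w =
          z (base 1) • w + Θ w := by
        refine symWords_ext (f := wcases 0 ((cons ∘ₗ parityPow P ε).compl₂ (contr z)))
          (g := z (base 1) • LinearMap.id + Θ) (fun v t ht => ?_) hw
        refine symWords_ext (f := wcases 0 ((cons ∘ₗ parityPow P ε).compl₂ (contr z)) ∘ₗ cons v)
          (g := (z (base 1) • LinearMap.id + Θ) ∘ₗ cons v) (fun u s _ => ?_) ht
        have := hone z ε hε hz v
        simp only [wcases_cons, LinearMap.compl₂_apply, LinearMap.comp_apply, contr_cons, map_add,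
          map_smul, Θ, wcases₂_cons_cons, LinearMap.mk₂_apply, LinearMap.add_apply,
          LinearMap.smul_apply, LinearMap.id_apply]
        rw [this]
      rw [h3]
      nth_rewrite 1 [h1]
      abel

theorem contr_symUpTo {P : V →ₗ[ℂ] V} (hP : P ∘ₗ P = LinearMap.id) {m : ℕ} {w : Words V F}
    (hw : w ∈ symUpTo P m) {z : Form V} {ε : ℂ} (hε : ε = 1 ∨ ε = -1)
    (hz : z ∘ₗ mapLetters P = ε • z) :
      contr z w = base (coeff (contr z w)) +
        wcases 0 ((cons ∘ₗ parityPow P ε).compl₂ (contr z)) w :=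
  LinearMap.mem_eqLocus.1 <| symUpTo_induction (p := LinearMap.eqLocus (contr z)
      (base ∘ₗ coeff ∘ₗ contr z + wcases 0 ((cons ∘ₗ parityPow P ε).compl₂ (contr z))))
    (fun k _ w hw => LinearMap.mem_eqLocus.2 (contr_symWords hP k w hw z ε hε hz)) hw

theorem mapCoeff_cons (f : F →ₗ[ℂ] F') (v : V) (w : Words V F) :
    mapCoeff f (cons v w) = cons v (mapCoeff f w) := by simp [mapCoeff]

theorem mapCoeff_base (f : F →ₗ[ℂ] F') (e : F) :
    mapCoeff f (base e : Words V F) = base (f e) := by simp [mapCoeff]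

theorem mapCoeff_symWords (P : V →ₗ[ℂ] V) (f : F →ₗ[ℂ] F') (k : ℕ) {w : Words V F}
    (hw : w ∈ symWords P k) : mapCoeff f w ∈ symWords P k := by
  have h2 : ∀ k, (∀ w : Words V F, w ∈ symWords P k → mapCoeff f w ∈ symWords P k) →
      ∀ w : Words V F, w ∈ Submodule.map₂ cons ⊤ (symWords P k) →
      mapCoeff f w ∈ Submodule.map₂ cons ⊤ (symWords P k) := by
    intro k ih w hw
    have : Submodule.map₂ cons ⊤ (symWords P k) ≤
        (Submodule.map₂ cons ⊤ (symWords P k)).comap (mapCoeff (V := V) f) :=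
      Submodule.map₂_le.2 fun v _ t ht => by
        rw [Submodule.mem_comap, mapCoeff_cons]
        exact Submodule.apply_mem_map₂ _ trivial (ih t ht)
    exact this hw
  induction k generalizing w with
  | zero => obtain ⟨e, rfl⟩ := hw; exact ⟨f e, (mapCoeff_base f e).symm⟩
  | succ k ih =>
    cases k with
    | zero => exact h2 0 (fun w => ih) w hw
    | succ k =>
      refine ⟨h2 (k + 1) (fun w => ih) w hw.1, ?_⟩
      have h3 : swapHead P (mapCoeff f w) = mapCoeff f (swapHead P w) := by
        refine symWords_ext (f := swapHead P ∘ₗ mapCoeff f) (g := mapCoeff f ∘ₗ swapHead P)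
          (fun v t ht => ?_) hw
        refine symWords_ext (f := swapHead P ∘ₗ mapCoeff f ∘ₗ cons v)
          (g := mapCoeff f ∘ₗ swapHead P ∘ₗ cons v) (fun u s _ => ?_) ht
        simp [mapCoeff_cons, swapHead_cons_cons]
      simp [h3, symWords_swap hw]

theorem mapCoeff_symUpTo (P : V →ₗ[ℂ] V) (f : F →ₗ[ℂ] F') (m : ℕ) {w : Words V F}
    (hw : w ∈ symUpTo P m) : mapCoeff f w ∈ symUpTo P m :=
  symUpTo_induction (p := (symUpTo P m).comap (mapCoeff f))
    (fun _ hk _ hw => symWords_le hk (mapCoeff_symWords P f _ hw)) hw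

/-- A homogeneous linear form which vanishes on symmetric words contracts symmetric words to 0. -/
theorem contr_eq_zero {P : V →ₗ[ℂ] V} (hP : P ∘ₗ P = LinearMap.id) {m : ℕ} {z : Form V} {ε : ℂ}
    (hε : ε = 1 ∨ ε = -1) (hz : z ∘ₗ mapLetters P = ε • z)
    (h : ∀ w ∈ symUpTo P m, z w = 0) {w : Words V F} (hw : w ∈ symUpTo P m) : contr z w = 0 := by
  have key : ∀ k ≤ m, ∀ w ∈ (symWords P k : Submodule ℂ (Words V F)), contr z w = 0 := by
    intro k
    induction k with
    | zero =>
      rintro - _ ⟨e, rfl⟩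
      rw [contr_base, h _ (symWords_le (Nat.zero_le m) ⟨1, rfl⟩), zero_smul]
    | succ k ih =>
      intro hk w hw
      rw [contr_symWords hP _ w hw z ε hε hz]
      have h1 : coeff (contr z w) = 0 := by
        rw [← Module.forall_dual_apply_eq_zero_iff ℂ]
        intro l
        rw [coeff_contr]
        exact h _ (mapCoeff_symUpTo P l m (symWords_le hk hw))
      have h2 : wcases 0 ((cons ∘ₗ parityPow P ε).compl₂ (contr z)) w = 0 := by
        refine symWords_ext (f := wcases 0 ((cons ∘ₗ parityPow P ε).compl₂ (contr z)))
          (g := 0) (fun v t ht => ?_) hw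
        simp [ih (by omega) t ht]
      rw [h1, h2]; simp
  exact symUpTo_induction (p := LinearMap.ker (contr z)) (fun k hk w hw => key k hk w hw) hw

/-- On symmetric words the contraction with an even form commutes with all contractions. -/
theorem contr_comm {P : V →ₗ[ℂ] V} (hP : P ∘ₗ P = LinearMap.id) {m : ℕ} {z : Form V}
    (hz : z ∘ₗ mapLetters P = z) (a : Form V) {w : Words V F} (hw : w ∈ symUpTo P m) :
    contr a (contr z w) = contr z (contr a w) := by
  have key : ∀ k, ∀ w ∈ (symWords P k : Submodule ℂ (Words V F)), ∀ a : Form V,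
      contr a (contr z w) = contr z (contr a w) := by
    intro k
    induction k with
    | zero =>
      rintro _ ⟨e, rfl⟩ a
      simp [smul_smul, mul_comm]
    | succ k ih =>
      intro w hw a
      have hz' : z ∘ₗ mapLetters P = (1 : ℂ) • z := by simpa using hz
      have h1 := contr_symWords hP _ w hw z 1 (Or.inl rfl) hz'
      have h2 : contr a (wcases 0 ((cons ∘ₗ parityPow P 1).compl₂ (contr z)) w) =
          a (base 1) • wcases 0 ((cons ∘ₗ parityPow P 1).compl₂ (contr z)) w
          + contr z (contr a w) - a (base 1) • contr z w := by
        refine symWords_ext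
          (f := contr a ∘ₗ wcases 0 ((cons ∘ₗ parityPow P 1).compl₂ (contr z)))
          (g := a (base 1) • wcases 0 ((cons ∘ₗ parityPow P 1).compl₂ (contr z))
          + contr z ∘ₗ contr a - a (base 1) • contr z) (fun v t ht => ?_) hw
        simp [ih t ht]
        abel
      calc contr a (contr z w)
          = a (base 1) • base (coeff (contr z w)) +
            contr a (wcases 0 ((cons ∘ₗ parityPow P 1).compl₂ (contr z)) w) := by
              nth_rewrite 1 [h1]; rw [map_add, contr_base]
        _ = a (base 1) • (base (coeff (contr z w)) +
            wcases 0 ((cons ∘ₗ parityPow P 1).compl₂ (contr z)) w)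
            + contr z (contr a w) - a (base 1) • contr z w := by
              rw [h2, smul_add]; abel
        _ = _ := by rw [← h1]; abel
  exact symUpTo_induction (p := LinearMap.eqLocus (contr a ∘ₗ contr z) (contr z ∘ₗ contr a))
    (fun k _ w hw => key k w hw a) hw

end Symmetric

/-! ## Differential graded Lie algebras and their modules -/

section DG

/-- The direct sum of the terms of a complex. -/
abbrev Tot (K : CochainComplex (ModuleCat.{0} ℂ) ℕ) : Type := ⨁ i, (K.X i : Type)

variable {K M M' : CochainComplex (ModuleCat.{0} ℂ) ℕ}

/-- A homogeneous element of degree `i`. -/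
def hom (K : CochainComplex (ModuleCat.{0} ℂ) ℕ) (i : ℕ) : K.X i →ₗ[ℂ] Tot K :=
  DirectSum.lof ℂ ℕ (fun i => (K.X i : Type)) i

/-- The component of degree `i`. -/
def comp (K : CochainComplex (ModuleCat.{0} ℂ) ℕ) (i : ℕ) : Tot K →ₗ[ℂ] K.X i :=
  DirectSum.component ℂ ℕ (fun i => (K.X i : Type)) i

/-- The differential on the direct sum of the terms. -/
def dTot (K : CochainComplex (ModuleCat.{0} ℂ) ℕ) : Tot K →ₗ[ℂ] Tot K :=
  DirectSum.toModule ℂ ℕ (Tot K) fun i => hom K (i + 1) ∘ₗ (K.d i (i + 1)).hom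

/-- Multiplication by the scalar `c i` in degree `i`. -/
def scale (K : CochainComplex (ModuleCat.{0} ℂ) ℕ) (c : ℕ → ℂ) : Tot K →ₗ[ℂ] Tot K :=
  DirectSum.lmap fun i => c i • LinearMap.id

/-- Multiplication by the degree. -/
def degree (K : CochainComplex (ModuleCat.{0} ℂ) ℕ) : Tot K →ₗ[ℂ] Tot K := scale K fun i => i

/-- Multiplication by the shifted degree `i - 1`, which is the degree of an element of `K.X i` when
it is used as a letter. -/
def weight (K : CochainComplex (ModuleCat.{0} ℂ) ℕ) : Tot K →ₗ[ℂ] Tot K := scale K fun i => i - 1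

/-- The parity operator for the shifted degree: the sign `(-1) ^ (i - 1)` in degree `i`. -/
def parity (K : CochainComplex (ModuleCat.{0} ℂ) ℕ) : Tot K →ₗ[ℂ] Tot K :=
  scale K fun i => (-1) ^ (i + 1)

/-- The projection to the part of degree `i`. -/
def part (K : CochainComplex (ModuleCat.{0} ℂ) ℕ) (i : ℕ) : Tot K →ₗ[ℂ] Tot K :=
  scale K fun j => if j = i then 1 else 0

@[simp] theorem scale_hom (c : ℕ → ℂ) (i : ℕ) (x : K.X i) :
    scale K c (hom K i x) = c i • hom K i x := by
  simp [scale, hom]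

@[simp] theorem dTot_hom (i : ℕ) (x : K.X i) :
    dTot K (hom K i x) = hom K (i + 1) ((K.d i (i + 1)).hom x) := by
  simp [dTot, hom]

theorem tot_induction {p : Tot K → Prop} (h : ∀ i x, p (hom K i x))
    (ha : ∀ x y, p x → p y → p (x + y)) (x : Tot K) : p x := by
  induction x using DirectSum.induction_on with
  | zero => simpa using h 0 0
  | of i x => exact h i x
  | add x y hx hy => exact ha _ _ hx hy

theorem tot_ext {A : Type} [AddCommGroup A] [Module ℂ A] {f g : Tot K →ₗ[ℂ] A}
    (h : ∀ i x, f (hom K i x) = g (hom K i x)) : f = g :=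
  LinearMap.ext (tot_induction (p := fun x => f x = g x) h (fun x y hx hy => by simp [hx, hy]))

variable (K) in
/-- The structure of a differential graded Lie algebra on a complex. -/
structure DGLie where
  /-- the bracket -/
  br : Tot K →ₗ[ℂ] Tot K →ₗ[ℂ] Tot K
  br_deg : ∀ i j (x : K.X i) (y : K.X j), br (hom K i x) (hom K j y) ∈ LinearMap.range (hom K (i + j))
  skew : ∀ i j (x : K.X i) (y : K.X j),
    br (hom K i x) (hom K j y) = -(-1 : ℂ) ^ (i * j) • br (hom K j y) (hom K i x)
  leibniz : ∀ i (x : K.X i) (y : Tot K),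
    dTot K (br (hom K i x) y) = br (dTot K (hom K i x)) y + (-1 : ℂ) ^ i • br (hom K i x) (dTot K y)
  jacobi : ∀ i j (x : K.X i) (y : K.X j) (z : Tot K),
    br (hom K i x) (br (hom K j y) z) = br (br (hom K i x) (hom K j y)) z +
      (-1 : ℂ) ^ (i * j) • br (hom K j y) (br (hom K i x) z)

/-- The structure of a differential graded module over a differential graded Lie algebra. -/
structure DGRep (L : DGLie K) (M : CochainComplex (ModuleCat.{0} ℂ) ℕ) where
  /-- the action -/
  act : Tot K →ₗ[ℂ] Tot M →ₗ[ℂ] Tot M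
  act_deg : ∀ i j (x : K.X i) (e : M.X j),
    act (hom K i x) (hom M j e) ∈ LinearMap.range (hom M (i + j))
  leibniz : ∀ i (x : K.X i) (e : Tot M), dTot M (act (hom K i x) e) =
    act (dTot K (hom K i x)) e + (-1 : ℂ) ^ i • act (hom K i x) (dTot M e)
  act_br : ∀ i j (x : K.X i) (y : K.X j) (e : Tot M),
    act (L.br (hom K i x) (hom K j y)) e = act (hom K i x) (act (hom K j y) e) -
      (-1 : ℂ) ^ (i * j) • act (hom K j y) (act (hom K i x) e)

theorem parity_parity : parity K ∘ₗ parity K = LinearMap.id :=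
  tot_ext fun i x => by
    simp [parity, smul_smul, ← mul_pow]

theorem parity_dTot (x : Tot K) : parity K (dTot K x) = -dTot K (parity K x) := by
  refine tot_induction (p := fun x => parity K (dTot K x) = -dTot K (parity K x)) ?_ ?_ x
  · intro i x; simp [parity, pow_succ]
  · intro x y hx hy; simp only [map_add, hx, hy, neg_add]

/-! ## The Jacobi complex -/

/-- Half the bracket, with the sign needed to make it a symmetric operation on letters. -/
def DGLie.half (L : DGLie K) : Tot K →ₗ[ℂ] Tot K →ₗ[ℂ] Tot K :=
  (1 / 2 : ℂ) • (L.br ∘ₗ parity K)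

theorem DGLie.parity_half (L : DGLie K) (x y : Tot K) :
    parity K (L.half x y) = -L.half (parity K x) (parity K y) := by
  refine tot_induction (p := fun x => parity K (L.half x y) =
    -L.half (parity K x) (parity K y)) ?_ ?_ x
  · intro i x
    refine tot_induction (p := fun y => parity K (L.half (hom K i x) y) =
      -L.half (parity K (hom K i x)) (parity K y)) ?_ ?_ y
    · intro j y
      obtain ⟨z, hz⟩ := L.br_deg i j x y
      simp only [DGLie.half, parity, scale_hom, map_smul, LinearMap.smul_apply,
        LinearMap.comp_apply, ← hz, smul_smul, ← neg_smul]
      congr 1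
      ring
    · intro x y hx hy; simp only [map_add, hx, hy, neg_add]
  · intro x y hx hy; simp only [map_add, LinearMap.add_apply, hx, hy, neg_add]

/-- The differential of the Jacobi complex, on words with trivial coefficients. -/
def DGLie.jacobiD (L : DGLie K) : Words (Tot K) ℂ →ₗ[ℂ] Words (Tot K) ℂ :=
  barD (parity K) (dTot K) L.half 0 0

/-- The degree operator on words with trivial coefficients: words of degree `r` are
the eigenvectors with eigenvalue `r`. -/
def wordDeg (K : CochainComplex (ModuleCat.{0} ℂ) ℕ) :
    Words (Tot K) ℂ →ₗ[ℂ] Words (Tot K) ℂ := derivWords (weight K) 0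

theorem parity_jacobiD (L : DGLie K) (w : Words (Tot K) ℂ) :
    L.jacobiD (mapLetters (parity K) w) = -mapLetters (parity K) (L.jacobiD w) := by
  have hm : ∀ (v : Tot K) (w : Words (Tot K) ℂ), mapLetters (parity K) (cons v w) =
    cons (parity K v) (mapLetters (parity K) w) := fun v w => by simp [mapLetters]
  refine words_induction (p := fun w => L.jacobiD (mapLetters (parity K) w) =
    -mapLetters (parity K) (L.jacobiD w)) ?_ ?_ ?_ ?_ w
  · intro e; simp [mapLetters, DGLie.jacobiD, barD_base]
  · intro v w ih
    have h2 : combine L.half 0 (parity K v) (mapLetters (parity K) w) =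
        -mapLetters (parity K) (combine L.half 0 v w) := by
      refine words_induction (p := fun w => combine L.half 0 (parity K v)
        (mapLetters (parity K) w) = -mapLetters (parity K) (combine L.half 0 v w)) ?_ ?_ ?_ ?_ w
      · intro e; simp [mapLetters]
      · intro u w _
        simp only [hm, combine_cons, L.parity_half]; simp
      · simp
      · intro x y hx hy; simp only [map_add, hx, hy, neg_add]
    simp only [DGLie.jacobiD] at ih
    have h3 : dTot K (parity K v) = -parity K (dTot K v) := by rw [parity_dTot, neg_neg]
    simp only [DGLie.jacobiD, hm, barD_cons, h2, ih, map_add, h3, map_neg, LinearMap.neg_apply]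
    abel
  · simp
  · intro x y hx hy; simp only [map_add, hx, hy, neg_add]

theorem form_parity {z : Form (Tot K)} {n : ℤ} (hz : z ∘ₗ wordDeg K = (n : ℂ) • z) :
    z ∘ₗ mapLetters (parity K) = ((-1 : ℂ) ^ n) • z := by
  let S : Submodule ℂ (Words (Tot K) ℂ) := Submodule.span ℂ
    {w | ∃ j : ℤ, wordDeg K w = (j : ℂ) • w ∧ mapLetters (parity K) w = ((-1 : ℂ) ^ j) • w}
  have hS : ∀ w, w ∈ S := by
    intro w
    refine words_induction (p := fun w => w ∈ S) ?_ ?_ ?_ ?_ w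
    · intro e
      exact Submodule.subset_span ⟨0, by simp [wordDeg, derivWords], by simp [mapLetters]⟩
    · intro v w hw
      refine tot_induction (p := fun v => cons v w ∈ S) ?_ ?_ v
      · intro i x
        have : S ≤ S.comap (cons (hom K i x)) := by
          refine Submodule.span_le.2 ?_
          rintro w ⟨j, h1, h2⟩
          refine Submodule.subset_span ⟨(i - 1) + j, ?_, ?_⟩
          · have : wordDeg K (cons (hom K i x) w) = cons (weight K (hom K i x)) w +
              cons (hom K i x) (wordDeg K w) := by simp [wordDeg, derivWords]
            rw [this, h1, weight, scale_hom]
            simp only [map_smul, LinearMap.smul_apply, ← add_smul]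
            push_cast
            rfl
          · have : mapLetters (parity K) (cons (hom K i x) w) = cons (parity K (hom K i x))
              (mapLetters (parity K) w) := by simp [mapLetters]
            rw [this, h2, parity, scale_hom]
            simp only [map_smul, LinearMap.smul_apply, smul_smul]
            congr 1
            rw [zpow_add₀ (by norm_num), zpow_sub₀ (by norm_num), pow_succ, zpow_one, zpow_natCast,
              div_neg, div_one]
            ring
        exact this hw
      · intro x y hx hy
        rw [map_add]; exact S.add_mem hx hy
    · exact S.zero_mem
    · intro x y hx hy; exact S.add_mem hx hy
  refine LinearMap.ext fun w => ?_
  have : S ≤ LinearMap.eqLocus (z ∘ₗ mapLetters (parity K)) (((-1 : ℂ) ^ n) • z) := by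
    refine Submodule.span_le.2 ?_
    rintro w ⟨j, h1, h2⟩
    have h3 := LinearMap.congr_fun hz w
    simp only [LinearMap.comp_apply, h1, map_smul, LinearMap.smul_apply, smul_eq_mul] at h3
    simp only [SetLike.mem_coe, LinearMap.mem_eqLocus, LinearMap.comp_apply, h2, map_smul,
      LinearMap.smul_apply, smul_eq_mul]
    by_cases h : z w = 0
    · simp [h]
    · have : j = n := by exact_mod_cast mul_right_cancel₀ h h3
      rw [this]
  exact LinearMap.mem_eqLocus.1 (this (hS w))

variable (L : DGLie K) (m : ℕ)

/-- Linear forms of degree `0` which are cocycles for the dual of the augmented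
Jacobi complex `ℂ ⊕ J_m`. -/
def DGLie.cocycles : Submodule ℂ (Form (Tot K)) where
  carrier := {z | z ∘ₗ wordDeg K = 0 ∧ ∀ w ∈ symUpTo (parity K) m, z (L.jacobiD w) = 0}
  add_mem' := fun ha hb => ⟨by rw [LinearMap.add_comp, ha.1, hb.1, add_zero], fun w hw => by
    simp [ha.2 w hw, hb.2 w hw]⟩
  zero_mem' := by simp
  smul_mem' := fun c z hz => ⟨by rw [LinearMap.smul_comp, hz.1, smul_zero], fun w hw => by
    simp [hz.2 w hw]⟩

/-- Linear forms which restrict to coboundaries on `ℂ ⊕ J_m`: those which on symmetric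
words with at most `m` letters are of the form `y ∘ D` with `y` of degree `-1`, that is
supported on the words of degree `1`. -/
def DGLie.coboundaries : Submodule ℂ (Form (Tot K)) where
  carrier := {z | ∃ y : Form (Tot K), y ∘ₗ wordDeg K = y ∧
    ∀ w ∈ symUpTo (parity K) m, z w = y (L.jacobiD w)}
  add_mem' := by
    rintro z z' ⟨y, hy, h⟩ ⟨y', hy', h'⟩
    exact ⟨y + y', by rw [LinearMap.add_comp, hy, hy'], fun w hw => by simp [h w hw, h' w hw]⟩
  zero_mem' := ⟨0, by simp, by simp⟩
  smul_mem' := by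
    rintro c z ⟨y, hy, h⟩
    exact ⟨c • y, by rw [LinearMap.smul_comp, hy], fun w hw => by simp [h w hw]⟩

variable {L m}

theorem even_of_deg {z : Form (Tot K)} (hz : z ∘ₗ wordDeg K = 0) :
    z ∘ₗ mapLetters (parity K) = z := by
  simpa using form_parity (n := 0) (by simpa using hz)

theorem odd_of_deg {y : Form (Tot K)} (hy : y ∘ₗ wordDeg K = y) :
    y ∘ₗ mapLetters (parity K) = -y := by
  simpa using form_parity (n := 1) (by simpa using hy)

theorem jacobiD_parity {z : Form (Tot K)} {ε : ℂ} (hz : z ∘ₗ mapLetters (parity K) = ε • z) :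
    (z ∘ₗ L.jacobiD) ∘ₗ mapLetters (parity K) = (-ε) • (z ∘ₗ L.jacobiD) := by
  refine LinearMap.ext fun w => ?_
  have := LinearMap.congr_fun hz (L.jacobiD w)
  simp only [LinearMap.comp_apply, LinearMap.smul_apply] at this
  simp [parity_jacobiD, this]

variable {F : Type} [AddCommGroup F] [Module ℂ F]

/-- Contraction with a cocycle commutes with the differential on symmetric words. -/
theorem contr_D {z : Form (Tot K)} (hz : z ∈ L.cocycles m) (d : F →ₗ[ℂ] F)
    (a : Tot K →ₗ[ℂ] F →ₗ[ℂ] F) {w : Words (Tot K) F} (hw : w ∈ symUpTo (parity K) m) :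
    contr z (barD (parity K) (dTot K) L.half d a w) =
      barD (parity K) (dTot K) L.half d a (contr z w) := by
  have he : z ∘ₗ mapLetters (parity K) = z := even_of_deg hz.1
  rw [contr_barD, he]
  have : contr (z ∘ₗ barD (parity K) (dTot K) L.half 0 0) w = 0 := by
    refine contr_eq_zero parity_parity (ε := -1) (Or.inr rfl) ?_ hz.2 hw
    exact jacobiD_parity (L := L) (ε := 1) (z := z) (by simpa using he)
  rw [this, zero_add]

/-- Contraction with a coboundary. -/
theorem contr_coboundary {z y : Form (Tot K)} (hz : z ∈ L.cocycles m) (hy : y ∘ₗ wordDeg K = y)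
    (h : ∀ w ∈ symUpTo (parity K) m, z w = y (L.jacobiD w)) (d : F →ₗ[ℂ] F)
    (a : Tot K →ₗ[ℂ] F →ₗ[ℂ] F) {w : Words (Tot K) F} (hw : w ∈ symUpTo (parity K) m) :
    contr z w = contr y (barD (parity K) (dTot K) L.half d a w) +
      barD (parity K) (dTot K) L.half d a (contr y w) := by
  have he : z ∘ₗ mapLetters (parity K) = z := even_of_deg hz.1
  have ho : y ∘ₗ mapLetters (parity K) = -y := odd_of_deg hy
  have h1 : contr (z - y ∘ₗ L.jacobiD) w = 0 := by
    refine contr_eq_zero parity_parity (ε := 1) (Or.inl rfl) ?_ (fun w hw => ?_) hw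
    · rw [LinearMap.sub_comp, jacobiD_parity (ε := -1) (by simpa using ho), he]; simp
    · simp [h w hw]
  rw [contr_barD, ho]
  have h2 : contr (-y) w = -contr y w := by
    simpa using contr_smul (-1) y w
  have h3 : contr z w = contr (y ∘ₗ L.jacobiD) w := by
    have h4 : z = (z - y ∘ₗ L.jacobiD) + y ∘ₗ L.jacobiD := by abel
    rw [h4, contr_add, h1, zero_add]
  rw [h2, h3, map_neg]
  simp [DGLie.jacobiD]

end DG

/-! ## Cohomology of the dual Jacobi complex: the ring `R_m` -/

section Coh
variable {A C C' : Type} [AddCommGroup A] [Module ℂ A] [AddCommGroup C] [Module ℂ C]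
  [AddCommGroup C'] [Module ℂ C']

/-- Cocycles modulo the coboundaries among them. -/
abbrev Coh (Z B : Submodule ℂ C) : Type := Z ⧸ B.submoduleOf Z

/-- The class of a cocycle. -/
def cls {Z : Submodule ℂ C} (B : Submodule ℂ C) (c : C) (hc : c ∈ Z) : Coh Z B :=
  Submodule.Quotient.mk ⟨c, hc⟩

theorem cls_eq {Z B : Submodule ℂ C} {c c' : C} {hc : c ∈ Z} {hc' : c' ∈ Z} :
    cls B c hc = cls B c' hc' ↔ c - c' ∈ B := by
  rw [cls, cls, Submodule.Quotient.eq]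
  rfl

theorem cls_rep {Z B : Submodule ℂ C} (x : Coh Z B) : ∃ c hc, x = cls B c hc := by
  obtain ⟨⟨c, hc⟩, rfl⟩ := Submodule.Quotient.mk_surjective _ x
  exact ⟨c, hc, rfl⟩

theorem cls_induction {Z B : Submodule ℂ C} {p : Coh Z B → Prop}
    (h : ∀ c hc, p (cls B c hc)) (x : Coh Z B) : p x := by
  obtain ⟨⟨c, hc⟩, rfl⟩ := Submodule.Quotient.mk_surjective _ x
  exact h c hc

/-- The map on cohomology induced by a linear map. -/
def cohMap {Z B : Submodule ℂ C} {Z' B' : Submodule ℂ C'} (T : C →ₗ[ℂ] C')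
    (hZ : ∀ c ∈ Z, T c ∈ Z') (hB : ∀ c ∈ Z, c ∈ B → T c ∈ B') : Coh Z B →ₗ[ℂ] Coh Z' B' :=
  Submodule.mapQ _ _ (T.restrict hZ) fun c hc => hB c c.2 hc

@[simp] theorem cohMap_cls {Z B : Submodule ℂ C} {Z' B' : Submodule ℂ C'} (T : C →ₗ[ℂ] C')
    (hZ : ∀ c ∈ Z, T c ∈ Z') (hB : ∀ c ∈ Z, c ∈ B → T c ∈ B') (c : C) (hc : c ∈ Z) :
    cohMap T hZ hB (cls B c hc) = cls B' (T c) (hZ c hc) := rfl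

/-- The bilinear action on cohomology induced by a bilinear action. -/
def cohAct {ZA BA : Submodule ℂ A} {Z B : Submodule ℂ C} (ρ : A →ₗ[ℂ] C →ₗ[ℂ] C)
    (h1 : ∀ a ∈ ZA, ∀ c ∈ Z, ρ a c ∈ Z) (h2 : ∀ a ∈ ZA, ∀ c ∈ Z, c ∈ B → ρ a c ∈ B)
    (h3 : ∀ a ∈ ZA, ∀ c ∈ Z, a ∈ BA → ρ a c ∈ B) : Coh ZA BA →ₗ[ℂ] Coh Z B →ₗ[ℂ] Coh Z B :=
  Submodule.liftQ _
    { toFun := fun a => cohMap (ρ a) (h1 a a.2) (h2 a a.2)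
      map_add' := fun a a' => LinearMap.ext <| cls_induction fun c hc => by
        simp only [cohMap_cls, LinearMap.add_apply]
        exact congrArg Submodule.Quotient.mk (Subtype.ext (by simp))
      map_smul' := fun t a => LinearMap.ext <| cls_induction fun c hc => by
        simp only [cohMap_cls, LinearMap.smul_apply]
        exact congrArg Submodule.Quotient.mk (Subtype.ext (by simp)) }
    fun a ha => LinearMap.ext <| cls_induction fun c hc => by
      have : cls B (ρ a c) (h1 a a.2 c hc) = cls B 0 (Submodule.zero_mem Z) := by
        rw [cls_eq, sub_zero]
        exact h3 a a.2 c hc ha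
      exact this

@[simp] theorem cohAct_cls {ZA BA : Submodule ℂ A} {Z B : Submodule ℂ C} (ρ : A →ₗ[ℂ] C →ₗ[ℂ] C)
    (h1 : ∀ a ∈ ZA, ∀ c ∈ Z, ρ a c ∈ Z) (h2 : ∀ a ∈ ZA, ∀ c ∈ Z, c ∈ B → ρ a c ∈ B)
    (h3 : ∀ a ∈ ZA, ∀ c ∈ Z, a ∈ BA → ρ a c ∈ B) (a : A) (ha : a ∈ ZA) (c : C) (hc : c ∈ Z) :
    cohAct ρ h1 h2 h3 (cls BA a ha) (cls B c hc) = cls B (ρ a c) (h1 a ha c hc) := rfl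

end Coh

section Ring
variable {K : CochainComplex (ModuleCat.{0} ℂ) ℕ} (L : DGLie K) (m : ℕ)

/-- The convolution product, bilinearly. -/
def convₗ (V : Type) [AddCommGroup V] [Module ℂ V] : Form V →ₗ[ℂ] Form V →ₗ[ℂ] Form V :=
  LinearMap.mk₂ ℂ Form.conv
    (fun z z' c => LinearMap.ext fun w => by simp [Form.conv, contr_add])
    (fun t z c => LinearMap.ext fun w => by simp [Form.conv, contr_smul])
    (fun z c c' => LinearMap.ext fun w => by simp [Form.conv])
    (fun t z c => LinearMap.ext fun w => by simp [Form.conv])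

/-- The action of linear forms on cochains through contraction. -/
def convAct (V A : Type) [AddCommGroup V] [Module ℂ V] [AddCommGroup A] [Module ℂ A] :
    Form V →ₗ[ℂ] (Words V ℂ →ₗ[ℂ] A) →ₗ[ℂ] (Words V ℂ →ₗ[ℂ] A) :=
  LinearMap.mk₂ ℂ (fun z c => c ∘ₗ contr z)
    (fun z z' c => LinearMap.ext fun w => by simp [contr_add])
    (fun t z c => LinearMap.ext fun w => by simp [contr_smul])
    (fun z c c' => LinearMap.ext fun w => by simp)
    (fun t z c => LinearMap.ext fun w => by simp)

@[simp] theorem convAct_apply {V A : Type} [AddCommGroup V] [Module ℂ V] [AddCommGroup A]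
    [Module ℂ A] (z : Form V) (c : Words V ℂ →ₗ[ℂ] A) (w : Words V ℂ) :
    convAct V A z c w = c (contr z w) := rfl

variable {L m}

section Deg
variable {F : Type} [AddCommGroup F] [Module ℂ F]

theorem contr_deg {z : Form (Tot K)} (hz : z ∘ₗ wordDeg K = 0) (ν : F →ₗ[ℂ] F)
    (w : Words (Tot K) F) :
    contr z (derivWords (weight K) ν w) = derivWords (weight K) ν (contr z w) := by
  have h : z ∘ₗ derivWords (weight K) 0 = 0 := hz
  rw [contr_derivWords, h, contr_zero, zero_add]

theorem contr_deg_one {y : Form (Tot K)} (hy : y ∘ₗ wordDeg K = y) (ν : F →ₗ[ℂ] F)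
    (w : Words (Tot K) F) :
    contr y (derivWords (weight K) ν w) = contr y w + derivWords (weight K) ν (contr y w) := by
  have h : y ∘ₗ derivWords (weight K) 0 = y := hy
  rw [contr_derivWords, h]

end Deg

section Cochains
variable {A A' A'' : Type} [AddCommGroup A] [Module ℂ A] [AddCommGroup A'] [Module ℂ A']
  [AddCommGroup A''] [Module ℂ A'']

/-- The cochain `x w ↦ a x (c w)` for a letter `x` and a word `w`. -/
def headAct (a : Tot K →ₗ[ℂ] A →ₗ[ℂ] A') :
    (Words (Tot K) ℂ →ₗ[ℂ] A) →ₗ[ℂ] (Words (Tot K) ℂ →ₗ[ℂ] A') where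
  toFun c := wcases 0 (a.compl₂ c)
  map_add' c c' := hom_ext (by simp) (by simp)
  map_smul' t c := hom_ext (by simp) (by simp)

@[simp] theorem headAct_base (a : Tot K →ₗ[ℂ] A →ₗ[ℂ] A') (c : Words (Tot K) ℂ →ₗ[ℂ] A) (t : ℂ) :
    headAct a c (base t) = 0 := by simp [headAct]

@[simp] theorem headAct_cons (a : Tot K →ₗ[ℂ] A →ₗ[ℂ] A') (c : Words (Tot K) ℂ →ₗ[ℂ] A) (x : Tot K)
    (w : Words (Tot K) ℂ) : headAct a c (cons x w) = a x (c w) := by simp [headAct]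

variable (L) in
/-- The differential of cochains of degree `0` with values in `A`, where `A` has the differential
`d` and the action `a` of letters. -/
def cochD (d : A →ₗ[ℂ] A) (a : Tot K →ₗ[ℂ] A →ₗ[ℂ] A) :
    (Words (Tot K) ℂ →ₗ[ℂ] A) →ₗ[ℂ] (Words (Tot K) ℂ →ₗ[ℂ] A) :=
  LinearMap.compRight ℂ d - LinearMap.lcomp ℂ A L.jacobiD + headAct (a ∘ₗ parity K)

variable (L) in
/-- The differential of cochains of degree `-1` with values in `A`, where `A` has the differential
`d` and the action `a` of letters. -/
def cochDPrev (d : A →ₗ[ℂ] A) (a : Tot K →ₗ[ℂ] A →ₗ[ℂ] A) :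
    (Words (Tot K) ℂ →ₗ[ℂ] A) →ₗ[ℂ] (Words (Tot K) ℂ →ₗ[ℂ] A) :=
  LinearMap.compRight ℂ d + LinearMap.lcomp ℂ A L.jacobiD + headAct a

theorem cochD_apply (d : A →ₗ[ℂ] A) (a : Tot K →ₗ[ℂ] A →ₗ[ℂ] A) (c : Words (Tot K) ℂ →ₗ[ℂ] A)
    (w : Words (Tot K) ℂ) :
    cochD L d a c w = d (c w) - c (L.jacobiD w) + headAct (a ∘ₗ parity K) c w := rfl

theorem cochDPrev_apply (d : A →ₗ[ℂ] A) (a : Tot K →ₗ[ℂ] A →ₗ[ℂ] A)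
    (c : Words (Tot K) ℂ →ₗ[ℂ] A) (w : Words (Tot K) ℂ) :
    cochDPrev L d a c w = d (c w) + c (L.jacobiD w) + headAct a c w := rfl

theorem headAct_contr {m : ℕ} (a : Tot K →ₗ[ℂ] A →ₗ[ℂ] A') (c : Words (Tot K) ℂ →ₗ[ℂ] A)
    {z : Form (Tot K)} {ε : ℂ} (hε : ε = 1 ∨ ε = -1) (hz : z ∘ₗ mapLetters (parity K) = ε • z)
    {w : Words (Tot K) ℂ} (hw : w ∈ symUpTo (parity K) m) :
    headAct a c (contr z w) = headAct (a ∘ₗ parityPow (parity K) ε) (c ∘ₗ contr z) w := by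
  have h : headAct a c ∘ₗ wcases 0 ((cons ∘ₗ parityPow (parity K) ε).compl₂ (contr z)) =
      headAct (a ∘ₗ parityPow (parity K) ε) (c ∘ₗ contr z) := hom_ext (by simp) (by simp)
  rw [contr_symUpTo parity_parity hw hε hz, map_add, headAct_base, zero_add, ← h]
  rfl

theorem headAct_contr_even {m : ℕ} (a : Tot K →ₗ[ℂ] A →ₗ[ℂ] A') (c : Words (Tot K) ℂ →ₗ[ℂ] A)
    {z : Form (Tot K)} (hz : z ∘ₗ wordDeg K = 0)
    {w : Words (Tot K) ℂ} (hw : w ∈ symUpTo (parity K) m) :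
    headAct a c (contr z w) = headAct a (c ∘ₗ contr z) w := by
  rw [headAct_contr a c (Or.inl rfl) (by simpa using even_of_deg hz) hw, parityPow_one]
  rfl

variable (L m) in
/-- Cocycles of degree `0` in the complex of cochains on `ℂ ⊕ J_m` with values in `A`, where
`A` has the degree operator `ν`, the differential `d` and the action `a`. -/
def cochZ (ν d : A →ₗ[ℂ] A) (a : Tot K →ₗ[ℂ] A →ₗ[ℂ] A) :
    Submodule ℂ (Words (Tot K) ℂ →ₗ[ℂ] A) where
  carrier := {c | ν ∘ₗ c = c ∘ₗ wordDeg K ∧ ∀ w ∈ symUpTo (parity K) m, cochD L d a c w = 0}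
  add_mem' := fun hc hc' => ⟨by rw [LinearMap.add_comp, LinearMap.comp_add, hc.1, hc'.1],
    fun w hw => by simp [hc.2 w hw, hc'.2 w hw]⟩
  zero_mem' := by simp
  smul_mem' := fun t c hc => ⟨by rw [LinearMap.smul_comp, LinearMap.comp_smul, hc.1],
    fun w hw => by simp [hc.2 w hw]⟩

variable (L m) in
/-- Cochains which restrict to coboundaries of degree `0` in the complex of cochains on
`ℂ ⊕ J_m` with values in `A`. -/
def cochB (ν d : A →ₗ[ℂ] A) (a : Tot K →ₗ[ℂ] A →ₗ[ℂ] A) :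
    Submodule ℂ (Words (Tot K) ℂ →ₗ[ℂ] A) where
  carrier := {c | ∃ b : Words (Tot K) ℂ →ₗ[ℂ] A, ν ∘ₗ b = b ∘ₗ wordDeg K - b ∧
    ∀ w ∈ symUpTo (parity K) m, c w = cochDPrev L d a b w}
  add_mem' := by
    rintro c c' ⟨b, hb, h⟩ ⟨b', hb', h'⟩
    refine ⟨b + b', ?_, fun w hw => by simp [h w hw, h' w hw]⟩
    rw [LinearMap.add_comp, LinearMap.comp_add, hb, hb']; abel
  zero_mem' := ⟨0, by simp, by simp⟩
  smul_mem' := by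
    rintro t c ⟨b, hb, h⟩
    refine ⟨t • b, ?_, fun w hw => by simp [h w hw]⟩
    rw [LinearMap.smul_comp, LinearMap.comp_smul, hb, smul_sub]

theorem cochB_of_zero {ν d : A →ₗ[ℂ] A} {a : Tot K →ₗ[ℂ] A →ₗ[ℂ] A}
    {c : Words (Tot K) ℂ →ₗ[ℂ] A} (h : ∀ w ∈ symUpTo (parity K) m, c w = 0) :
    c ∈ cochB L m ν d a := ⟨0, by simp, fun w hw => by simp [h w hw]⟩

theorem cochD_contr {d : A →ₗ[ℂ] A} {a : Tot K →ₗ[ℂ] A →ₗ[ℂ] A} (c : Words (Tot K) ℂ →ₗ[ℂ] A)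
    {z : Form (Tot K)} (hz : z ∈ L.cocycles m) {w : Words (Tot K) ℂ}
    (hw : w ∈ symUpTo (parity K) m) :
    cochD L d a (c ∘ₗ contr z) w = cochD L d a c (contr z w) := by
  have h : contr z (L.jacobiD w) = L.jacobiD (contr z w) := contr_D hz 0 0 hw
  rw [cochD_apply, cochD_apply, headAct_contr_even _ c hz.1 hw, LinearMap.comp_apply,
    LinearMap.comp_apply, h]

theorem cochDPrev_contr {d : A →ₗ[ℂ] A} {a : Tot K →ₗ[ℂ] A →ₗ[ℂ] A}
    (c : Words (Tot K) ℂ →ₗ[ℂ] A) {z : Form (Tot K)} (hz : z ∈ L.cocycles m)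
    {w : Words (Tot K) ℂ} (hw : w ∈ symUpTo (parity K) m) :
    cochDPrev L d a (c ∘ₗ contr z) w = cochDPrev L d a c (contr z w) := by
  have h : contr z (L.jacobiD w) = L.jacobiD (contr z w) := contr_D hz 0 0 hw
  rw [cochDPrev_apply, cochDPrev_apply, headAct_contr_even _ c hz.1 hw, LinearMap.comp_apply,
    LinearMap.comp_apply, h]

theorem convAct_mem {ν d : A →ₗ[ℂ] A} {a : Tot K →ₗ[ℂ] A →ₗ[ℂ] A} :
    ∀ z ∈ L.cocycles m, ∀ c ∈ cochZ L m ν d a, convAct (Tot K) A z c ∈ cochZ L m ν d a := by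
  rintro z hz c ⟨hc, h⟩
  refine ⟨LinearMap.ext fun w => ?_, fun w hw => ?_⟩
  · have := LinearMap.congr_fun hc (contr z w)
    simp only [LinearMap.comp_apply] at this
    simp only [LinearMap.comp_apply, convAct_apply, this, wordDeg, contr_deg hz.1]
  · exact (cochD_contr c hz hw).trans (h _ (contr_mem z hw))

theorem convAct_mem_right {ν d : A →ₗ[ℂ] A} {a : Tot K →ₗ[ℂ] A →ₗ[ℂ] A} :
    ∀ z ∈ L.cocycles m, ∀ c ∈ cochZ L m ν d a, c ∈ cochB L m ν d a →
      convAct (Tot K) A z c ∈ cochB L m ν d a := by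
  rintro z hz c - ⟨b, hb, h⟩
  refine ⟨b ∘ₗ contr z, LinearMap.ext fun w => ?_, fun w hw => ?_⟩
  · have := LinearMap.congr_fun hb (contr z w)
    simp only [LinearMap.comp_apply, LinearMap.sub_apply] at this
    simp only [LinearMap.comp_apply, LinearMap.sub_apply, this, wordDeg, contr_deg hz.1]
  · rw [cochDPrev_contr b hz hw]
    exact h _ (contr_mem z hw)

theorem convAct_mem_left {ν d : A →ₗ[ℂ] A} {a : Tot K →ₗ[ℂ] A →ₗ[ℂ] A} :
    ∀ z ∈ L.cocycles m, ∀ c ∈ cochZ L m ν d a, z ∈ L.coboundaries m →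
      convAct (Tot K) A z c ∈ cochB L m ν d a := by
  rintro z hz c ⟨hc, h⟩ ⟨y, hy, hzy⟩
  refine ⟨c ∘ₗ contr y, LinearMap.ext fun w => ?_, fun w hw => ?_⟩
  · have := LinearMap.congr_fun hc (contr y w)
    simp only [LinearMap.comp_apply] at this
    simp only [LinearMap.comp_apply, LinearMap.sub_apply, this, wordDeg, contr_deg_one hy, map_add]
    abel
  · have h1 : contr z w = contr y (L.jacobiD w) + L.jacobiD (contr y w) :=
      contr_coboundary hz hy hzy 0 0 hw
    have h2 := h _ (contr_mem y hw)
    rw [cochD_apply, headAct_contr (a ∘ₗ parity K) c (Or.inr rfl)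
      (by simpa using odd_of_deg hy) hw, parityPow_neg_one, LinearMap.comp_assoc,
      parity_parity, LinearMap.comp_id] at h2
    simp only [convAct_apply, cochDPrev_apply, h1, map_add, LinearMap.comp_apply]
    rw [← sub_eq_zero, ← neg_eq_zero, ← h2]
    abel

end Cochains

/-! ### The ring -/

theorem mem_cocycles_iff {z : Form (Tot K)} : z ∈ L.cocycles m ↔ z ∈ cochZ L m 0 0 0 := by
  refine and_congr ?_ (forall₂_congr fun w _ => ?_)
  · rw [LinearMap.zero_comp, eq_comm]
  · have : headAct ((0 : Tot K →ₗ[ℂ] ℂ →ₗ[ℂ] ℂ) ∘ₗ parity K) z w = 0 := by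
      have h : headAct ((0 : Tot K →ₗ[ℂ] ℂ →ₗ[ℂ] ℂ) ∘ₗ parity K) z = 0 :=
        hom_ext (by simp) (by simp)
      rw [h]; rfl
    rw [cochD_apply, this]; simp

theorem mem_coboundaries_iff {z : Form (Tot K)} :
    z ∈ L.coboundaries m ↔ z ∈ cochB L m 0 0 0 := by
  refine exists_congr fun y => and_congr ?_ (forall₂_congr fun w _ => ?_)
  · rw [LinearMap.zero_comp, eq_comm (a := (0 : Form (Tot K))), sub_eq_zero]
  · have : headAct (0 : Tot K →ₗ[ℂ] ℂ →ₗ[ℂ] ℂ) y w = 0 := by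
      have h : headAct (0 : Tot K →ₗ[ℂ] ℂ →ₗ[ℂ] ℂ) y = 0 := hom_ext (by simp) (by simp)
      rw [h]; rfl
    rw [cochDPrev_apply, this]; simp

variable (L m) in
/-- The ring `R_m`: the cohomology in degree `0` of the dual of the augmented Jacobi complex
`ℂ ⊕ J_m`. -/
def DGLie.Rm : Type := Coh (L.cocycles m) (L.coboundaries m)

instance : AddCommGroup (L.Rm m) :=
  inferInstanceAs (AddCommGroup (Coh (L.cocycles m) (L.coboundaries m)))

instance : Module ℂ (L.Rm m) :=
  inferInstanceAs (Module ℂ (Coh (L.cocycles m) (L.coboundaries m)))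

/-- The class in `R_m` of a cocycle. -/
def DGLie.Rm.mk (z : Form (Tot K)) (hz : z ∈ L.cocycles m) : L.Rm m := cls _ z hz

theorem DGLie.Rm.exists_rep (r : L.Rm m) : ∃ z hz, r = DGLie.Rm.mk z hz :=
  cls_rep r

theorem DGLie.Rm.mk_eq {z z' : Form (Tot K)} {hz : z ∈ L.cocycles m} {hz' : z' ∈ L.cocycles m}
    (h : ∀ w ∈ symUpTo (parity K) m, z w = z' w) : DGLie.Rm.mk z hz = DGLie.Rm.mk z' hz' :=
  cls_eq.2 ⟨0, by simp, fun w hw => by simp [h w hw]⟩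

theorem conv_mem {z z' : Form (Tot K)} (hz : z ∈ L.cocycles m) (hz' : z' ∈ L.cocycles m) :
    z.conv z' ∈ L.cocycles m :=
  mem_cocycles_iff.2 (convAct_mem z hz z' (mem_cocycles_iff.1 hz'))

theorem unit_mem : Form.unit (Tot K) ∈ L.cocycles m := by
  refine ⟨hom_ext (by simp [wordDeg, derivWords, Form.unit])
    (by simp [wordDeg, derivWords, Form.unit]), fun w _ => ?_⟩
  have h0 : ∀ (x : Tot K) (w : Words (Tot K) ℂ), Form.unit (Tot K) (combine L.half 0 x w) = 0 := by
    intro x w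
    have : Form.unit (Tot K) ∘ₗ combine L.half 0 x = 0 := hom_ext (by simp) (by simp [Form.unit])
    exact LinearMap.congr_fun this w
  have : Form.unit (Tot K) ∘ₗ L.jacobiD = 0 := by
    refine hom_ext (by simp [DGLie.jacobiD, barD_base]) fun x w _ => ?_
    simp only [DGLie.jacobiD, LinearMap.comp_apply, barD_cons, map_add, h0]
    simp [Form.unit]
  exact LinearMap.congr_fun this w

/-- The multiplication of `R_m`, induced by the convolution of linear forms. -/
def DGLie.Rm.mul : L.Rm m →ₗ[ℂ] L.Rm m →ₗ[ℂ] L.Rm m :=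
  cohAct (ZA := L.cocycles m) (BA := L.coboundaries m) (Z := L.cocycles m)
    (B := L.coboundaries m) (convₗ (Tot K)) (fun _ hz _ hc => conv_mem hz hc)
    (fun z hz c hc h => mem_coboundaries_iff.2
      (convAct_mem_right z hz c (mem_cocycles_iff.1 hc) (mem_coboundaries_iff.1 h)))
    (fun z hz c hc h => mem_coboundaries_iff.2 (convAct_mem_left z hz c (mem_cocycles_iff.1 hc) h))

theorem DGLie.Rm.mul_mk {z z' : Form (Tot K)} (hz : z ∈ L.cocycles m) (hz' : z' ∈ L.cocycles m) :
    DGLie.Rm.mul (DGLie.Rm.mk z hz) (DGLie.Rm.mk z' hz') =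
      DGLie.Rm.mk (z.conv z') (conv_mem hz hz') := rfl

theorem DGLie.Rm.mul_comm' (r s : L.Rm m) : DGLie.Rm.mul r s = DGLie.Rm.mul s r := by
  obtain ⟨z, hz, rfl⟩ := r.exists_rep
  obtain ⟨z', hz', rfl⟩ := s.exists_rep
  rw [DGLie.Rm.mul_mk, DGLie.Rm.mul_mk]
  refine DGLie.Rm.mk_eq fun w hw => ?_
  have key : ∀ (z : Form (Tot K)) (w : Words (Tot K) ℂ), coeff (contr z w) = z w := by
    intro z w
    have h := coeff_contr LinearMap.id z w
    have h' : mapCoeff LinearMap.id w = w := by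
      have : (mapCoeff LinearMap.id : Words (Tot K) ℂ →ₗ[ℂ] Words (Tot K) ℂ) = LinearMap.id :=
        hom_ext (by simp [mapCoeff]) fun v w h => by
          simp only [mapCoeff_cons, h]; rfl
      rw [this]; rfl
    rw [h'] at h
    exact h
  change z' (contr z w) = z (contr z' w)
  rw [← key z', ← key z, contr_comm parity_parity (even_of_deg hz.1) z' hw]

theorem DGLie.Rm.mul_assoc' (r s t : L.Rm m) :
    DGLie.Rm.mul (DGLie.Rm.mul r s) t = DGLie.Rm.mul r (DGLie.Rm.mul s t) := by
  obtain ⟨z, hz, rfl⟩ := r.exists_rep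
  obtain ⟨z', hz', rfl⟩ := s.exists_rep
  obtain ⟨z'', hz'', rfl⟩ := t.exists_rep
  simp only [DGLie.Rm.mul_mk]
  exact DGLie.Rm.mk_eq fun w _ => congrArg z'' (contr_conv z z' w)

theorem DGLie.Rm.one_mul' (r : L.Rm m) : DGLie.Rm.mul (DGLie.Rm.mk _ unit_mem) r = r := by
  obtain ⟨z, hz, rfl⟩ := r.exists_rep
  rw [DGLie.Rm.mul_mk]
  exact DGLie.Rm.mk_eq fun w _ => by simp [Form.conv, contr_unit]

instance : CommRing (L.Rm m) :=
  { (inferInstance : AddCommGroup (L.Rm m)) with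
    mul := fun r s => DGLie.Rm.mul r s
    one := DGLie.Rm.mk _ unit_mem
    left_distrib := fun r s t => map_add _ s t
    right_distrib := fun r s t => by
      change DGLie.Rm.mul (r + s) t = DGLie.Rm.mul r t + DGLie.Rm.mul s t
      simp
    zero_mul := fun r => by
      change DGLie.Rm.mul 0 r = 0
      simp
    mul_zero := fun r => map_zero _
    mul_assoc := DGLie.Rm.mul_assoc'
    one_mul := DGLie.Rm.one_mul'
    mul_one := fun r => (DGLie.Rm.mul_comm' _ _).trans (DGLie.Rm.one_mul' r)
    mul_comm := DGLie.Rm.mul_comm' }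

instance : Algebra ℂ (L.Rm m) :=
  Algebra.ofModule
    (fun t r s => by
      change DGLie.Rm.mul (t • r) s = t • DGLie.Rm.mul r s
      simp)
    (fun t r s => by
      change DGLie.Rm.mul r (t • s) = t • DGLie.Rm.mul r s
      simp)

/-- The augmentation `R_m → ℂ`: the value on the word without letters. -/
def DGLie.Rm.aug : L.Rm m →ₗ[ℂ] ℂ :=
  Submodule.liftQ _ ((LinearMap.applyₗ (base 1 : Words (Tot K) ℂ)) ∘ₗ (L.cocycles m).subtype) <| by
    rintro ⟨z, hz⟩ ⟨y, _, h⟩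
    have := h _ (symWords_le (Nat.zero_le m) ⟨1, rfl⟩)
    simpa [DGLie.jacobiD, barD_base] using this

/-- The module structure over `R_m` on a cohomology space, from an action on the level of
cocycles. -/
@[reducible] def rmModule {C : Type} [AddCommGroup C] [Module ℂ C] {Z B : Submodule ℂ C}
    (ρ : Form (Tot K) →ₗ[ℂ] C →ₗ[ℂ] C)
    (h1 : ∀ z ∈ L.cocycles m, ∀ c ∈ Z, ρ z c ∈ Z)
    (h2 : ∀ z ∈ L.cocycles m, ∀ c ∈ Z, c ∈ B → ρ z c ∈ B)
    (h3 : ∀ z ∈ L.cocycles m, ∀ c ∈ Z, z ∈ L.coboundaries m → ρ z c ∈ B)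
    (h4 : ∀ c ∈ Z, ρ (Form.unit (Tot K)) c = c)
    (h5 : ∀ z ∈ L.cocycles m, ∀ z' ∈ L.cocycles m, ∀ c ∈ Z, ρ (z.conv z') c = ρ z (ρ z' c)) :
    Module (L.Rm m) (Coh Z B) where
  smul r x := cohAct (BA := L.coboundaries m) ρ h1 h2 h3 r x
  one_smul := cls_induction fun c hc => by
    refine (cls_eq (hc := h1 _ unit_mem c hc) (hc' := hc)).2 ?_
    rw [h4 c hc, sub_self]
    exact B.zero_mem
  mul_smul r s x := by
    obtain ⟨z, hz, rfl⟩ := r.exists_rep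
    obtain ⟨z', hz', rfl⟩ := s.exists_rep
    obtain ⟨c, hc, rfl⟩ := cls_rep x
    refine (cls_eq (hc := h1 _ (conv_mem hz hz') c hc) (hc' := h1 _ hz _ (h1 _ hz' c hc))).2 ?_
    rw [h5 z hz z' hz' c hc, sub_self]
    exact B.zero_mem
  smul_zero r := map_zero _
  smul_add r x y := map_add _ x y
  add_smul r s x := LinearMap.congr_fun (map_add (cohAct (BA := L.coboundaries m) ρ h1 h2 h3) r s) x
  zero_smul x := LinearMap.congr_fun (map_zero (cohAct (BA := L.coboundaries m) ρ h1 h2 h3)) x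

section CochH
variable {A A' : Type} [AddCommGroup A] [Module ℂ A] [AddCommGroup A'] [Module ℂ A']

variable (L m) in
/-- The cohomology in degree `0` of the complex of cochains on `ℂ ⊕ J_m` with values in `A`. -/
def CochH (ν d : A →ₗ[ℂ] A) (a : Tot K →ₗ[ℂ] A →ₗ[ℂ] A) : Type :=
  Coh (cochZ L m ν d a) (cochB L m ν d a)

variable {ν d : A →ₗ[ℂ] A} {a : Tot K →ₗ[ℂ] A →ₗ[ℂ] A}
  {ν' d' : A' →ₗ[ℂ] A'} {a' : Tot K →ₗ[ℂ] A' →ₗ[ℂ] A'}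

instance : AddCommGroup (CochH L m ν d a) :=
  inferInstanceAs (AddCommGroup (Coh (cochZ L m ν d a) (cochB L m ν d a)))

instance : Module (L.Rm m) (CochH L m ν d a) :=
  rmModule (convAct (Tot K) A) convAct_mem convAct_mem_right convAct_mem_left
    (fun c _ => LinearMap.ext fun w => by rw [convAct_apply, contr_unit])
    (fun z _ z' _ c _ => LinearMap.ext fun w => by simp [contr_conv])

/-- The map on cohomology induced by an operator on cochains which commutes with the action
of `R_m`. -/
def CochH.map (T : (Words (Tot K) ℂ →ₗ[ℂ] A) →ₗ[ℂ] (Words (Tot K) ℂ →ₗ[ℂ] A'))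
    (hZ : ∀ c ∈ cochZ L m ν d a, T c ∈ cochZ L m ν' d' a')
    (hB : ∀ c ∈ cochZ L m ν d a, c ∈ cochB L m ν d a → T c ∈ cochB L m ν' d' a')
    (hT : ∀ z ∈ L.cocycles m, ∀ c, ∀ w ∈ symUpTo (parity K) m,
      T (c ∘ₗ contr z) w = T c (contr z w)) :
    CochH L m ν d a →ₗ[L.Rm m] CochH L m ν' d' a' where
  toFun := cohMap T hZ hB
  map_add' := map_add _
  map_smul' r x := by
    obtain ⟨z, hz, rfl⟩ := r.exists_rep
    obtain ⟨c, hc, rfl⟩ := cls_rep x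
    refine (cls_eq (hc := hZ _ (convAct_mem z hz c hc))
      (hc' := convAct_mem z hz _ (hZ c hc))).2 (cochB_of_zero fun w hw => ?_)
    rw [LinearMap.sub_apply, sub_eq_zero]
    exact hT z hz c w hw

theorem CochH.map_cls (T : (Words (Tot K) ℂ →ₗ[ℂ] A) →ₗ[ℂ] (Words (Tot K) ℂ →ₗ[ℂ] A'))
    (hZ : ∀ c ∈ cochZ L m ν d a, T c ∈ cochZ L m ν' d' a')
    (hB : ∀ c ∈ cochZ L m ν d a, c ∈ cochB L m ν d a → T c ∈ cochB L m ν' d' a')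
    (hT : ∀ z ∈ L.cocycles m, ∀ c, ∀ w ∈ symUpTo (parity K) m,
      T (c ∘ₗ contr z) w = T c (contr z w)) (c : Words (Tot K) ℂ →ₗ[ℂ] A)
    (hc : c ∈ cochZ L m ν d a) :
    CochH.map T hZ hB hT (cls _ c hc) = cls (cochB L m ν' d' a') (T c) (hZ c hc) := rfl

theorem CochH.exists_rep (x : CochH L m ν d a) :
    ∃ c hc, x = cls (cochB L m ν d a) c hc := cls_rep x

/-- The map on cohomology induced by a map of the coefficients. -/
def CochH.push (f : A →ₗ[ℂ] A') (hν : f ∘ₗ ν = ν' ∘ₗ f) (hd : f ∘ₗ d = d' ∘ₗ f)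
    (ha : ∀ x e, f (a x e) = a' x (f e)) : CochH L m ν d a →ₗ[L.Rm m] CochH L m ν' d' a' := by
  have hh : ∀ (p : Tot K →ₗ[ℂ] Tot K) (c : Words (Tot K) ℂ →ₗ[ℂ] A),
      headAct (a' ∘ₗ p) (f ∘ₗ c) = f ∘ₗ headAct (a ∘ₗ p) c := fun p c =>
    hom_ext (by simp) (by simp [ha])
  have hdx : ∀ e, f (d e) = d' (f e) := LinearMap.congr_fun hd
  refine CochH.map (LinearMap.compRight ℂ f) (fun c hc => ⟨?_, fun w hw => ?_⟩) ?_
    (fun z _ c w _ => rfl)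
  · have := hc.1
    change ν' ∘ₗ (f ∘ₗ c) = (f ∘ₗ c) ∘ₗ wordDeg K
    rw [← LinearMap.comp_assoc, ← hν, LinearMap.comp_assoc, this, LinearMap.comp_assoc]
  · change d' (f (c w)) - f (c (L.jacobiD w)) + headAct (a' ∘ₗ parity K) (f ∘ₗ c) w = 0
    have h := congrArg f (hc.2 w hw)
    rw [cochD_apply, map_add, map_sub, hdx, map_zero] at h
    rw [hh]
    exact h
  · rintro c - ⟨b, hb, h⟩
    refine ⟨f ∘ₗ b, ?_, fun w hw => ?_⟩
    · rw [← LinearMap.comp_assoc, ← hν, LinearMap.comp_assoc, hb, LinearMap.comp_sub,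
        LinearMap.comp_assoc]
    · change f (c w) = d' (f (b w)) + f (b (L.jacobiD w)) + headAct a' (f ∘ₗ b) w
      have h' := hh LinearMap.id b
      rw [LinearMap.comp_id, LinearMap.comp_id] at h'
      rw [h w hw, cochDPrev_apply, h', map_add, map_add, hdx]
      rfl

theorem CochH.push_cls (f : A →ₗ[ℂ] A') (hν : f ∘ₗ ν = ν' ∘ₗ f) (hd : f ∘ₗ d = d' ∘ₗ f)
    (ha : ∀ x e, f (a x e) = a' x (f e)) (c : Words (Tot K) ℂ →ₗ[ℂ] A)
    (hc : c ∈ cochZ L m ν d a) : ∃ h, CochH.push (m := m) (L := L) f hν hd ha (cls _ c hc) =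
      cls (cochB L m ν' d' a') (f ∘ₗ c) h := ⟨_, rfl⟩

end CochH

end Ring

/-! ## The functors attached to a differential graded Lie algebra -/

section Functors
variable {K : CochainComplex (ModuleCat.{0} ℂ) ℕ} {L : DGLie K} {m : ℕ}

/-- A complex with the structure of a differential graded module over `L`. -/
structure DGMod (L : DGLie K) where
  /-- the complex -/
  cx : CochainComplex (ModuleCat.{0} ℂ) ℕ
  /-- the action -/
  rep : DGRep L cx

/-- The map on direct sums of terms induced by a map of complexes. -/
def totMap {M M' : CochainComplex (ModuleCat.{0} ℂ) ℕ} (f : M ⟶ M') : Tot M →ₗ[ℂ] Tot M' :=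
  DirectSum.lmap fun i => (f.f i).hom

@[simp] theorem totMap_hom {M M' : CochainComplex (ModuleCat.{0} ℂ) ℕ} (f : M ⟶ M') (i : ℕ)
    (e : M.X i) : totMap f (hom M i e) = hom M' i ((f.f i).hom e) := by simp [totMap, hom]

theorem totMap_id (M : CochainComplex (ModuleCat.{0} ℂ) ℕ) : totMap (𝟙 M) = LinearMap.id :=
  tot_ext fun i x => by simp

theorem totMap_comp {M M' M'' : CochainComplex (ModuleCat.{0} ℂ) ℕ} (f : M ⟶ M') (g : M' ⟶ M'') :
    totMap (f ≫ g) = totMap g ∘ₗ totMap f := tot_ext fun i x => by simp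

theorem totMap_dTot {M M' : CochainComplex (ModuleCat.{0} ℂ) ℕ} (f : M ⟶ M') :
    totMap f ∘ₗ dTot M = dTot M' ∘ₗ totMap f := tot_ext fun i x => by
  have := congrArg (fun g => g.hom x) (f.comm i (i + 1))
  simp only [ModuleCat.hom_comp, LinearMap.comp_apply] at this
  simp [this]

theorem totMap_scale {M M' : CochainComplex (ModuleCat.{0} ℂ) ℕ} (f : M ⟶ M') (c : ℕ → ℂ) :
    totMap f ∘ₗ scale M c = scale M' c ∘ₗ totMap f := tot_ext fun i x => by simp

/-- Maps of differential graded modules: the maps of complexes which commute with the action. -/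
@[ext] structure DGMod.Hom (E E' : DGMod L) where
  /-- the map of complexes -/
  map : E.cx ⟶ E'.cx
  comm : ∀ x e, totMap map (E.rep.act x e) = E'.rep.act x (totMap map e)

instance : Category (DGMod L) where
  Hom := DGMod.Hom
  id E := ⟨𝟙 _, fun x e => by simp [totMap_id]⟩
  comp f g := ⟨f.map ≫ g.map, fun x e => by simp [totMap_comp, f.comm, g.comm]⟩
  id_comp f := DGMod.Hom.ext (Category.id_comp _)
  comp_id f := DGMod.Hom.ext (Category.comp_id _)
  assoc f g h := DGMod.Hom.ext (Category.assoc _ _ _)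

@[simp] theorem DGMod.id_map (E : DGMod L) : DGMod.Hom.map (𝟙 E) = 𝟙 E.cx := rfl

@[simp] theorem DGMod.comp_map {E E' E'' : DGMod L} (f : E ⟶ E') (g : E' ⟶ E'') :
    DGMod.Hom.map (f ≫ g) = DGMod.Hom.map f ≫ DGMod.Hom.map g := rfl

/-! ### The cohomology of `ᵗK_m` -/

variable (L m) in
/-- The cohomology in degree `0` of the transposed complex `ᵗK_m`, whose part of degree `r` is
the space of the linear maps of degree `r` from `ℂ ⊕ J_m` to the module. -/
def tKH : DGMod L ⥤ ModuleCat.{0} (L.Rm m) where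
  obj E := ModuleCat.of _ (CochH L m (degree E.cx) (dTot E.cx) E.rep.act)
  map f := ModuleCat.ofHom (CochH.push (totMap f.map) (totMap_scale _ _) (totMap_dTot _) f.comm)
  map_id E := by
    ext x
    obtain ⟨c, hc, rfl⟩ := CochH.exists_rep x
    exact cls_eq.2 (cochB_of_zero fun w _ => by simp [totMap_id])
  map_comp f g := by
    ext x
    obtain ⟨c, hc, rfl⟩ := CochH.exists_rep x
    refine cls_eq.2 (cochB_of_zero fun w _ => ?_)
    change totMap (f.map ≫ g.map) (c w) - totMap g.map (totMap f.map (c w)) = 0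
    simp [totMap_comp]

/-! ### The cohomology of `K_m` -/

/-- The differential of the complex `K_m = (ℂ ⊕ J_m) ⊗ E`. -/
def DGMod.jacobiD (E : DGMod L) : Words (Tot K) (Tot E.cx) →ₗ[ℂ] Words (Tot K) (Tot E.cx) :=
  barD (parity K) (dTot K) L.half (dTot E.cx) (E.rep.act ∘ₗ parity K)

/-- The degree operator of the complex `K_m`. -/
def DGMod.totDeg (E : DGMod L) : Words (Tot K) (Tot E.cx) →ₗ[ℂ] Words (Tot K) (Tot E.cx) :=
  derivWords (weight K) (degree E.cx)

variable (m) in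
/-- The cocycles of degree `0` in `K_m`. -/
def DGMod.cycles (E : DGMod L) : Submodule ℂ (Words (Tot K) (Tot E.cx)) :=
  symUpTo (parity K) m ⊓ LinearMap.ker E.totDeg ⊓ LinearMap.ker E.jacobiD

variable (m) in
/-- The coboundaries of degree `0` in `K_m`: the images of the elements of degree `-1`. -/
def DGMod.bounds (E : DGMod L) : Submodule ℂ (Words (Tot K) (Tot E.cx)) :=
  (symUpTo (parity K) m ⊓ LinearMap.ker (E.totDeg + LinearMap.id)).map E.jacobiD

/-- The action of linear forms through contraction. -/
def contrₗ (V F : Type) [AddCommGroup V] [Module ℂ V] [AddCommGroup F] [Module ℂ F] :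
    Form V →ₗ[ℂ] Words V F →ₗ[ℂ] Words V F := contrAux.flip

variable (m) in
/-- The cohomology of `K_m` in degree `0`. -/
def KH (E : DGMod L) : Type := Coh (E.cycles m) (E.bounds m)

instance (E : DGMod L) : AddCommGroup (KH m E) :=
  inferInstanceAs (AddCommGroup (Coh (E.cycles m) (E.bounds m)))

instance (E : DGMod L) : Module (L.Rm m) (KH m E) :=
  rmModule (contrₗ (Tot K) (Tot E.cx))
    (fun z hz w hw => by
      have hN : E.totDeg w = 0 := hw.1.2
      have hD : E.jacobiD w = 0 := hw.2
      refine ⟨⟨contr_mem z hw.1.1, ?_⟩, ?_⟩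
      · have h : contr z (E.totDeg w) = E.totDeg (contr z w) := contr_deg hz.1 _ w
        rw [hN, map_zero] at h
        exact h.symm
      · have h : contr z (E.jacobiD w) = E.jacobiD (contr z w) := contr_D hz _ _ hw.1.1
        rw [hD, map_zero] at h
        exact h.symm)
    (fun z hz w _ hw => by
      obtain ⟨w', ⟨hJ, hN⟩, rfl⟩ := hw
      have hN : E.totDeg w' + w' = 0 := hN
      refine ⟨contr z w', ⟨contr_mem z hJ, ?_⟩, (contr_D hz _ _ hJ).symm⟩
      have h : contr z (E.totDeg w') = E.totDeg (contr z w') := contr_deg hz.1 _ w'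
      change E.totDeg (contr z w') + contr z w' = 0
      rw [← h, ← map_add, hN, map_zero])
    (fun z hz w hw hzB => by
      obtain ⟨y, hy, hzy⟩ := hzB
      have hN : E.totDeg w = 0 := hw.1.2
      have hD : E.jacobiD w = 0 := hw.2
      refine ⟨contr y w, ⟨contr_mem y hw.1.1, ?_⟩, ?_⟩
      · have h : contr y (E.totDeg w) = contr y w + E.totDeg (contr y w) := contr_deg_one hy _ w
        rw [hN, map_zero, add_comm] at h
        exact h.symm
      · have h : contr z w = contr y (E.jacobiD w) + E.jacobiD (contr y w) :=
          contr_coboundary hz hy hzy _ _ hw.1.1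
        rw [hD, map_zero, zero_add] at h
        exact h.symm)
    (fun w _ => contr_unit w)
    (fun z hz z' _ w hw => (contr_conv z z' w).trans
      (contr_comm parity_parity (even_of_deg hz.1) z' hw.1.1))

theorem KH.exists_rep {E : DGMod L} (x : KH m E) : ∃ c hc, x = cls (E.bounds m) c hc := cls_rep x

theorem mapCoeff_totDeg {E E' : DGMod L} (f : E ⟶ E') (w : Words (Tot K) (Tot E.cx)) :
    mapCoeff (totMap f.map) (E.totDeg w) = E'.totDeg (mapCoeff (totMap f.map) w) := by
  have : mapCoeff (totMap f.map) ∘ₗ E.totDeg = E'.totDeg ∘ₗ mapCoeff (totMap f.map) := by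
    refine hom_ext (fun e => ?_) fun v w h => ?_
    · have := LinearMap.congr_fun (totMap_scale f.map fun i => (i : ℂ)) e
      simp only [LinearMap.comp_apply] at this
      simp [DGMod.totDeg, derivWords, mapCoeff_base, degree, this]
    · simp only [LinearMap.comp_apply, DGMod.totDeg, derivWords] at h
      simp [DGMod.totDeg, derivWords, mapCoeff_cons, h]
  exact LinearMap.congr_fun this w

theorem mapCoeff_jacobiD {E E' : DGMod L} (f : E ⟶ E') (w : Words (Tot K) (Tot E.cx)) :
    mapCoeff (totMap f.map) (E.jacobiD w) = E'.jacobiD (mapCoeff (totMap f.map) w) := by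
  have h0 : ∀ v w, mapCoeff (totMap f.map) (combine L.half (E.rep.act ∘ₗ parity K) v w) =
      combine L.half (E'.rep.act ∘ₗ parity K) v (mapCoeff (totMap f.map) w) := by
    intro v w
    have : mapCoeff (totMap f.map) ∘ₗ combine L.half (E.rep.act ∘ₗ parity K) v =
      combine L.half (E'.rep.act ∘ₗ parity K) v ∘ₗ mapCoeff (totMap f.map) :=
      hom_ext (fun e => by simp [mapCoeff_base, f.comm]) (fun u w _ => by simp [mapCoeff_cons])
    exact LinearMap.congr_fun this w
  have : mapCoeff (totMap f.map) ∘ₗ E.jacobiD = E'.jacobiD ∘ₗ mapCoeff (totMap f.map) := by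
    refine hom_ext (fun e => ?_) fun v w h => ?_
    · have := LinearMap.congr_fun (totMap_dTot f.map) e
      simp only [LinearMap.comp_apply] at this
      simp [DGMod.jacobiD, barD_base, mapCoeff_base, this]
    · simp only [LinearMap.comp_apply, DGMod.jacobiD] at h
      simp [DGMod.jacobiD, barD_cons, mapCoeff_cons, h, h0]
  exact LinearMap.congr_fun this w

/-- The map on the cohomology of `K_m` induced by a map of modules. -/
def KH.push {E E' : DGMod L} (f : E ⟶ E') : KH m E →ₗ[L.Rm m] KH m E' where
  toFun := cohMap (mapCoeff (totMap f.map))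
    (fun w hw => by
      have hN : E.totDeg w = 0 := hw.1.2
      have hD : E.jacobiD w = 0 := hw.2
      refine ⟨⟨mapCoeff_symUpTo _ _ _ hw.1.1, ?_⟩, ?_⟩
      · change E'.totDeg _ = 0
        rw [← mapCoeff_totDeg, hN, map_zero]
      · change E'.jacobiD _ = 0
        rw [← mapCoeff_jacobiD, hD, map_zero])
    (fun w _ hw => by
      obtain ⟨w', ⟨hJ, hN⟩, rfl⟩ := hw
      have hN : E.totDeg w' + w' = 0 := hN
      refine ⟨mapCoeff (totMap f.map) w', ⟨mapCoeff_symUpTo _ _ _ hJ, ?_⟩,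
        (mapCoeff_jacobiD f w').symm⟩
      change E'.totDeg _ + mapCoeff (totMap f.map) w' = 0
      rw [← mapCoeff_totDeg, ← map_add, hN, map_zero])
  map_add' := map_add _
  map_smul' r x := by
    obtain ⟨z, hz, rfl⟩ := r.exists_rep
    obtain ⟨w, hw, rfl⟩ := x.exists_rep
    refine cls_eq.2 ?_
    have : mapCoeff (totMap f.map) (contr z w) = contr z (mapCoeff (totMap f.map) w) :=
      mapCoeff_contr _ z w
    change mapCoeff (totMap f.map) (contr z w) - contr z (mapCoeff (totMap f.map) w) ∈ _
    rw [this, sub_self]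
    exact Submodule.zero_mem _

variable (L m) in
/-- The cohomology in degree `0` of the complex `K_m = (ℂ ⊕ J_m) ⊗ E`. -/
def KHfun : DGMod L ⥤ ModuleCat.{0} (L.Rm m) where
  obj E := ModuleCat.of _ (KH m E)
  map f := ModuleCat.ofHom (KH.push f)
  map_id E := by
    ext x
    obtain ⟨w, hw, rfl⟩ := KH.exists_rep x
    refine cls_eq.2 ?_
    have : (mapCoeff (totMap (𝟙 E.cx)) : Words (Tot K) (Tot E.cx) →ₗ[ℂ] _) = LinearMap.id :=
      hom_ext (fun e => by simp [mapCoeff_base, totMap_id])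
        (fun v w h => by rw [mapCoeff_cons, h]; rfl)
    change mapCoeff (totMap (𝟙 E.cx)) w - w ∈ _
    rw [this, LinearMap.id_apply, sub_self]
    exact Submodule.zero_mem _
  map_comp {E E' E''} f g := by
    ext x
    obtain ⟨w, hw, rfl⟩ := KH.exists_rep x
    refine cls_eq.2 ?_
    have : (mapCoeff (totMap (f.map ≫ g.map)) : Words (Tot K) (Tot E.cx) →ₗ[ℂ] _) =
        mapCoeff (totMap g.map) ∘ₗ mapCoeff (totMap f.map) :=
      hom_ext (fun e => by simp [mapCoeff_base, totMap_comp])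
        (fun v w h => by
          rw [mapCoeff_cons, h]; simp [mapCoeff_cons])
    change mapCoeff (totMap (f.map ≫ g.map)) w -
      mapCoeff (totMap g.map) (mapCoeff (totMap f.map) w) ∈ _
    rw [this, LinearMap.comp_apply, sub_self]
    exact Submodule.zero_mem _

variable (L) in
/-- The trivial module `ℂ` in degree `0`. -/
def trivMod : DGMod L where
  cx := (CochainComplex.single₀ (ModuleCat.{0} ℂ)).obj (ModuleCat.of ℂ ℂ)
  rep :=
    { act := 0
      act_deg := fun i j x e => by simp
      leibniz := fun i x e => by simp
      act_br := fun i j x y e => by simp }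

variable (L m) in
/-- The dual `R_m^*` of `R_m` as an `R_m`-module: the cohomology in degree `0` of
`ℂ ⊕ J_m`. -/
def coR : ModuleCat.{0} (L.Rm m) := (KHfun L m).obj (trivMod L)

/-! ### The deformation attached to a Maurer-Cartan element -/

/-- The operator by which an element of `R_m ⊗ g` of degree `1` acts on `R_m ⊗ E`. -/
def phiAct (E : DGMod L) :
    (L.Rm m ⊗[ℂ] K.X 1) →ₗ[ℂ] (L.Rm m ⊗[ℂ] Tot E.cx) →ₗ[ℂ] (L.Rm m ⊗[ℂ] Tot E.cx) :=
  TensorProduct.map₂ (LinearMap.mul ℂ (L.Rm m)) (E.rep.act ∘ₗ hom K 1)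

/-- The differential `∂ + φ` of the deformation attached to `φ`. -/
def defD (φ : L.Rm m ⊗[ℂ] K.X 1) (E : DGMod L) :
    (L.Rm m ⊗[ℂ] Tot E.cx) →ₗ[ℂ] (L.Rm m ⊗[ℂ] Tot E.cx) :=
  LinearMap.lTensor _ (dTot E.cx) + phiAct E φ

theorem phiAct_smul (φ : L.Rm m ⊗[ℂ] K.X 1) (E : DGMod L) (r : L.Rm m)
    (x : L.Rm m ⊗[ℂ] Tot E.cx) : phiAct E φ (r • x) = r • phiAct E φ x := by
  induction φ with
  | zero => simp
  | add φ ψ h h' => simp only [map_add, LinearMap.add_apply, h, h', smul_add]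
  | tmul s y =>
    induction x with
    | zero => simp
    | add x x' h h' => simp only [map_add, smul_add, h, h']
    | tmul t e => simp [phiAct, TensorProduct.smul_tmul', mul_left_comm]

theorem lTensor_smul {N N' : Type} [AddCommGroup N] [Module ℂ N] [AddCommGroup N'] [Module ℂ N']
    (f : N →ₗ[ℂ] N') (r : L.Rm m) (x : L.Rm m ⊗[ℂ] N) :
    LinearMap.lTensor (L.Rm m) f (r • x) = r • LinearMap.lTensor (L.Rm m) f x := by
  induction x with
  | zero => simp
  | add x x' h h' => simp only [map_add, smul_add, h, h']
  | tmul t e => simp [TensorProduct.smul_tmul']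

theorem defD_smul (φ : L.Rm m ⊗[ℂ] K.X 1) (E : DGMod L) (r : L.Rm m)
    (x : L.Rm m ⊗[ℂ] Tot E.cx) : defD φ E (r • x) = r • defD φ E x := by
  simp only [defD, LinearMap.add_apply, phiAct_smul, lTensor_smul, smul_add]

/-- The kernel of `∂ + φ` in degree `0`. -/
def defKer (φ : L.Rm m ⊗[ℂ] K.X 1) (E : DGMod L) :
    Submodule (L.Rm m) (L.Rm m ⊗[ℂ] E.cx.X 0) where
  carrier := {x | defD φ E (LinearMap.lTensor _ (hom E.cx 0) x) = 0}
  add_mem' := fun {x y} hx hy => by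
    have hx : defD φ E (LinearMap.lTensor _ (hom E.cx 0) x) = 0 := hx
    have hy : defD φ E (LinearMap.lTensor _ (hom E.cx 0) y) = 0 := hy
    change defD φ E (LinearMap.lTensor _ (hom E.cx 0) (x + y)) = 0
    rw [map_add, map_add, hx, hy, add_zero]
  zero_mem' := by
    change defD φ E (LinearMap.lTensor _ (hom E.cx 0) 0) = 0
    simp
  smul_mem' := fun r x hx => by
    have hx : defD φ E (LinearMap.lTensor _ (hom E.cx 0) x) = 0 := hx
    change defD φ E (LinearMap.lTensor _ (hom E.cx 0) (r • x)) = 0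
    rw [lTensor_smul, defD_smul, hx, smul_zero]

theorem phiAct_push (φ : L.Rm m ⊗[ℂ] K.X 1) {E E' : DGMod L} (f : E ⟶ E')
    (x : L.Rm m ⊗[ℂ] Tot E.cx) : phiAct E' φ (LinearMap.lTensor _ (totMap f.map) x) =
      LinearMap.lTensor _ (totMap f.map) (phiAct E φ x) := by
  induction φ with
  | zero => simp
  | add φ ψ h h' => simp only [map_add, LinearMap.add_apply, h, h']
  | tmul s y =>
    induction x with
    | zero => simp
    | add x x' h h' => simp only [map_add, h, h']
    | tmul t e => simp [phiAct, f.comm]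

/-- The map on kernels induced by a map of modules. -/
def defKer.push (φ : L.Rm m ⊗[ℂ] K.X 1) {E E' : DGMod L} (f : E ⟶ E') :
    defKer φ E →ₗ[L.Rm m] defKer φ E' :=
  LinearMap.restrict (p := defKer φ E) (q := defKer φ E')
    { toFun := LinearMap.lTensor (L.Rm m) (f.map.f 0).hom
      map_add' := map_add _
      map_smul' := lTensor_smul _ } fun x hx => by
    have hx : defD φ E (LinearMap.lTensor _ (hom E.cx 0) x) = 0 := hx
    change defD φ E' (LinearMap.lTensor _ (hom E'.cx 0)
      (LinearMap.lTensor (L.Rm m) (f.map.f 0).hom x)) = 0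
    have h1 : hom E'.cx 0 ∘ₗ (f.map.f 0).hom = totMap f.map ∘ₗ hom E.cx 0 :=
      LinearMap.ext fun e => by simp
    rw [← LinearMap.lTensor_comp_apply, h1, LinearMap.lTensor_comp_apply, defD,
      LinearMap.add_apply, phiAct_push, ← LinearMap.lTensor_comp_apply, ← totMap_dTot,
      LinearMap.lTensor_comp_apply, ← map_add]
    have : LinearMap.lTensor (L.Rm m) (dTot E.cx) (LinearMap.lTensor _ (hom E.cx 0) x) +
      phiAct E φ (LinearMap.lTensor _ (hom E.cx 0) x) = 0 := hx
    rw [this, map_zero]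

/-- The functor sending a module to `H^0` of its deformation by `φ`. -/
def defFun (φ : L.Rm m ⊗[ℂ] K.X 1) : DGMod L ⥤ ModuleCat.{0} (L.Rm m) where
  obj E := ModuleCat.of _ (defKer φ E)
  map f := ModuleCat.ofHom (defKer.push φ f)
  map_id E := by
    ext x
    change LinearMap.lTensor (L.Rm m) ((𝟙 E.cx : E.cx ⟶ E.cx).f 0).hom x.1 = x.1
    simp
  map_comp f g := by
    ext x
    change LinearMap.lTensor (L.Rm m) ((f.map ≫ g.map).f 0).hom x.1 =
      LinearMap.lTensor (L.Rm m) (g.map.f 0).hom (LinearMap.lTensor (L.Rm m) (f.map.f 0).hom x.1)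
    rw [← LinearMap.lTensor_comp_apply]; simp

/-! ### Tautological elements -/

/-- The element `φ ⋯ φ` (`k` letters) of `R_m ⊗ T(g)`, for `φ` in `R_m ⊗ g` of degree `1`. -/
def phiPow (φ : L.Rm m ⊗[ℂ] K.X 1) : ℕ → L.Rm m ⊗[ℂ] Words (Tot K) ℂ
  | 0 => 1 ⊗ₜ base 1
  | k + 1 => TensorProduct.map₂ (LinearMap.mul ℂ (L.Rm m)) (cons ∘ₗ hom K 1) φ (phiPow φ k)

/-- The value of a linear form on an element of `R_m ⊗ T(g)`. -/
def evalForm (z : Form (Tot K)) : L.Rm m ⊗[ℂ] Words (Tot K) ℂ →ₗ[ℂ] L.Rm m :=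
  TensorProduct.lift ((LinearMap.lsmul ℂ (L.Rm m)).flip.compl₂ z)

/-- `φ` is the element of `m_R ⊗ g` of degree `1` defining an `m`-universal deformation: it is a
Maurer-Cartan element with coefficients in the kernel of the augmentation, and its
Kodaira-Spencer homomorphism `R_m → R_m`, which sends the class of `z` to the value of `z` on
`1 + φ + φφ + ⋯ + φ ⋯ φ`, is the identity. -/
structure IsTautological (φ : L.Rm m ⊗[ℂ] K.X 1) : Prop where
  aug : LinearMap.rTensor (K.X 1) DGLie.Rm.aug φ = 0
  maurerCartan : LinearMap.lTensor (L.Rm m) (dTot K ∘ₗ hom K 1) φ + (1 / 2 : ℂ) •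
    TensorProduct.map₂ (LinearMap.mul ℂ (L.Rm m)) (L.br.compl₁₂ (hom K 1) (hom K 1)) φ φ = 0
  kodairaSpencer : ∀ (z : Form (Tot K)) (hz : z ∈ L.cocycles m),
    ∑ k ∈ Finset.range (m + 1), evalForm z (phiPow φ k) = DGLie.Rm.mk z hz

end Functors

/-! ### The complex `L_m` -/

section Lm
variable {K : CochainComplex (ModuleCat.{0} ℂ) ℕ} {L : DGLie K} {m : ℕ}

theorem comp_hom_self {M : CochainComplex (ModuleCat.{0} ℂ) ℕ} (i : ℕ) (e : M.X i) :
    comp M i (hom M i e) = e := by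
  simp only [comp, hom]
  exact DirectSum.component.lof_self (R := ℂ) (M := fun i => (M.X i : Type)) i e

theorem comp_hom_ne {M : CochainComplex (ModuleCat.{0} ℂ) ℕ} {i j : ℕ} (h : i ≠ j) (e : M.X i) :
    comp M j (hom M i e) = 0 := by
  have := DirectSum.component.of (R := ℂ) (M := fun i => (M.X i : Type)) j i e
  rw [dif_neg h] at this
  exact this

theorem hom_injective {M : CochainComplex (ModuleCat.{0} ℂ) ℕ} {i : ℕ} {e e' : M.X i}
    (h : hom M i e = hom M i e') : e = e' := by
  rw [← comp_hom_self i e, h, comp_hom_self]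

/-- The part of the action which goes from degree `p` to degree `q`; only letters of
degree `q - p` contribute. -/
def DGMod.aComp (E : DGMod L) (p q : ℕ) : Tot K →ₗ[ℂ] E.cx.X p →ₗ[ℂ] E.cx.X q :=
  (E.rep.act.compl₂ (hom E.cx p)).compr₂ (comp E.cx q)

theorem DGMod.aComp_ne (E : DGMod L) {i p q : ℕ} (h : i + p ≠ q) (x : K.X i) :
    E.aComp p q (hom K i x) = 0 := by
  refine LinearMap.ext fun e => ?_
  obtain ⟨e', he⟩ := E.rep.act_deg i p x e
  change comp E.cx q (E.rep.act (hom K i x) (hom E.cx p e)) = 0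
  rw [← he, comp_hom_ne h]

theorem DGMod.hom_aComp (E : DGMod L) {i p q : ℕ} (h : i + p = q) (x : K.X i) (e : E.cx.X p) :
    hom E.cx q (E.aComp p q (hom K i x) e) = E.rep.act (hom K i x) (hom E.cx p e) := by
  subst h
  obtain ⟨e', he⟩ := E.rep.act_deg i p x e
  change hom E.cx _ (comp E.cx _ (E.rep.act (hom K i x) (hom E.cx p e))) = _
  rw [← he, comp_hom_self]

theorem DGMod.aComp_scale (E : DGMod L) {p q n : ℕ} (h : n + p = q) (c : ℕ → ℂ) :
    E.aComp p q ∘ₗ scale K c = c n • E.aComp p q := by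
  refine tot_ext fun i x => ?_
  rw [LinearMap.comp_apply, scale_hom, map_smul, LinearMap.smul_apply]
  by_cases hi : i + p = q
  · obtain rfl : i = n := by omega
    rfl
  · rw [E.aComp_ne hi, smul_zero, smul_zero]

theorem DGMod.aComp_br (E : DGMod L) {i j p q : ℕ} (h : i + j + p = q) (x : K.X i) (y : K.X j)
    (e : E.cx.X p) : hom E.cx q (E.aComp p q (L.br (hom K i x) (hom K j y)) e) =
      E.rep.act (L.br (hom K i x) (hom K j y)) (hom E.cx p e) := by
  obtain ⟨z, hz⟩ := L.br_deg i j x y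
  rw [← hz, E.hom_aComp h]

theorem DGMod.aComp_br_ne (E : DGMod L) {i j p q : ℕ} (h : i + j + p ≠ q) (x : K.X i) (y : K.X j) :
    E.aComp p q (L.br (hom K i x) (hom K j y)) = 0 := by
  obtain ⟨z, hz⟩ := L.br_deg i j x y
  rw [← hz, E.aComp_ne h]

section HeadAct₂
variable {A A' A'' : Type} [AddCommGroup A] [Module ℂ A] [AddCommGroup A'] [Module ℂ A']
  [AddCommGroup A''] [Module ℂ A'']

/-- The cochain `x y w ↦ Φ x y (c w)` for letters `x`, `y` and a word `w`. -/
def headAct₂ (Φ : Tot K →ₗ[ℂ] Tot K →ₗ[ℂ] A →ₗ[ℂ] A') (c : Words (Tot K) ℂ →ₗ[ℂ] A) :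
    Words (Tot K) ℂ →ₗ[ℂ] A' := wcases₂ (Φ.compr₂ (LinearMap.lcomp ℂ A' c))

theorem headAct₂_base (Φ : Tot K →ₗ[ℂ] Tot K →ₗ[ℂ] A →ₗ[ℂ] A') (c : Words (Tot K) ℂ →ₗ[ℂ] A)
    (t : ℂ) : headAct₂ Φ c (base t) = 0 := by simp [headAct₂]

theorem headAct₂_cons (Φ : Tot K →ₗ[ℂ] Tot K →ₗ[ℂ] A →ₗ[ℂ] A') (c : Words (Tot K) ℂ →ₗ[ℂ] A)
    (x : Tot K) (w : Words (Tot K) ℂ) : headAct₂ Φ c (cons x w) = headAct (Φ x) c w := by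
  have : headAct₂ Φ c ∘ₗ cons x = headAct (Φ x) c :=
    hom_ext (by simp [headAct₂]) (by simp [headAct₂])
  exact LinearMap.congr_fun this w

theorem headAct_headAct (a : Tot K →ₗ[ℂ] A' →ₗ[ℂ] A'') (a' : Tot K →ₗ[ℂ] A →ₗ[ℂ] A')
    (c : Words (Tot K) ℂ →ₗ[ℂ] A) (x : Tot K) (w : Words (Tot K) ℂ) :
    a x (headAct a' c w) = headAct (a'.compr₂ (a x)) c w := by
  have : a x ∘ₗ headAct a' c = headAct (a'.compr₂ (a x)) c := hom_ext (by simp) (by simp)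
  exact LinearMap.congr_fun this w

theorem headAct_combine (a : Tot K →ₗ[ℂ] A →ₗ[ℂ] A') (c : Words (Tot K) ℂ →ₗ[ℂ] A) (x : Tot K)
    (w : Words (Tot K) ℂ) :
    headAct a c (combine L.half 0 x w) = headAct (a ∘ₗ L.half x) c w := by
  have : headAct a c ∘ₗ combine L.half 0 x = headAct (a ∘ₗ L.half x) c :=
    hom_ext (by simp) (by simp)
  exact LinearMap.congr_fun this w

theorem headAct₂_vanish (Φ : Tot K →ₗ[ℂ] Tot K →ₗ[ℂ] A →ₗ[ℂ] A') (c : Words (Tot K) ℂ →ₗ[ℂ] A)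
    (h : ∀ i j (x : K.X i) (y : K.X j) (e : A), Φ (hom K i x) (hom K j y) e +
      ((1 + (-1) ^ (j + 1) + (-1) ^ (i + 1) - (-1) ^ (j + 1) * (-1) ^ (i + 1)) / 2 : ℂ) •
        Φ (hom K j y) (hom K i x) e = 0) {w : Words (Tot K) ℂ}
    (hw : w ∈ symUpTo (parity K) m) : headAct₂ Φ c w = 0 := by
  have h2 : ∀ (x y : Tot K) (w : Words (Tot K) ℂ), headAct₂ Φ c (cons x (cons y w)) +
      headAct₂ Φ c (swapHead (parity K) (cons x (cons y w))) = 0 := by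
    intro x y w
    revert x
    refine tot_induction (fun i x => ?_) (fun x x' hx hx' => ?_)
    · revert y
      refine tot_induction (fun j y => ?_) (fun y y' hy hy' => ?_)
      · rw [← h i j x y (c w), swapHead_cons_cons]
        simp only [parity, scale_hom, map_smul, LinearMap.smul_apply, map_add, map_sub,
          headAct₂_cons, headAct_cons, smul_smul]
        module
      · have : headAct₂ Φ c (cons (hom K i x) (cons (y + y') w)) +
            headAct₂ Φ c (swapHead (parity K) (cons (hom K i x) (cons (y + y') w))) =
            (headAct₂ Φ c (cons (hom K i x) (cons y w)) +
              headAct₂ Φ c (swapHead (parity K) (cons (hom K i x) (cons y w)))) +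
            (headAct₂ Φ c (cons (hom K i x) (cons y' w)) +
              headAct₂ Φ c (swapHead (parity K) (cons (hom K i x) (cons y' w)))) := by
          simp only [map_add, LinearMap.add_apply]; abel
        rw [this, hy, hy', add_zero]
    · have : headAct₂ Φ c (cons (x + x') (cons y w)) +
          headAct₂ Φ c (swapHead (parity K) (cons (x + x') (cons y w))) =
          (headAct₂ Φ c (cons x (cons y w)) +
            headAct₂ Φ c (swapHead (parity K) (cons x (cons y w)))) +
          (headAct₂ Φ c (cons x' (cons y w)) +
            headAct₂ Φ c (swapHead (parity K) (cons x' (cons y w)))) := by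
        simp only [map_add, LinearMap.add_apply]; abel
      rw [this, hx, hx', add_zero]
  refine symUpTo_induction (p := LinearMap.ker (headAct₂ Φ c)) (fun k _ w hw => ?_) hw
  rw [LinearMap.mem_ker]
  match k, hw with
  | 0, hw => obtain ⟨e, rfl⟩ := hw; exact headAct₂_base _ _ _
  | 1, hw =>
    refine symWords_ext (f := headAct₂ Φ c) (g := 0) (fun v t ht => ?_) hw
    obtain ⟨e, rfl⟩ := ht
    rw [headAct₂_cons, headAct_base]; rfl
  | k + 2, hw =>
    have h3 : headAct₂ Φ c w + headAct₂ Φ c (swapHead (parity K) w) = 0 := by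
      refine symWords_ext (f := headAct₂ Φ c + headAct₂ Φ c ∘ₗ swapHead (parity K)) (g := 0)
        (fun v t ht => ?_) hw
      exact symWords_ext (f := (headAct₂ Φ c + headAct₂ Φ c ∘ₗ swapHead (parity K)) ∘ₗ cons v)
        (g := 0) (fun u s _ => h2 v u s) ht
    rw [symWords_swap hw, ← two_smul ℂ] at h3
    exact (smul_eq_zero.1 h3).resolve_left two_ne_zero

end HeadAct₂

theorem DGMod.aComp_d_zero (E : DGMod L) (p : ℕ) (x : Tot K) (e : E.cx.X p) :
    E.aComp p (p + 1) (dTot K x) e + E.aComp (p + 1) (p + 1) x ((E.cx.d p (p + 1)).hom e) =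
      (E.cx.d p (p + 1)).hom (E.aComp p p x e) := by
  revert x
  refine tot_induction (fun i x => ?_) (fun x x' hx hx' => ?_)
  · by_cases hi : i = 0
    · subst hi
      apply hom_injective
      have h := E.rep.leibniz 0 x (hom E.cx p e)
      rw [map_add, ← dTot_hom (K := E.cx), E.hom_aComp (by omega), E.hom_aComp (by omega), dTot_hom,
        E.hom_aComp (by omega), h, dTot_hom, dTot_hom]
      simp
    · rw [dTot_hom, E.aComp_ne (by omega), E.aComp_ne (by omega), E.aComp_ne (by omega)]
      simp
  · simp only [map_add, LinearMap.add_apply, ← hx, ← hx']; abel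

theorem DGMod.aComp_d_one (E : DGMod L) (p : ℕ) (x : Tot K) (e : E.cx.X p) :
    (E.cx.d (p + 1) (p + 1 + 1)).hom (E.aComp p (p + 1) x e) +
      E.aComp (p + 1) (p + 1 + 1) x ((E.cx.d p (p + 1)).hom e) =
      E.aComp p (p + 1 + 1) (dTot K x) e := by
  revert x
  refine tot_induction (fun i x => ?_) (fun x x' hx hx' => ?_)
  · by_cases hi : i = 1
    · subst hi
      apply hom_injective
      have h := E.rep.leibniz 1 x (hom E.cx p e)
      rw [map_add, ← dTot_hom (K := E.cx), E.hom_aComp (by omega), E.hom_aComp (by omega), dTot_hom,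
        E.hom_aComp (by omega), h, dTot_hom, dTot_hom]
      simp
    · rw [dTot_hom, E.aComp_ne (by omega), E.aComp_ne (by omega), E.aComp_ne (by omega)]
      simp
  · simp only [map_add, LinearMap.add_apply, ← hx, ← hx']; abel

/-- The horizontal differential on cochains with values in the term of degree `p`. -/
def DGMod.hd (E : DGMod L) (p : ℕ) :
    (Words (Tot K) ℂ →ₗ[ℂ] E.cx.X p) →ₗ[ℂ] (Words (Tot K) ℂ →ₗ[ℂ] E.cx.X (p + 1)) :=
  LinearMap.compRight ℂ (E.cx.d p (p + 1)).hom + headAct (E.aComp p (p + 1))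

theorem DGMod.hd_apply (E : DGMod L) (p : ℕ) (c : Words (Tot K) ℂ →ₗ[ℂ] E.cx.X p)
    (w : Words (Tot K) ℂ) :
    E.hd p c w = (E.cx.d p (p + 1)).hom (c w) + headAct (E.aComp p (p + 1)) c w := rfl

theorem DGMod.vd_eq (E : DGMod L) (p : ℕ) :
    cochD L 0 (E.aComp p p) = -cochDPrev L 0 (E.aComp p p) := by
  refine LinearMap.ext fun c => LinearMap.ext fun w => ?_
  rw [cochD_apply, LinearMap.neg_apply, LinearMap.neg_apply, cochDPrev_apply, parity,
    E.aComp_scale (n := 0) (by omega)]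
  have : headAct (((-1 : ℂ) ^ (0 + 1)) • E.aComp p p) c = -headAct (E.aComp p p) c :=
    hom_ext (by simp) (by simp)
  rw [this]
  simp
  abel

theorem jacobiD_base (t : ℂ) : L.jacobiD (base t) = 0 := by
  simp [DGLie.jacobiD, barD_base]

theorem jacobiD_cons (x : Tot K) (w : Words (Tot K) ℂ) : L.jacobiD (cons x w) =
    cons (dTot K x) w + combine L.half 0 x w + cons (parity K x) (L.jacobiD w) := by
  simp [DGLie.jacobiD, barD_cons]

/-- The vertical and horizontal differentials commute on symmetric words. -/
theorem DGMod.vd_hd (E : DGMod L) (p : ℕ) (c : Words (Tot K) ℂ →ₗ[ℂ] E.cx.X p)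
    {w : Words (Tot K) ℂ} (hw : w ∈ symUpTo (parity K) m) :
    cochDPrev L 0 (E.aComp (p + 1) (p + 1)) (E.hd p c) w =
      E.hd p (cochDPrev L 0 (E.aComp p p) c) w := by
  let Φ : Tot K →ₗ[ℂ] Tot K →ₗ[ℂ] E.cx.X p →ₗ[ℂ] E.cx.X (p + 1) :=
    (LinearMap.llcomp ℂ (Tot K) (Tot K) (E.cx.X p →ₗ[ℂ] E.cx.X (p + 1)) (E.aComp p (p + 1))) ∘ₗ
      L.half +
    (LinearMap.mk₂ ℂ (fun x y => E.aComp (p + 1) (p + 1) x ∘ₗ E.aComp p (p + 1) y)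
      (fun x x' y => by simp [LinearMap.add_comp]) (fun t x y => by simp [LinearMap.smul_comp])
      (fun x y y' => by simp [LinearMap.comp_add]) (fun t x y => by simp [LinearMap.comp_smul])) -
    (LinearMap.mk₂ ℂ (fun x y => E.aComp p (p + 1) x ∘ₗ E.aComp p p y)
      (fun x x' y => by simp [LinearMap.add_comp]) (fun t x y => by simp [LinearMap.smul_comp])
      (fun x y y' => by simp [LinearMap.comp_add]) (fun t x y => by simp [LinearMap.comp_smul]))
  have hΦ : ∀ x y e, Φ x y e = E.aComp p (p + 1) (L.half x y) e +
      E.aComp (p + 1) (p + 1) x (E.aComp p (p + 1) y e) -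
      E.aComp p (p + 1) x (E.aComp p p y e) := fun x y e => rfl
  have key : cochDPrev L 0 (E.aComp (p + 1) (p + 1)) (E.hd p c) -
      E.hd p (cochDPrev L 0 (E.aComp p p) c) = headAct₂ Φ c := by
    refine hom_ext (fun t => ?_) (fun x w _ => ?_)
    · simp [cochDPrev_apply, E.hd_apply, headAct₂_base, jacobiD_base]
    · have hx : headAct (Φ x) c w = headAct (E.aComp p (p + 1) ∘ₗ L.half x) c w +
          headAct ((E.aComp p (p + 1)).compr₂ (E.aComp (p + 1) (p + 1) x)) c w -
          headAct ((E.aComp p p).compr₂ (E.aComp p (p + 1) x)) c w := by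
        have : headAct (Φ x) c = headAct (E.aComp p (p + 1) ∘ₗ L.half x) c +
          headAct ((E.aComp p (p + 1)).compr₂ (E.aComp (p + 1) (p + 1) x)) c -
          headAct ((E.aComp p p).compr₂ (E.aComp p (p + 1) x)) c :=
          hom_ext (by simp) (by simp [hΦ])
        rw [this]; rfl
      have hP : E.aComp p (p + 1) (parity K x) = E.aComp p (p + 1) x := by
        have := LinearMap.congr_fun (E.aComp_scale (p := p) (q := p + 1) (n := 1) (by omega)
          fun i => (-1) ^ (i + 1)) x
        rw [LinearMap.comp_apply] at this
        refine this.trans ?_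
        norm_num
      have hd := E.aComp_d_zero p x (c w)
      rw [headAct₂_cons, hx, ← headAct_headAct, ← headAct_headAct, ← headAct_combine]
      simp only [LinearMap.sub_apply, cochDPrev_apply, E.hd_apply, headAct_cons, jacobiD_cons,
        map_add, LinearMap.zero_apply, zero_add, hP, ← hd]
      abel
  have h0 : headAct₂ Φ c w = 0 := by
    refine headAct₂_vanish Φ c (fun i j x y e => ?_) hw
    simp only [hΦ, DGLie.half, LinearMap.smul_apply, LinearMap.comp_apply, parity, scale_hom,
      map_smul]
    apply hom_injective
    have hs := L.skew j i y x
    by_cases h01 : i = 0 ∧ j = 1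
    · obtain ⟨rfl, rfl⟩ := h01
      have h3 := E.rep.act_br 0 1 x y (hom E.cx p e)
      rw [hs]
      simp only [map_add, map_sub, map_smul, map_zero, E.aComp_ne (i := 1) (p := p) (q := p)
        (by omega), LinearMap.zero_apply, E.aComp_ne (i := 1) (p := p + 1) (q := p + 1) (by omega),
        E.hom_aComp (i := 0) (p := p + 1) (q := p + 1) (by omega), LinearMap.smul_apply,
        E.hom_aComp (i := 1) (p := p) (q := p + 1) (by omega),
        E.hom_aComp (i := 0) (p := p) (q := p) (by omega), E.aComp_br (i := 0) (j := 1)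
          (p := p) (q := p + 1) (by omega), h3]
      norm_num
      module
    · by_cases h10 : i = 1 ∧ j = 0
      · obtain ⟨rfl, rfl⟩ := h10
        have h3 := E.rep.act_br 1 0 x y (hom E.cx p e)
        rw [hs]
        simp only [map_add, map_sub, map_smul, map_zero, E.aComp_ne (i := 1) (p := p) (q := p)
          (by omega), LinearMap.zero_apply, E.aComp_ne (i := 1) (p := p + 1) (q := p + 1)
          (by omega), LinearMap.smul_apply,
          E.hom_aComp (i := 0) (p := p + 1) (q := p + 1) (by omega),
          E.hom_aComp (i := 1) (p := p) (q := p + 1) (by omega),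
          E.hom_aComp (i := 0) (p := p) (q := p) (by omega), E.aComp_br (i := 1) (j := 0)
            (p := p) (q := p + 1) (by omega), h3]
        norm_num
        module
      · have hij : i + j ≠ 1 := by omega
        have e1 : ∀ (e : E.cx.X p), E.aComp (p + 1) (p + 1) (hom K i x)
            (E.aComp p (p + 1) (hom K j y) e) = 0 := fun e => by
          by_cases hi : i = 0
          · rw [E.aComp_ne (i := j) (by omega)]; simp
          · rw [E.aComp_ne (i := i) (by omega)]; simp
        have e2 : ∀ (e : E.cx.X p), E.aComp (p + 1) (p + 1) (hom K j y)
            (E.aComp p (p + 1) (hom K i x) e) = 0 := fun e => by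
          by_cases hi : j = 0
          · rw [E.aComp_ne (i := i) (by omega)]; simp
          · rw [E.aComp_ne (i := j) (by omega)]; simp
        have e3 : ∀ (e : E.cx.X p), E.aComp p (p + 1) (hom K i x)
            (E.aComp p p (hom K j y) e) = 0 := fun e => by
          by_cases hi : j = 0
          · rw [E.aComp_ne (i := i) (by omega)]; simp
          · rw [E.aComp_ne (i := j) (by omega)]; simp
        have e4 : ∀ (e : E.cx.X p), E.aComp p (p + 1) (hom K j y)
            (E.aComp p p (hom K i x) e) = 0 := fun e => by
          by_cases hi : i = 0
          · rw [E.aComp_ne (i := j) (by omega)]; simp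
          · rw [E.aComp_ne (i := i) (by omega)]; simp
        rw [e1, e2, e3, e4, E.aComp_br_ne (by omega), E.aComp_br_ne (by omega)]
        simp
  rw [← sub_eq_zero]
  exact (LinearMap.congr_fun key w).trans h0

/-- On vertical cocycles the square of the horizontal differential is a vertical coboundary. -/
theorem DGMod.hd_hd (E : DGMod L) (p : ℕ) {c : Words (Tot K) ℂ →ₗ[ℂ] E.cx.X p}
    (hc : ∀ w ∈ symUpTo (parity K) m, cochD L 0 (E.aComp p p) c w = 0)
    {w : Words (Tot K) ℂ} (hw : w ∈ symUpTo (parity K) m) :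
    E.hd (p + 1) (E.hd p c) w = cochDPrev L 0 (E.aComp (p + 1 + 1) (p + 1 + 1))
      (headAct (E.aComp p (p + 1 + 1)) c) w := by
  let Φ : Tot K →ₗ[ℂ] Tot K →ₗ[ℂ] E.cx.X p →ₗ[ℂ] E.cx.X (p + 1 + 1) :=
    (LinearMap.llcomp ℂ (Tot K) (Tot K) (E.cx.X p →ₗ[ℂ] E.cx.X (p + 1 + 1))
      (E.aComp p (p + 1 + 1))) ∘ₗ L.half +
    (LinearMap.mk₂ ℂ (fun x y => E.aComp (p + 1 + 1) (p + 1 + 1) x ∘ₗ E.aComp p (p + 1 + 1) y)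
      (fun x x' y => by simp [LinearMap.add_comp]) (fun t x y => by simp [LinearMap.smul_comp])
      (fun x y y' => by simp [LinearMap.comp_add]) (fun t x y => by simp [LinearMap.comp_smul])) +
    (LinearMap.mk₂ ℂ (fun x y => E.aComp p (p + 1 + 1) x ∘ₗ E.aComp p p y)
      (fun x x' y => by simp [LinearMap.add_comp]) (fun t x y => by simp [LinearMap.smul_comp])
      (fun x y y' => by simp [LinearMap.comp_add]) (fun t x y => by simp [LinearMap.comp_smul])) -
    (LinearMap.mk₂ ℂ (fun x y => E.aComp (p + 1) (p + 1 + 1) x ∘ₗ E.aComp p (p + 1) y)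
      (fun x x' y => by simp [LinearMap.add_comp]) (fun t x y => by simp [LinearMap.smul_comp])
      (fun x y y' => by simp [LinearMap.comp_add]) (fun t x y => by simp [LinearMap.comp_smul]))
  have hΦ : ∀ x y e, Φ x y e = E.aComp p (p + 1 + 1) (L.half x y) e +
      E.aComp (p + 1 + 1) (p + 1 + 1) x (E.aComp p (p + 1 + 1) y e) +
      E.aComp p (p + 1 + 1) x (E.aComp p p y e) -
      E.aComp (p + 1) (p + 1 + 1) x (E.aComp p (p + 1) y e) := fun x y e => rfl
  have hc' : ∀ w ∈ symUpTo (parity K) m, c (L.jacobiD w) = -headAct (E.aComp p p) c w := by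
    intro w hw
    have := hc w hw
    rw [E.vd_eq, LinearMap.neg_apply, LinearMap.neg_apply, neg_eq_zero, cochDPrev_apply,
      LinearMap.zero_apply, zero_add] at this
    exact eq_neg_of_add_eq_zero_left this
  have key : cochDPrev L 0 (E.aComp (p + 1 + 1) (p + 1 + 1))
      (headAct (E.aComp p (p + 1 + 1)) c) w - E.hd (p + 1) (E.hd p c) w = headAct₂ Φ c w := by
    refine symUpTo_induction (p := LinearMap.eqLocus (cochDPrev L 0
      (E.aComp (p + 1 + 1) (p + 1 + 1)) (headAct (E.aComp p (p + 1 + 1)) c) -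
      E.hd (p + 1) (E.hd p c)) (headAct₂ Φ c)) (fun k hk w hw => ?_) hw
    have hdd : ∀ e, (E.cx.d (p + 1) (p + 1 + 1)).hom ((E.cx.d p (p + 1)).hom e) = 0 := fun e => by
      have := congrArg (fun g => g.hom e) (E.cx.d_comp_d p (p + 1) (p + 1 + 1))
      exact this
    rw [LinearMap.mem_eqLocus]
    cases k with
    | zero =>
      obtain ⟨t, rfl⟩ := hw
      have h0 : (E.cx.d (p + 1) (p + 1 + 1)).hom ((E.cx.d p (p + 1)).hom (c (base t))) = 0 := hdd _
      simp [cochDPrev_apply, E.hd_apply, headAct₂_base, jacobiD_base, h0]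
    | succ k =>
      refine symWords_ext (fun x w hw => ?_) hw
      have hx : headAct (Φ x) c w = headAct (E.aComp p (p + 1 + 1) ∘ₗ L.half x) c w +
          headAct ((E.aComp p (p + 1 + 1)).compr₂ (E.aComp (p + 1 + 1) (p + 1 + 1) x)) c w +
          headAct ((E.aComp p p).compr₂ (E.aComp p (p + 1 + 1) x)) c w -
          headAct ((E.aComp p (p + 1)).compr₂ (E.aComp (p + 1) (p + 1 + 1) x)) c w := by
        have : headAct (Φ x) c = headAct (E.aComp p (p + 1 + 1) ∘ₗ L.half x) c +
          headAct ((E.aComp p (p + 1 + 1)).compr₂ (E.aComp (p + 1 + 1) (p + 1 + 1) x)) c +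
          headAct ((E.aComp p p).compr₂ (E.aComp p (p + 1 + 1) x)) c -
          headAct ((E.aComp p (p + 1)).compr₂ (E.aComp (p + 1) (p + 1 + 1) x)) c :=
          hom_ext (by simp) (by simp [hΦ])
        rw [this]; rfl
      have hP : E.aComp p (p + 1 + 1) (parity K x) = -E.aComp p (p + 1 + 1) x := by
        have := LinearMap.congr_fun (E.aComp_scale (p := p) (q := p + 1 + 1) (n := 2) (by omega)
          fun i => (-1) ^ (i + 1)) x
        rw [LinearMap.comp_apply] at this
        refine this.trans ?_
        norm_num
      have hd := E.aComp_d_one p x (c w)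
      have hD := hc' w (symWords_le (Nat.le_of_succ_le hk) hw)
      rw [headAct₂_cons, hx, ← headAct_headAct, ← headAct_headAct, ← headAct_headAct,
        ← headAct_combine]
      simp only [LinearMap.sub_apply, cochDPrev_apply, E.hd_apply, headAct_cons, jacobiD_cons,
        map_add, LinearMap.zero_apply, zero_add, hP, ← hd, hD, LinearMap.neg_apply, map_neg, hdd]
      abel
  have h0 : headAct₂ Φ c w = 0 := by
    refine headAct₂_vanish Φ c (fun i j x y e => ?_) hw
    simp only [hΦ, DGLie.half, LinearMap.smul_apply, LinearMap.comp_apply, parity, scale_hom,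
      map_smul]
    apply hom_injective
    have hs := L.skew j i y x
    have h3 := E.rep.act_br i j x y (hom E.cx p e)
    by_cases hij : i + j = 2
    · have hi : i ≤ 2 := by omega
      rw [hs]
      interval_cases i
      · obtain rfl : j = 2 := by omega
        simp only [map_add, map_sub, map_smul, map_zero,
          E.aComp_ne (i := 2) (p := p) (q := p) (by omega),
          E.aComp_ne (i := 2) (p := p) (q := p + 1) (by omega),
          E.aComp_ne (i := 0) (p := p) (q := p + 1) (by omega),
          E.aComp_ne (i := 0) (p := p) (q := p + 1 + 1) (by omega), LinearMap.zero_apply,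
          E.hom_aComp (i := 0) (p := p + 1 + 1) (q := p + 1 + 1) (by omega), LinearMap.smul_apply,
          E.hom_aComp (i := 2) (p := p) (q := p + 1 + 1) (by omega),
          E.hom_aComp (i := 0) (p := p) (q := p) (by omega),
          E.aComp_br (i := 0) (j := 2) (p := p) (q := p + 1 + 1) (by omega), h3]
        norm_num
        module
      · obtain rfl : j = 1 := by omega
        simp only [map_add, map_sub, map_smul, map_zero,
          E.aComp_ne (i := 1) (p := p) (q := p) (by omega),
          E.aComp_ne (i := 1) (p := p) (q := p + 1 + 1) (by omega), LinearMap.zero_apply,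
          E.hom_aComp (i := 1) (p := p + 1) (q := p + 1 + 1) (by omega), LinearMap.smul_apply,
          E.hom_aComp (i := 1) (p := p) (q := p + 1) (by omega),
          E.aComp_br (i := 1) (j := 1) (p := p) (q := p + 1 + 1) (by omega), h3]
        norm_num
        module
      · obtain rfl : j = 0 := by omega
        simp only [map_add, map_sub, map_smul, map_zero,
          E.aComp_ne (i := 2) (p := p) (q := p) (by omega),
          E.aComp_ne (i := 2) (p := p) (q := p + 1) (by omega),
          E.aComp_ne (i := 0) (p := p) (q := p + 1) (by omega),
          E.aComp_ne (i := 0) (p := p) (q := p + 1 + 1) (by omega), LinearMap.zero_apply,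
          E.hom_aComp (i := 0) (p := p + 1 + 1) (q := p + 1 + 1) (by omega), LinearMap.smul_apply,
          E.hom_aComp (i := 2) (p := p) (q := p + 1 + 1) (by omega),
          E.hom_aComp (i := 0) (p := p) (q := p) (by omega),
          E.aComp_br (i := 2) (j := 0) (p := p) (q := p + 1 + 1) (by omega), h3]
        norm_num
        module
    · have e1 : ∀ q r (i j : ℕ) (x : K.X i) (y : K.X j) (e : E.cx.X p), i + j ≠ 2 → r = p + 1 + 1 →
          E.aComp q r (hom K i x) (E.aComp p q (hom K j y) e) = 0 := fun q r i j x y e h hr => by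
        by_cases hi : j + p = q
        · rw [E.aComp_ne (i := i) (by omega)]; simp
        · rw [E.aComp_ne (i := j) hi]; simp
      rw [e1 _ _ i j _ _ _ hij rfl, e1 _ _ i j _ _ _ hij rfl, e1 _ _ i j _ _ _ hij rfl,
        e1 _ _ j i _ _ _ (by omega) rfl, e1 _ _ j i _ _ _ (by omega) rfl,
        e1 _ _ j i _ _ _ (by omega) rfl, E.aComp_br_ne (by omega), E.aComp_br_ne (by omega)]
      simp
  rw [h0] at key
  exact (sub_eq_zero.1 key).symm

theorem headAct_wordDeg {A A' : Type} [AddCommGroup A] [Module ℂ A] [AddCommGroup A'] [Module ℂ A']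
    (a : Tot K →ₗ[ℂ] A →ₗ[ℂ] A') (c : Words (Tot K) ℂ →ₗ[ℂ] A) {s t : ℂ}
    (ha : a ∘ₗ weight K = s • a) (hc : c ∘ₗ wordDeg K = t • c) :
    headAct a c ∘ₗ wordDeg K = (s + t) • headAct a c := by
  refine hom_ext (by simp [wordDeg, derivWords]) fun x w _ => ?_
  have h1 := LinearMap.congr_fun ha x
  have h2 := LinearMap.congr_fun hc w
  simp only [LinearMap.comp_apply, LinearMap.smul_apply] at h1 h2
  have h3 : wordDeg K (cons x w) = cons (weight K x) w + cons x (wordDeg K w) := by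
    simp [wordDeg, derivWords]
  simp [h3, h1, h2, add_smul]

theorem DGMod.hd_wordDeg (E : DGMod L) (p : ℕ) (c : Words (Tot K) ℂ →ₗ[ℂ] E.cx.X p) {t : ℂ}
    (hc : c ∘ₗ wordDeg K = t • c) : E.hd p c ∘ₗ wordDeg K = t • E.hd p c := by
  have h1 : E.aComp p (p + 1) ∘ₗ weight K = (0 : ℂ) • E.aComp p (p + 1) := by
    have := E.aComp_scale (p := p) (q := p + 1) (n := 1) (by omega) fun i => (i : ℂ) - 1
    rw [weight, this]; simp
  have h2 := headAct_wordDeg _ c h1 hc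
  refine LinearMap.ext fun w => ?_
  have h3 := LinearMap.congr_fun h2 w
  have h4 := LinearMap.congr_fun hc w
  simp only [LinearMap.comp_apply, LinearMap.smul_apply, zero_add] at h3 h4
  simp [E.hd_apply, h3, h4]

/-- The term of degree `p` of the complex `L_m`: the cohomology in vertical degree `0` of the
column of `ᵗK_m` of horizontal degree `p`, which consists of the cochains with values in
the term of degree `p` of the module. -/
abbrev LmX (L : DGLie K) (m : ℕ) (E : DGMod L) (p : ℕ) : Type :=
  CochH L m (0 : E.cx.X p →ₗ[ℂ] E.cx.X p) 0 (E.aComp p p)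

variable (m) in
/-- The differential of the complex `L_m`. -/
def LmD (E : DGMod L) (p : ℕ) : LmX L m E p →ₗ[L.Rm m] LmX L m E (p + 1) :=
  CochH.map (E.hd p)
    (fun c hc => by
      have h0 : c ∘ₗ wordDeg K = (0 : ℂ) • c := by rw [zero_smul, ← hc.1, LinearMap.zero_comp]
      refine ⟨by rw [E.hd_wordDeg p c h0, zero_smul, LinearMap.zero_comp], fun w hw => ?_⟩
      have h1 : ∀ w ∈ symUpTo (parity K) m, cochDPrev L 0 (E.aComp p p) c w = 0 := fun w hw => by
        have := hc.2 w hw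
        rwa [E.vd_eq, LinearMap.neg_apply, LinearMap.neg_apply, neg_eq_zero] at this
      rw [E.vd_eq, LinearMap.neg_apply, LinearMap.neg_apply, neg_eq_zero, E.vd_hd p c hw,
        E.hd_apply, h1 w hw, map_zero, zero_add]
      refine symUpTo_induction (p := LinearMap.ker (headAct (E.aComp p (p + 1))
        (cochDPrev L 0 (E.aComp p p) c))) (fun k hk w hw => ?_) hw
      rw [LinearMap.mem_ker]
      cases k with
      | zero => obtain ⟨t, rfl⟩ := hw; exact headAct_base _ _ _
      | succ k =>
        refine symWords_ext (g := 0) (fun x w hw => ?_) hw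
        rw [headAct_cons, h1 w (symWords_le (Nat.le_of_succ_le hk) hw), map_zero]
        rfl)
    (fun c _ hcB => by
      obtain ⟨b, hb, h⟩ := hcB
      have h0 : b ∘ₗ wordDeg K = (1 : ℂ) • b := by
        rw [one_smul, ← sub_eq_zero, ← hb, LinearMap.zero_comp]
      refine ⟨E.hd p b, by rw [E.hd_wordDeg p b h0, one_smul, LinearMap.zero_comp, sub_self],
        fun w hw => ?_⟩
      rw [E.vd_hd p b hw, E.hd_apply, E.hd_apply, h w hw]
      congr 1
      rw [← sub_eq_zero]
      refine symUpTo_induction (p := LinearMap.ker (headAct (E.aComp p (p + 1)) c -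
        headAct (E.aComp p (p + 1)) (cochDPrev L 0 (E.aComp p p) b))) (fun k hk w hw => ?_) hw
      rw [LinearMap.mem_ker]
      cases k with
      | zero => obtain ⟨t, rfl⟩ := hw; simp
      | succ k =>
        refine symWords_ext (g := 0) (fun x w hw => ?_) hw
        rw [LinearMap.sub_apply, headAct_cons, headAct_cons,
          h w (symWords_le (Nat.le_of_succ_le hk) hw), sub_self]
        rfl)
    (fun z hz c w hw => by
      rw [E.hd_apply, E.hd_apply, headAct_contr_even _ c hz.1 hw]
      rfl)

theorem LmD_LmD (E : DGMod L) (p : ℕ) (x : LmX L m E p) :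
    LmD m E (p + 1) (LmD m E p x) = 0 := by
  obtain ⟨c, hc, rfl⟩ := x.exists_rep
  have h0 : c ∘ₗ wordDeg K = (0 : ℂ) • c := by rw [zero_smul, ← hc.1, LinearMap.zero_comp]
  have h1 : E.aComp p (p + 1 + 1) ∘ₗ weight K = (1 : ℂ) • E.aComp p (p + 1 + 1) := by
    have := E.aComp_scale (p := p) (q := p + 1 + 1) (n := 2) (by omega) fun i => (i : ℂ) - 1
    rw [weight, this]; norm_num
  refine (cls_eq (hc' := Submodule.zero_mem _)).2 ?_
  rw [sub_zero]
  refine ⟨headAct (E.aComp p (p + 1 + 1)) c, ?_, fun w hw => E.hd_hd p hc.2 hw⟩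
  rw [headAct_wordDeg _ c h1 h0, add_zero, one_smul, sub_self, LinearMap.zero_comp]

theorem comp_totMap {M M' : CochainComplex (ModuleCat.{0} ℂ) ℕ} (f : M ⟶ M') (q : ℕ) (e : Tot M) :
    comp M' q (totMap f e) = (f.f q).hom (comp M q e) := by
  revert e
  refine tot_induction (fun i e => ?_) (fun x y hx hy => by simp [hx, hy])
  by_cases h : i = q
  · subst h; rw [totMap_hom, comp_hom_self, comp_hom_self]
  · rw [totMap_hom, comp_hom_ne h, comp_hom_ne h, map_zero]

theorem DGMod.aComp_push {E E' : DGMod L} (f : E ⟶ E') (p q : ℕ) (x : Tot K) (e : E.cx.X p) :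
    (f.map.f q).hom (E.aComp p q x e) = E'.aComp p q x ((f.map.f p).hom e) := by
  change (f.map.f q).hom (comp E.cx q (E.rep.act x (hom E.cx p e))) =
    comp E'.cx q (E'.rep.act x (hom E'.cx p ((f.map.f p).hom e)))
  rw [← comp_totMap, f.comm, totMap_hom]

variable (L m) in
/-- The terms of the complex `L_m`, as functors. -/
def LmFun (p : ℕ) : DGMod L ⥤ ModuleCat.{0} (L.Rm m) where
  obj E := ModuleCat.of _ (LmX L m E p)
  map f := ModuleCat.ofHom (CochH.push (f.map.f p).hom (by simp) (by simp)
    (DGMod.aComp_push f p p))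
  map_id E := by
    ext x
    obtain ⟨c, hc, rfl⟩ := CochH.exists_rep x
    exact cls_eq.2 (cochB_of_zero fun w _ => by simp)
  map_comp f g := by
    ext x
    obtain ⟨c, hc, rfl⟩ := CochH.exists_rep x
    refine cls_eq.2 (cochB_of_zero fun w _ => ?_)
    change ((f.map ≫ g.map).f p).hom (c w) - (g.map.f p).hom ((f.map.f p).hom (c w)) = 0
    simp

variable (L m) in
/-- The differential of the complex `L_m`, as a natural transformation. -/
def LmDiff (p : ℕ) : LmFun L m p ⟶ LmFun L m (p + 1) where
  app E := ModuleCat.ofHom (LmD m E p)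
  naturality E E' f := by
    ext x
    obtain ⟨c, hc, rfl⟩ := CochH.exists_rep x
    refine cls_eq.2 (cochB_of_zero fun w _ => ?_)
    change E'.hd p ((f.map.f p).hom ∘ₗ c) w - (f.map.f (p + 1)).hom (E.hd p c w) = 0
    have h1 := congrArg (fun g => g.hom (c w)) (f.map.comm p (p + 1))
    simp only [ModuleCat.hom_comp, LinearMap.comp_apply] at h1
    have h2 : headAct (E'.aComp p (p + 1)) ((f.map.f p).hom ∘ₗ c) =
        (f.map.f (p + 1)).hom ∘ₗ headAct (E.aComp p (p + 1)) c :=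
      hom_ext (by simp) (by simp [DGMod.aComp_push])
    rw [E'.hd_apply, E.hd_apply, h2, map_add, LinearMap.comp_apply, LinearMap.comp_apply, h1,
      sub_self]

theorem LmDiff_comp (p : ℕ) : LmDiff L m p ≫ LmDiff L m (p + 1) = 0 := by
  ext E x
  exact LmD_LmD E p x

end Lm

/-! ## Sheaves -/

section Sheaves
variable (X : TopCat.{0}) (R : Type) [CommRing R]

/-- Sheaves of `R`-modules on `X`. -/
abbrev Sh := Sheaf (Opens.grothendieckTopology X) (ModuleCat.{0} R)

variable {X} in
/-- The functor of sections over `U`. -/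
def secFun (U : (Opens X)ᵒᵖ) : Sh X R ⥤ ModuleCat.{0} R :=
  sheafToPresheaf _ _ ⋙ (evaluation _ _).obj U

instance (U : (Opens X)ᵒᵖ) : (secFun R U).Additive :=
  inferInstanceAs (sheafToPresheaf _ _ ⋙ (evaluation _ _).obj U).Additive

variable {X R}

/-- The complex of sections over `U` of a complex of sheaves. -/
def secCx (F : CochainComplex (Sh X R) ℕ) (U : (Opens X)ᵒᵖ) : CochainComplex (ModuleCat.{0} R) ℕ :=
  ((secFun R U).mapHomologicalComplex _).obj F

/-- The restriction map between complexes of sections. -/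
def secRes (F : CochainComplex (Sh X R) ℕ) {U V : (Opens X)ᵒᵖ} (h : U ⟶ V) :
    secCx F U ⟶ secCx F V :=
  (NatTrans.mapHomologicalComplex (Functor.whiskerLeft (sheafToPresheaf _ _)
    ((evaluation _ _).map h) : secFun R U ⟶ secFun R V) _).app F

/-- The map between complexes of sections induced by a map of complexes of sheaves. -/
def secMap {F F' : CochainComplex (Sh X R) ℕ} (f : F ⟶ F') (U : (Opens X)ᵒᵖ) :
    secCx F U ⟶ secCx F' U := ((secFun R U).mapHomologicalComplex _).map f

theorem secRes_id (F : CochainComplex (Sh X R) ℕ) (U : (Opens X)ᵒᵖ) :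
    secRes F (𝟙 U) = 𝟙 _ := by
  ext i x
  exact LinearMap.congr_fun (congrArg ModuleCat.Hom.hom ((F.X i).obj.map_id U)) x

theorem secRes_comp (F : CochainComplex (Sh X R) ℕ) {U V W : (Opens X)ᵒᵖ} (h : U ⟶ V)
    (h' : V ⟶ W) : secRes F (h ≫ h') = secRes F h ≫ secRes F h' := by
  ext i x
  exact LinearMap.congr_fun (congrArg ModuleCat.Hom.hom ((F.X i).obj.map_comp h h')) x

theorem secMap_id (F : CochainComplex (Sh X R) ℕ) (U : (Opens X)ᵒᵖ) :
    secMap (𝟙 F) U = 𝟙 _ := ((secFun R U).mapHomologicalComplex _).map_id F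

theorem secMap_comp {F F' F'' : CochainComplex (Sh X R) ℕ} (f : F ⟶ F') (f' : F' ⟶ F'')
    (U : (Opens X)ᵒᵖ) : secMap (f ≫ f') U = secMap f U ≫ secMap f' U :=
  ((secFun R U).mapHomologicalComplex _).map_comp f f'

theorem secMap_secRes {F F' : CochainComplex (Sh X R) ℕ} (f : F ⟶ F') {U V : (Opens X)ᵒᵖ}
    (h : U ⟶ V) : secMap f U ≫ secRes F' h = secRes F h ≫ secMap f V :=
  (NatTrans.mapHomologicalComplex (Functor.whiskerLeft (sheafToPresheaf _ _)
    ((evaluation _ _).map h) : secFun R U ⟶ secFun R V) _).naturality f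

/-- The cohomology `H^i(X, F)` of a sheaf of `R`-modules: `Ext^i` from the constant sheaf `R`. -/
def Hcoh (F : Sh X R) (i : ℕ) : Type :=
  Abelian.Ext.{0} ((constantSheaf (Opens.grothendieckTopology X) (ModuleCat.{0} R)).obj
    (ModuleCat.of R R)) F i

instance (F : Sh X R) (i : ℕ) : AddCommGroup (Hcoh F i) := by
  unfold Hcoh
  infer_instance

instance (F : Sh X R) (i : ℕ) : Module R (Hcoh F i) := by
  unfold Hcoh
  infer_instance

/-- A sheaf is soft if each of its sections over a closed set `Z` extends to a global section.
A section over `Z` is a family `s` of germs, for the points of `Z`, which locally on `Z` is given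
by sections over open sets. -/
def IsSoft (F : Sh X R) : Prop :=
  ∀ Z : Set X, IsClosed Z → ∀ s : ∀ x : X, (TopCat.Presheaf.stalk F.obj x : ModuleCat R),
    (∀ x ∈ Z, ∃ (U : Opens X) (t : F.obj.obj (op U)), x ∈ U ∧
      ∀ y (hy : y ∈ U), y ∈ Z → TopCat.Presheaf.germ F.obj U y hy t = s y) →
    ∃ t : F.obj.obj (op ⊤), ∀ x ∈ Z, TopCat.Presheaf.germ F.obj ⊤ x trivial t = s x

/-- `i : F ⟶ C⁰` makes the complex `C` a resolution of `F`. -/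
def IsResolution {F : Sh X R} {C : CochainComplex (Sh X R) ℕ} (i : F ⟶ C.X 0) : Prop :=
  ∃ h : i ≫ C.d 0 1 = 0, QuasiIso ((CochainComplex.fromSingle₀Equiv C F).symm ⟨i, h⟩)

/-- The sections over `U`, with the linear structure of the sheaf. -/
abbrev sec (F : Sh X R) (U : (Opens X)ᵒᵖ) : Type := F.obj.obj U

/-- The restriction of sections. -/
abbrev rsec (F : Sh X R) {U V : (Opens X)ᵒᵖ} (h : U ⟶ V) : sec F U →ₗ[R] sec F V :=
  (F.obj.map h).hom

variable (X) in
/-- Sheaves of complex Lie algebras on `X`. -/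
structure LieSheaf where
  /-- the underlying sheaf of vector spaces -/
  sh : Sh X ℂ
  /-- the bracket -/
  br : ∀ U, sec sh U →ₗ[ℂ] sec sh U →ₗ[ℂ] sec sh U
  br_self : ∀ U x, br U x x = 0
  jacobi : ∀ U x y z, br U x (br U y z) = br U (br U x y) z + br U y (br U x z)
  res : ∀ {U V} (h : U ⟶ V) x y, rsec sh h (br U x y) = br V (rsec sh h x) (rsec sh h y)

/-- Sheaves of modules over a sheaf of Lie algebras. -/
structure LieModSheaf (g : LieSheaf X) where
  /-- the underlying sheaf of vector spaces -/
  sh : Sh X ℂ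
  /-- the action -/
  act : ∀ U, sec g.sh U →ₗ[ℂ] sec sh U →ₗ[ℂ] sec sh U
  act_br : ∀ U x y e, act U (g.br U x y) e = act U x (act U y e) - act U y (act U x e)
  res : ∀ {U V} (h : U ⟶ V) x e, rsec sh h (act U x e) = act V (rsec g.sh h x) (rsec sh h e)

variable (X) in
/-- Sheaves of differential graded Lie algebras on `X`. -/
structure DGLieSheaf where
  /-- the underlying complex of sheaves -/
  cx : CochainComplex (Sh X ℂ) ℕ
  /-- the structure on the complexes of sections -/
  lie : ∀ U, DGLie (secCx cx U)
  res : ∀ {U V} (h : U ⟶ V) x y, totMap (secRes cx h) ((lie U).br x y) =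
    (lie V).br (totMap (secRes cx h) x) (totMap (secRes cx h) y)

/-- Sheaves of differential graded modules over a sheaf of differential graded Lie algebras. -/
structure DGModSheaf (G : DGLieSheaf X) where
  /-- the underlying complex of sheaves -/
  cx : CochainComplex (Sh X ℂ) ℕ
  /-- the structure on the complexes of sections -/
  rep : ∀ U, DGRep (G.lie U) (secCx cx U)
  res : ∀ {U V} (h : U ⟶ V) x e, totMap (secRes cx h) ((rep U).act x e) =
    (rep V).act (totMap (secRes G.cx h) x) (totMap (secRes cx h) e)

/-- The element of degree `0` of the complex of sections over `U` given by a section. -/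
def sec₀ {F : Sh X ℂ} {C : CochainComplex (Sh X ℂ) ℕ} (i : F ⟶ C.X 0) (U : (Opens X)ᵒᵖ) :
    sec F U →ₗ[ℂ] Tot (secCx C U) :=
  hom (secCx C U) 0 ∘ₗ ((secFun ℂ U).map i).hom

/-- Soft resolutions of a sheaf of Lie algebras by sheaves of differential graded Lie algebras. -/
structure SoftLieResolution (g : LieSheaf X) extends DGLieSheaf X where
  /-- the augmentation -/
  aug : g.sh ⟶ cx.X 0
  isResolution : IsResolution aug
  isSoft : ∀ i, IsSoft (cx.X i)
  aug_br : ∀ U x y, sec₀ aug U (g.br U x y) = (lie U).br (sec₀ aug U x) (sec₀ aug U y)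

/-- The modules `E` over a sheaf of Lie algebras `g` such that the pair `(g, E)` is admissible,
each with a soft resolution by a sheaf of differential graded modules over the given
resolution `G` of `g`. -/
structure AdmMod {g : LieSheaf X} (G : SoftLieResolution g) extends
    DGModSheaf G.toDGLieSheaf where
  /-- the module -/
  E : LieModSheaf g
  /-- the augmentation -/
  aug : E.sh ⟶ cx.X 0
  isResolution : IsResolution aug
  isSoft : ∀ i, IsSoft (cx.X i)
  aug_act : ∀ U x e, sec₀ aug U (E.act U x e) = (rep U).act (sec₀ G.aug U x) (sec₀ aug U e)

variable {g : LieSheaf X} {G : SoftLieResolution g}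

/-- Maps of resolved modules: the maps of complexes of sheaves which commute with the action
(they induce maps of the modules which are resolved). -/
@[ext] structure AdmMod.Hom (E E' : AdmMod G) where
  /-- the map of complexes -/
  map : E.cx ⟶ E'.cx
  comm : ∀ U x e, totMap (secMap map U) ((E.rep U).act x e) =
    (E'.rep U).act x (totMap (secMap map U) e)

instance : Category (AdmMod G) where
  Hom := AdmMod.Hom
  id E := ⟨𝟙 _, fun U x e => by simp [secMap_id, totMap_id]⟩
  comp f f' := ⟨f.map ≫ f'.map, fun U x e => by
    simp [secMap_comp, totMap_comp, f.comm, f'.comm]⟩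
  id_comp f := AdmMod.Hom.ext (Category.id_comp _)
  comp_id f := AdmMod.Hom.ext (Category.comp_id _)
  assoc f f' f'' := AdmMod.Hom.ext (Category.assoc _ _ _)

variable (G) in
/-- The complex of global sections of the resolution of `g`. -/
abbrev SoftLieResolution.gcx : CochainComplex (ModuleCat.{0} ℂ) ℕ := secCx G.cx (op ⊤)

variable (G) in
/-- The differential graded Lie algebra of global sections of the resolution of `g`. -/
abbrev SoftLieResolution.glie : DGLie G.gcx := G.lie (op ⊤)

/-- A representation pulled back along a homomorphism of differential graded Lie algebras. -/
def DGRep.pull {K K' M : CochainComplex (ModuleCat.{0} ℂ) ℕ} {L : DGLie K} {L' : DGLie K'}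
    (r : DGRep L' M) (f : K ⟶ K')
    (hf : ∀ x y, totMap f (L.br x y) = L'.br (totMap f x) (totMap f y)) : DGRep L M where
  act := r.act ∘ₗ totMap f
  act_deg i j x e := by
    rw [LinearMap.comp_apply, totMap_hom]
    exact r.act_deg i j _ e
  leibniz i x e := by
    simp only [LinearMap.comp_apply, totMap_hom, r.leibniz]
    have := LinearMap.congr_fun (totMap_dTot f) (hom K i x)
    simp only [LinearMap.comp_apply, totMap_hom] at this
    rw [this]
  act_br i j x y e := by
    simp only [LinearMap.comp_apply, hf, totMap_hom, r.act_br]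

/-- The sections over `U` of a resolved module, as a differential graded module over the
differential graded Lie algebra of global sections. -/
def AdmMod.secMod (E : AdmMod G) (U : (Opens X)ᵒᵖ) : DGMod G.glie where
  cx := secCx E.cx U
  rep := (E.rep U).pull (secRes G.cx (homOfLE le_top : U.unop ⟶ ⊤).op) (G.res _)

variable (G) in
/-- The functor sending a resolved module to the presheaf of its sections, as differential graded
modules over the differential graded Lie algebra of global sections. -/
def secMods : AdmMod G ⥤ (Opens X)ᵒᵖ ⥤ DGMod G.glie where
  obj E :=
    { obj := E.secMod
      map := fun {U V} h => ⟨secRes E.cx h, fun x e => by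
        change totMap (secRes E.cx h) ((E.rep U).act (totMap (secRes G.cx _) x) e) =
          (E.rep V).act (totMap (secRes G.cx _) x) (totMap (secRes E.cx h) e)
        have key : totMap (secRes G.cx h) (totMap (secRes G.cx
            (homOfLE le_top : U.unop ⟶ ⊤).op) x) =
            totMap (secRes G.cx (homOfLE le_top : V.unop ⟶ ⊤).op) x := by
          rw [← LinearMap.comp_apply, ← totMap_comp, ← secRes_comp]
          rfl
        exact (E.res h _ _).trans (congrArg (fun y => (E.rep V).act y _) key)⟩
      map_id := fun U => DGMod.Hom.ext (secRes_id _ _)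
      map_comp := fun h h' => DGMod.Hom.ext (secRes_comp _ _ _) }
  map f :=
    { app := fun U => ⟨secMap f.map U, fun x e => f.comm U _ e⟩
      naturality := fun U V h => DGMod.Hom.ext (secMap_secRes f.map h).symm }
  map_id E := by
    ext U
    exact DGMod.Hom.ext (secMap_id _ _)
  map_comp f f' := by
    ext U
    exact DGMod.Hom.ext (secMap_comp _ _ _)

variable (G) (m : ℕ)

/-- The universal deformation ring `R_m(g)`, computed with the resolution `G` of `g`. -/
abbrev SoftLieResolution.Rm : Type := G.glie.Rm m

variable {m}

/-- Sheafification of a functor of differential graded modules. -/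
def shFun (H : DGMod G.glie ⥤ ModuleCat.{0} (G.Rm m)) : AdmMod G ⥤ Sh X (G.Rm m) :=
  secMods G ⋙ (Functor.whiskeringRight _ _ _).obj H ⋙ presheafToSheaf _ _

/-- The natural transformation between sheafifications induced by a natural transformation. -/
def shMap {H H' : DGMod G.glie ⥤ ModuleCat.{0} (G.Rm m)} (α : H ⟶ H') : shFun G H ⟶ shFun G H' :=
  Functor.whiskerLeft (secMods G) (Functor.whiskerRight
    ((Functor.whiskeringRight _ _ _).map α) (presheafToSheaf _ _))

theorem shMap_comp {H H' H'' : DGMod G.glie ⥤ ModuleCat.{0} (G.Rm m)} (α : H ⟶ H')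
    (β : H' ⟶ H'') : shMap G (α ≫ β) = shMap G α ≫ shMap G β := by
  simp only [shMap, Functor.map_comp, Functor.whiskerRight_comp, Functor.whiskerLeft_comp]
  rfl

theorem shMap_zero {H H' : DGMod G.glie ⥤ ModuleCat.{0} (G.Rm m)} :
    shMap G (0 : H ⟶ H') = 0 := by
  ext E : 2
  exact (presheafToSheaf _ _).map_zero _ _

/-- The deformation `E_φ = ℋ^0(R_m ⊗ E^., ∂ + φ)` of `E` defined by an
element `φ` of degree `1` of `R_m ⊗ Γ(g^.)`. -/
def deformation (φ : G.Rm m ⊗[ℂ] G.gcx.X 1) : AdmMod G ⥤ Sh X (G.Rm m) := shFun G (defFun φ)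

variable (m)

/-- The sheaf `ℋ^0(ᵗK_m(g, E))`. -/
def transposedSheaf : AdmMod G ⥤ Sh X (G.Rm m) := shFun G (tKH G.glie m)

/-- The sheaf `V^m(E) = ℋ^0(K_m(g, E))`. -/
def jacobiSheaf : AdmMod G ⥤ Sh X (G.Rm m) := shFun G (KHfun G.glie m)

/-- The sheaf `M_m(g, E) = Hom_R(R^*, V^m(E))` for `R = R_m(g)`. -/
def moduliSheaf : AdmMod G ⥤ Sh X (G.Rm m) :=
  jacobiSheaf G m ⋙ sheafToPresheaf _ _ ⋙ (Functor.whiskeringRight _ _ _).obj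
    ((linearCoyoneda (G.Rm m) (ModuleCat.{0} (G.Rm m))).obj (op (coR G.glie m))) ⋙
    presheafToSheaf _ _

theorem shMap_LmDiff (E : AdmMod G) (p : ℕ) :
    (shMap G (LmDiff (L := G.glie) (m := m) p)).app E ≫
      (shMap G (LmDiff (L := G.glie) (m := m) (p + 1))).app E = 0 := by
  rw [← NatTrans.comp_app, ← shMap_comp, LmDiff_comp, shMap_zero]
  rfl

/-- The complex of sheaves `L_m(g, E)`. -/
def LmComplex : AdmMod G ⥤ CochainComplex (Sh X (G.Rm m)) ℕ where
  obj E := CochainComplex.of (fun p => (shFun G (LmFun G.glie m p)).obj E)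
    (fun p => (shMap G (LmDiff (L := G.glie) (m := m) p)).app E)
    (shMap_LmDiff G m E)
  map {E E'} f := CochainComplex.ofHom (fun p => (shFun G (LmFun G.glie m p)).map f) (fun p => by
    have h : ∀ F : AdmMod G, (CochainComplex.of (fun p => (shFun G (LmFun G.glie m p)).obj F)
        (fun p => (shMap G (LmDiff (L := G.glie) (m := m) p)).app F) (shMap_LmDiff G m F)).d p
        (p + 1) = (shMap G (LmDiff (L := G.glie) (m := m) p)).app F :=
      fun F => CochainComplex.of_d (fun p => (shFun G (LmFun G.glie m p)).obj F)
        (fun p => (shMap G (LmDiff (L := G.glie) (m := m) p)).app F) p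
    exact ((congrArg _ (h E')).trans ((shMap G (LmDiff (L := G.glie) (m := m) p)).naturality f)).trans
      (congrArg (fun d => d ≫ _) (h E).symm))
  map_id E := by
    ext p : 1
    exact (shFun G (LmFun G.glie m p)).map_id E
  map_comp f f' := by
    ext p : 1
    exact (shFun G (LmFun G.glie m p)).map_comp f f'

end Sheaves

end
end JacobiModuli

open CategoryTheory TopologicalSpace Opposite
open scoped TensorProduct DirectSum

namespace JacobiModuli
noncomputable section


/-! ## Operators on symmetric words -/

section WordOperators
variable {V F : Type} [AddCommGroup V] [Module ℂ V] [AddCommGroup F] [Module ℂ F]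
variable {A : Type} [AddCommGroup A] [Module ℂ A]

/-- The operator which keeps the first letter, changed by `Q`, and applies `f` to the rest. -/
def onTail (Q : V →ₗ[ℂ] V) (f : Words V F →ₗ[ℂ] Words V F) : Words V F →ₗ[ℂ] Words V F :=
  wcases 0 ((cons ∘ₗ Q).compl₂ f)

@[simp] theorem onTail_base (Q : V →ₗ[ℂ] V) (f : Words V F →ₗ[ℂ] Words V F) (e : F) :
    onTail Q f (base e) = 0 := by simp [onTail]

@[simp] theorem onTail_cons (Q : V →ₗ[ℂ] V) (f : Words V F →ₗ[ℂ] Words V F) (v : V)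
    (w : Words V F) : onTail Q f (cons v w) = cons (Q v) (f w) := by simp [onTail]

@[simp] theorem swapHead_base (P : V →ₗ[ℂ] V) (e : F) :
    swapHead P (base e : Words V F) = 0 := by simp [swapHead]

@[simp] theorem swapHead_cons_base (P : V →ₗ[ℂ] V) (v : V) (e : F) :
    swapHead P (cons v (base e) : Words V F) = 0 := by simp [swapHead]

theorem swapHead_eigen {P : V →ₗ[ℂ] V} {v u : V} {η θ : ℂ} (hv : P v = η • v) (hu : P u = θ • u)
    (w : Words V F) : swapHead P (cons v (cons u w)) =
      ((1 + θ + η - θ * η) / 2) • cons u (cons v w) := by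
  rw [swapHead_cons_cons, hv, hu]
  simp only [map_smul, LinearMap.smul_apply]
  module

/-- Linear maps on words agree if they agree on words without letters and on words with first
letter in an eigenspace of `P`. -/
theorem hom_ext_eigen {P : V →ₗ[ℂ] V} (hP : P ∘ₗ P = LinearMap.id) {f g : Words V F →ₗ[ℂ] A}
    (h₀ : ∀ e, f (base e) = g (base e))
    (h₁ : ∀ v (η : ℂ) w, (η = 1 ∨ η = -1) → P v = η • v → f w = g w →
      f (cons v w) = g (cons v w)) : f = g :=
  hom_ext h₀ fun v w hw => by
    revert v
    refine eigen_split hP (fun v η hη hv => h₁ v η w hη hv hw) fun v v' h h' => ?_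
    simp only [map_add, LinearMap.add_apply, h, h']

/-- Linear maps on words agree if they agree on words with at most one letter and on words with the
first two letters in eigenspaces of `P`. -/
theorem hom_ext_eigen₂ {P : V →ₗ[ℂ] V} (hP : P ∘ₗ P = LinearMap.id) {f g : Words V F →ₗ[ℂ] A}
    (h₀ : ∀ e, f (base e) = g (base e)) (h₁ : ∀ v e, f (cons v (base e)) = g (cons v (base e)))
    (h₂ : ∀ v u (η θ : ℂ) w, (η = 1 ∨ η = -1) → (θ = 1 ∨ θ = -1) → P v = η • v → P u = θ • u →
      f (cons v (cons u w)) = g (cons v (cons u w))) : f = g := by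
  refine hom_ext_eigen hP h₀ fun v η w hη hv _ => ?_
  have : f ∘ₗ cons v = g ∘ₗ cons v := hom_ext_eigen hP (h₁ v)
    fun u θ t hθ hu _ => h₂ v u η θ t hη hθ hv hu
  exact LinearMap.congr_fun this w

/-- The extension of an operator on letters and of an operator on coefficients to words as a
derivation, with the sign operator `Q`. -/
def der (Q δ : V →ₗ[ℂ] V) (d : F →ₗ[ℂ] F) : Words V F →ₗ[ℂ] Words V F :=
  wrec (base ∘ₗ d) (cons ∘ₗ δ) (cons ∘ₗ Q)

@[simp] theorem der_base (Q δ : V →ₗ[ℂ] V) (d : F →ₗ[ℂ] F) (e : F) :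
    der Q δ d (base e) = base (d e) := by simp [der]

@[simp] theorem der_cons (Q δ : V →ₗ[ℂ] V) (d : F →ₗ[ℂ] F) (v : V) (w : Words V F) :
    der Q δ d (cons v w) = cons (δ v) w + cons (Q v) (der Q δ d w) := by simp [der]

theorem derivWords_eq (n : V →ₗ[ℂ] V) (ν : F →ₗ[ℂ] F) :
    derivWords n ν = der LinearMap.id n ν := rfl

/-- The part of the bar differential which multiplies neighbours. -/
def bra (P : V →ₗ[ℂ] V) (b : V →ₗ[ℂ] V →ₗ[ℂ] V) (a : V →ₗ[ℂ] F →ₗ[ℂ] F) :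
    Words V F →ₗ[ℂ] Words V F := wrec 0 (combine b a) (cons ∘ₗ P)

@[simp] theorem bra_base (P : V →ₗ[ℂ] V) (b : V →ₗ[ℂ] V →ₗ[ℂ] V) (a : V →ₗ[ℂ] F →ₗ[ℂ] F) (e : F) :
    bra P b a (base e) = 0 := by simp [bra]

@[simp] theorem bra_cons (P : V →ₗ[ℂ] V) (b : V →ₗ[ℂ] V →ₗ[ℂ] V) (a : V →ₗ[ℂ] F →ₗ[ℂ] F) (v : V)
    (w : Words V F) : bra P b a (cons v w) = combine b a v w + cons (P v) (bra P b a w) := by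
  simp [bra]

theorem barD_eq (P δ : V →ₗ[ℂ] V) (b : V →ₗ[ℂ] V →ₗ[ℂ] V) (d : F →ₗ[ℂ] F) (a : V →ₗ[ℂ] F →ₗ[ℂ] F) :
    barD P δ b d a = der P δ d + bra P b a :=
  hom_ext (by simp [barD_base]) fun v w h => by
    simp only [barD_cons, h, LinearMap.add_apply, der_cons, bra_cons, map_add]; abel

/-- Multiply the first two letters. -/
def mulHead (b : V →ₗ[ℂ] V →ₗ[ℂ] V) (a : V →ₗ[ℂ] F →ₗ[ℂ] F) : Words V F →ₗ[ℂ] Words V F :=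
  wcases 0 (combine b a)

@[simp] theorem mulHead_base (b : V →ₗ[ℂ] V →ₗ[ℂ] V) (a : V →ₗ[ℂ] F →ₗ[ℂ] F) (e : F) :
    mulHead b a (base e) = 0 := by simp [mulHead]

@[simp] theorem mulHead_cons (b : V →ₗ[ℂ] V →ₗ[ℂ] V) (a : V →ₗ[ℂ] F →ₗ[ℂ] F) (v : V)
    (w : Words V F) : mulHead b a (cons v w) = combine b a v w := by simp [mulHead]

theorem bra_eq (P : V →ₗ[ℂ] V) (b : V →ₗ[ℂ] V →ₗ[ℂ] V) (a : V →ₗ[ℂ] F →ₗ[ℂ] F) :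
    bra P b a = mulHead b a + onTail P (bra P b a) :=
  hom_ext (by simp) (by simp)

theorem onTail_symWords {P Q : V →ₗ[ℂ] V} {f : Words V F →ₗ[ℂ] Words V F} {k l : ℕ}
    (h : ∀ w ∈ symWords P k, f w ∈ (symWords P l : Submodule ℂ (Words V F))) {w : Words V F}
    (hw : w ∈ symWords P (k + 1)) : onTail Q f w ∈ Submodule.map₂ cons ⊤ (symWords P l) := by
  have : (symWords P (k + 1) : Submodule ℂ (Words V F)) ≤
      (Submodule.map₂ cons ⊤ (symWords P l)).comap (onTail Q f) :=
    (symWords_succ_le P k).trans <| Submodule.map₂_le.2 fun v _ t ht => by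
      rw [Submodule.mem_comap, onTail_cons]
      exact Submodule.apply_mem_map₂ _ trivial (h t ht)
  exact this hw

theorem consOp_symWords {P Q : V →ₗ[ℂ] V} {k : ℕ} {w : Words V F}
    (hw : w ∈ symWords P (k + 1)) :
    wcases 0 (cons ∘ₗ Q) w ∈ Submodule.map₂ cons ⊤ (symWords P k) := by
  have : (symWords P (k + 1) : Submodule ℂ (Words V F)) ≤
      (Submodule.map₂ cons ⊤ (symWords P k)).comap (wcases 0 (cons ∘ₗ Q)) :=
    (symWords_succ_le P k).trans <| Submodule.map₂_le.2 fun v _ t ht => by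
      rw [Submodule.mem_comap, wcases_cons]
      exact Submodule.apply_mem_map₂ _ trivial ht
  exact this hw

theorem onTail_eq_self {P : V →ₗ[ℂ] V} {f : Words V F →ₗ[ℂ] Words V F} {k : ℕ}
    (h : ∀ w ∈ symWords P k, f w = w) {w : Words V F} (hw : w ∈ symWords P (k + 1)) :
    onTail LinearMap.id f w = w :=
  symWords_ext (f := onTail LinearMap.id f) (g := LinearMap.id)
    (fun v t ht => by simp [h t ht]) hw

theorem mem_symWords {P : V →ₗ[ℂ] V} {k : ℕ} {w : Words V F}
    (h : w ∈ Submodule.map₂ cons ⊤ (symWords P (k + 1))) (h' : swapHead P w = w) :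
    w ∈ symWords P (k + 2) := ⟨h, by simp [h']⟩

/-- An operator preserves symmetric words if it is compatible with the decomposition of words in a
first letter and the rest, and commutes with the exchange of the first two letters. -/
theorem symWords_stable {P : V →ₗ[ℂ] V} {f : Words V F →ₗ[ℂ] Words V F}
    (h₀ : ∀ e, f (base e) ∈ LinearMap.range (base : F →ₗ[ℂ] Words V F))
    (h₁ : ∀ k, (∀ w ∈ symWords P k, f w ∈ (symWords P k : Submodule ℂ (Words V F))) →
      ∀ w ∈ symWords P (k + 1), f w ∈ Submodule.map₂ cons ⊤ (symWords P k))
    (h₂ : ∀ w, swapHead P (f w) = f (swapHead P w)) (k : ℕ) {w : Words V F}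
    (hw : w ∈ symWords P k) : f w ∈ symWords P k := by
  induction k generalizing w with
  | zero => obtain ⟨e, rfl⟩ := hw; exact h₀ e
  | succ k ih =>
    cases k with
    | zero => exact h₁ 0 (fun w => ih) w hw
    | succ k => exact mem_symWords (h₁ (k + 1) (fun w => ih) w hw) (by rw [h₂, symWords_swap hw])

theorem swapHead_der {P Q δ : V →ₗ[ℂ] V} (hP : P ∘ₗ P = LinearMap.id) {ε : ℂ}
    (hε : ε = 1 ∨ ε = -1) (hQ : Q = parityPow P ε) (hδ : ∀ v, δ (P v) = ε • P (δ v))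
    (d : F →ₗ[ℂ] F) (w : Words V F) : swapHead P (der Q δ d w) = der Q δ d (swapHead P w) := by
  subst hQ
  have : swapHead P ∘ₗ der (parityPow P ε) δ d = der (parityPow P ε) δ d ∘ₗ swapHead P := by
    refine hom_ext_eigen₂ hP (by simp) (by simp) ?_
    rintro v u η θ w hη hθ hv hu
    have h1 : P (δ v) = (ε * η) • δ v := by
      have := hδ v
      rw [hv, map_smul] at this
      rw [mul_smul, this, smul_smul]
      rcases hε with rfl | rfl <;> simp
    have h2 : P (δ u) = (ε * θ) • δ u := by
      have := hδ u
      rw [hu, map_smul] at this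
      rw [mul_smul, this, smul_smul]
      rcases hε with rfl | rfl <;> simp
    rcases hε with rfl | rfl
    · simp only [parityPow_one, LinearMap.comp_apply, der_cons, map_add, LinearMap.id_apply,
        swapHead_eigen hv hu, swapHead_eigen h1 hu, swapHead_eigen hv h2, map_smul]
      rcases hη with rfl | rfl <;> rcases hθ with rfl | rfl <;> module
    · simp only [parityPow_neg_one, LinearMap.comp_apply, der_cons, map_add, hv, hu, map_smul,
        LinearMap.smul_apply, swapHead_eigen hv hu, swapHead_eigen h1 hu, swapHead_eigen hv h2]
      rcases hη with rfl | rfl <;> rcases hθ with rfl | rfl <;> module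
  exact LinearMap.congr_fun this w

theorem der_symWords {P Q δ : V →ₗ[ℂ] V} (hP : P ∘ₗ P = LinearMap.id) {ε : ℂ}
    (hε : ε = 1 ∨ ε = -1) (hQ : Q = parityPow P ε) (hδ : ∀ v, δ (P v) = ε • P (δ v))
    (d : F →ₗ[ℂ] F) (k : ℕ) {w : Words V F} (hw : w ∈ symWords P k) :
    der Q δ d w ∈ symWords P k := by
  refine symWords_stable (fun e => ⟨d e, by simp⟩) (fun k ih w hw => ?_)
    (swapHead_der hP hε hQ hδ d) k hw
  have : der Q δ d w = wcases 0 (cons ∘ₗ δ) w + onTail Q (der Q δ d) w :=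
    symWords_ext (f := der Q δ d) (g := wcases 0 (cons ∘ₗ δ) + onTail Q (der Q δ d))
      (fun v t _ => by simp) hw
  rw [this]
  exact add_mem (consOp_symWords hw) (onTail_symWords ih hw)

theorem derP_symWords {P δ : V →ₗ[ℂ] V} (hP : P ∘ₗ P = LinearMap.id)
    (hδ : ∀ v, δ (P v) = -P (δ v)) (d : F →ₗ[ℂ] F) {k : ℕ} {w : Words V F} (hw : w ∈ symWords P k) :
    der P δ d w ∈ symWords P k :=
  der_symWords hP (Or.inr rfl) (by simp) (fun v => by rw [hδ]; simp) d k hw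

theorem derivWords_symWords {P n : V →ₗ[ℂ] V} (hP : P ∘ₗ P = LinearMap.id)
    (hn : ∀ v, n (P v) = P (n v)) (ν : F →ₗ[ℂ] F) {k : ℕ} {w : Words V F} (hw : w ∈ symWords P k) :
    derivWords n ν w ∈ symWords P k := by
  rw [derivWords_eq]
  exact der_symWords hP (Or.inl rfl) (parityPow_one P).symm (fun v => by rw [hn, one_smul]) ν k hw

@[simp] theorem mapLetters_base (p : V →ₗ[ℂ] V) (e : F) :
    mapLetters p (base e : Words V F) = base e := by simp [mapLetters]

@[simp] theorem mapLetters_cons (p : V →ₗ[ℂ] V) (v : V) (w : Words V F) :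
    mapLetters p (cons v w) = cons (p v) (mapLetters p w) := by simp [mapLetters]

theorem mapLetters_symWords {P p : V →ₗ[ℂ] V} (hP : P ∘ₗ P = LinearMap.id)
    (hp : ∀ v, p (P v) = P (p v)) {k : ℕ} {w : Words V F} (hw : w ∈ symWords P k) :
    mapLetters p w ∈ symWords P k := by
  refine symWords_stable (fun e => ⟨e, by simp⟩) (fun k ih w hw => ?_) (fun w => ?_) k hw
  · have : mapLetters p w = onTail p (mapLetters p) w :=
      symWords_ext (f := mapLetters p) (g := onTail p (mapLetters p)) (fun v t _ => by simp) hw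
    rw [this]
    exact onTail_symWords ih hw
  · have : (swapHead P ∘ₗ mapLetters p : Words V F →ₗ[ℂ] _) = mapLetters p ∘ₗ swapHead P := by
      refine hom_ext_eigen₂ hP (by simp) (by simp) ?_
      rintro v u η θ w hη hθ hv hu
      have h1 : P (p v) = η • p v := by rw [← hp, hv, map_smul]
      have h2 : P (p u) = θ • p u := by rw [← hp, hu, map_smul]
      simp [swapHead_eigen hv hu, swapHead_eigen h1 h2]
    exact LinearMap.congr_fun this w

theorem mulHead_symWords {P : V →ₗ[ℂ] V} (b : V →ₗ[ℂ] V →ₗ[ℂ] V) (a : V →ₗ[ℂ] F →ₗ[ℂ] F) {k : ℕ}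
    {w : Words V F} (hw : w ∈ symWords P (k + 2)) :
    mulHead b a w ∈ Submodule.map₂ cons ⊤ (symWords P k) := by
  have : (symWords P (k + 2) : Submodule ℂ (Words V F)) ≤
      (Submodule.map₂ cons ⊤ (symWords P k)).comap (mulHead b a) := by
    refine (symWords_succ_le P (k + 1)).trans <| Submodule.map₂_le.2 fun v _ t ht => ?_
    have : (symWords P (k + 1) : Submodule ℂ (Words V F)) ≤
        ((Submodule.map₂ cons ⊤ (symWords P k)).comap (mulHead b a)).comap (cons v) :=
      (symWords_succ_le P k).trans <| Submodule.map₂_le.2 fun u _ s hs => by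
        rw [Submodule.mem_comap, Submodule.mem_comap, mulHead_cons, combine_cons]
        exact Submodule.apply_mem_map₂ _ trivial hs
    exact this ht
  exact this hw

theorem swapHead_swapHead {P : V →ₗ[ℂ] V} (hP : P ∘ₗ P = LinearMap.id) {k : ℕ} {w : Words V F}
    (hw : w ∈ Submodule.map₂ cons ⊤ (symWords P (k + 1))) : swapHead P (swapHead P w) = w := by
  have key : ∀ (v u : V) (s : Words V F),
      swapHead P (swapHead P (cons v (cons u s))) = cons v (cons u s) := by
    intro v u s
    revert v
    refine eigen_split hP (fun v η hη hv => ?_) (fun v v' h h' => by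
      simp only [map_add, LinearMap.add_apply, h, h'])
    revert u
    refine eigen_split hP (fun u θ hθ hu => ?_) (fun v v' h h' => by
      simp only [map_add, LinearMap.add_apply, h, h'])
    rw [swapHead_eigen hv hu, map_smul, swapHead_eigen hu hv]
    rcases hη with rfl | rfl <;> rcases hθ with rfl | rfl <;> module
  have h3 : Submodule.map₂ cons ⊤ (symWords P (k + 1)) ≤
      LinearMap.eqLocus (swapHead P ∘ₗ swapHead P) (LinearMap.id : Words V F →ₗ[ℂ] Words V F) :=
    Submodule.map₂_le.2 fun v _ t ht => LinearMap.mem_eqLocus.2 <|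
      symWords_ext (f := (swapHead P ∘ₗ swapHead P) ∘ₗ cons v) (g := cons v)
        (fun u s _ => key v u s) ht
  exact h3 hw

theorem bra_symWords {P : V →ₗ[ℂ] V} (hP : P ∘ₗ P = LinearMap.id) {b : V →ₗ[ℂ] V →ₗ[ℂ] V}
    (hb : ∀ v u, P (b v u) = -b (P v) (P u)) (a : V →ₗ[ℂ] F →ₗ[ℂ] F) (k : ℕ) {w : Words V F}
    (hw : w ∈ symWords P (k + 1)) : bra P b a w ∈ symWords P k := by
  induction k generalizing w with
  | zero =>
    have : (symWords P 1 : Submodule ℂ (Words V F)) ≤ (symWords P 0).comap (bra P b a) :=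
      Submodule.map₂_le.2 <| by
        rintro v - _ ⟨e, rfl⟩
        exact ⟨a v e, by simp⟩
    exact this hw
  | succ k ih =>
    have h1 : bra P b a w ∈ Submodule.map₂ cons ⊤ (symWords P k) := by
      rw [bra_eq]
      exact add_mem (mulHead_symWords b a hw) (onTail_symWords (fun w => ih) hw)
    cases k with
    | zero => exact h1
    | succ k =>
      refine mem_symWords h1 ?_
      have e1 : (swapHead P ∘ₗ mulHead b a : Words V F →ₗ[ℂ] _) =
          onTail P (mulHead b a) ∘ₗ swapHead P ∘ₗ onTail LinearMap.id (swapHead P) := by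
        refine hom_ext_eigen hP (by simp) fun v η w hη hv _ => ?_
        have : swapHead P ∘ₗ mulHead b a ∘ₗ cons v = onTail P (mulHead b a) ∘ₗ swapHead P ∘ₗ
            onTail LinearMap.id (swapHead P) ∘ₗ cons v := by
          refine hom_ext_eigen₂ hP (by simp) (by simp) fun u x θ ζ w hθ hζ hu hx => ?_
          have hbb : P (b v u) = (-(η * θ)) • b v u := by
            rw [hb, hv, hu]; simp [smul_smul, mul_comm]
          simp only [LinearMap.comp_apply, mulHead_cons, combine_cons, onTail_cons,
            LinearMap.id_apply, swapHead_eigen hu hx, swapHead_eigen hbb hx, map_smul,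
            swapHead_eigen hv hx, hx, LinearMap.smul_apply]
          rcases hη with rfl | rfl <;> rcases hθ with rfl | rfl <;> rcases hζ with rfl | rfl <;>
            module
        exact LinearMap.congr_fun this w
      have e2 : ∀ f : Words V F →ₗ[ℂ] Words V F, swapHead P ∘ₗ onTail P (onTail P f) =
          onTail P (onTail P f) ∘ₗ swapHead P := fun f => by
        refine hom_ext_eigen₂ hP (by simp) (by simp) fun u x θ ζ w hθ hζ hu hx => ?_
        simp only [LinearMap.comp_apply, onTail_cons, hu, hx, map_smul, LinearMap.smul_apply,
          swapHead_eigen hu hx]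
        module
      have hs := symWords_swap hw
      have ht : onTail LinearMap.id (swapHead P) w = w :=
        onTail_eq_self (fun t ht => symWords_swap ht) hw
      have f1 : swapHead P (mulHead b a w) = onTail P (mulHead b a) w := by
        have := LinearMap.congr_fun e1 w
        simpa only [LinearMap.comp_apply, ht, hs] using this
      have f3 : swapHead P (onTail P (mulHead b a) w) = mulHead b a w := by
        rw [← f1]
        exact swapHead_swapHead hP (mulHead_symWords b a hw)
      have e3 : bra P b a = mulHead b a + onTail P (mulHead b a) +
          onTail P (onTail P (bra P b a)) := by
        nth_rewrite 1 [bra_eq, bra_eq]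
        have : ∀ f g : Words V F →ₗ[ℂ] Words V F, onTail P (f + g) = onTail P f + onTail P g :=
          fun f g => hom_ext (by simp) (by simp)
        rw [this, add_assoc]
      have f2 := LinearMap.congr_fun (e2 (bra P b a)) w
      simp only [LinearMap.comp_apply, hs] at f2
      rw [e3]
      simp only [LinearMap.add_apply, map_add, f1, f2, f3]
      abel

end WordOperators


/-! ## The square of the bar differential -/

section BarSquare
variable {V F : Type} [AddCommGroup V] [Module ℂ V] [AddCommGroup F] [Module ℂ F]

theorem derivWords_base (n : V →ₗ[ℂ] V) (ν : F →ₗ[ℂ] F) (e : F) :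
    derivWords n ν (base e : Words V F) = base (ν e) := by simp [derivWords]

theorem derivWords_cons (n : V →ₗ[ℂ] V) (ν : F →ₗ[ℂ] F) (v : V) (w : Words V F) :
    derivWords n ν (cons v w) = cons (n v) w + cons v (derivWords n ν w) := by simp [derivWords]

theorem derivWords_der {n Q δ : V →ₗ[ℂ] V} {ν d : F →ₗ[ℂ] F} {κ : ℂ}
    (hQ : ∀ v, n (Q v) = Q (n v)) (hδ : ∀ v, n (δ v) = δ (n v) + κ • δ v)
    (hd : ∀ e, ν (d e) = d (ν e) + κ • d e) (w : Words V F) :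
    derivWords n ν (der Q δ d w) = der Q δ d (derivWords n ν w) + κ • der Q δ d w := by
  have : derivWords n ν ∘ₗ der Q δ d = der Q δ d ∘ₗ derivWords n ν + κ • der Q δ d := by
    refine hom_ext (fun e => by simp [derivWords_base, hd]) fun v w h => ?_
    simp only [LinearMap.comp_apply, LinearMap.add_apply, LinearMap.smul_apply, der_cons,
      derivWords_cons, map_add, hQ, hδ, map_smul, smul_add] at h ⊢
    rw [h]
    simp only [map_add, map_smul]
    abel
  exact LinearMap.congr_fun this w

theorem derivWords_bra {n P : V →ₗ[ℂ] V} {b : V →ₗ[ℂ] V →ₗ[ℂ] V} {ν : F →ₗ[ℂ] F}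
    {a : V →ₗ[ℂ] F →ₗ[ℂ] F} {κ : ℂ} (hP : ∀ v, n (P v) = P (n v))
    (hb : ∀ v u, n (b v u) = b (n v) u + b v (n u) + κ • b v u)
    (ha : ∀ v e, ν (a v e) = a (n v) e + a v (ν e) + κ • a v e) (w : Words V F) :
    derivWords n ν (bra P b a w) = bra P b a (derivWords n ν w) + κ • bra P b a w := by
  have h1 : ∀ v (w : Words V F), derivWords n ν (combine b a v w) = combine b a (n v) w +
      combine b a v (derivWords n ν w) + κ • combine b a v w := fun v w => by
    have : derivWords n ν ∘ₗ combine b a v = combine b a (n v) +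
        combine b a v ∘ₗ derivWords n ν + κ • combine b a v :=
      hom_ext (fun e => by simp [derivWords_base, ha]) fun u w _ => by
        simp only [LinearMap.comp_apply, LinearMap.add_apply, LinearMap.smul_apply, combine_cons,
          derivWords_cons, map_add, hb, map_smul]
        abel
    exact LinearMap.congr_fun this w
  have : derivWords n ν ∘ₗ bra P b a = bra P b a ∘ₗ derivWords n ν + κ • bra P b a := by
    refine hom_ext (fun e => by simp [derivWords_base]) fun v w h => ?_
    simp only [LinearMap.comp_apply, LinearMap.add_apply, LinearMap.smul_apply, bra_cons,
      derivWords_cons, map_add, hP, smul_add, h1] at h ⊢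
    rw [h]
    simp only [map_add, map_smul]
    abel
  exact LinearMap.congr_fun this w

theorem derivWords_mapLetters {n p : V →ₗ[ℂ] V} (ν : F →ₗ[ℂ] F) (hp : ∀ v, n (p v) = p (n v))
    (w : Words V F) : derivWords n ν (mapLetters p w) = mapLetters p (derivWords n ν w) := by
  have : derivWords n ν ∘ₗ mapLetters p = mapLetters p ∘ₗ derivWords n ν :=
    hom_ext (fun e => by simp [derivWords_base]) fun v w h => by
      simp only [LinearMap.comp_apply, mapLetters_cons, derivWords_cons, map_add, hp] at h ⊢
      rw [h]
  exact LinearMap.congr_fun this w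

/-- The anticommutator of two derivations with the sign operator `P`. -/
theorem der_anticomm {P δ s π : V →ₗ[ℂ] V} (hP : P ∘ₗ P = LinearMap.id)
    (hδ : ∀ v, δ (P v) = -P (δ v)) (hs : ∀ v, s (P v) = -P (s v))
    (hπ : ∀ v, δ (s v) + s (δ v) = π v) {d t ν : F →ₗ[ℂ] F} (hν : ∀ e, d (t e) + t (d e) = ν e)
    (w : Words V F) :
    der P δ d (der P s t w) + der P s t (der P δ d w) = derivWords π ν w := by
  have hPP : ∀ v, P (P v) = v := LinearMap.congr_fun hP
  have : der P δ d ∘ₗ der P s t + der P s t ∘ₗ der P δ d = derivWords π ν := by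
    refine hom_ext (fun e => by simp [derivWords_base, ← map_add, hν]) fun v w h => ?_
    simp only [LinearMap.comp_apply, LinearMap.add_apply, der_cons, derivWords_cons, map_add, hδ,
      hs, hPP, ← hπ, map_neg, LinearMap.neg_apply] at h ⊢
    rw [← h]
    simp only [map_add]
    abel
  exact LinearMap.congr_fun this w

theorem der_bra {P δ : V →ₗ[ℂ] V} {b : V →ₗ[ℂ] V →ₗ[ℂ] V} {d : F →ₗ[ℂ] F} {a : V →ₗ[ℂ] F →ₗ[ℂ] F}
    (hP : P ∘ₗ P = LinearMap.id) (hδ : ∀ v, δ (P v) = -P (δ v))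
    (hPb : ∀ v u, P (b v u) = -b (P v) (P u))
    (hb : ∀ v u, δ (b v u) + b (δ v) u + b (P v) (δ u) = 0)
    (ha : ∀ v e, d (a v e) + a (δ v) e + a (P v) (d e) = 0) (w : Words V F) :
    der P δ d (bra P b a w) + bra P b a (der P δ d w) = 0 := by
  have hPP : ∀ v, P (P v) = v := LinearMap.congr_fun hP
  have h1 : ∀ v (w : Words V F), der P δ d (combine b a v w) + combine b a (δ v) w +
      combine b a (P v) (der P δ d w) = 0 := fun v w => by
    have : der P δ d ∘ₗ combine b a v + combine b a (δ v) + combine b a (P v) ∘ₗ der P δ d = 0 := by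
      refine hom_ext (fun e => by simp [← map_add, ha]) fun u w _ => ?_
      have e1 : δ (b v u) = -b (δ v) u - b (P v) (δ u) := by
        rw [← sub_eq_zero, ← hb v u]; abel
      simp only [LinearMap.comp_apply, LinearMap.add_apply, LinearMap.zero_apply, combine_cons,
        der_cons, map_add, hPb, e1, map_neg, LinearMap.neg_apply, map_sub, LinearMap.sub_apply]
      abel
    exact LinearMap.congr_fun this w
  have : der P δ d ∘ₗ bra P b a + bra P b a ∘ₗ der P δ d = 0 := by
    refine hom_ext (by simp) fun v w h => ?_
    simp only [LinearMap.comp_apply, LinearMap.add_apply, der_cons, bra_cons, map_add, hδ, hPP,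
      map_neg, LinearMap.neg_apply, LinearMap.zero_apply] at h ⊢
    have h2 : bra P b a (der P δ d w) = -der P δ d (bra P b a w) := by
      rw [eq_neg_iff_add_eq_zero, ← h]; abel
    rw [h2, map_neg, ← h1 v w]
    abel
  exact LinearMap.congr_fun this w

/-- The square of the multiplication of neighbours, if it vanishes on the first three letters. -/
theorem bra_bra_of_head {P : V →ₗ[ℂ] V} {b : V →ₗ[ℂ] V →ₗ[ℂ] V} {a : V →ₗ[ℂ] F →ₗ[ℂ] F}
    (hP : P ∘ₗ P = LinearMap.id) (hPb : ∀ v u, P (b v u) = -b (P v) (P u))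
    (hG : ∀ k, ∀ w ∈ (symWords P k : Submodule ℂ (Words V F)),
      mulHead b a (mulHead b a w) + mulHead b a (onTail P (mulHead b a) w) = 0)
    (k : ℕ) {w : Words V F} (hw : w ∈ symWords P k) : bra P b a (bra P b a w) = 0 := by
  have hPP : ∀ v, P (P v) = v := LinearMap.congr_fun hP
  have key : bra P b a ∘ₗ bra P b a = mulHead b a ∘ₗ mulHead b a +
      mulHead b a ∘ₗ onTail P (mulHead b a) +
      onTail LinearMap.id (bra P b a ∘ₗ bra P b a) := by
    refine hom_ext (by simp) fun v w _ => ?_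
    have : bra P b a ∘ₗ bra P b a ∘ₗ cons v = (mulHead b a ∘ₗ mulHead b a +
      mulHead b a ∘ₗ onTail P (mulHead b a) +
      onTail LinearMap.id (bra P b a ∘ₗ bra P b a)) ∘ₗ cons v := by
      refine hom_ext (by simp) fun u w _ => ?_
      simp only [LinearMap.comp_apply, LinearMap.add_apply, bra_cons, map_add, combine_cons, hPP,
        mulHead_cons, onTail_cons, hPb, map_neg, LinearMap.neg_apply, LinearMap.id_apply]
      abel
    exact LinearMap.congr_fun this w
  induction k generalizing w with
  | zero => obtain ⟨e, rfl⟩ := hw; simp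
  | succ k ih =>
    have h := LinearMap.congr_fun key w
    simp only [LinearMap.comp_apply, LinearMap.add_apply, hG _ w hw, zero_add] at h
    rw [h]
    exact symWords_ext (f := onTail LinearMap.id (bra P b a ∘ₗ bra P b a)) (g := 0)
      (fun v t ht => by simp [ih ht]) hw

end BarSquare

section DGBar
variable {K : CochainComplex (ModuleCat.{0} ℂ) ℕ} (L : DGLie K)
variable {A : Type} [AddCommGroup A] [Module ℂ A]

/-- The structure of a module over `L`, without the grading: a differential `d` and an action `a`. -/
structure DGLie.IsRep (d : A →ₗ[ℂ] A) (a : Tot K →ₗ[ℂ] A →ₗ[ℂ] A) : Prop where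
  dd : ∀ e, d (d e) = 0
  leibniz : ∀ x e, d (a x e) = a (dTot K x) e - a (parity K x) (d e)
  rep : ∀ i j (x : K.X i) (y : K.X j) e, a (L.br (hom K i x) (hom K j y)) e =
    a (hom K i x) (a (hom K j y) e) - (-1 : ℂ) ^ (i * j) • a (hom K j y) (a (hom K i x) e)

variable {L}

theorem parity_hom (i : ℕ) (x : K.X i) : parity K (hom K i x) = (-1 : ℂ) ^ (i + 1) • hom K i x :=
  scale_hom _ _ _

theorem parity_apply_apply (x : Tot K) : parity K (parity K x) = x :=
  LinearMap.congr_fun parity_parity x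

theorem dTot_parity (x : Tot K) : dTot K (parity K x) = -parity K (dTot K x) := by
  rw [parity_dTot, neg_neg]

theorem dTot_dTot (x : Tot K) : dTot K (dTot K x) = 0 := by
  refine tot_induction (p := fun x => dTot K (dTot K x) = 0) (fun i x => ?_)
    (fun x y hx hy => by simp [hx, hy]) x
  have := congrArg (fun g => g.hom x) (K.d_comp_d i (i + 1) (i + 1 + 1))
  rw [dTot_hom, dTot_hom]
  exact (congrArg (hom K (i + 1 + 1)) this).trans (map_zero _)

theorem DGRep.isRep {M : CochainComplex (ModuleCat.{0} ℂ) ℕ} (r : DGRep L M) :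
    L.IsRep (dTot M) r.act where
  dd := dTot_dTot
  leibniz x e := by
    refine tot_induction (p := fun x => dTot M (r.act x e) = r.act (dTot K x) e -
      r.act (parity K x) (dTot M e)) (fun i x => ?_) (fun x y hx hy => ?_) x
    · rw [r.leibniz, parity_hom, pow_succ]; simp
    · simp only [map_add, LinearMap.add_apply, hx, hy]; abel
  rep := r.act_br

theorem DGLie.isRep_zero : L.IsRep (0 : A →ₗ[ℂ] A) 0 where
  dd := by simp
  leibniz := by simp
  rep := by simp

theorem DGMod.isRep_aComp (E : DGMod L) (p : ℕ) : L.IsRep (0 : E.cx.X p →ₗ[ℂ] E.cx.X p)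
    (E.aComp p p) where
  dd := by simp
  leibniz x e := by
    have : E.aComp p p ∘ₗ dTot K = 0 := tot_ext fun i x => by
      rw [LinearMap.comp_apply, dTot_hom, E.aComp_ne (by omega)]; rfl
    have := LinearMap.congr_fun this x
    rw [LinearMap.comp_apply] at this
    simp [this]
  rep i j x y e := by
    by_cases h : i = 0 ∧ j = 0
    · obtain ⟨rfl, rfl⟩ := h
      apply hom_injective
      rw [E.aComp_br (by omega), E.rep.act_br, map_sub, map_smul, E.hom_aComp (by omega),
        E.hom_aComp (by omega), E.hom_aComp (by omega), E.hom_aComp (by omega)]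
    · rw [E.aComp_br_ne (by omega)]
      rcases not_and_or.1 h with h | h
      · rw [E.aComp_ne (i := i) (by omega)]; simp
      · rw [E.aComp_ne (i := j) (by omega)]; simp

theorem half_hom (i j : ℕ) (x : K.X i) (y : K.X j) : L.half (hom K i x) (hom K j y) =
    ((-1 : ℂ) ^ (i + 1) / 2) • L.br (hom K i x) (hom K j y) := by
  simp only [DGLie.half, LinearMap.smul_apply, LinearMap.comp_apply, parity_hom, map_smul,
    smul_smul]
  congr 1
  ring

theorem half_leibniz (x y : Tot K) : dTot K (L.half x y) + L.half (dTot K x) y +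
    L.half (parity K x) (dTot K y) = 0 := by
  refine tot_induction (p := fun x => dTot K (L.half x y) + L.half (dTot K x) y +
    L.half (parity K x) (dTot K y) = 0) (fun i x => ?_) (fun x x' hx hx' => ?_) x
  · simp only [DGLie.half, LinearMap.smul_apply, LinearMap.comp_apply, map_smul,
      parity_hom, L.leibniz, dTot_hom]
    rw [pow_succ, pow_succ, pow_succ]
    rcases neg_one_pow_eq_or ℂ i with h | h <;> rw [h] <;> module
  · have h := congrArg₂ (· + ·) hx hx'
    simp only [add_zero] at h
    rw [← h]
    simp only [map_add, LinearMap.add_apply]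
    abel

theorem DGLie.IsRep.leibniz_parity {d : A →ₗ[ℂ] A} {a : Tot K →ₗ[ℂ] A →ₗ[ℂ] A}
    (h : L.IsRep d a) (x : Tot K) (e : A) : d ((a ∘ₗ parity K) x e) +
      (a ∘ₗ parity K) (dTot K x) e + (a ∘ₗ parity K) (parity K x) (d e) = 0 := by
  simp only [LinearMap.comp_apply, h.leibniz, parity_apply_apply, dTot_parity, map_neg,
    LinearMap.neg_apply]
  abel

/-- The sign in the exchange of homogeneous letters. -/
def swapSign (i j : ℕ) : ℂ := (-1) ^ ((i + 1) * (j + 1))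

theorem swapHead_hom (i j : ℕ) (x : K.X i) (y : K.X j) (w : Words (Tot K) A) :
    swapHead (parity K) (cons (hom K i x) (cons (hom K j y) w)) =
      swapSign i j • cons (hom K j y) (cons (hom K i x) w) := by
  rw [swapHead_eigen (parity_hom i x) (parity_hom j y), swapSign, pow_mul]
  congr 1
  rcases neg_one_pow_eq_or ℂ (i + 1) with h | h <;>
  rcases neg_one_pow_eq_or ℂ (j + 1) with h' | h' <;> rw [h, h'] <;> norm_num

theorem jacobi_cyclic (i j k : ℕ) (x : K.X i) (y : K.X j) (z : K.X k) :
    (-1 : ℂ) ^ (i * k) • L.br (hom K i x) (L.br (hom K j y) (hom K k z)) +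
    (-1 : ℂ) ^ (i * j) • L.br (hom K j y) (L.br (hom K k z) (hom K i x)) +
    (-1 : ℂ) ^ (j * k) • L.br (hom K k z) (L.br (hom K i x) (hom K j y)) = 0 := by
  obtain ⟨u, hu⟩ := L.br_deg i j x y
  rw [L.jacobi, ← hu, L.skew (i + j) k u z, hu, L.skew k i z x, smul_add]
  simp only [map_smul, neg_smul, smul_neg, map_neg, smul_smul, ← pow_add]
  have e1 : (-1 : ℂ) ^ (i * k + (i + j) * k) = (-1) ^ (j * k) := by
    rw [show i * k + (i + j) * k = 2 * (i * k) + j * k by ring, pow_add, pow_mul]; simp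
  have e2 : (-1 : ℂ) ^ (i * j + k * i) = (-1) ^ (i * k + i * j) := by ring
  rw [e1, e2]
  abel

theorem half_jacobi (i j k : ℕ) (x : K.X i) (y : K.X j) (z : K.X k) :
    L.half (L.half (hom K i x) (hom K j y)) (hom K k z) +
      L.half (parity K (hom K i x)) (L.half (hom K j y) (hom K k z)) =
    ((-1) ^ (j + 1 + i * j) / 4 : ℂ) • L.br (hom K j y) (L.br (hom K i x) (hom K k z)) := by
  obtain ⟨u, hu⟩ := L.br_deg i j x y
  have h := L.jacobi i j x y (hom K k z)
  simp only [half_hom, map_smul, LinearMap.smul_apply, parity_hom]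
  rw [← hu, half_hom, hu]
  simp only [DGLie.half, LinearMap.smul_apply, LinearMap.comp_apply, parity_hom, map_smul, h,
    smul_add, smul_smul]
  simp only [pow_succ, pow_add]
  rcases neg_one_pow_eq_or ℂ i with h1 | h1 <;> rcases neg_one_pow_eq_or ℂ j with h2 | h2 <;>
    rw [h1, h2] <;> module

theorem cons_hom_ext {B : Type} [AddCommGroup B] [Module ℂ B] {f g : Words (Tot K) A →ₗ[ℂ] B}
    {w : Words (Tot K) A} (h : ∀ i (x : K.X i), f (cons (hom K i x) w) = g (cons (hom K i x) w))
    (v : Tot K) : f (cons v w) = g (cons v w) :=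
  LinearMap.congr_fun (tot_ext (f := f ∘ₗ cons.flip w) (g := g ∘ₗ cons.flip w) h) v

theorem cons_hom_ext₂ {B : Type} [AddCommGroup B] [Module ℂ B] {f g : Words (Tot K) A →ₗ[ℂ] B}
    {w : Words (Tot K) A} (h : ∀ i j (x : K.X i) (y : K.X j),
      f (cons (hom K i x) (cons (hom K j y) w)) = g (cons (hom K i x) (cons (hom K j y) w)))
    (v u : Tot K) : f (cons v (cons u w)) = g (cons v (cons u w)) :=
  cons_hom_ext (fun i x => cons_hom_ext (f := f ∘ₗ cons (hom K i x)) (g := g ∘ₗ cons (hom K i x))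
    (fun j y => h i j x y) u) v

theorem cons_hom_ext₃ {B : Type} [AddCommGroup B] [Module ℂ B] {f g : Words (Tot K) A →ₗ[ℂ] B}
    {w : Words (Tot K) A} (h : ∀ i j l (x : K.X i) (y : K.X j) (z : K.X l),
      f (cons (hom K i x) (cons (hom K j y) (cons (hom K l z) w))) =
        g (cons (hom K i x) (cons (hom K j y) (cons (hom K l z) w))))
    (v u t : Tot K) : f (cons v (cons u (cons t w))) = g (cons v (cons u (cons t w))) :=
  cons_hom_ext (fun i x => cons_hom_ext₂ (f := f ∘ₗ cons (hom K i x))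
    (g := g ∘ₗ cons (hom K i x)) (fun j l y z => h i j l x y z) u t) v

/-- The multiplication of three letters vanishes on symmetric words by the Jacobi identity. -/
theorem mulHead_mulHead {d : A →ₗ[ℂ] A} {a : Tot K →ₗ[ℂ] A →ₗ[ℂ] A} (h : L.IsRep d a) (k : ℕ)
    (w : Words (Tot K) A) (hw : w ∈ symWords (parity K) k) :
    mulHead L.half (a ∘ₗ parity K) (mulHead L.half (a ∘ₗ parity K) w) +
      mulHead L.half (a ∘ₗ parity K) (onTail (parity K) (mulHead L.half (a ∘ₗ parity K)) w) =
        0 := by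
  set C := mulHead L.half (a ∘ₗ parity K) with hC
  set G : Words (Tot K) A →ₗ[ℂ] Words (Tot K) A := C ∘ₗ C + C ∘ₗ onTail (parity K) C with hG
  change G w = 0
  match k, hw with
  | 0, hw => obtain ⟨e, rfl⟩ := hw; simp [hG, hC]
  | 1, hw =>
    refine symWords_ext (f := G) (g := 0) (fun v t ht => ?_) hw
    obtain ⟨e, rfl⟩ := ht
    simp [hG, hC]
  | 2, hw =>
    have h1 : G w + G (swapHead (parity K) w) = 0 := by
      refine symWords_ext (f := G + G ∘ₗ swapHead (parity K)) (g := 0) (fun v t ht => ?_) hw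
      refine symWords_ext (f := (G + G ∘ₗ swapHead (parity K)) ∘ₗ cons v) (g := 0)
        (fun u s hs => ?_) ht
      obtain ⟨e, rfl⟩ := hs
      refine cons_hom_ext₂ (f := G + G ∘ₗ swapHead (parity K)) (g := 0) (fun i j x y => ?_) v u
      have e1 := h.rep i j x y e
      have e2 := L.skew j i y x
      simp only [LinearMap.comp_apply, LinearMap.add_apply, swapHead_hom, map_smul, hG, hC,
        mulHead_cons, combine_cons, onTail_cons, combine_base, parity_apply_apply, half_hom,
        LinearMap.smul_apply, LinearMap.zero_apply]
      obtain ⟨u, hu⟩ := L.br_deg i j x y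
      have hp : parity K (L.br (hom K i x) (hom K j y)) =
          (-1 : ℂ) ^ (i + j + 1) • L.br (hom K i x) (hom K j y) := by rw [← hu, parity_hom]
      rw [e2]
      simp only [parity_hom, hp, map_smul, LinearMap.smul_apply, e1, smul_smul, swapSign, smul_add,
        map_neg, map_sub, smul_sub, neg_smul, smul_neg, LinearMap.neg_apply]
      simp only [show ∀ n : ℕ, (-1 : ℂ) ^ (n + 1) = -(-1) ^ n from fun n => by rw [pow_succ]; ring,
        show (-1 : ℂ) ^ ((i + 1) * (j + 1)) = -((-1) ^ (i * j) * (-1) ^ i * (-1) ^ j) by ring,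
        pow_add, mul_comm j i]
      rcases neg_one_pow_eq_or ℂ i with h1 | h1 <;> rcases neg_one_pow_eq_or ℂ j with h2 | h2 <;>
        rcases neg_one_pow_eq_or ℂ (i * j) with h3 | h3 <;>
        simp only [h1, h2, h3] <;> module
    rw [symWords_swap hw, ← two_smul ℂ] at h1
    exact (smul_eq_zero.1 h1).resolve_left two_ne_zero
  | k + 3, hw =>
    set S := (swapHead (parity K) : Words (Tot K) A →ₗ[ℂ] Words (Tot K) A) with hS
    set T := onTail LinearMap.id S with hT
    have hs : S w = w := symWords_swap hw
    have ht : T w = w := onTail_eq_self (fun t ht => symWords_swap ht) hw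
    have h1 : G w + G (S (T w)) + G (T (S w)) = 0 := by
      refine symWords_ext (f := G + G ∘ₗ S ∘ₗ T + G ∘ₗ T ∘ₗ S) (g := 0) (fun v t ht => ?_) hw
      refine symWords_ext (f := (G + G ∘ₗ S ∘ₗ T + G ∘ₗ T ∘ₗ S) ∘ₗ cons v) (g := 0)
        (fun u s hs => ?_) ht
      refine symWords_ext (f := (G + G ∘ₗ S ∘ₗ T + G ∘ₗ T ∘ₗ S) ∘ₗ cons v ∘ₗ cons u) (g := 0)
        (fun r q _ => ?_) hs
      refine cons_hom_ext₃ (f := G + G ∘ₗ S ∘ₗ T + G ∘ₗ T ∘ₗ S) (g := 0)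
        (fun i j l x y z => ?_) v u r
      have hGG : ∀ (i j l : ℕ) (x : K.X i) (y : K.X j) (z : K.X l) (q : Words (Tot K) A),
          G (cons (hom K i x) (cons (hom K j y) (cons (hom K l z) q))) =
          ((-1) ^ (j + 1 + i * j) / 4 : ℂ) •
            cons (L.br (hom K j y) (L.br (hom K i x) (hom K l z))) q := by
        intro i j l x y z q
        simp only [hG, hC, LinearMap.add_apply, LinearMap.comp_apply, mulHead_cons, combine_cons,
          onTail_cons]
        rw [← LinearMap.add_apply, ← map_add, half_jacobi, map_smul, LinearMap.smul_apply]
      have hj := jacobi_cyclic (L := L) j i l y x z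
      have h2 := congrArg (fun e => ((-1 : ℂ) ^ (j + 1 + i * j + j * l) / 4) • cons e q) hj
      simp only [map_add, map_smul, LinearMap.add_apply, LinearMap.smul_apply, smul_add, smul_smul,
        map_zero, LinearMap.zero_apply, smul_zero] at h2
      simp only [LinearMap.comp_apply, LinearMap.add_apply, hS, hT, swapHead_hom, map_smul,
        onTail_cons, LinearMap.id_apply, hGG, LinearMap.zero_apply, smul_smul, swapSign]
      rw [← h2]
      congr 1
      · congr 1
        · congr 1
          rw [div_mul_eq_mul_div, ← pow_add]
          congr 1
          refine neg_one_pow_congr ?_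
          by_cases hi : Even i <;> by_cases hj : Even j <;> by_cases hl : Even l <;>
            simp [Nat.even_add, Nat.even_mul, hi, hj, hl]
        · congr 1
          rw [div_mul_eq_mul_div, ← pow_add, ← mul_div_assoc, ← pow_add, ← pow_add]
          congr 1
          refine neg_one_pow_congr ?_
          by_cases hi : Even i <;> by_cases hj : Even j <;> by_cases hl : Even l <;>
            simp [Nat.even_add, Nat.even_mul, hi, hj, hl]
      · congr 1
        rw [div_mul_eq_mul_div, ← pow_add, ← mul_div_assoc, ← pow_add, ← pow_add]
        congr 1
        refine neg_one_pow_congr ?_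
        by_cases hi : Even i <;> by_cases hj : Even j <;> by_cases hl : Even l <;>
            simp [Nat.even_add, Nat.even_mul, hi, hj, hl]
    rw [ht, hs, ht] at h1
    have h2 : (3 : ℂ) • G w = 0 := by rw [← h1]; module
    exact (smul_eq_zero.1 h2).resolve_left three_ne_zero

end DGBar

section Differentials
variable {K : CochainComplex (ModuleCat.{0} ℂ) ℕ} {L : DGLie K}
variable {A : Type} [AddCommGroup A] [Module ℂ A]

variable (L) in
/-- The differential on words with coefficients in `A`. -/
def DGLie.wordD (d : A →ₗ[ℂ] A) (a : Tot K →ₗ[ℂ] A →ₗ[ℂ] A) :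
    Words (Tot K) A →ₗ[ℂ] Words (Tot K) A :=
  barD (parity K) (dTot K) L.half d (a ∘ₗ parity K)

theorem DGLie.wordD_eq (d : A →ₗ[ℂ] A) (a : Tot K →ₗ[ℂ] A →ₗ[ℂ] A) :
    L.wordD d a = der (parity K) (dTot K) d + bra (parity K) L.half (a ∘ₗ parity K) :=
  barD_eq _ _ _ _ _

theorem DGLie.jacobiD_eq : L.jacobiD = L.wordD 0 0 := by
  rw [DGLie.wordD, LinearMap.zero_comp, DGLie.jacobiD]

theorem der_symUpTo {d : A →ₗ[ℂ] A} {m : ℕ} {w : Words (Tot K) A}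
    (hw : w ∈ symUpTo (parity K) m) : der (parity K) (dTot K) d w ∈ symUpTo (parity K) m :=
  symUpTo_induction (p := (symUpTo (parity K) m).comap (der (parity K) (dTot K) d))
    (fun _ hk _ hw => symWords_le hk (derP_symWords parity_parity dTot_parity d hw)) hw

theorem bra_symWords_le {a : Tot K →ₗ[ℂ] A →ₗ[ℂ] A} {k m : ℕ} (hk : k ≤ m + 1)
    {w : Words (Tot K) A} (hw : w ∈ symWords (parity K) k) :
    bra (parity K) L.half a w ∈ symUpTo (parity K) m := by
  cases k with
  | zero => obtain ⟨e, rfl⟩ := hw; simp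
  | succ k => exact symWords_le (by omega) (bra_symWords parity_parity L.parity_half a k hw)

theorem DGLie.wordD_symUpTo {d : A →ₗ[ℂ] A} {a : Tot K →ₗ[ℂ] A →ₗ[ℂ] A} {m : ℕ}
    {w : Words (Tot K) A} (hw : w ∈ symUpTo (parity K) m) :
    L.wordD d a w ∈ symUpTo (parity K) m := by
  rw [L.wordD_eq]
  refine add_mem (der_symUpTo hw) ?_
  exact symUpTo_induction (p := (symUpTo (parity K) m).comap
    (bra (parity K) L.half (a ∘ₗ parity K)))
    (fun _ hk _ hw => bra_symWords_le (by omega) hw) hw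

theorem DGLie.IsRep.wordD_wordD {d : A →ₗ[ℂ] A} {a : Tot K →ₗ[ℂ] A →ₗ[ℂ] A}
    (h : L.IsRep d a) {m : ℕ} {w : Words (Tot K) A} (hw : w ∈ symUpTo (parity K) m) :
    L.wordD d a (L.wordD d a w) = 0 := by
  have h1 : ∀ w, der (parity K) (dTot K) d (der (parity K) (dTot K) d w) = 0 := fun w => by
    have h2 := der_anticomm (P := parity K) (δ := dTot K) (s := dTot K) (π := 0)
      parity_parity dTot_parity dTot_parity (fun v => by simp [dTot_dTot]) (d := d) (t := d)
      (ν := 0) (fun e => by simp [h.dd]) w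
    have h3 : derivWords (0 : Tot K →ₗ[ℂ] Tot K) (0 : A →ₗ[ℂ] A) = 0 :=
      hom_ext (by simp [derivWords_base]) (fun v w h => by
        rw [derivWords_cons, h]; simp)
    rw [h3, LinearMap.zero_apply, ← two_smul ℂ] at h2
    exact (smul_eq_zero.1 h2).resolve_left two_ne_zero
  have h2 := der_bra (P := parity K) (δ := dTot K) (b := L.half) (a := a ∘ₗ parity K) (d := d)
    parity_parity dTot_parity L.parity_half half_leibniz h.leibniz_parity w
  have h3 : bra (parity K) L.half (a ∘ₗ parity K)
      (bra (parity K) L.half (a ∘ₗ parity K) w) = 0 :=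
    symUpTo_induction (p := LinearMap.ker (bra (parity K) L.half (a ∘ₗ parity K) ∘ₗ
      bra (parity K) L.half (a ∘ₗ parity K)))
      (fun k _ w hw => bra_bra_of_head parity_parity L.parity_half (mulHead_mulHead h) k hw) hw
  simp only [L.wordD_eq, LinearMap.add_apply, map_add, h1, h3, zero_add, add_zero]
  rw [add_comm]; exact h2

theorem DGLie.jacobiD_jacobiD {m : ℕ} {w : Words (Tot K) ℂ} (hw : w ∈ symUpTo (parity K) m) :
    L.jacobiD (L.jacobiD w) = 0 := by
  rw [L.jacobiD_eq]; exact L.isRep_zero.wordD_wordD hw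

theorem DGLie.jacobiD_symUpTo {m : ℕ} {w : Words (Tot K) ℂ} (hw : w ∈ symUpTo (parity K) m) :
    L.jacobiD w ∈ symUpTo (parity K) m := by
  rw [L.jacobiD_eq]; exact L.wordD_symUpTo hw

/-! ### Degrees -/

theorem weight_hom (i : ℕ) (x : K.X i) : weight K (hom K i x) = ((i : ℂ) - 1) • hom K i x :=
  scale_hom _ _ _

theorem scale_comm (c c' : ℕ → ℂ) (x : Tot K) : scale K c (scale K c' x) = scale K c' (scale K c x) := by
  have : scale K c ∘ₗ scale K c' = scale K c' ∘ₗ scale K c := tot_ext fun i x => by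
    simp [smul_smul, mul_comm]
  exact LinearMap.congr_fun this x

theorem weight_dTot (x : Tot K) : weight K (dTot K x) = dTot K (weight K x) + (1 : ℂ) • dTot K x := by
  have : weight K ∘ₗ dTot K = dTot K ∘ₗ weight K + dTot K := tot_ext fun i x => by
    simp only [LinearMap.comp_apply, LinearMap.add_apply, dTot_hom, weight_hom, map_smul]
    push_cast; module
  rw [one_smul]; exact LinearMap.congr_fun this x

theorem weight_parity (x : Tot K) : weight K (parity K x) = parity K (weight K x) :=
  scale_comm _ _ _

theorem weight_half (x y : Tot K) : weight K (L.half x y) =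
    L.half (weight K x) y + L.half x (weight K y) + (1 : ℂ) • L.half x y := by
  have : L.half.compr₂ (weight K) = L.half ∘ₗ weight K + L.half.compl₂ (weight K) + L.half :=
    tot_ext fun i x => tot_ext fun j y => by
      obtain ⟨u, hu⟩ := L.br_deg i j x y
      simp only [LinearMap.compr₂_apply, LinearMap.add_apply, LinearMap.comp_apply,
        LinearMap.compl₂_apply, weight_hom, half_hom, map_smul, LinearMap.smul_apply, ← hu]
      push_cast; module
  rw [one_smul]; exact LinearMap.congr_fun (LinearMap.congr_fun this x) y

/-- The compatibility of the differential and the action with a degree operator. -/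
structure IsGraded (ν d : A →ₗ[ℂ] A) (a : Tot K →ₗ[ℂ] A →ₗ[ℂ] A) : Prop where
  diff : ∀ e, ν (d e) = d (ν e) + d e
  act : ∀ x e, ν (a x e) = a (weight K x) e + a x (ν e) + a x e

theorem isGraded_zero : IsGraded (K := K) (0 : A →ₗ[ℂ] A) 0 0 := ⟨by simp, by simp⟩

theorem DGRep.isGraded {M : CochainComplex (ModuleCat.{0} ℂ) ℕ} (r : DGRep L M) :
    IsGraded (degree M) (dTot M) r.act where
  diff e := by
    have : degree M ∘ₗ dTot M = dTot M ∘ₗ degree M + dTot M := tot_ext fun i x => by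
      simp only [LinearMap.comp_apply, LinearMap.add_apply, dTot_hom, degree, scale_hom, map_smul]
      push_cast; module
    exact LinearMap.congr_fun this e
  act x e := by
    have : r.act.compr₂ (degree M) = r.act ∘ₗ weight K + r.act.compl₂ (degree M) + r.act :=
      tot_ext fun i x => tot_ext fun j y => by
        obtain ⟨u, hu⟩ := r.act_deg i j x y
        simp only [LinearMap.compr₂_apply, LinearMap.add_apply, LinearMap.comp_apply,
          LinearMap.compl₂_apply, weight_hom, degree, scale_hom, map_smul, LinearMap.smul_apply,
          ← hu]
        push_cast; module
    exact LinearMap.congr_fun (LinearMap.congr_fun this x) e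

theorem IsGraded.wordD {ν d : A →ₗ[ℂ] A} {a : Tot K →ₗ[ℂ] A →ₗ[ℂ] A} (h : IsGraded ν d a)
    (w : Words (Tot K) A) : derivWords (weight K) ν (L.wordD d a w) =
      L.wordD d a (derivWords (weight K) ν w) + L.wordD d a w := by
  have h1 := derivWords_der (n := weight K) (Q := parity K) (δ := dTot K) (ν := ν) (d := d)
    (κ := 1) (scale_comm _ _) weight_dTot (by simpa using h.diff) w
  have h2 := derivWords_bra (n := weight K) (P := parity K) (b := L.half) (ν := ν)
    (a := a ∘ₗ parity K) (κ := 1) (scale_comm _ _) weight_half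
    (fun v e => by simp only [LinearMap.comp_apply, h.act, one_smul, weight_parity]) w
  rw [L.wordD_eq, LinearMap.add_apply, map_add, h1, h2]
  simp only [one_smul, LinearMap.add_apply]
  abel

theorem wordDeg_jacobiD (w : Words (Tot K) ℂ) :
    wordDeg K (L.jacobiD w) = L.jacobiD (wordDeg K w) + L.jacobiD w := by
  rw [L.jacobiD_eq]; exact isGraded_zero.wordD w

end Differentials

section CochainDifferential
variable {K : CochainComplex (ModuleCat.{0} ℂ) ℕ} {L : DGLie K}
variable {A : Type} [AddCommGroup A] [Module ℂ A]

variable (L) in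
/-- The differential of cochains; `ε` is the sign of the degree of the cochain. -/
def DGLie.cd (ε : ℂ) (d : A →ₗ[ℂ] A) (a : Tot K →ₗ[ℂ] A →ₗ[ℂ] A) :
    (Words (Tot K) ℂ →ₗ[ℂ] A) →ₗ[ℂ] (Words (Tot K) ℂ →ₗ[ℂ] A) :=
  LinearMap.compRight ℂ d - ε • LinearMap.lcomp ℂ A L.jacobiD +
    headAct (a ∘ₗ parityPow (parity K) (-ε))

theorem DGLie.cd_apply (ε : ℂ) (d : A →ₗ[ℂ] A) (a : Tot K →ₗ[ℂ] A →ₗ[ℂ] A)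
    (c : Words (Tot K) ℂ →ₗ[ℂ] A) (w : Words (Tot K) ℂ) : L.cd ε d a c w =
      d (c w) - ε • c (L.jacobiD w) + headAct (a ∘ₗ parityPow (parity K) (-ε)) c w := rfl

theorem DGLie.cd_one (d : A →ₗ[ℂ] A) (a : Tot K →ₗ[ℂ] A →ₗ[ℂ] A) :
    L.cd 1 d a = cochD L d a := by
  refine LinearMap.ext fun c => LinearMap.ext fun w => ?_
  rw [L.cd_apply, cochD_apply, parityPow_neg_one, one_smul]

theorem DGLie.cd_neg_one (d : A →ₗ[ℂ] A) (a : Tot K →ₗ[ℂ] A →ₗ[ℂ] A) :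
    L.cd (-1) d a = cochDPrev L d a := by
  refine LinearMap.ext fun c => LinearMap.ext fun w => ?_
  rw [L.cd_apply, cochDPrev_apply, neg_neg, parityPow_one, LinearMap.comp_id, neg_one_smul,
    sub_neg_eq_add]

theorem DGLie.IsRep.cd_cd {d : A →ₗ[ℂ] A} {a : Tot K →ₗ[ℂ] A →ₗ[ℂ] A} (h : L.IsRep d a) {ε : ℂ}
    (hε : ε = 1 ∨ ε = -1) (c : Words (Tot K) ℂ →ₗ[ℂ] A) {m : ℕ} {w : Words (Tot K) ℂ}
    (hw : w ∈ symUpTo (parity K) m) : L.cd (-ε) d a (L.cd ε d a c) w = 0 := by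
  set p := parityPow (parity K) (-ε) with hp
  set q := parityPow (parity K) (- -ε) with hq
  have hpq : ∀ x, parity K (p x) = q x := fun x => by
    rcases hε with rfl | rfl <;> simp [hp, hq, parity_apply_apply]
  have hpP : ∀ x, p (parity K x) = q x := fun x => by
    rcases hε with rfl | rfl <;> simp [hp, hq, parity_apply_apply]
  have hpd : ∀ x, dTot K (p x) = -ε • p (dTot K x) := fun x => by
    rcases hε with rfl | rfl <;> simp [hp, dTot_parity]
  let Φ : Tot K →ₗ[ℂ] Tot K →ₗ[ℂ] A →ₗ[ℂ] A :=
    ε • L.half.compr₂ (a ∘ₗ p) +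
    (LinearMap.mk₂ ℂ (fun x y => a (q x) ∘ₗ a (p y))
      (fun x x' y => by simp [LinearMap.add_comp]) (fun t x y => by simp [LinearMap.smul_comp])
      (fun x y y' => by simp [LinearMap.comp_add]) (fun t x y => by simp [LinearMap.comp_smul]))
  have hΦ : ∀ x y e, Φ x y e = ε • a (p (L.half x y)) e + a (q x) (a (p y) e) := fun x y e => rfl
  have key : L.cd (-ε) d a (L.cd ε d a c) w = headAct₂ Φ c w := by
    refine symUpTo_induction (p := LinearMap.eqLocus (L.cd (-ε) d a (L.cd ε d a c))
      (headAct₂ Φ c)) (fun k hk w hw => ?_) hw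
    rw [LinearMap.mem_eqLocus]
    cases k with
    | zero => obtain ⟨t, rfl⟩ := hw; simp [L.cd_apply, headAct₂_base, jacobiD_base, h.dd]
    | succ k =>
      have hDD := L.jacobiD_jacobiD (symWords_le le_rfl hw)
      rw [L.cd_apply, L.cd_apply, L.cd_apply, hDD]
      simp only [map_zero, smul_zero, sub_zero, map_add, map_sub, h.dd, zero_sub, map_smul,
        neg_smul, smul_add]
      have h1 : d (headAct (a ∘ₗ p) c w) + ε • headAct (a ∘ₗ p) c (L.jacobiD w) +
          headAct (a ∘ₗ q) (L.cd ε d a c) w = headAct₂ Φ c w := by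
        refine symWords_ext (f := d ∘ₗ headAct (a ∘ₗ p) c +
          ε • headAct (a ∘ₗ p) c ∘ₗ L.jacobiD + headAct (a ∘ₗ q) (L.cd ε d a c))
          (g := headAct₂ Φ c) (fun x t _ => ?_) hw
        have hx : headAct (Φ x) c t = ε • headAct ((a ∘ₗ p) ∘ₗ L.half x) c t +
            headAct ((a ∘ₗ p).compr₂ (a (q x))) c t := by
          have : headAct (Φ x) c = ε • headAct ((a ∘ₗ p) ∘ₗ L.half x) c +
              headAct ((a ∘ₗ p).compr₂ (a (q x))) c := hom_ext (by simp) (by simp [hΦ])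
          rw [this]; rfl
        have hl := h.leibniz (p x) (c t)
        rw [hpq, hpd] at hl
        rw [headAct₂_cons, hx, ← headAct_headAct, ← headAct_combine]
        simp only [LinearMap.add_apply, LinearMap.comp_apply, LinearMap.smul_apply, headAct_cons,
          jacobiD_cons, map_add, hl, L.cd_apply, hpP, map_sub, map_smul, neg_smul, map_neg,
          LinearMap.neg_apply, smul_add, ← hp]
        abel
      rw [← h1]; abel
  rw [key]
  refine headAct₂_vanish Φ c (fun i j x y e => ?_) hw
  obtain ⟨u, hu⟩ := L.br_deg i j x y
  have e1 := h.rep i j x y e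
  have e2 := L.skew j i y x
  simp only [hp, hq] at hΦ
  rw [neg_neg] at hΦ
  simp only [hΦ, half_hom, e2, map_smul, LinearMap.smul_apply, map_neg, LinearMap.neg_apply,
    neg_smul, smul_neg, mul_comm j i]
  rw [← hu]
  rw [← hu] at e1
  simp only [show ∀ n : ℕ, (-1 : ℂ) ^ (n + 1) = -(-1) ^ n from fun n => by rw [pow_succ]; ring]
  have hij : (-1 : ℂ) ^ (i * j) = (1 + (-1) ^ i + (-1) ^ j - (-1) ^ i * (-1) ^ j) / 2 := by
    rw [pow_mul]
    rcases neg_one_pow_eq_or ℂ i with h1 | h1 <;> rcases neg_one_pow_eq_or ℂ j with h2 | h2 <;>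
      rw [h1] <;> simp only [h2, one_pow] <;> norm_num
  rcases hε with rfl | rfl
  · simp only [parityPow_one, parityPow_neg_one, parity_hom, LinearMap.id_apply, map_smul,
      LinearMap.smul_apply, e1]
    rcases neg_one_pow_eq_or ℂ i with h1 | h1 <;> rcases neg_one_pow_eq_or ℂ j with h2 | h2 <;>
      simp only [pow_add, pow_one, h1, h2, hij] <;> module
  · simp only [neg_neg, parityPow_one, parityPow_neg_one, parity_hom, LinearMap.id_apply, map_smul,
      LinearMap.smul_apply, e1]
    rcases neg_one_pow_eq_or ℂ i with h1 | h1 <;> rcases neg_one_pow_eq_or ℂ j with h2 | h2 <;>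
      simp only [pow_add, pow_one, h1, h2, hij] <;> module

/-- A cochain has degree `ρ`. -/
def HasDeg (ν : A →ₗ[ℂ] A) (ρ : ℂ) (c : Words (Tot K) ℂ →ₗ[ℂ] A) : Prop :=
  ν ∘ₗ c = c ∘ₗ wordDeg K + ρ • c

theorem HasDeg.apply {ν : A →ₗ[ℂ] A} {ρ : ℂ} {c : Words (Tot K) ℂ →ₗ[ℂ] A} (h : HasDeg ν ρ c)
    (w : Words (Tot K) ℂ) : ν (c w) = c (wordDeg K w) + ρ • c w := LinearMap.congr_fun h w

theorem wordDeg_cons (x : Tot K) (w : Words (Tot K) ℂ) :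
    wordDeg K (cons x w) = cons (weight K x) w + cons x (wordDeg K w) := derivWords_cons _ _ _ _

@[simp] theorem wordDeg_base (t : ℂ) : wordDeg K (base t) = 0 := by
  simp [wordDeg, derivWords_base]

theorem HasDeg.cd {ν d : A →ₗ[ℂ] A} {a : Tot K →ₗ[ℂ] A →ₗ[ℂ] A} (h : IsGraded ν d a) {ε ρ : ℂ}
    {c : Words (Tot K) ℂ →ₗ[ℂ] A} (hc : HasDeg ν ρ c) : HasDeg ν (ρ + 1) (L.cd ε d a c) := by
  have h1 : HasDeg ν (ρ + 1) (headAct (a ∘ₗ parityPow (parity K) (-ε)) c) := by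
    refine hom_ext (by simp) fun x w _ => ?_
    have hP : weight K (parityPow (parity K) (-ε) x) = parityPow (parity K) (-ε) (weight K x) := by
      simp only [parityPow, LinearMap.add_apply, LinearMap.smul_apply, LinearMap.id_apply, map_add,
        map_smul, weight_parity]
    simp only [LinearMap.comp_apply, LinearMap.add_apply, LinearMap.smul_apply, headAct_cons,
      h.act, hc.apply, wordDeg_cons, map_add, hP, map_smul]
    module
  refine LinearMap.ext fun w => ?_
  have h2 := h1.apply w
  simp only [LinearMap.comp_apply, LinearMap.add_apply, LinearMap.smul_apply, L.cd_apply, map_add,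
    map_sub, map_smul, h.diff, hc.apply, h2, wordDeg_jacobiD]
  module

end CochainDifferential

section Length
variable {V F : Type} [AddCommGroup V] [Module ℂ V] [AddCommGroup F] [Module ℂ F]
variable {A : Type} [AddCommGroup A] [Module ℂ A]

variable (V F) in
/-- The words in `k` letters. -/
def lenWords : ℕ → Submodule ℂ (Words V F)
  | 0 => LinearMap.range base
  | k + 1 => Submodule.map₂ cons ⊤ (lenWords k)

theorem lenWords_ext {k : ℕ} {f g : Words V F →ₗ[ℂ] A}
    (h : ∀ v, ∀ t ∈ lenWords V F k, f (cons v t) = g (cons v t)) {w : Words V F}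
    (hw : w ∈ lenWords V F (k + 1)) : f w = g w := by
  have : lenWords V F (k + 1) ≤ LinearMap.eqLocus f g := Submodule.map₂_le.2 fun v _ t ht => h v t ht
  exact this hw

theorem symWords_le_lenWords (P : V →ₗ[ℂ] V) (k : ℕ) : symWords P k ≤ lenWords V F k := by
  induction k with
  | zero => exact le_rfl
  | succ k ih => exact (symWords_succ_le P k).trans (Submodule.map₂_le_map₂ le_rfl ih)

/-- The projection to the words in `k` letters. -/
def prlen : ℕ → Words V F →ₗ[ℂ] Words V F
  | 0 => wcases base 0
  | k + 1 => onTail LinearMap.id (prlen k)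

@[simp] theorem prlen_zero_base (e : F) : prlen 0 (base e : Words V F) = base e := by simp [prlen]
@[simp] theorem prlen_zero_cons (v : V) (w : Words V F) : prlen 0 (cons v w) = 0 := by simp [prlen]
@[simp] theorem prlen_succ_base (k : ℕ) (e : F) : prlen (k + 1) (base e : Words V F) = 0 := by
  simp [prlen]
@[simp] theorem prlen_succ_cons (k : ℕ) (v : V) (w : Words V F) :
    prlen (k + 1) (cons v w) = cons v (prlen k w) := by simp [prlen]

theorem prlen_self {k : ℕ} {w : Words V F} (hw : w ∈ lenWords V F k) : prlen k w = w := by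
  induction k generalizing w with
  | zero => obtain ⟨e, rfl⟩ := hw; simp
  | succ k ih => exact lenWords_ext (g := LinearMap.id) (fun v t ht => by simp [ih ht]) hw

theorem prlen_ne {j k : ℕ} (h : j ≠ k) {w : Words V F} (hw : w ∈ lenWords V F k) :
    prlen j w = 0 := by
  induction k generalizing j w with
  | zero =>
    obtain ⟨e, rfl⟩ := hw
    cases j with
    | zero => exact absurd rfl h
    | succ j => simp
  | succ k ih =>
    refine lenWords_ext (g := 0) (fun v t ht => ?_) hw
    cases j with
    | zero => simp
    | succ j =>
      have := ih (j := j) (by omega) ht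
      simp [this]

theorem prlen_comm {f : Words V F →ₗ[ℂ] Words V F} {p q : V →ₗ[ℂ] V} {ν : F →ₗ[ℂ] F}
    (h₀ : ∀ e, f (base e) = base (ν e))
    (h₁ : ∀ v w, f (cons v w) = cons (p v) w + cons (q v) (f w)) (k : ℕ) (w : Words V F) :
    prlen k (f w) = f (prlen k w) := by
  induction k generalizing w with
  | zero =>
    have : prlen 0 ∘ₗ f = f ∘ₗ prlen 0 := hom_ext (by simp [h₀]) (by simp [h₁])
    exact LinearMap.congr_fun this w
  | succ k ih =>
    have : prlen (k + 1) ∘ₗ f = f ∘ₗ prlen (k + 1) := hom_ext (by simp [h₀]) (by simp [h₁, ih])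
    exact LinearMap.congr_fun this w

theorem prlen_der (Q δ : V →ₗ[ℂ] V) (d : F →ₗ[ℂ] F) (k : ℕ) (w : Words V F) :
    prlen k (der Q δ d w) = der Q δ d (prlen k w) :=
  prlen_comm (der_base Q δ d) (der_cons Q δ d) k w

theorem prlen_derivWords (n : V →ₗ[ℂ] V) (ν : F →ₗ[ℂ] F) (k : ℕ) (w : Words V F) :
    prlen k (derivWords n ν w) = derivWords n ν (prlen k w) :=
  prlen_comm (q := LinearMap.id) (derivWords_base n ν) (derivWords_cons n ν) k w

theorem prlen_mapLetters (p : V →ₗ[ℂ] V) (k : ℕ) (w : Words V F) :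
    prlen k (mapLetters p w) = mapLetters p (prlen k w) :=
  prlen_comm (p := 0) (q := p) (ν := LinearMap.id) (by simp) (by simp) k w

theorem prlen_symUpTo {P : V →ₗ[ℂ] V} {m : ℕ} {w : Words V F} (hw : w ∈ symUpTo P m) (k : ℕ) :
    prlen k w ∈ symWords P k := by
  refine symUpTo_induction (p := (symWords P k).comap (prlen k)) (fun j _ w hw => ?_) hw
  rw [Submodule.mem_comap]
  by_cases h : k = j
  · subst h; rwa [prlen_self (symWords_le_lenWords P k hw)]
  · rw [prlen_ne h (symWords_le_lenWords P j hw)]; exact zero_mem _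

theorem prlen_eq_zero {P : V →ₗ[ℂ] V} {m k : ℕ} (hk : m < k) {w : Words V F}
    (hw : w ∈ symUpTo P m) : prlen k w = 0 :=
  symUpTo_induction (p := LinearMap.ker (prlen k)) (fun j hj w hw =>
    prlen_ne (by omega) (symWords_le_lenWords P j hw)) hw

theorem sum_prlen {P : V →ₗ[ℂ] V} {m : ℕ} {w : Words V F} (hw : w ∈ symUpTo P m) :
    ∑ k ∈ Finset.range (m + 1), prlen k w = w := by
  have := symUpTo_induction (p := LinearMap.eqLocus (∑ k ∈ Finset.range (m + 1), prlen k)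
    LinearMap.id) (fun j hj w hw => ?_) hw
  · simpa using this
  · rw [LinearMap.mem_eqLocus, LinearMap.sum_apply, Finset.sum_eq_single j]
    · exact prlen_self (symWords_le_lenWords P j hw)
    · exact fun k _ hk => prlen_ne hk (symWords_le_lenWords P j hw)
    · intro h; exact absurd (Finset.mem_range.2 (by omega)) h

theorem symUpTo_of_prlen {P : V →ₗ[ℂ] V} {m : ℕ} {w : Words V F} (hw : w ∈ symUpTo P (m + 1))
    (h : prlen (m + 1) w = 0) : w ∈ symUpTo P m := by
  have h1 := sum_prlen hw
  rw [Finset.sum_range_succ, h, add_zero] at h1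
  rw [← h1]
  exact sum_mem fun k hk => symWords_le (by simpa [Nat.lt_succ_iff] using hk) (prlen_symUpTo hw k)

end Length

section Homotopy
variable {V F : Type} [AddCommGroup V] [Module ℂ V] [AddCommGroup F] [Module ℂ F]

/-- Data of a homotopy `s` for the differential `δ`. -/
structure IsHtpy (P δ s : V →ₗ[ℂ] V) : Prop where
  PP : P ∘ₗ P = LinearMap.id
  dP : ∀ v, δ (P v) = -P (δ v)
  sP : ∀ v, s (P v) = -P (s v)
  dd : ∀ v, δ (δ v) = 0
  ss : ∀ v, s (s v) = 0
  sds : ∀ v, s (δ (s v)) = s v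

/-- The idempotent `δ s + s δ`. -/
def lap (δ s : V →ₗ[ℂ] V) : V →ₗ[ℂ] V := δ ∘ₗ s + s ∘ₗ δ

/-- The projection complementary to `δ s + s δ`. -/
def harm (δ s : V →ₗ[ℂ] V) : V →ₗ[ℂ] V := LinearMap.id - lap δ s

variable {P δ s : V →ₗ[ℂ] V}

theorem lap_apply (v : V) : lap δ s v = δ (s v) + s (δ v) := rfl
theorem harm_apply (v : V) : harm δ s v = v - (δ (s v) + s (δ v)) := rfl

namespace IsHtpy
variable (H : IsHtpy P δ s)
include H

theorem lap_P (v : V) : lap δ s (P v) = P (lap δ s v) := by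
  simp only [lap_apply, H.sP, H.dP, map_neg, neg_neg, map_add]

theorem lap_s (v : V) : lap δ s (s v) = s v := by
  simp only [lap_apply, H.ss, H.sds, map_zero, zero_add]

theorem s_lap (v : V) : s (lap δ s v) = s v := by
  simp only [lap_apply, map_add, H.ss, H.sds, add_zero]

theorem lap_d (v : V) : lap δ s (δ v) = δ (lap δ s v) := by
  simp only [lap_apply, map_add, H.dd, map_zero, zero_add, add_zero]

theorem lap_lap (v : V) : lap δ s (lap δ s v) = lap δ s v := by
  conv_lhs => rw [lap_apply v, map_add, H.lap_d, lap_apply, H.lap_s]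
  simp only [map_add, H.dd, map_zero, H.sds, add_zero, H.ss]
  rw [lap_apply, zero_add]

theorem harm_P (v : V) : harm δ s (P v) = P (harm δ s v) := by
  have := H.lap_P v
  simp only [harm, LinearMap.sub_apply, LinearMap.id_apply, this, map_sub]

theorem harm_harm (v : V) : harm δ s (harm δ s v) = harm δ s v := by
  simp only [harm, LinearMap.sub_apply, LinearMap.id_apply, map_sub, H.lap_lap]
  abel

theorem harm_lap (v : V) : harm δ s (lap δ s v) = 0 := by
  simp only [harm, LinearMap.sub_apply, LinearMap.id_apply, H.lap_lap, sub_self]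

theorem lap_harm (v : V) : lap δ s (harm δ s v) = 0 := by
  simp only [harm, LinearMap.sub_apply, LinearMap.id_apply, H.lap_lap, map_sub, sub_self]

theorem s_harm (v : V) : s (harm δ s v) = 0 := by
  simp only [harm, LinearMap.sub_apply, LinearMap.id_apply, map_sub, H.s_lap, sub_self]

theorem harm_d (v : V) : harm δ s (δ v) = δ (harm δ s v) := by
  simp only [harm, LinearMap.sub_apply, LinearMap.id_apply, map_sub, H.lap_d]

end IsHtpy

variable (F) in
/-- The derivation of words extending `δ s + s δ`. -/
def lapW (δ s : V →ₗ[ℂ] V) : Words V F →ₗ[ℂ] Words V F := derivWords (lap δ s) 0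

variable (F) in
/-- The polynomials `∏ (1 - lapW / i)`. -/
def htpyT (δ s : V →ₗ[ℂ] V) : ℕ → Words V F →ₗ[ℂ] Words V F
  | 0 => LinearMap.id
  | i + 1 => htpyT δ s i - (1 / (i + 1 : ℂ)) • htpyT δ s i ∘ₗ lapW F δ s

variable (F) in
/-- The homotopy on words with at most `i` letters. -/
def htpy (P δ s : V →ₗ[ℂ] V) : ℕ → Words V F →ₗ[ℂ] Words V F
  | 0 => 0
  | i + 1 => htpy P δ s i + (1 / (i + 1 : ℂ)) • der P s 0 ∘ₗ htpyT F δ s i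

theorem htpyT_succ (i : ℕ) (w : Words V F) : htpyT F δ s (i + 1) w =
    htpyT F δ s i w - (1 / (i + 1 : ℂ)) • htpyT F δ s i (lapW F δ s w) := rfl

theorem htpy_succ (i : ℕ) (w : Words V F) : htpy F P δ s (i + 1) w =
    htpy F P δ s i w + (1 / (i + 1 : ℂ)) • der P s 0 (htpyT F δ s i w) := rfl

theorem htpyT_comm {f : Words V F →ₗ[ℂ] Words V F}
    (h : ∀ w, f (lapW F δ s w) = lapW F δ s (f w)) (i : ℕ) (w : Words V F) :
    f (htpyT F δ s i w) = htpyT F δ s i (f w) := by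
  induction i generalizing w with
  | zero => rfl
  | succ i ih => simp only [htpyT_succ, map_sub, map_smul, ih, h]

theorem htpyT_mem {N : Submodule ℂ (Words V F)} (h : ∀ w ∈ N, lapW F δ s w ∈ N) (i : ℕ)
    {w : Words V F} (hw : w ∈ N) : htpyT F δ s i w ∈ N := by
  induction i generalizing w with
  | zero => exact hw
  | succ i ih =>
    rw [htpyT_succ]
    exact sub_mem (ih hw) (N.smul_mem _ (ih (h _ hw)))

theorem htpyT_cons_of_zero {v : V} (hv : lap δ s v = 0) (i : ℕ) (w : Words V F) :
    htpyT F δ s i (cons v w) = cons v (htpyT F δ s i w) := by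
  induction i generalizing w with
  | zero => rfl
  | succ i ih =>
    simp only [htpyT_succ, map_sub, map_smul, ih, lapW, derivWords_cons, hv, map_zero,
      LinearMap.zero_apply, zero_add]

theorem htpyT_cons_of_self {v : V} (hv : lap δ s v = v) (i : ℕ) (w : Words V F) :
    htpyT F δ s (i + 1) (cons v w) =
      -(1 / (i + 1 : ℂ)) • cons v (lapW F δ s (htpyT F δ s i w)) := by
  induction i generalizing w with
  | zero => simp [htpyT, lapW, derivWords_cons, hv]
  | succ i ih =>
    have h1 : lapW F δ s (cons v w) = cons v w + cons v (lapW F δ s w) := by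
      simp [lapW, derivWords_cons, hv]
    have hi : (i : ℂ) + 1 ≠ 0 := by exact_mod_cast Nat.succ_ne_zero i
    have hi' : (i : ℂ) + 1 + 1 ≠ 0 := by exact_mod_cast Nat.succ_ne_zero (i + 1)
    rw [htpyT_succ, h1, map_add, ih, ih, htpyT_succ]
    simp only [map_sub, map_smul, smul_sub, smul_add, smul_smul, Nat.cast_add, Nat.cast_one]
    match_scalars <;> field_simp <;> ring

namespace IsHtpy
variable (H : IsHtpy P δ s)
include H

theorem lapW_Q (w : Words V F) : lapW F δ s (mapLetters (harm δ s) w) = 0 := by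
  have : lapW F δ s ∘ₗ mapLetters (harm δ s) = 0 :=
    hom_ext (by simp [lapW, derivWords_base]) fun v w h => by
      simp only [lapW, LinearMap.comp_apply, LinearMap.zero_apply] at h
      simp [lapW, derivWords_cons, H.lap_harm, h]
  exact LinearMap.congr_fun this w

theorem Q_lapW (w : Words V F) : mapLetters (harm δ s) (lapW F δ s w) = 0 := by
  have h := derivWords_mapLetters (n := lap δ s) (p := harm δ s) (0 : F →ₗ[ℂ] F)
    (fun v => by rw [H.lap_harm, H.harm_lap]) w
  rw [lapW, ← h]
  exact H.lapW_Q w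

theorem Q_Q (w : Words V F) :
    mapLetters (harm δ s) (mapLetters (harm δ s) w) = mapLetters (harm δ s) w := by
  have : mapLetters (harm δ s) ∘ₗ mapLetters (harm δ s) =
      (mapLetters (harm δ s) : Words V F →ₗ[ℂ] _) :=
    hom_ext (by simp) fun v w h => by
      simp only [LinearMap.comp_apply] at h
      simp [H.harm_harm, h]
  exact LinearMap.congr_fun this w

theorem lapW_symWords {k : ℕ} {w : Words V F} (hw : w ∈ symWords P k) :
    lapW F δ s w ∈ symWords P k := derivWords_symWords H.PP H.lap_P 0 hw

theorem htpyT_len {j k : ℕ} (hjk : k ≤ j) {w : Words V F} (hw : w ∈ lenWords V F k) :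
    htpyT F δ s j w = mapLetters (harm δ s) w := by
  have hl : ∀ k, ∀ w ∈ lenWords V F k, lapW F δ s w ∈ lenWords V F k := by
    intro k
    induction k with
    | zero => rintro _ ⟨e, rfl⟩; exact ⟨0, by simp [lapW, derivWords_base]⟩
    | succ k ih =>
      intro w hw
      have : lenWords V F (k + 1) ≤ (lenWords V F (k + 1)).comap (lapW F δ s) :=
        Submodule.map₂_le.2 fun v _ t ht => by
          rw [Submodule.mem_comap]
          simp only [lapW, derivWords_cons]
          exact add_mem (Submodule.apply_mem_map₂ _ trivial ht)
            (Submodule.apply_mem_map₂ _ trivial (ih t ht))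
      exact this hw
  have hk : ∀ w ∈ lenWords V F k, htpyT F δ s k w = mapLetters (harm δ s) w := by
    clear hw hjk
    induction k with
    | zero => rintro _ ⟨e, rfl⟩; simp [htpyT]
    | succ k ih =>
      intro w hw
      refine lenWords_ext (f := htpyT F δ s (k + 1)) (fun v t ht => ?_) hw
      have e1 : v = lap δ s v + harm δ s v := by simp [harm]
      rw [e1]
      simp only [map_add, LinearMap.add_apply, mapLetters_cons]
      rw [htpyT_cons_of_self (H.lap_lap v), htpyT_cons_of_zero (H.lap_harm v), htpyT_succ,
        ih t ht, ih _ (hl _ _ ht), H.lapW_Q, H.Q_lapW, H.harm_harm, H.harm_lap]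
      simp
  induction j, hjk using Nat.le_induction generalizing w with
  | base => exact hk w hw
  | succ j _ ih => rw [htpyT_succ, ih hw, ih (hl _ _ hw), H.Q_lapW, smul_zero, sub_zero]

theorem der_lapW (d : F →ₗ[ℂ] F) (w : Words V F) :
    der P δ d (lapW F δ s w) = lapW F δ s (der P δ d w) := by
  have := derivWords_der (n := lap δ s) (Q := P) (δ := δ) (ν := 0) (d := d) (κ := 0)
    H.lap_P (fun v => by rw [H.lap_d, zero_smul, add_zero]) (by simp) w
  rw [zero_smul, add_zero] at this
  exact this.symm

theorem sW_lapW (w : Words V F) : der P s 0 (lapW F δ s w) = lapW F δ s (der P s 0 w) := by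
  have := derivWords_der (n := lap δ s) (Q := P) (δ := s) (ν := (0 : F →ₗ[ℂ] F)) (d := 0) (κ := 0)
    H.lap_P (fun v => by rw [H.lap_s, H.s_lap, zero_smul, add_zero]) (by simp) w
  rw [zero_smul, add_zero] at this
  exact this.symm

theorem htpy_eq (d : F →ₗ[ℂ] F) (i : ℕ) (w : Words V F) :
    der P δ d (htpy F P δ s i w) + htpy F P δ s i (der P δ d w) = w - htpyT F δ s i w := by
  induction i with
  | zero => simp [htpy, htpyT]
  | succ i ih =>
    have h1 := der_anticomm H.PP H.dP H.sP (fun v => (lap_apply v).symm) (d := d) (t := 0) (ν := 0)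
      (by simp) (htpyT F δ s i w)
    rw [htpyT_comm (H.der_lapW d)] at h1
    have h2 : htpyT F δ s i (lapW F δ s w) = derivWords (lap δ s) 0 (htpyT F δ s i w) :=
      (htpyT_comm (fun _ => rfl) i w).symm
    rw [htpyT_succ, h2, ← h1, htpy_succ, htpy_succ]
    simp only [map_add, map_smul, smul_add]
    rw [← sub_eq_zero] at ih ⊢
    rw [← ih]; abel

theorem htpy_symWords (i : ℕ) {k : ℕ} {w : Words V F} (hw : w ∈ symWords P k) :
    htpy F P δ s i w ∈ symWords P k := by
  induction i with
  | zero => exact zero_mem _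
  | succ i ih =>
    rw [htpy_succ]
    exact add_mem ih (Submodule.smul_mem _ _ (derP_symWords H.PP H.sP 0
      (htpyT_mem (fun w hw => H.lapW_symWords hw) i hw)))

theorem htpy_symUpTo (i : ℕ) {k : ℕ} {w : Words V F} (hw : w ∈ symUpTo P k) :
    htpy F P δ s i w ∈ symUpTo P k :=
  symUpTo_induction (p := (symUpTo P k).comap (htpy F P δ s i))
    (fun _ hj _ hw => symWords_le hj (H.htpy_symWords i hw)) hw

theorem htpy_of_sW {w : Words V F} (hw : der P s 0 w = 0) (i : ℕ) : htpy F P δ s i w = 0 := by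
  induction i with
  | zero => rfl
  | succ i ih => rw [htpy_succ, ih, htpyT_comm H.sW_lapW, hw]; simp

theorem sW_of_letters {p : V →ₗ[ℂ] V} (hp : ∀ v, s (p v) = 0) (w : Words V F) :
    der P s 0 (mapLetters p w) = 0 := by
  have : der P s 0 ∘ₗ mapLetters p = (0 : Words V F →ₗ[ℂ] _) :=
    hom_ext (by simp) fun v w h => by
      simp only [LinearMap.comp_apply, LinearMap.zero_apply] at h
      simp [hp, h]
  exact LinearMap.congr_fun this w

theorem htpy_Q (i : ℕ) (w : Words V F) : htpy F P δ s i (mapLetters (harm δ s) w) = 0 :=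
  H.htpy_of_sW (H.sW_of_letters H.s_harm w) i

theorem Q_symWords {k : ℕ} {w : Words V F} (hw : w ∈ symWords P k) :
    mapLetters (harm δ s) w ∈ symWords P k := mapLetters_symWords H.PP H.harm_P hw

theorem Q_symUpTo {k : ℕ} {w : Words V F} (hw : w ∈ symUpTo P k) :
    mapLetters (harm δ s) w ∈ symUpTo P k :=
  symUpTo_induction (p := (symUpTo P k).comap (mapLetters (harm δ s)))
    (fun _ hj _ hw => symWords_le hj (H.Q_symWords hw)) hw

theorem htpy_deg {n : V →ₗ[ℂ] V} (hP : ∀ v, n (P v) = P (n v))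
    (hd : ∀ v, n (δ v) = δ (n v) + (1 : ℂ) • δ v) (hs : ∀ v, n (s v) = s (n v) + (-1 : ℂ) • s v)
    (ν : F →ₗ[ℂ] F) (i : ℕ) (w : Words V F) :
    derivWords n ν (htpy F P δ s i w) = htpy F P δ s i (derivWords n ν w) - htpy F P δ s i w := by
  have hl : ∀ w, derivWords n ν (lapW F δ s w) = lapW F δ s (derivWords n ν w) := fun w => by
    have := derivWords_der (n := n) (Q := LinearMap.id) (δ := lap δ s) (ν := ν) (d := 0) (κ := 0)
      (fun _ => rfl) (fun v => by simp only [lap_apply, map_add, hd, hs, map_smul]; module)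
      (by simp) w
    rw [zero_smul, add_zero] at this
    exact this
  induction i with
  | zero => simp [htpy]
  | succ i ih =>
    have h1 := derivWords_der (n := n) (Q := P) (δ := s) (ν := ν) (d := 0) (κ := -1) hP hs (by simp)
      (htpyT F δ s i w)
    rw [htpy_succ, htpy_succ, map_add, map_smul, h1, ih, htpyT_comm hl]
    module

end IsHtpy

end Homotopy

/-! ## Acyclicity -/

section Acyclic
variable {K : CochainComplex (ModuleCat.{0} ℂ) ℕ} {L : DGLie K}
variable {A A' : Type} [AddCommGroup A] [Module ℂ A] [AddCommGroup A'] [Module ℂ A']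
  {d : A →ₗ[ℂ] A} {a : Tot K →ₗ[ℂ] A →ₗ[ℂ] A} {s : Tot K →ₗ[ℂ] Tot K}

theorem headAct_eq_zero {P : Tot K →ₗ[ℂ] Tot K} {a : Tot K →ₗ[ℂ] A →ₗ[ℂ] A'}
    {c : Words (Tot K) ℂ →ₗ[ℂ] A} {k : ℕ}
    (h : ∀ j < k, ∀ t ∈ symWords P j, c t = 0) {w : Words (Tot K) ℂ}
    (hw : w ∈ symWords P k) : headAct a c w = 0 := by
  cases k with
  | zero => obtain ⟨t, rfl⟩ := hw; exact headAct_base _ _ _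
  | succ k =>
    refine symWords_ext (g := 0) (fun x t ht => ?_) hw
    rw [headAct_cons, h k (by omega) t ht, map_zero]; rfl

theorem headAct_eq_zero_of {P : Tot K →ₗ[ℂ] Tot K} {a : Tot K →ₗ[ℂ] A →ₗ[ℂ] A'}
    {c : Words (Tot K) ℂ →ₗ[ℂ] A} {m : ℕ}
    (h : ∀ t ∈ symUpTo P m, c t = 0) {w : Words (Tot K) ℂ}
    (hw : w ∈ symUpTo P m) : headAct a c w = 0 :=
  symUpTo_induction (p := LinearMap.ker (headAct a c)) (fun _ hk _ hw =>
    headAct_eq_zero (fun j hj t ht => h t (symWords_le (by omega) ht)) hw) hw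

theorem headAct_mapLetters (a : Tot K →ₗ[ℂ] A →ₗ[ℂ] A') (c : Words (Tot K) ℂ →ₗ[ℂ] A)
    (p : Tot K →ₗ[ℂ] Tot K) (w : Words (Tot K) ℂ) :
    headAct a c (mapLetters p w) = headAct (a ∘ₗ p) (c ∘ₗ mapLetters p) w := by
  have : headAct a c ∘ₗ mapLetters p = headAct (a ∘ₗ p) (c ∘ₗ mapLetters p) :=
    hom_ext (by simp) (by simp)
  exact LinearMap.congr_fun this w

theorem jacobiD_split (w : Words (Tot K) ℂ) : L.jacobiD w =
    der (parity K) (dTot K) 0 w + bra (parity K) L.half 0 w := by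
  rw [L.jacobiD_eq, L.wordD_eq]; simp

theorem bra_eq_zero_of {c : Words (Tot K) ℂ →ₗ[ℂ] A} {k : ℕ}
    (h : ∀ j < k, ∀ t ∈ symWords (parity K) j, c t = 0) {w : Words (Tot K) ℂ}
    (hw : w ∈ symWords (parity K) k) : c (bra (parity K) L.half 0 w) = 0 := by
  cases k with
  | zero => obtain ⟨t, rfl⟩ := hw; simp
  | succ k => exact h k (by omega) _ (bra_symWords parity_parity L.parity_half 0 k hw)

theorem der_mem {d : A →ₗ[ℂ] A} {k : ℕ} {w : Words (Tot K) A} (hw : w ∈ symWords (parity K) k) :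
    der (parity K) (dTot K) d w ∈ symWords (parity K) k :=
  derP_symWords parity_parity dTot_parity d hw

theorem cd_of_lower {c : Words (Tot K) ℂ →ₗ[ℂ] A} {k : ℕ} {ε : ℂ}
    (h : ∀ j < k, ∀ t ∈ symWords (parity K) j, c t = 0) {w : Words (Tot K) ℂ}
    (hw : w ∈ symWords (parity K) k) :
    L.cd ε d a c w = d (c w) - ε • c (der (parity K) (dTot K) 0 w) := by
  rw [L.cd_apply, headAct_eq_zero h hw, jacobiD_split, map_add, bra_eq_zero_of h hw]
  simp

theorem cd_lower {c : Words (Tot K) ℂ →ₗ[ℂ] A} {k : ℕ} {ε : ℂ}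
    (h : ∀ j < k, ∀ t ∈ symWords (parity K) j, c t = 0) {j : ℕ} (hj : j < k)
    {w : Words (Tot K) ℂ} (hw : w ∈ symWords (parity K) j) : L.cd ε d a c w = 0 := by
  rw [cd_of_lower (fun i hi t ht => h i (by omega) t ht) hw, h j hj w hw, h j hj _ (der_mem hw)]
  simp

variable (H : IsHtpy (parity K) (dTot K) s)
include H

/-- The correction in length `k`. -/
theorem htpy_step {ε : ℂ} (hε : ε = 1 ∨ ε = -1) {e : Words (Tot K) ℂ →ₗ[ℂ] A} {k : ℕ}
    (he : ∀ w ∈ symWords (parity K) k, L.cd ε d a e w = 0)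
    (h0 : ∀ j < k, ∀ w ∈ symWords (parity K) j, e w = 0) {w : Words (Tot K) ℂ}
    (hw : w ∈ symWords (parity K) k) :
    L.cd (-ε) d a (ε • e ∘ₗ htpy ℂ (parity K) (dTot K) s k ∘ₗ prlen k) w =
      e w - e (mapLetters (harm (dTot K) s) w) := by
  have hεε : ε * ε = 1 := by rcases hε with rfl | rfl <;> norm_num
  have hb : ∀ j < k, ∀ t ∈ symWords (parity K) j,
      (ε • e ∘ₗ htpy ℂ (parity K) (dTot K) s k ∘ₗ prlen k) t = 0 := fun j hj t ht => by
    simp [prlen_ne hj.ne' (symWords_le_lenWords _ _ ht)]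
  have hh := H.htpy_symWords (F := ℂ) k hw
  have h1 := he _ hh
  rw [cd_of_lower h0 hh, sub_eq_zero] at h1
  have h2 := H.htpy_eq (F := ℂ) 0 k w
  rw [H.htpyT_len le_rfl (symWords_le_lenWords _ _ hw)] at h2
  rw [cd_of_lower hb hw]
  simp only [LinearMap.smul_apply, LinearMap.comp_apply, map_smul,
    prlen_self (symWords_le_lenWords _ _ hw), prlen_self (symWords_le_lenWords _ _ (der_mem hw)), h1]
  rw [← map_sub, ← h2, map_add, smul_smul, neg_smul, smul_smul, hεε]
  simp

variable (hs : ∀ v, weight K (s v) = s (weight K v) - s v)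
include hs

theorem IsHtpy.weight_harm (v : Tot K) :
    weight K (harm (dTot K) s v) = harm (dTot K) s (weight K v) := by
  simp only [harm_apply, map_sub, map_add, weight_dTot, hs, one_smul]
  abel

theorem IsHtpy.weight_htpy (ν : A →ₗ[ℂ] A) (i : ℕ) (w : Words (Tot K) A) :
    derivWords (weight K) ν (htpy A (parity K) (dTot K) s i w) =
      htpy A (parity K) (dTot K) s i (derivWords (weight K) ν w) -
        htpy A (parity K) (dTot K) s i w :=
  H.htpy_deg weight_parity weight_dTot (fun v => by rw [hs]; module) ν i w

/-- A cocycle which vanishes on the harmonic words is the coboundary of a cochain which vanishes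
on the harmonic words. -/
theorem IsHtpy.exists_primitive (hL : L.IsRep d a) {ν : A →ₗ[ℂ] A} (hg : IsGraded ν d a) {m : ℕ}
    (hcl : ∀ w ∈ symUpTo (parity K) m, mapLetters (harm (dTot K) s) w = w →
      mapLetters (harm (dTot K) s) (L.jacobiD w) = L.jacobiD w)
    {ε : ℂ} (hε : ε = 1 ∨ ε = -1) {ρ : ℂ} {e : Words (Tot K) ℂ →ₗ[ℂ] A} (hde : HasDeg ν ρ e)
    (he : ∀ w ∈ symUpTo (parity K) m, L.cd ε d a e w = 0)
    (h0 : ∀ w ∈ symUpTo (parity K) m, mapLetters (harm (dTot K) s) w = w → e w = 0) :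
    ∃ b : Words (Tot K) ℂ →ₗ[ℂ] A, HasDeg ν (ρ - 1) b ∧
      (∀ w, b (mapLetters (harm (dTot K) s) w) = 0) ∧
      ∀ w ∈ symUpTo (parity K) m, e w = L.cd (-ε) d a b w := by
  have hε' : -ε = 1 ∨ -ε = -1 := by rcases hε with rfl | rfl <;> norm_num
  suffices key : ∀ n ≤ m + 1, ∃ b : Words (Tot K) ℂ →ₗ[ℂ] A, HasDeg ν (ρ - 1) b ∧
      (∀ w, b (mapLetters (harm (dTot K) s) w) = 0) ∧
      ∀ k < n, ∀ w ∈ symWords (parity K) k, e w = L.cd (-ε) d a b w by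
    obtain ⟨b, hb, hbQ, h⟩ := key (m + 1) le_rfl
    exact ⟨b, hb, hbQ, fun w hw => LinearMap.mem_eqLocus.1 (symUpTo_induction
      (p := LinearMap.eqLocus e (L.cd (-ε) d a b)) (fun k hk w hw => h k (by omega) w hw) hw)⟩
  intro n
  induction n with
  | zero => exact fun _ => ⟨0, by simp [HasDeg], by simp, by simp⟩
  | succ k ih =>
    intro hk
    obtain ⟨b, hb, hbQ, h⟩ := ih (by omega)
    set e' := e - L.cd (-ε) d a b with he'
    have h1 : ∀ w ∈ symWords (parity K) k, L.cd ε d a e' w = 0 := fun w hw => by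
      have h2 := hL.cd_cd hε' b (symWords_le (show k ≤ m by omega) hw)
      rw [neg_neg] at h2
      rw [he', map_sub, LinearMap.sub_apply, h2, he w (symWords_le (by omega) hw), sub_zero]
    have h2 : ∀ j < k, ∀ w ∈ symWords (parity K) j, e' w = 0 := fun j hj w hw => by
      rw [he', LinearMap.sub_apply, h j hj w hw, sub_self]
    have hd : HasDeg ν ρ e' := by
      have := hb.cd (L := L) hg (ε := -ε)
      rw [sub_add_cancel] at this
      rw [HasDeg] at this hde ⊢
      rw [he', LinearMap.comp_sub, LinearMap.sub_comp, this, hde, smul_sub]; abel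
    have h3 : ∀ w ∈ symWords (parity K) k, e' (mapLetters (harm (dTot K) s) w) = 0 := by
      intro w hw
      have hw' := symWords_le (show k ≤ m by omega) (H.Q_symWords hw)
      have h4 : L.cd (-ε) d a b (mapLetters (harm (dTot K) s) w) = 0 := by
        rw [L.cd_apply, hbQ, ← hcl _ hw' (H.Q_Q w), hbQ, headAct_mapLetters]
        have : b ∘ₗ mapLetters (harm (dTot K) s) = 0 := LinearMap.ext hbQ
        rw [this]; simp
      rw [he', LinearMap.sub_apply, h4, h0 _ hw' (H.Q_Q w), sub_self]
    refine ⟨b + ε • e' ∘ₗ htpy ℂ (parity K) (dTot K) s k ∘ₗ prlen k, ?_, ?_, ?_⟩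
    · have h5 : HasDeg ν (ρ - 1) (ε • e' ∘ₗ htpy ℂ (parity K) (dTot K) s k ∘ₗ prlen k) := by
        refine LinearMap.ext fun w => ?_
        have h6 := hd.apply (htpy ℂ (parity K) (dTot K) s k (prlen k w))
        have h7 := H.weight_htpy hs (0 : ℂ →ₗ[ℂ] ℂ) k (prlen k w)
        rw [← prlen_derivWords] at h7
        simp only [LinearMap.smul_apply, LinearMap.comp_apply, LinearMap.add_apply, map_smul]
        rw [h6, wordDeg, h7, map_sub]
        module
      rw [HasDeg] at hb h5 ⊢
      rw [LinearMap.comp_add, LinearMap.add_comp, hb, h5, smul_add]; abel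
    · intro w
      simp [hbQ, prlen_mapLetters, H.htpy_Q]
    · intro j hj w hw
      rw [map_add, LinearMap.add_apply]
      rcases Nat.lt_succ_iff_lt_or_eq.1 hj with hj | rfl
      · rw [← h j hj w hw, cd_lower (k := k) (fun i hi t ht => ?_) hj hw, add_zero]
        simp [prlen_ne hi.ne' (symWords_le_lenWords _ _ ht)]
      · rw [htpy_step H hε h1 h2 hw, h3 w hw, he', LinearMap.sub_apply]; abel

omit H hs in
theorem wordD_prlen_top {k : ℕ} {z : Words (Tot K) A} (hz : z ∈ symUpTo (parity K) k) :
    prlen k (L.wordD d a z) = der (parity K) (dTot K) d (prlen k z) := by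
  rw [L.wordD_eq, LinearMap.add_apply, map_add, prlen_der]
  have : prlen k (bra (parity K) L.half (a ∘ₗ parity K) z) = 0 := by
    cases k with
    | zero =>
      refine LinearMap.mem_ker.1 (symUpTo_induction (p := LinearMap.ker (prlen 0 ∘ₗ
        bra (parity K) L.half (a ∘ₗ parity K))) (fun j hj w hw => ?_) hz)
      obtain rfl : j = 0 := by omega
      obtain ⟨t, rfl⟩ := hw
      simp
    | succ k =>
      refine prlen_eq_zero (P := parity K) (m := k) (by omega) ?_
      exact symUpTo_induction (p := (symUpTo (parity K) k).comap
        (bra (parity K) L.half (a ∘ₗ parity K))) (fun j hj w hw => bra_symWords_le hj hw) hz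
  rw [this, add_zero]

/-- A symmetric word with harmonic differential is, up to a boundary, harmonic. -/
theorem IsHtpy.exists_harmonic (hL : L.IsRep d a) {ν : A →ₗ[ℂ] A} (hg : IsGraded ν d a) {m : ℕ}
    (hcl : ∀ w ∈ symUpTo (parity K) m, mapLetters (harm (dTot K) s) w = w →
      mapLetters (harm (dTot K) s) (L.wordD d a w) = L.wordD d a w) {ρ : ℂ}
    {z : Words (Tot K) A} (hz : z ∈ symUpTo (parity K) m)
    (hdz : derivWords (weight K) ν z = ρ • z)
    (hQ : mapLetters (harm (dTot K) s) (L.wordD d a z) = L.wordD d a z) :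
    ∃ u ∈ symUpTo (parity K) m, derivWords (weight K) ν u = (ρ - 1) • u ∧
      mapLetters (harm (dTot K) s) (z - L.wordD d a u) = z - L.wordD d a u := by
  suffices key : ∀ k ≤ m, ∀ z ∈ (symUpTo (parity K) k : Submodule ℂ (Words (Tot K) A)),
      derivWords (weight K) ν z = ρ • z →
      mapLetters (harm (dTot K) s) (L.wordD d a z) = L.wordD d a z →
      ∃ u ∈ symUpTo (parity K) m, derivWords (weight K) ν u = (ρ - 1) • u ∧
      mapLetters (harm (dTot K) s) (z - L.wordD d a u) = z - L.wordD d a u from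
    key m le_rfl z hz hdz hQ
  intro k
  induction k with
  | zero =>
    intro _ z hz _ _
    refine ⟨0, zero_mem _, by simp, ?_⟩
    have h1 := prlen_symUpTo hz 0
    have h2 := sum_prlen hz
    rw [zero_add, Finset.sum_range_one] at h2
    rw [h2] at h1
    obtain ⟨e, rfl⟩ := h1
    simp
  | succ k ih =>
    intro hk z hz hdz hQ
    set zk := prlen (k + 1) z with hzk
    set y := htpy A (parity K) (dTot K) s (k + 1) zk with hy
    have hzk' : zk ∈ symWords (parity K) (k + 1) := prlen_symUpTo hz _
    have hym : y ∈ symWords (parity K) (k + 1) := H.htpy_symWords _ hzk'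
    have hy' : y ∈ symUpTo (parity K) (k + 1) := symWords_le le_rfl hym
    have hQz : mapLetters (harm (dTot K) s) zk ∈ symUpTo (parity K) (k + 1) :=
      symWords_le le_rfl (H.Q_symWords hzk')
    have hdzk : derivWords (weight K) ν zk = ρ • zk := by
      rw [hzk, ← prlen_derivWords, hdz, map_smul]
    have hyd : derivWords (weight K) ν y = (ρ - 1) • y := by
      rw [hy, H.weight_htpy hs, hdzk, map_smul]; module
    have hz1 : z - mapLetters (harm (dTot K) s) zk - L.wordD d a y ∈
        symUpTo (parity K) (k + 1) := sub_mem (sub_mem hz hQz) (L.wordD_symUpTo hy')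
    have hDz : der (parity K) (dTot K) d zk = prlen (k + 1) (L.wordD d a z) :=
      (wordD_prlen_top hz).symm
    have hlen : ∀ w ∈ (symWords (parity K) (k + 1) : Submodule ℂ (Words (Tot K) A)),
        prlen (k + 1) w = w := fun w hw => prlen_self (symWords_le_lenWords _ _ hw)
    have h0 : prlen (k + 1) (z - mapLetters (harm (dTot K) s) zk - L.wordD d a y) = 0 := by
      rw [map_sub, map_sub, wordD_prlen_top hy', hlen y hym, hlen _ (H.Q_symWords hzk'), ← hzk]
      have h1 := H.htpy_eq (F := A) d (k + 1) zk
      rw [H.htpyT_len le_rfl (symWords_le_lenWords _ _ hzk'), ← hy, hDz, ← hQ, prlen_mapLetters,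
        H.htpy_Q, add_zero] at h1
      rw [h1]; abel
    have hD1 : L.wordD d a (z - mapLetters (harm (dTot K) s) zk - L.wordD d a y) =
        L.wordD d a z - L.wordD d a (mapLetters (harm (dTot K) s) zk) := by
      rw [map_sub, map_sub, hL.wordD_wordD hy', sub_zero]
    have hd1 : derivWords (weight K) ν (mapLetters (harm (dTot K) s) zk) =
        ρ • mapLetters (harm (dTot K) s) zk := by
      rw [derivWords_mapLetters ν (H.weight_harm hs), hdzk, map_smul]
    have hd2 : derivWords (weight K) ν (z - mapLetters (harm (dTot K) s) zk - L.wordD d a y) =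
        ρ • (z - mapLetters (harm (dTot K) s) zk - L.wordD d a y) := by
      rw [map_sub, map_sub, hdz, hd1, hg.wordD, hyd, map_smul]
      module
    obtain ⟨u, hu, hud, huQ⟩ := ih (by omega) _ (symUpTo_of_prlen hz1 h0) hd2
      (by rw [hD1, map_sub, hQ, hcl _ (symUpTo_mono hk hQz) (H.Q_Q zk)])
    refine ⟨u + y, add_mem hu (symUpTo_mono hk hy'), ?_, ?_⟩
    · rw [map_add, hud, hyd, smul_add]
    · have h2 : z - L.wordD d a (u + y) = mapLetters (harm (dTot K) s) zk +
          (z - mapLetters (harm (dTot K) s) zk - L.wordD d a y - L.wordD d a u) := by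
        rw [map_add]; abel
      rw [h2, map_add, huQ, H.Q_Q]

end Acyclic

/-! ### Gradings by eigenspaces -/

section Graded
variable {W A : Type} [AddCommGroup W] [Module ℂ W] [AddCommGroup A] [Module ℂ A]

/-- The operator `N` is diagonalizable with integral eigenvalues. -/
def IsDeg (N : W →ₗ[ℂ] W) : Prop := ⨆ n : ℤ, Module.End.eigenspace N (n : ℂ) = ⊤

variable {N : W →ₗ[ℂ] W}

theorem eigenspaces_indep (N : W →ₗ[ℂ] W) :
    iSupIndep fun n : ℤ => Module.End.eigenspace N (n : ℂ) :=
  (Module.End.eigenspaces_iSupIndep (f := N)).comp (f := fun n : ℤ => (n : ℂ)) Int.cast_injective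

theorem IsDeg.ext (hN : IsDeg N) {f g : W →ₗ[ℂ] A}
    (h : ∀ n : ℤ, ∀ w, N w = (n : ℂ) • w → f w = g w) : f = g := by
  have : (⨆ n : ℤ, Module.End.eigenspace N (n : ℂ)) ≤ LinearMap.eqLocus f g :=
    iSup_le fun n w hw => h n w (Module.End.mem_eigenspace_iff.1 hw)
  rw [IsDeg] at hN
  exact LinearMap.ext fun w => this (hN ▸ Submodule.mem_top : w ∈ _)

theorem IsDeg.exists_glue (hN : IsDeg N) (c : ℤ → W →ₗ[ℂ] A) :
    ∃ g : W →ₗ[ℂ] A, ∀ n : ℤ, ∀ w, N w = (n : ℂ) • w → g w = c n w := by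
  have hI := DirectSum.isInternal_submodule_of_iSupIndep_of_iSup_eq_top (eigenspaces_indep N) hN
  let e := LinearEquiv.ofBijective (DirectSum.coeLinearMap fun n : ℤ =>
    Module.End.eigenspace N (n : ℂ)) hI
  refine ⟨DirectSum.toModule ℂ ℤ A (fun n => c n ∘ₗ Submodule.subtype _) ∘ₗ e.symm.toLinearMap,
    fun n w hw => ?_⟩
  have : e.symm w = DirectSum.lof ℂ ℤ (fun n : ℤ => Module.End.eigenspace N (n : ℂ)) n
      ⟨w, Module.End.mem_eigenspace_iff.2 hw⟩ := by
    rw [LinearEquiv.symm_apply_eq]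
    exact (DirectSum.coeLinearMap_lof (fun n : ℤ => Module.End.eigenspace N (n : ℂ))
      (i := n) ⟨w, _⟩).symm
  simp [this]

theorem mem_of_sum_eigen {S : Submodule ℂ W} (hS : ∀ w ∈ S, N w ∈ S) (t : Finset ℤ)
    {x : ℤ → W} (hx : ∀ i ∈ t, N (x i) = (i : ℂ) • x i) (h : ∑ i ∈ t, x i ∈ S) :
    ∀ i ∈ t, x i ∈ S := by
  induction t using Finset.induction_on generalizing x with
  | empty => simp
  | insert j t hj ih =>
    have h1 : ∑ i ∈ t, ((i : ℂ) - j) • x i ∈ S := by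
      have h2 : N (∑ i ∈ insert j t, x i) - (j : ℂ) • ∑ i ∈ insert j t, x i ∈ S :=
        sub_mem (hS _ h) (S.smul_mem _ h)
      convert h2 using 1
      rw [map_sum, Finset.smul_sum, ← Finset.sum_sub_distrib, Finset.sum_insert hj,
        hx j (Finset.mem_insert_self _ _), sub_self, zero_add]
      exact Finset.sum_congr rfl fun i hi => by
        rw [hx i (Finset.mem_insert_of_mem hi), sub_smul]
    have h3 : ∀ i ∈ t, x i ∈ S := fun i hi => by
      have h4 := ih (x := fun i => ((i : ℂ) - j) • x i) (fun i hi => by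
        rw [map_smul, hx i (Finset.mem_insert_of_mem hi), smul_comm]) h1 i hi
      have h5 : ((i : ℂ) - j) ≠ 0 := by
        rw [sub_ne_zero]
        exact_mod_cast fun h : i = j => hj (h ▸ hi)
      exact (Submodule.smul_mem_iff S h5).1 h4
    intro i hi
    rcases Finset.mem_insert.1 hi with rfl | hi
    · rw [Finset.sum_insert hj] at h
      exact (Submodule.add_mem_iff_left S (sum_mem h3)).1 h
    · exact h3 i hi

theorem IsDeg.induction_stable (hN : IsDeg N) {S : Submodule ℂ W} (hS : ∀ w ∈ S, N w ∈ S)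
    {T : Submodule ℂ W} (h : ∀ n : ℤ, ∀ w ∈ S, N w = (n : ℂ) • w → w ∈ T) {w : W} (hw : w ∈ S) :
    w ∈ T := by
  have hI := DirectSum.isInternal_submodule_of_iSupIndep_of_iSup_eq_top (eigenspaces_indep N) hN
  obtain ⟨x, rfl⟩ := hI.2 w
  classical
  have hx : (DirectSum.coeAddMonoidHom fun n : ℤ => Module.End.eigenspace N (n : ℂ)) x =
      ∑ i ∈ DFinsupp.support x, (x i : W) := DirectSum.coeAddMonoidHom_eq_dfinsuppSum _ x
  have h1 : ∀ i, N (x i : W) = (i : ℂ) • (x i : W) := fun i =>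
    Module.End.mem_eigenspace_iff.1 (x i).2
  rw [hx] at hw ⊢
  exact sum_mem fun i hi => h i _ (mem_of_sum_eigen hS _ (fun i _ => h1 i) hw i hi) (h1 i)

/-- A sum of eigenvectors for eigenvalues different from that of the sum vanishes. -/
theorem eq_zero_of_eigen {n : ℤ} {s : Set ℤ} (hn : n ∉ s) {w : W} (hw : N w = (n : ℂ) • w)
    (h : w ∈ ⨆ j ∈ s, Module.End.eigenspace N (j : ℂ)) : w = 0 := by
  have h1 := (eigenspaces_indep N) n
  refine (Submodule.disjoint_def.1 h1) w (Module.End.mem_eigenspace_iff.2 hw) ?_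
  exact (iSup₂_le fun j hj => le_iSup₂_of_le j (fun h => hn (h ▸ hj)) le_rfl :
    (⨆ j ∈ s, Module.End.eigenspace N (j : ℂ)) ≤ ⨆ j, ⨆ (_ : j ≠ n), _) h

end Graded

section WordsGraded
variable {K : CochainComplex (ModuleCat.{0} ℂ) ℕ} {F : Type} [AddCommGroup F] [Module ℂ F]

theorem eigen_cons {ν : F →ₗ[ℂ] F} (i : ℕ) (x : K.X i) {w : Words (Tot K) F} {n : ℤ}
    (hw : derivWords (weight K) ν w = (n : ℂ) • w) :
    derivWords (weight K) ν (cons (hom K i x) w) =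
      ((i - 1 + n : ℤ) : ℂ) • cons (hom K i x) w := by
  rw [derivWords_cons, hw, weight_hom]
  simp only [map_smul, LinearMap.smul_apply, ← add_smul]
  push_cast
  rfl

theorem isDeg_words {ν : F →ₗ[ℂ] F} (hν : IsDeg ν) :
    IsDeg (derivWords (weight K) ν) := by
  rw [IsDeg, eq_top_iff]
  rintro w -
  refine words_induction (fun e => ?_) (fun v w hw => ?_) (zero_mem _)
    (fun x y hx hy => add_mem hx hy) w
  · rw [IsDeg, eq_top_iff] at hν
    have : (⨆ n : ℤ, Module.End.eigenspace ν (n : ℂ)) ≤ (⨆ n : ℤ, Module.End.eigenspace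
        (derivWords (weight K) ν) (n : ℂ)).comap base := by
      refine iSup_le fun n e he => Submodule.mem_iSup_of_mem n ?_
      rw [Module.End.mem_eigenspace_iff] at he ⊢
      rw [derivWords_base, he, map_smul]
    exact this (hν trivial)
  · refine tot_induction (p := fun v => cons v w ∈ ⨆ n : ℤ, Module.End.eigenspace
      (derivWords (weight K) ν) (n : ℂ)) (fun i x => ?_) (fun x y hx hy => ?_) v
    · have : (⨆ n : ℤ, Module.End.eigenspace (derivWords (weight K) ν) (n : ℂ)) ≤
        (⨆ n : ℤ, Module.End.eigenspace
        (derivWords (weight K) ν) (n : ℂ)).comap (cons (hom K i x)) := by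
        refine iSup_le fun n e he => Submodule.mem_iSup_of_mem (i - 1 + n : ℤ) ?_
        rw [Module.End.mem_eigenspace_iff] at he ⊢
        exact eigen_cons i x he
      exact this hw
    · rw [map_add]; exact add_mem hx hy

theorem isDeg_zero : IsDeg (0 : F →ₗ[ℂ] F) := by
  rw [IsDeg, eq_top_iff]
  exact fun w _ => Submodule.mem_iSup_of_mem 0 (Module.End.mem_eigenspace_iff.2 (by simp))

theorem isDeg_wordDeg : IsDeg (wordDeg K) := isDeg_words isDeg_zero

/-- The nonnegative part of a grading: the vectors of degree `0`, which are fixed by `E`, and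
those of positive degree. -/
def nonneg (N E : F →ₗ[ℂ] F) : Submodule ℂ F :=
  (Module.End.eigenspace N (0 : ℂ) ⊓ LinearMap.ker (E - LinearMap.id)) ⊔
    ⨆ j ∈ {j : ℤ | 0 < j}, Module.End.eigenspace N (j : ℂ)

theorem eq_zero_of_nonneg {N E : F →ₗ[ℂ] F} {w : F} (h : w ∈ nonneg N E) {n : ℤ} (hn : n < 0)
    (hw : N w = (n : ℂ) • w) : w = 0 := by
  refine eq_zero_of_eigen (s := {j : ℤ | 0 ≤ j}) (n := n) (by simpa using hn) hw ?_
  have : nonneg N E ≤ ⨆ j ∈ {j : ℤ | 0 ≤ j}, Module.End.eigenspace N (j : ℂ) := by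
    refine sup_le (inf_le_left.trans ?_) (iSup₂_le fun j hj => ?_)
    · refine le_iSup₂_of_le 0 (by simp) (by simp)
    · exact le_iSup₂_of_le j (show 0 ≤ j from le_of_lt hj) le_rfl
  exact this h

theorem eq_self_of_nonneg {N E : F →ₗ[ℂ] F} {w : F} (h : w ∈ nonneg N E)
    (hw : N w = 0) : E w = w := by
  obtain ⟨x, hx, y, hy, rfl⟩ := Submodule.mem_sup.1 h
  have h1 : N x = 0 := by simpa using hx.1
  have h2 : y = 0 := by
    refine eq_zero_of_eigen (n := 0) (by simp) ?_ hy
    rw [map_add, h1, zero_add] at hw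
    simp [hw]
  have h3 : E x - x = 0 := hx.2
  rw [h2, add_zero]; exact sub_eq_zero.1 h3

theorem nonneg_of_degree (M : CochainComplex (ModuleCat.{0} ℂ) ℕ) (e : Tot M) :
    e ∈ nonneg (degree M) (part M 0) := by
  refine tot_induction (fun i x => ?_) (fun x y hx hy => add_mem hx hy) e
  rcases Nat.eq_zero_or_pos i with rfl | hi
  · refine Submodule.mem_sup_left ⟨Module.End.mem_eigenspace_iff.2 (by simp [degree]), ?_⟩
    simp [part]
  · refine Submodule.mem_sup_right (Submodule.mem_iSup_of_mem i (Submodule.mem_iSup_of_mem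
      (by simpa using hi) (Module.End.mem_eigenspace_iff.2 (by simp [degree]))))

theorem nonneg_of_zero (e : F) : e ∈ nonneg (0 : F →ₗ[ℂ] F) LinearMap.id :=
  Submodule.mem_sup_left ⟨Module.End.mem_eigenspace_iff.2 (by simp), by simp⟩

/-- Words in letters of positive degree, with coefficients of nonnegative degree. -/
theorem nonneg_words {p : Tot K →ₗ[ℂ] Tot K} (hp : ∀ v, part K 0 (p v) = 0) {ν E : F →ₗ[ℂ] F}
    (hν : ∀ e, e ∈ nonneg ν E) (w : Words (Tot K) F) : mapLetters p w ∈
      nonneg (derivWords (weight K) ν) (mapCoeff E ∘ₗ mapLetters (part K 1)) := by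
  set N := nonneg (derivWords (weight K) ν) (mapCoeff E ∘ₗ mapLetters (part K 1))
  have hc : ∀ i (x : K.X i), i ≠ 0 → N ≤ N.comap (cons (hom K i x)) := by
    intro i x hi
    refine sup_le ?_ (iSup₂_le fun j hj w hw => ?_)
    · rintro w ⟨h1, h2⟩
      have h1 := Module.End.mem_eigenspace_iff.1 h1
      have h4 := eigen_cons (w := w) (ν := ν) i x (n := 0) (by simpa using h1)
      by_cases hi1 : i = 1
      · refine Submodule.mem_sup_left ⟨Module.End.mem_eigenspace_iff.2 ?_, ?_⟩
        · rw [h4]; simp [hi1]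
        · have h2 : mapCoeff E (mapLetters (part K 1) w) - w = 0 := h2
          rw [SetLike.mem_coe, LinearMap.mem_ker, LinearMap.sub_apply, LinearMap.comp_apply, mapLetters_cons,
            mapCoeff_cons, sub_eq_zero.1 h2]
          simp [part, hi1]
      · refine Submodule.mem_sup_right (Submodule.mem_iSup_of_mem (i - 1 + 0 : ℤ)
          (Submodule.mem_iSup_of_mem (by simp; omega) (Module.End.mem_eigenspace_iff.2 h4)))
    · refine Submodule.mem_sup_right (Submodule.mem_iSup_of_mem (i - 1 + j : ℤ)
        (Submodule.mem_iSup_of_mem ?_ (Module.End.mem_eigenspace_iff.2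
          (eigen_cons i x (Module.End.mem_eigenspace_iff.1 hw)))))
      have : 0 < j := hj
      simp; omega
  refine words_induction (p := fun w => mapLetters p w ∈ N) (fun e => ?_) (fun v w hw => ?_)
    (by simp) (fun x y hx hy => by rw [map_add]; exact add_mem hx hy) w
  · have : nonneg ν E ≤ N.comap base := by
      refine sup_le ?_ (iSup₂_le fun j hj e he => ?_)
      · rintro e ⟨h1, h2⟩
        have h1 := Module.End.mem_eigenspace_iff.1 h1
        have h2 : E e - e = 0 := h2
        refine Submodule.mem_sup_left ⟨Module.End.mem_eigenspace_iff.2 ?_, ?_⟩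
        · rw [derivWords_base, h1]; simp
        · simp [mapCoeff_base, sub_eq_zero.1 h2]
      · refine Submodule.mem_sup_right (Submodule.mem_iSup_of_mem j
          (Submodule.mem_iSup_of_mem hj (Module.End.mem_eigenspace_iff.2 ?_)))
        rw [derivWords_base, Module.End.mem_eigenspace_iff.1 he, map_smul]
    rw [mapLetters_base]
    exact this (hν e)
  · rw [mapLetters_cons]
    have h0 := hp v
    generalize p v = u at h0
    have h1 : u = u - part K 0 u := by rw [h0, sub_zero]
    rw [h1]
    refine tot_induction (p := fun u => cons (u - part K 0 u) (mapLetters p w) ∈ N)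
      (fun i x => ?_) (fun x y hx hy => ?_) u
    · by_cases hi : i = 0
      · simp [part, hi]
      · simp only [part, scale_hom, if_neg hi, zero_smul, sub_zero]
        exact hc i x hi hw
    · have : x + y - part K 0 (x + y) = (x - part K 0 x) + (y - part K 0 y) := by
        rw [map_add]; abel
      rw [this, map_add]; exact add_mem hx hy

end WordsGraded

/-! ## Hodge decomposition of a complex of vector spaces -/

section Contraction
variable {K : CochainComplex (ModuleCat.{0} ℂ) ℕ}

variable (K) in
/-- A contraction of the complex `K` onto a complex with zero differential of finite total
dimension without part of degree `0`. -/
structure Contraction where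
  /-- the contracting homotopy -/
  s : Tot K →ₗ[ℂ] Tot K
  isHtpy : IsHtpy (parity K) (dTot K) s
  s_zero : ∀ x, s (hom K 0 x) = 0
  s_mem : ∀ i (x : K.X (i + 1)), s (hom K (i + 1) x) ∈ LinearMap.range (hom K i)
  fin : (LinearMap.range (harm (dTot K) s)).FG
  harm_zero : ∀ x, harm (dTot K) s (hom K 0 x) = 0
  harm_closed : ∀ v, harm (dTot K) s (dTot K v) = 0

/-- The operator on the direct sum given by operators of degree `-1`. -/
def lowerTot (σ : ∀ i, K.X (i + 1) →ₗ[ℂ] K.X i) : Tot K →ₗ[ℂ] Tot K :=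
  DirectSum.toModule ℂ ℕ (Tot K) fun i => match i with
    | 0 => 0
    | i + 1 => hom K i ∘ₗ σ i

@[simp] theorem lowerTot_zero (σ : ∀ i, K.X (i + 1) →ₗ[ℂ] K.X i) (x : K.X 0) :
    lowerTot σ (hom K 0 x) = 0 := by
  simp only [lowerTot, hom]
  rw [DirectSum.toModule_lof]; rfl

@[simp] theorem lowerTot_succ (σ : ∀ i, K.X (i + 1) →ₗ[ℂ] K.X i) (i : ℕ) (x : K.X (i + 1)) :
    lowerTot σ (hom K (i + 1) x) = hom K i (σ i x) := by
  simp only [lowerTot, hom]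
  rw [DirectSum.toModule_lof]; rfl

theorem exists_proj {U : Type} [AddCommGroup U] [Module ℂ U] (Z : Submodule ℂ U) :
    ∃ r : U →ₗ[ℂ] U, (∀ x, r x ∈ Z) ∧ ∀ x ∈ Z, r x = x := by
  obtain ⟨p, hp⟩ := Z.subtype.exists_leftInverse_of_injective (by simp)
  exact ⟨Z.subtype ∘ₗ p, fun x => (p x).2, fun x hx =>
    congrArg Subtype.val (LinearMap.congr_fun hp ⟨x, hx⟩)⟩

theorem exists_section {U W : Type} [AddCommGroup U] [Module ℂ U] [AddCommGroup W] [Module ℂ W]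
    (f : U →ₗ[ℂ] W) : ∃ σ : W →ₗ[ℂ] U, ∀ x, f (σ (f x)) = f x := by
  obtain ⟨g, hg⟩ := f.rangeRestrict.exists_rightInverse_of_surjective f.range_rangeRestrict
  obtain ⟨σ, hσ⟩ := LinearMap.exists_extend g
  refine ⟨σ, fun x => ?_⟩
  have h1 : σ (f x) = g ⟨f x, x, rfl⟩ := LinearMap.congr_fun hσ ⟨f x, x, rfl⟩
  rw [h1]
  exact congrArg Subtype.val (LinearMap.congr_fun hg ⟨f x, x, rfl⟩)

theorem d_d_apply (i : ℕ) (x : K.X i) :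
    (K.d (i + 1) (i + 1 + 1)).hom ((K.d i (i + 1)).hom x) = 0 :=
  congrArg (fun g => g.hom x) (K.d_comp_d i (i + 1) (i + 1 + 1))

theorem exists_contraction (h0 : ∀ x : K.X 0, (K.d 0 1).hom x = 0 → x = 0)
    (hfin : ∀ i, ∃ W : Submodule ℂ (K.X (i + 1)), W.FG ∧
      LinearMap.ker (K.d (i + 1) (i + 1 + 1)).hom ≤ W ⊔ LinearMap.range (K.d i (i + 1)).hom)
    (hvan : ∃ n, ∀ i ≥ n,
      LinearMap.ker (K.d (i + 1) (i + 1 + 1)).hom ≤ LinearMap.range (K.d i (i + 1)).hom) :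
    Nonempty (Contraction K) := by
  choose r hr1 hr2 using fun i => exists_proj (LinearMap.ker (K.d i (i + 1)).hom)
  choose q hq1 hq2 using fun i => exists_proj (LinearMap.range (K.d i (i + 1)).hom)
  choose σ hσ using fun i => exists_section (K.d i (i + 1)).hom
  have hdr : ∀ i x, (K.d i (i + 1)).hom (r i x) = 0 := fun i x => hr1 i x
  have hrd : ∀ i x, r (i + 1) ((K.d i (i + 1)).hom x) = (K.d i (i + 1)).hom x := fun i x =>
    hr2 _ _ (d_d_apply i x)
  have hrq : ∀ i x, r (i + 1) (q i x) = q i x := fun i x => by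
    obtain ⟨y, hy⟩ := hq1 i x
    rw [← hy, hrd]
  let τ : ∀ i, K.X (i + 1) →ₗ[ℂ] K.X i := fun i =>
    (LinearMap.id - r i) ∘ₗ σ i ∘ₗ q i ∘ₗ r (i + 1)
  have hrr : ∀ i x, r i (r i x) = r i x := fun i x => hr2 _ _ (hr1 i x)
  have hτr : ∀ i x, r i (τ i x) = 0 := fun i x => by simp [τ, hrr]
  have hττ : ∀ i x, τ i (τ (i + 1) x) = 0 := fun i x => by
    have : τ i (τ (i + 1) x) = (LinearMap.id - r i : K.X i →ₗ[ℂ] K.X i)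
      (σ i (q i (r (i + 1) (τ (i + 1) x)))) := rfl
    rw [this, hτr]; simp
  have hdτ : ∀ i x, (K.d i (i + 1)).hom (τ i x) = q i (r (i + 1) x) := fun i x => by
    obtain ⟨y, hy⟩ := hq1 i (r (i + 1) x)
    simp only [τ, LinearMap.comp_apply, LinearMap.sub_apply, LinearMap.id_apply, map_sub, hdr,
      sub_zero]
    rw [← hy, hσ]
  have hτd : ∀ i x, τ i ((K.d i (i + 1)).hom x) = x - r i x := fun i x => by
    have h1 : σ i ((K.d i (i + 1)).hom x) - x ∈ LinearMap.ker (K.d i (i + 1)).hom := by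
      rw [LinearMap.mem_ker, map_sub, hσ, sub_self]
    have h2 := hr2 i _ h1
    simp only [τ, LinearMap.comp_apply, LinearMap.sub_apply, LinearMap.id_apply, hrd,
      hq2 i _ ⟨x, rfl⟩]
    rw [map_sub] at h2
    have h3 := congrArg (fun y => y + r i x) h2
    simp only [sub_add_cancel] at h3
    rw [h3]; abel
  set s := lowerTot τ
  have harm_s : ∀ i (x : K.X (i + 1)), harm (dTot K) s (hom K (i + 1) x) =
      hom K (i + 1) (r (i + 1) x - q i (r (i + 1) x)) := fun i x => by
    simp only [harm_apply, s, lowerTot_succ, dTot_hom, hdτ, hτd]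
    rw [← map_add, ← map_sub]
    congr 1
    abel
  have harm_0 : ∀ x : K.X 0, harm (dTot K) s (hom K 0 x) = 0 := fun x => by
    have h1 : r 0 x = 0 := h0 _ (hdr 0 x)
    simp only [harm_apply, s, lowerTot_succ, dTot_hom, lowerTot_zero, hτd, h1]
    simp
  have harm_dTot : ∀ v, harm (dTot K) s (dTot K v) = 0 := fun v => by
    refine tot_induction (p := fun v => harm (dTot K) s (dTot K v) = 0) (fun i x => ?_)
      (fun x y hx hy => by simp only [map_add, hx, hy, add_zero]) v
    rw [dTot_hom, harm_s, hrd, hq2 i _ ⟨x, rfl⟩, sub_self, map_zero]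
  refine ⟨⟨s, ⟨parity_parity, fun v => ?_, fun v => ?_, dTot_dTot, fun v => ?_, fun v => ?_⟩,
    fun x => ?_, fun i x => ?_, ?_, harm_0, harm_dTot⟩⟩
  · rw [parity_dTot, neg_neg]
  · refine tot_induction (p := fun v => s (parity K v) = -parity K (s v)) (fun i x => ?_)
      (fun x y hx hy => by simp only [map_add, hx, hy, neg_add]) v
    cases i with
    | zero => simp [s, parity]
    | succ i => simp [s, parity, pow_succ]
  · refine tot_induction (p := fun v => s (s v) = 0) (fun i x => ?_)
      (fun x y hx hy => by simp only [map_add, hx, hy, add_zero]) v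
    match i with
    | 0 => simp [s]
    | 1 => simp [s]
    | i + 2 => simp [s, hττ]
  · refine tot_induction (p := fun v => s (dTot K (s v)) = s v) (fun i x => ?_)
      (fun x y hx hy => by simp only [map_add, hx, hy]) v
    cases i with
    | zero => simp [s]
    | succ i => simp only [s, lowerTot_succ, dTot_hom, hτd, hτr, sub_zero]
  · simp [s]
  · simp [s]
  · obtain ⟨n, hn⟩ := hvan
    choose W hW hWle using hfin
    have hle : LinearMap.range (harm (dTot K) s) ≤
        ⨆ i ∈ Finset.range n, (W i).map (harm (dTot K) s ∘ₗ hom K (i + 1)) := by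
      rintro _ ⟨v, rfl⟩
      refine tot_induction (p := fun v => harm (dTot K) s v ∈ _) (fun i x => ?_)
        (fun x y hx hy => by rw [map_add]; exact add_mem hx hy) v
      cases i with
      | zero => rw [harm_0]; exact zero_mem _
      | succ i =>
        have h1 : harm (dTot K) s (hom K (i + 1) x) =
            harm (dTot K) s (hom K (i + 1) (r (i + 1) x)) := by
          rw [harm_s, harm_s, hrr]
        have hB : ∀ y, harm (dTot K) s (hom K (i + 1) ((K.d i (i + 1)).hom y)) = 0 := fun y => by
          rw [harm_s, hrd, hq2 i _ ⟨y, rfl⟩, sub_self, map_zero]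
        rw [h1]
        by_cases hi : i < n
        · obtain ⟨y, hy, z, hz, hyz⟩ := Submodule.mem_sup.1 (hWle i (hr1 (i + 1) x))
          obtain ⟨z, rfl⟩ := hz
          rw [← hyz, map_add, map_add, hB, add_zero]
          exact Submodule.mem_iSup_of_mem i (Submodule.mem_iSup_of_mem (Finset.mem_range.2 hi)
            ⟨y, hy, rfl⟩)
        · obtain ⟨z, hz⟩ := hn i (by omega) (hr1 (i + 1) x)
          rw [← hz, hB]; exact zero_mem _
    have hfg : (⨆ i ∈ Finset.range n,
        (W i).map (harm (dTot K) s ∘ₗ hom K (i + 1))).FG :=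
      Submodule.fg_biSup _ _ fun i _ => (hW i).map _
    have := Module.Finite.iff_fg.2 hfg
    exact Module.Finite.iff_fg.1 (Submodule.finiteDimensional_of_le hle)

namespace Contraction
variable (T : Contraction K)

/-- The homotopy in degree `1` only. -/
def t : Tot K →ₗ[ℂ] Tot K := T.s ∘ₗ part K 1

theorem weight_s (v : Tot K) : weight K (T.s v) = T.s (weight K v) - T.s v := by
  refine tot_induction (p := fun v => weight K (T.s v) = T.s (weight K v) - T.s v) (fun i x => ?_)
    (fun x y hx hy => by simp only [map_add, hx, hy]; abel) v
  cases i with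
  | zero => simp [weight_hom, T.s_zero]
  | succ i =>
    obtain ⟨y, hy⟩ := T.s_mem i x
    simp only [weight_hom, map_smul, ← hy]
    push_cast
    module

theorem t_one (x : K.X 1) : T.t (hom K 1 x) = T.s (hom K 1 x) := by simp [t, part]

theorem t_ne {i : ℕ} (hi : i ≠ 1) (x : K.X i) : T.t (hom K i x) = 0 := by simp [t, part, hi]

theorem t_isHtpy : IsHtpy (parity K) (dTot K) T.t where
  PP := parity_parity
  dP := T.isHtpy.dP
  sP v := by
    have : part K 1 (parity K v) = parity K (part K 1 v) := scale_comm _ _ _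
    simp only [t, LinearMap.comp_apply, this, T.isHtpy.sP]
  dd := dTot_dTot
  ss v := by
    refine tot_induction (p := fun v => T.t (T.t v) = 0) (fun i x => ?_)
      (fun x y hx hy => by simp only [map_add, hx, hy, add_zero]) v
    by_cases hi : i = 1
    · subst hi
      obtain ⟨y, hy⟩ := T.s_mem 0 x
      rw [t_one, ← hy, T.t_ne (by omega)]
    · rw [T.t_ne hi, map_zero]
  sds v := by
    refine tot_induction (p := fun v => T.t (dTot K (T.t v)) = T.t v) (fun i x => ?_)
      (fun x y hx hy => by simp only [map_add, hx, hy]) v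
    by_cases hi : i = 1
    · subst hi
      have h := T.isHtpy.sds (hom K 1 x)
      obtain ⟨y, hy⟩ := T.s_mem 0 x
      rw [t_one, ← hy, dTot_hom, T.t_one, ← dTot_hom, hy, h]
    · rw [T.t_ne hi, map_zero, map_zero]

theorem t_weight (v : Tot K) : weight K (T.t v) = T.t (weight K v) - T.t v := by
  have : part K 1 (weight K v) = weight K (part K 1 v) := scale_comm _ _ _
  simp only [t, LinearMap.comp_apply, this, T.weight_s]

/-- The projection to the subcomplex of `K` obtained by splitting off the part of degree `0` and
its differential. -/
def pr : Tot K →ₗ[ℂ] Tot K := harm (dTot K) T.t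

theorem pr_zero (x : K.X 0) : T.pr (hom K 0 x) = 0 := by
  have h := T.harm_zero x
  rw [harm_apply, T.s_zero, dTot_hom] at h
  rw [pr, harm_apply, T.t_ne (by omega), dTot_hom, T.t_one, h]

theorem pr_of_two_le {i : ℕ} (hi : 2 ≤ i) (x : K.X i) : T.pr (hom K i x) = hom K i x := by
  rw [pr, harm_apply, T.t_ne (by omega), dTot_hom, T.t_ne (by omega)]
  simp

theorem pr_one (x : K.X 1) : T.pr (hom K 1 x) = hom K 1 x - dTot K (T.s (hom K 1 x)) := by
  rw [pr, harm_apply, T.t_one, dTot_hom, T.t_ne (by omega), add_zero]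

theorem part_zero_pr (v : Tot K) : part K 0 (T.pr v) = 0 := by
  refine tot_induction (p := fun v => part K 0 (T.pr v) = 0) (fun i x => ?_)
    (fun x y hx hy => by simp only [map_add, hx, hy, add_zero]) v
  match i with
  | 0 => rw [T.pr_zero, map_zero]
  | 1 =>
    obtain ⟨y, hy⟩ := T.s_mem 0 x
    rw [T.pr_one, ← hy, dTot_hom]
    simp [part]
  | i + 2 => rw [T.pr_of_two_le (by omega)]; simp [part]

theorem pr_pr (v : Tot K) : T.pr (T.pr v) = T.pr v := T.t_isHtpy.harm_harm v

theorem pr_parity (v : Tot K) : T.pr (parity K v) = parity K (T.pr v) := T.t_isHtpy.harm_P v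

theorem pr_dTot (v : Tot K) : T.pr (dTot K v) = dTot K (T.pr v) := T.t_isHtpy.harm_d v

theorem weight_pr (v : Tot K) : weight K (T.pr v) = T.pr (weight K v) :=
  T.t_isHtpy.weight_harm T.t_weight v

/-- The projection is the identity on elements without parts of degree `0` and `1`. -/
theorem pr_half (L : DGLie K) (x y : Tot K) :
    T.pr (L.half (T.pr x) (T.pr y)) = L.half (T.pr x) (T.pr y) := by
  have key : ∀ x y : Tot K, T.pr (L.half (x - part K 0 x) (y - part K 0 y)) =
      L.half (x - part K 0 x) (y - part K 0 y) := by
    intro x y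
    refine tot_induction (p := fun x => T.pr (L.half (x - part K 0 x) (y - part K 0 y)) =
      L.half (x - part K 0 x) (y - part K 0 y)) (fun i x => ?_) (fun x x' hx hx' => ?_) x
    · refine tot_induction (p := fun y => T.pr (L.half (hom K i x - part K 0 (hom K i x))
        (y - part K 0 y)) = L.half (hom K i x - part K 0 (hom K i x)) (y - part K 0 y))
        (fun j y => ?_) (fun y y' hy hy' => ?_) y
      · by_cases hi : i = 0
        · simp [part, hi]
        by_cases hj : j = 0
        · simp [part, hj]
        obtain ⟨z, hz⟩ := L.br_deg i j x y
        simp only [part, scale_hom, if_neg hi, if_neg hj, zero_smul, sub_zero, DGLie.half,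
          LinearMap.smul_apply, LinearMap.comp_apply, parity, map_smul, ← hz,
          T.pr_of_two_le (show 2 ≤ i + j by omega)]
      · have : y + y' - part K 0 (y + y') = (y - part K 0 y) + (y' - part K 0 y') := by
          rw [map_add]; abel
        rw [this, map_add, map_add, hy, hy']
    · have : x + x' - part K 0 (x + x') = (x - part K 0 x) + (x' - part K 0 x') := by
        rw [map_add]; abel
      rw [this, map_add, LinearMap.add_apply, map_add, hx, hx']
  have h := key (T.pr x) (T.pr y)
  rwa [T.part_zero_pr, T.part_zero_pr, sub_zero, sub_zero] at h

variable {A : Type} [AddCommGroup A] [Module ℂ A]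

/-- The words in letters of the subcomplex are stable under the differential. -/
theorem pr_wordD {L : DGLie K} (d : A →ₗ[ℂ] A) (a : Tot K →ₗ[ℂ] A →ₗ[ℂ] A)
    {w : Words (Tot K) A} (hw : mapLetters T.pr w = w) :
    mapLetters T.pr (L.wordD d a w) = L.wordD d a w := by
  have hc : ∀ v (w : Words (Tot K) A), mapLetters T.pr (combine L.half (a ∘ₗ parity K) (T.pr v)
      (mapLetters T.pr w)) = combine L.half (a ∘ₗ parity K) (T.pr v) (mapLetters T.pr w) := by
    intro v w
    have : mapLetters T.pr ∘ₗ combine L.half (a ∘ₗ parity K) (T.pr v) ∘ₗ mapLetters T.pr =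
        combine L.half (a ∘ₗ parity K) (T.pr v) ∘ₗ mapLetters T.pr :=
      hom_ext (fun e => by simp) (fun u w _ => by
        simp only [LinearMap.comp_apply, mapLetters_cons, combine_cons, T.pr_half,
          show mapLetters T.pr (mapLetters T.pr w) = mapLetters T.pr w from T.t_isHtpy.Q_Q w])
    exact LinearMap.congr_fun this w
  have : mapLetters T.pr ∘ₗ L.wordD d a ∘ₗ mapLetters T.pr = L.wordD d a ∘ₗ mapLetters T.pr := by
    refine hom_ext (fun e => by simp [DGLie.wordD, barD_base]) fun v w h => ?_
    simp only [LinearMap.comp_apply, DGLie.wordD] at h ⊢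
    simp only [mapLetters_cons, barD_cons, map_add, hc, h, T.pr_dTot, ← T.pr_parity, T.pr_pr]
    rw [show mapLetters T.pr (mapLetters T.pr w) = mapLetters T.pr w from T.t_isHtpy.Q_Q w]
  have := LinearMap.congr_fun this w
  simpa only [LinearMap.comp_apply, hw] using this

end Contraction
end Contraction

/-! ## The coalgebra of harmonic cycles -/

section Words
variable {V F F' : Type} [AddCommGroup V] [Module ℂ V] [AddCommGroup F] [Module ℂ F]
  [AddCommGroup F'] [Module ℂ F']

theorem contr_mapLetters (p : V →ₗ[ℂ] V) (z : Form V) (w : Words V F) :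
    contr z (mapLetters p w) = mapLetters p (contr (z ∘ₗ mapLetters p) w) := by
  revert z
  refine words_induction (p := fun w => ∀ z : Form V,
    contr z (mapLetters p w) = mapLetters p (contr (z ∘ₗ mapLetters p) w)) ?_ ?_ ?_ ?_ w
  · intro e z; simp
  · intro v w ih z
    have : Form.shift v (z ∘ₗ mapLetters p) = (z.shift (p v)) ∘ₗ mapLetters p :=
      LinearMap.ext fun t => by simp
    simp [ih, this]
  · simp
  · intro x y hx hy z; simp only [map_add, hx, hy]

theorem mapLetters_comp (p q : V →ₗ[ℂ] V) (w : Words V F) :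
    mapLetters p (mapLetters q w) = mapLetters (p ∘ₗ q) w := by
  have : mapLetters p ∘ₗ mapLetters q = (mapLetters (p ∘ₗ q) : Words V F →ₗ[ℂ] _) :=
    hom_ext (by simp) (fun v w h => by
      simp only [LinearMap.comp_apply] at h
      simp [h])
  exact LinearMap.congr_fun this w

theorem mapCoeff_id (w : Words V F) : mapCoeff LinearMap.id w = w := by
  have : (mapCoeff LinearMap.id : Words V F →ₗ[ℂ] Words V F) = LinearMap.id :=
    hom_ext (by simp [mapCoeff_base]) (fun v w h => by rw [mapCoeff_cons, h]; rfl)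
  rw [this]; rfl

theorem coeff_contr_form (z : Form V) (w : Words V ℂ) : coeff (contr z w) = z w := by
  have h := coeff_contr LinearMap.id z w
  rwa [mapCoeff_id] at h

theorem mapLetters_fixed {p : V →ₗ[ℂ] V} (hp : ∀ v, p (p v) = p v) (w : Words V F) :
    mapLetters p (mapLetters p w) = mapLetters p w := by
  rw [mapLetters_comp]
  have : p ∘ₗ p = p := LinearMap.ext hp
  rw [this]

theorem contr_fixed {p : V →ₗ[ℂ] V} (hp : ∀ v, p (p v) = p v) (z : Form V) {w : Words V F}
    (hw : mapLetters p w = w) : mapLetters p (contr z w) = contr z w := by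
  rw [← hw, contr_mapLetters, mapLetters_fixed hp]

theorem exists_factor {U W A : Type} [AddCommGroup U] [Module ℂ U] [AddCommGroup W] [Module ℂ W]
    [AddCommGroup A] [Module ℂ A] (S : Submodule ℂ U) (f : U →ₗ[ℂ] W) (c : U →ₗ[ℂ] A)
    (h : ∀ u ∈ S, f u = 0 → c u = 0) : ∃ b : W →ₗ[ℂ] A, ∀ u ∈ S, c u = b (f u) := by
  let f' := f ∘ₗ S.subtype
  obtain ⟨g, hg⟩ := f'.rangeRestrict.exists_rightInverse_of_surjective f'.range_rangeRestrict
  obtain ⟨b, hb⟩ := LinearMap.exists_extend (c ∘ₗ S.subtype ∘ₗ g)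
  refine ⟨b, fun u hu => ?_⟩
  have h1 : b (f u) = c (g ⟨f u, ⟨u, hu⟩, rfl⟩) :=
    LinearMap.congr_fun hb ⟨f u, ⟨u, hu⟩, rfl⟩
  have h2 : f (g ⟨f u, ⟨u, hu⟩, rfl⟩) = f u :=
    congrArg Subtype.val (LinearMap.congr_fun hg ⟨f u, ⟨u, hu⟩, rfl⟩)
  rw [h1, ← sub_eq_zero, ← map_sub]
  refine h _ (sub_mem hu (Submodule.coe_mem _)) ?_
  rw [map_sub, h2, sub_self]

end Words

section Core
variable {K : CochainComplex (ModuleCat.{0} ℂ) ℕ} (T : Contraction K) (L : DGLie K) (m : ℕ)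

/-- The cycles of degree `0` among the symmetric words in letters of the subcomplex. -/
def Contraction.core : Submodule ℂ (Words (Tot K) ℂ) :=
  symUpTo (parity K) m ⊓ LinearMap.ker (mapLetters T.pr - LinearMap.id) ⊓
    LinearMap.ker (wordDeg K) ⊓ LinearMap.ker L.jacobiD

variable {T L m}

theorem mem_core {w : Words (Tot K) ℂ} : w ∈ T.core L m ↔ w ∈ symUpTo (parity K) m ∧
    mapLetters T.pr w = w ∧ wordDeg K w = 0 ∧ L.jacobiD w = 0 := by
  simp only [Contraction.core, Submodule.mem_inf, LinearMap.mem_ker, LinearMap.sub_apply,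
    LinearMap.id_apply, sub_eq_zero, and_assoc]

theorem part_part (i : ℕ) (v : Tot K) : part K i (part K i v) = part K i v := by
  refine tot_induction (p := fun v => part K i (part K i v) = part K i v) (fun j x => ?_)
    (fun x y hx hy => by simp only [map_add, hx, hy]) v
  by_cases h : j = i
  · simp [part, h]
  · simp [part, h]

theorem parity_part_one (v : Tot K) : parity K (part K 1 v) = part K 1 v := by
  refine tot_induction (p := fun v => parity K (part K 1 v) = part K 1 v) (fun j x => ?_)
    (fun x y hx hy => by simp only [map_add, hx, hy]) v
  by_cases h : j = 1
  · simp [part, parity, h]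
  · simp [part, h]

theorem weight_part_one (v : Tot K) : weight K (part K 1 v) = 0 := by
  refine tot_induction (p := fun v => weight K (part K 1 v) = 0) (fun j x => ?_)
    (fun x y hx hy => by simp only [map_add, hx, hy, add_zero]) v
  by_cases h : j = 1
  · simp [part, weight, h]
  · simp [part, h]

variable {F : Type} [AddCommGroup F] [Module ℂ F]

theorem mapLetters_part_one {ν E : F →ₗ[ℂ] F} (hν : ∀ e, e ∈ nonneg ν E) {w : Words (Tot K) F}
    (h1 : mapLetters T.pr w = w) (h2 : derivWords (weight K) ν w = 0) :
    mapCoeff E (mapLetters (part K 1) w) = w := by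
  have h := nonneg_words (p := T.pr) T.part_zero_pr hν w
  rw [h1] at h
  exact eq_self_of_nonneg h h2

theorem part_one_of_core {w : Words (Tot K) ℂ} (h1 : mapLetters T.pr w = w)
    (h2 : wordDeg K w = 0) : mapLetters (part K 1) w = w := by
  have := mapLetters_part_one (T := T) (nonneg_of_zero (F := ℂ)) h1 h2
  rwa [mapCoeff_id] at this

theorem core_part_one {w : Words (Tot K) ℂ} (hw : w ∈ T.core L m) :
    mapLetters (part K 1) w = w :=
  part_one_of_core (mem_core.1 hw).2.1 (mem_core.1 hw).2.2.1

theorem wordDeg_of_part_one {w : Words (Tot K) ℂ} (hw : mapLetters (part K 1) w = w) :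
    wordDeg K w = 0 := by
  have : wordDeg K ∘ₗ mapLetters (part K 1) = 0 :=
    hom_ext (by simp) (fun v w h => by
      simp only [LinearMap.comp_apply, LinearMap.zero_apply] at h
      simp [wordDeg_cons, weight_part_one, h])
  rw [← hw]
  exact LinearMap.congr_fun this w

theorem mapLetters_parity_of_part_one {w : Words (Tot K) F} (hw : mapLetters (part K 1) w = w) :
    mapLetters (parity K) w = w := by
  have h : parity K ∘ₗ part K 1 = part K 1 := LinearMap.ext parity_part_one
  rw [← hw, mapLetters_comp, h]

theorem contr_parity_of_part_one (y : Form (Tot K)) {w : Words (Tot K) F}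
    (hw : mapLetters (part K 1) w = w) : contr (y ∘ₗ mapLetters (parity K)) w = contr y w := by
  have h := contr_mapLetters (parity K) y w
  rw [mapLetters_parity_of_part_one hw,
    mapLetters_parity_of_part_one (contr_fixed (part_part 1) _ hw)] at h
  exact h.symm

/-- Contraction with the form made even. -/
theorem contr_part_one (y : Form (Tot K)) {w : Words (Tot K) F}
    (hw : mapLetters (part K 1) w = w) : contr (y ∘ₗ mapLetters (part K 1)) w = contr y w := by
  have h := contr_mapLetters (part K 1) y w
  rw [hw, contr_fixed (part_part 1) _ hw] at h
  exact h.symm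

theorem even_part_one (y : Form (Tot K)) :
    (y ∘ₗ mapLetters (part K 1)) ∘ₗ mapLetters (parity K) = y ∘ₗ mapLetters (part K 1) := by
  refine LinearMap.ext fun w => ?_
  have h : part K 1 ∘ₗ parity K = part K 1 := LinearMap.ext fun v => by
    have : part K 1 (parity K v) = parity K (part K 1 v) := scale_comm _ _ _
    rw [LinearMap.comp_apply, this, parity_part_one]
  simp only [LinearMap.comp_apply, mapLetters_comp, h]

theorem contr_core (y : Form (Tot K)) {w : Words (Tot K) ℂ} (hw : w ∈ T.core L m) :
    contr y w ∈ T.core L m := by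
  obtain ⟨h1, h2, h3, h4⟩ := mem_core.1 hw
  have h5 := core_part_one hw
  have h6 := contr_fixed (part_part 1) y h5
  refine mem_core.2 ⟨contr_mem y h1, contr_fixed T.pr_pr y h2, wordDeg_of_part_one h6, ?_⟩
  have h7 := contr_barD (parity K) (dTot K) L.half (0 : ℂ →ₗ[ℂ] ℂ) 0 y w
  have h4' : barD (parity K) (dTot K) L.half (0 : ℂ →ₗ[ℂ] ℂ) 0 w = 0 := h4
  rw [h4', map_zero, contr_parity_of_part_one y h5] at h7
  have h8 : L.jacobiD (contr y w) = -contr (y ∘ₗ L.jacobiD) w :=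
    (neg_eq_of_add_eq_zero_right h7.symm).symm
  have h9 : wordDeg K (L.jacobiD (contr y w)) = 0 := by
    rw [h8, map_neg, wordDeg_of_part_one (contr_fixed (part_part 1) _ h5), neg_zero]
  rwa [wordDeg_jacobiD, wordDeg_of_part_one h6, map_zero, zero_add] at h9

/-- Contractions commute on the harmonic cycles. -/
theorem contr_comm_core (y z : Form (Tot K)) {w : Words (Tot K) ℂ} (hw : w ∈ T.core L m) :
    contr y (contr z w) = contr z (contr y w) := by
  have h5 := core_part_one hw
  have h6 := contr_fixed (part_part 1) y h5
  have := contr_comm parity_parity (even_part_one z) y (mem_core.1 hw).1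
  rwa [contr_part_one z h5, contr_part_one z h6] at this

theorem form_contr_comm (y z : Form (Tot K)) {w : Words (Tot K) ℂ} (hw : w ∈ T.core L m) :
    y (contr z w) = z (contr y w) := by
  rw [← coeff_contr_form, contr_comm_core y z hw, coeff_contr_form]

theorem eq_zero_of_forms {V : Type} [AddCommGroup V] [Module ℂ V] {w : Words V ℂ}
    (h : ∀ z : Form V, z w = 0) : w = 0 :=
  (Module.forall_dual_apply_eq_zero_iff ℂ w).1 h

/-- Contraction of harmonic cycles depends only on the values of the form on harmonic cycles. -/
theorem contr_congr_core {y z : Form (Tot K)} (h : ∀ w ∈ T.core L m, y w = z w)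
    {w : Words (Tot K) ℂ} (hw : w ∈ T.core L m) : contr y w = contr z w := by
  rw [← sub_eq_zero]
  refine eq_zero_of_forms fun a => ?_
  rw [map_sub, form_contr_comm a y hw, form_contr_comm a z hw, h _ (contr_core a hw), sub_self]

theorem base_mem_core (t : ℂ) : (base t : Words (Tot K) ℂ) ∈ T.core L m :=
  mem_core.2 ⟨symWords_le (Nat.zero_le m) ⟨t, rfl⟩, by simp, by simp, jacobiD_base t⟩

/-! ### Finiteness -/

theorem jacobiD_prlen_top {k : ℕ} {w : Words (Tot K) ℂ} (hw : w ∈ symUpTo (parity K) k)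
    (h : L.jacobiD w = 0) : der (parity K) (dTot K) 0 (prlen k w) = 0 := by
  have := wordD_prlen_top (L := L) (d := (0 : ℂ →ₗ[ℂ] ℂ)) (a := 0) hw
  rw [← L.jacobiD_eq, h, map_zero] at this
  exact this.symm

theorem s_pr_part_one (v : Tot K) : T.s (T.pr (part K 1 v)) = 0 := by
  refine tot_induction (p := fun v => T.s (T.pr (part K 1 v)) = 0) (fun j x => ?_)
    (fun x y hx hy => by simp only [map_add, hx, hy, add_zero]) v
  by_cases h : j = 1
  · subst h
    simp only [part, scale_hom, if_true, one_smul]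
    rw [T.pr_one, map_sub, T.isHtpy.sds, sub_self]
  · simp [part, h]

theorem htpy_eq_zero {w : Words (Tot K) F} (h1 : mapLetters T.pr w = w)
    (h2 : mapLetters (part K 1) w = w) (i : ℕ) : htpy F (parity K) (dTot K) T.s i w = 0 := by
  refine T.isHtpy.htpy_of_sW ?_ i
  have h3 : mapLetters (T.pr ∘ₗ part K 1) w = w := by rw [← mapLetters_comp, h2, h1]
  rw [← h3]
  exact T.isHtpy.sW_of_letters (p := T.pr ∘ₗ part K 1) s_pr_part_one w

theorem core_eq_zero {k : ℕ} {w : Words (Tot K) ℂ} (hk : w ∈ symUpTo (parity K) k)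
    (hw : w ∈ T.core L m) (hQ : mapLetters (harm (dTot K) T.s) w = 0) : w = 0 := by
  induction k with
  | zero =>
    have h1 := prlen_symUpTo hk 0
    have h2 := sum_prlen hk
    rw [zero_add, Finset.sum_range_one] at h2
    rw [h2] at h1
    obtain ⟨e, rfl⟩ := h1
    simpa using hQ
  | succ k ih =>
    refine ih (symUpTo_of_prlen hk ?_)
    obtain ⟨h1, h2, h3, h4⟩ := mem_core.1 hw
    have h5 := core_part_one hw
    have h6 := T.isHtpy.htpy_eq (F := ℂ) 0 (k + 1) (prlen (k + 1) w)
    rw [jacobiD_prlen_top hk h4, map_zero, htpy_eq_zero (by rw [← prlen_mapLetters, h2])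
      (by rw [← prlen_mapLetters, h5]), map_zero, T.isHtpy.htpyT_len le_rfl
      (symWords_le_lenWords _ _ (prlen_symUpTo hk _)), ← prlen_mapLetters, hQ] at h6
    simpa using h6.symm

theorem map_lenWords_fg {p : Tot K →ₗ[ℂ] Tot K} (hp : (LinearMap.range p).FG) (k : ℕ) :
    ((lenWords (Tot K) ℂ k).map (mapLetters p)).FG := by
  induction k with
  | zero =>
    have h : (⊤ : Submodule ℂ ℂ).FG := Module.Finite.fg_top
    have : ((lenWords (Tot K) ℂ 0).map (mapLetters p)) =
        (⊤ : Submodule ℂ ℂ).map (mapLetters p ∘ₗ base) := by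
      rw [Submodule.map_comp, Submodule.map_top]; rfl
    rw [this]
    exact h.map _
  | succ k ih =>
    have h1 := hp.map₂ cons ih
    have h2 : ((lenWords (Tot K) ℂ (k + 1)).map (mapLetters p)) ≤ Submodule.map₂ cons
        (LinearMap.range p) ((lenWords (Tot K) ℂ k).map (mapLetters p)) := by
      rw [Submodule.map_le_iff_le_comap]
      refine Submodule.map₂_le.2 fun v _ t ht => ?_
      rw [Submodule.mem_comap, mapLetters_cons]
      exact Submodule.apply_mem_map₂ _ ⟨v, rfl⟩ ⟨t, ht, rfl⟩
    have := Module.Finite.iff_fg.2 h1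
    exact Module.Finite.iff_fg.1 (Submodule.finiteDimensional_of_le h2)

instance core_finite : Module.Finite ℂ (T.core L m) := by
  let N : Submodule ℂ (Words (Tot K) ℂ) := ⨆ k ∈ Finset.range (m + 1),
    (lenWords (Tot K) ℂ k).map (mapLetters (harm (dTot K) T.s))
  have hN : N.FG := Submodule.fg_biSup _ _ fun k _ => map_lenWords_fg T.fin k
  have := Module.Finite.iff_fg.2 hN
  have hle : ∀ w ∈ T.core L m, mapLetters (harm (dTot K) T.s) w ∈ N := fun w hw =>
    symUpTo_induction (p := N.comap (mapLetters (harm (dTot K) T.s))) (fun k hk w hw =>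
      Submodule.mem_iSup_of_mem k (Submodule.mem_iSup_of_mem (Finset.mem_range.2 (by omega))
        ⟨w, symWords_le_lenWords _ _ hw, rfl⟩)) (mem_core.1 hw).1
  refine Module.Finite.of_injective
    (LinearMap.codRestrict N (mapLetters (harm (dTot K) T.s) ∘ₗ (T.core L m).subtype)
      fun w => hle w w.2) ?_
  rw [← LinearMap.ker_eq_bot, LinearMap.ker_eq_bot']
  intro w hw
  exact Subtype.ext (core_eq_zero (mem_core.1 w.2).1 w.2 (congrArg Subtype.val hw))

/-! ### Cochains and their restrictions to the harmonic cycles -/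

variable {A : Type} [AddCommGroup A] [Module ℂ A]

theorem pr_wordDeg {w : Words (Tot K) ℂ} (hw : mapLetters T.pr w = w) :
    mapLetters T.pr (wordDeg K w) = wordDeg K w := by
  rw [wordDeg, ← derivWords_mapLetters 0 T.weight_pr, hw]

theorem symUpTo_wordDeg {ν : F →ₗ[ℂ] F} {w : Words (Tot K) F} (hw : w ∈ symUpTo (parity K) m) :
    derivWords (weight K) ν w ∈ symUpTo (parity K) m :=
  symUpTo_induction (p := (symUpTo (parity K) m).comap (derivWords (weight K) ν))
    (fun _ hk _ hw => symWords_le hk (derivWords_symWords parity_parity weight_parity ν hw)) hw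

theorem hasDeg_of_glue {ρ : ℤ} {g : Words (Tot K) ℂ →ₗ[ℂ] A}
    (h : ∀ n : ℤ, n ≠ -ρ → ∀ w, wordDeg K w = (n : ℂ) • w → g w = 0) :
    HasDeg (0 : A →ₗ[ℂ] A) ρ g := by
  refine isDeg_wordDeg.ext fun n w hw => ?_
  simp only [LinearMap.zero_comp, LinearMap.zero_apply, LinearMap.add_apply, LinearMap.comp_apply,
    LinearMap.smul_apply, hw, map_smul]
  by_cases hn : n = -ρ
  · rw [hn, ← add_smul]; push_cast; simp
  · rw [h n hn w hw]; simp

theorem pr_words_neg {w : Words (Tot K) ℂ} (h1 : mapLetters T.pr w = w) {n : ℤ} (hn : n < 0)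
    (h2 : wordDeg K w = (n : ℂ) • w) : w = 0 := by
  have h := nonneg_words (p := T.pr) T.part_zero_pr (nonneg_of_zero (F := ℂ)) w
  rw [h1] at h
  exact eq_zero_of_nonneg h hn h2

theorem wordDeg_D {w : Words (Tot K) ℂ} {n : ℤ} (h : wordDeg K w = (n : ℂ) • w) :
    wordDeg K (L.jacobiD w) = ((n + 1 : ℤ) : ℂ) • L.jacobiD w := by
  rw [wordDeg_jacobiD, h, map_smul]; push_cast; module

theorem pr_induction {S : Submodule ℂ (Words (Tot K) ℂ)}
    (h : ∀ n : ℤ, ∀ w ∈ symUpTo (parity K) m, mapLetters T.pr w = w →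
      wordDeg K w = (n : ℂ) • w → w ∈ S) {w : Words (Tot K) ℂ} (hw : w ∈ symUpTo (parity K) m)
    (hpr : mapLetters T.pr w = w) : w ∈ S := by
  refine isDeg_wordDeg.induction_stable
    (S := symUpTo (parity K) m ⊓ LinearMap.ker (mapLetters T.pr - LinearMap.id))
    (fun w hw => ⟨symUpTo_wordDeg hw.1, ?_⟩) (fun n w hw hn => h n w hw.1 ?_ hn) ⟨hw, ?_⟩
  · have h2 : mapLetters T.pr w - w = 0 := hw.2
    change mapLetters T.pr (wordDeg K w) - wordDeg K w = 0
    rw [pr_wordDeg (sub_eq_zero.1 h2), sub_self]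
  · have h2 : mapLetters T.pr w - w = 0 := hw.2
    exact sub_eq_zero.1 h2
  · change mapLetters T.pr w - w = 0
    rw [hpr, sub_self]

variable (L) in
/-- An action of letters in which only the letters of degree `0` act. -/
structure ActZero (a : Tot K →ₗ[ℂ] A →ₗ[ℂ] A) : Prop where
  rep : L.IsRep 0 a
  zero : ∀ i (x : K.X i), i ≠ 0 → a (hom K i x) = 0

theorem actZero_zero : ActZero L (0 : Tot K →ₗ[ℂ] A →ₗ[ℂ] A) :=
  ⟨L.isRep_zero, fun _ _ _ => rfl⟩

theorem actZero_aComp (E : DGMod L) (p : ℕ) : ActZero L (E.aComp p p) :=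
  ⟨E.isRep_aComp p, fun _ x hi => E.aComp_ne (by omega) x⟩

section
variable {a : Tot K →ₗ[ℂ] A →ₗ[ℂ] A} (ha : ActZero L a)
include ha

theorem ActZero.isGraded : IsGraded (0 : A →ₗ[ℂ] A) 0 a where
  diff := by simp
  act x e := by
    have : a ∘ₗ weight K + a = 0 := tot_ext fun i x => by
      by_cases hi : i = 0
      · subst hi; simp [weight_hom]
      · simp [weight_hom, ha.zero i x hi]
    have h := LinearMap.congr_fun (LinearMap.congr_fun this x) e
    simp only [LinearMap.add_apply, LinearMap.comp_apply, LinearMap.zero_apply] at h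
    simp [h]

theorem ActZero.parity (v : Tot K) : a (JacobiModuli.parity K v) = -a v := by
  refine tot_induction (p := fun v => a (JacobiModuli.parity K v) = -a v) (fun i x => ?_)
    (fun x y hx hy => by simp only [map_add, hx, hy, neg_add]) v
  by_cases hi : i = 0
  · subst hi; simp [JacobiModuli.parity]
  · simp [JacobiModuli.parity, ha.zero i x hi]

theorem ActZero.pr (v : Tot K) : a (T.pr v) = 0 := by
  have key : ∀ v : Tot K, a v = a (part K 0 v) := fun v => by
    refine tot_induction (p := fun v => a v = a (part K 0 v)) (fun i x => ?_)
      (fun x y hx hy => by simp only [map_add, hx, hy]) v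
    by_cases hi : i = 0
    · subst hi; simp [part]
    · simp [part, hi, ha.zero i x hi]
  rw [key, T.part_zero_pr, map_zero]

theorem ActZero.headAct_pr (c : Words (Tot K) ℂ →ₗ[ℂ] A) {w : Words (Tot K) ℂ}
    (hw : mapLetters T.pr w = w) : headAct a c w = 0 := by
  rw [← hw, headAct_mapLetters]
  have : a ∘ₗ T.pr = 0 := LinearMap.ext ha.pr
  rw [this]
  have h : headAct (0 : Tot K →ₗ[ℂ] A →ₗ[ℂ] A) (c ∘ₗ mapLetters T.pr) = 0 :=
    hom_ext (by simp) (by simp)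
  rw [h]; rfl

theorem ActZero.headAct_parity_pr (c : Words (Tot K) ℂ →ₗ[ℂ] A) {w : Words (Tot K) ℂ}
    (hw : mapLetters T.pr w = w) : headAct (a ∘ₗ JacobiModuli.parity K) c w = 0 := by
  have : headAct (a ∘ₗ JacobiModuli.parity K) c = -headAct a c :=
    hom_ext (by simp) (by simp [ha.parity])
  rw [this, LinearMap.neg_apply, ha.headAct_pr c hw, neg_zero]

theorem ActZero.coboundary_core {c : Words (Tot K) ℂ →ₗ[ℂ] A} (hc : c ∈ cochB L m 0 0 a)
    {w : Words (Tot K) ℂ} (hw : w ∈ T.core L m) : c w = 0 := by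
  obtain ⟨b, -, h⟩ := hc
  obtain ⟨h1, h2, -, h4⟩ := mem_core.1 hw
  rw [h w h1, cochDPrev_apply, h4, ha.headAct_pr b h2]
  simp

end

section
variable {a : Tot K →ₗ[ℂ] A →ₗ[ℂ] A} (ha : ActZero L a)
include ha

theorem cd_pr {ε : ℂ} (hε : ε = 1 ∨ ε = -1) (c : Words (Tot K) ℂ →ₗ[ℂ] A) {w : Words (Tot K) ℂ}
    (hw : mapLetters T.pr w = w) : L.cd ε 0 a c w = -ε • c (L.jacobiD w) := by
  rw [L.cd_apply]
  have h : headAct (a ∘ₗ parityPow (JacobiModuli.parity K) (-ε)) c w = 0 := by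
    rcases hε with rfl | rfl
    · rw [parityPow_neg_one]; exact ha.headAct_parity_pr c hw
    · rw [neg_neg, parityPow_one, LinearMap.comp_id]; exact ha.headAct_pr c hw
  rw [h]; simp

/-- A cocycle which vanishes on the harmonic cycles is a coboundary. -/
theorem ActZero.mem_cochB (T : Contraction K) {c : Words (Tot K) ℂ →ₗ[ℂ] A}
    (hc : c ∈ cochZ L m 0 0 a) (h0 : ∀ w ∈ T.core L m, c w = 0) : c ∈ cochB L m 0 0 a := by
  have hcd : ∀ w ∈ symUpTo (JacobiModuli.parity K) m, L.cd 1 0 a c w = 0 := fun w hw => by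
    rw [L.cd_one]; exact hc.2 w hw
  have hdeg : ∀ w, c (wordDeg K w) = 0 := fun w => by
    have := LinearMap.congr_fun hc.1 w
    simpa using this.symm
  obtain ⟨b₁, hb₁⟩ := exists_factor (symUpTo (JacobiModuli.parity K) m ⊓
    LinearMap.ker (mapLetters T.pr - LinearMap.id) ⊓ LinearMap.ker (wordDeg K)) L.jacobiD c
    fun w hw hD => h0 w ⟨hw, hD⟩
  obtain ⟨b, hb⟩ := isDeg_wordDeg.exists_glue (fun n => if n = 1 then b₁ else 0)
  have hbd : HasDeg (0 : A →ₗ[ℂ] A) (-1) b := by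
    have := hasDeg_of_glue (ρ := -1) (g := b) (fun n hn w hw => by
      rw [hb n w hw, if_neg (by omega)]; rfl)
    simpa using this
  have hk := hbd.cd (L := L) ha.isGraded (ε := -1)
  rw [neg_add_cancel] at hk
  have hcdeg : HasDeg (0 : A →ₗ[ℂ] A) 0 c := by
    rw [HasDeg, hc.1]; simp
  have he : HasDeg (0 : A →ₗ[ℂ] A) 0 (c - L.cd (-1) 0 a b) := by
    rw [HasDeg] at hk hcdeg ⊢
    rw [LinearMap.comp_sub, LinearMap.sub_comp, hk, hcdeg]; simp
  obtain ⟨b', hb'd, -, hb'⟩ := T.t_isHtpy.exists_primitive T.t_weight ha.rep ha.isGraded (m := m)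
    (fun w _ hw => by rw [L.jacobiD_eq]; exact T.pr_wordD 0 0 hw) (Or.inl rfl) he (fun w hw => by
      have h2 := ha.rep.cd_cd (Or.inr rfl) b hw
      rw [neg_neg] at h2
      rw [map_sub, LinearMap.sub_apply, h2, hcd w hw, sub_zero]) (fun w hw hpr => by
      refine pr_induction (T := T)
        (S := LinearMap.ker (c - L.cd (-1) 0 a b)) (fun n w hw hpr hn => ?_) hw hpr
      rw [LinearMap.mem_ker, LinearMap.sub_apply, cd_pr ha (Or.inr rfl) b hpr, neg_neg, one_smul,
        hb (n + 1) _ (wordDeg_D hn)]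
      by_cases h : n = 0
      · subst h
        rw [if_pos (by norm_num), ← hb₁ w ⟨⟨hw, ?_⟩, ?_⟩, sub_self]
        · change mapLetters T.pr w - w = 0
          rw [hpr, sub_self]
        · change wordDeg K w = 0
          simpa using hn
      · rw [if_neg (by omega)]
        have h3 := hdeg w
        rw [hn, map_smul] at h3
        rw [(smul_eq_zero.1 h3).resolve_left (by exact_mod_cast h)]
        simp)
  refine ⟨b + b', ?_, fun w hw => ?_⟩
  · rw [zero_sub] at hb'd
    rw [HasDeg] at hbd hb'd
    rw [LinearMap.comp_add, hbd, hb'd, LinearMap.add_comp]; module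
  · have h := hb' w hw
    rw [LinearMap.sub_apply, sub_eq_iff_eq_add] at h
    rw [h, ← L.cd_neg_one, map_add, LinearMap.add_apply, add_comm]

/-- Every linear map on the harmonic cycles extends to a cocycle. -/
theorem ActZero.exists_cocycle (T : Contraction K) (f : T.core L m →ₗ[ℂ] A) :
    ∃ c ∈ cochZ L m 0 0 a, ∀ w : T.core L m, c w = f w := by
  obtain ⟨f', hf'⟩ := LinearMap.exists_extend f
  obtain ⟨c₀, hc₀⟩ := (isDeg_wordDeg (K := K)).exists_glue (fun n => if n = 0 then f' else 0)
  have hcd : HasDeg (0 : A →ₗ[ℂ] A) 0 c₀ := by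
    have := hasDeg_of_glue (ρ := 0) (g := c₀) (fun n hn w hw => by
      rw [hc₀ n w hw, if_neg (by omega)]; rfl)
    simpa using this
  have hk := hcd.cd (L := L) ha.isGraded (ε := 1)
  rw [zero_add] at hk
  obtain ⟨c₁, hc₁d, hc₁Q, hc₁⟩ := T.t_isHtpy.exists_primitive T.t_weight ha.rep ha.isGraded (m := m)
    (fun w _ hw => by rw [L.jacobiD_eq]; exact T.pr_wordD 0 0 hw) (ε := -1) (Or.inr rfl) hk
    (fun w hw => ha.rep.cd_cd (Or.inl rfl) c₀ hw) (fun w hw hpr => by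
      refine pr_induction (T := T) (S := LinearMap.ker (L.cd 1 0 a c₀))
        (fun n w hw hpr hn => ?_) hw hpr
      rw [LinearMap.mem_ker, cd_pr ha (Or.inl rfl) c₀ hpr, hc₀ (n + 1) _ (wordDeg_D hn)]
      by_cases h : n = -1
      · have : w = 0 := pr_words_neg hpr (by omega) hn
        simp [this]
      · rw [if_neg (by omega)]; simp)
  rw [sub_self] at hc₁d
  refine ⟨c₀ - c₁, ⟨?_, fun w hw => ?_⟩, fun w => ?_⟩
  · rw [HasDeg] at hcd hc₁d
    rw [LinearMap.comp_sub, hcd, hc₁d, LinearMap.sub_comp]; simp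
  · rw [← L.cd_one, map_sub, LinearMap.sub_apply, hc₁ w hw, neg_neg, sub_self]
  · obtain ⟨-, h2, h3, -⟩ := mem_core.1 w.2
    have h4 : c₀ w = f' w := by
      rw [hc₀ 0 w (by rw [h3]; simp), if_pos rfl]
    have h5 : c₁ w = 0 := by
      have : mapLetters T.pr (w : Words (Tot K) ℂ) = w := h2
      rw [← this]; exact hc₁Q _
    rw [LinearMap.sub_apply, h4, h5, sub_zero]
    exact LinearMap.congr_fun hf' w

end

end Core

/-! ## Elements with coefficients in an algebra -/

section Coefficients
variable {R : Type} [CommRing R] [Algebra ℂ R]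
variable {N N' N'' : Type} [AddCommGroup N] [Module ℂ N] [AddCommGroup N'] [Module ℂ N']
  [AddCommGroup N''] [Module ℂ N'']

section
variable {M : Type} [AddCommGroup M] [Module ℂ M]

/-- The image of an element of a tensor product under a linear form on the left factor. -/
def slice (l : M →ₗ[ℂ] ℂ) : M ⊗[ℂ] N →ₗ[ℂ] N := TensorProduct.lift ((LinearMap.lsmul ℂ N) ∘ₗ l)

@[simp] theorem slice_tmul (l : M →ₗ[ℂ] ℂ) (r : M) (n : N) : slice l (r ⊗ₜ n) = l r • n := rfl

theorem slice_lTensor (l : M →ₗ[ℂ] ℂ) (f : N →ₗ[ℂ] N') (y : M ⊗[ℂ] N) :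
    slice l (LinearMap.lTensor M f y) = f (slice l y) := by
  induction y with
  | zero => simp
  | add x y hx hy => simp only [map_add, hx, hy]
  | tmul r n => simp

theorem eq_zero_of_slice {y : M ⊗[ℂ] N} (h : ∀ l : M →ₗ[ℂ] ℂ, slice l y = 0) : y = 0 := by
  classical
  let b := Module.Basis.ofVectorSpace ℂ M
  refine (TensorProduct.equivFinsuppOfBasisLeft b).injective (Finsupp.ext fun i => ?_)
  rw [map_zero, Finsupp.zero_apply, TensorProduct.equivFinsuppOfBasisLeft_apply]
  rw [← h (b.coord i)]
  have key : (TensorProduct.lid ℂ N).toLinearMap ∘ₗ LinearMap.rTensor N (b.coord i) = slice (b.coord i) :=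
    TensorProduct.ext' fun r n => by simp
  exact LinearMap.congr_fun key y

end

theorem lTensor_eq_zero {S : Submodule ℂ N} {f : N →ₗ[ℂ] N'} (hf : ∀ n ∈ S, f n = 0)
    {y : R ⊗[ℂ] N} (hy : ∀ l : R →ₗ[ℂ] ℂ, slice l y ∈ S) : LinearMap.lTensor R f y = 0 :=
  eq_zero_of_slice fun l => by rw [slice_lTensor, hf _ (hy l)]

theorem lTensor_lsmul {M : Type} [AddCommGroup M] [Module ℂ M] [Module R M] [SMulCommClass ℂ R M]
    (f : N →ₗ[ℂ] N') (r : R) (y : M ⊗[ℂ] N) :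
    LinearMap.lTensor M f (r • y) = r • LinearMap.lTensor M f y := by
  induction y with
  | zero => simp
  | add x y h h' => simp only [map_add, smul_add, h, h']
  | tmul t e => simp [TensorProduct.smul_tmul']

/-- The bilinear extension of a bilinear map to elements with coefficients in `R`. -/
def opR (β : N →ₗ[ℂ] N' →ₗ[ℂ] N'') : R ⊗[ℂ] N →ₗ[ℂ] R ⊗[ℂ] N' →ₗ[ℂ] R ⊗[ℂ] N'' :=
  TensorProduct.map₂ (LinearMap.mul ℂ R) β

@[simp] theorem opR_tmul (β : N →ₗ[ℂ] N' →ₗ[ℂ] N'') (r s : R) (n : N) (n' : N') :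
    opR β (r ⊗ₜ n) (s ⊗ₜ n') = (r * s) ⊗ₜ β n n' := rfl

theorem opR_tmul_left (β : N →ₗ[ℂ] N' →ₗ[ℂ] N'') (r : R) (n : N) (y : R ⊗[ℂ] N') :
    opR β (r ⊗ₜ n) y = r • LinearMap.lTensor R (β n) y := by
  induction y with
  | zero => simp
  | add x y hx hy => simp only [map_add, smul_add, hx, hy]
  | tmul s n' => simp [TensorProduct.smul_tmul']

theorem opR_one_right (β : N →ₗ[ℂ] N' →ₗ[ℂ] N'') (x : R ⊗[ℂ] N) (n' : N') :
    opR β x (1 ⊗ₜ n') = LinearMap.lTensor R (β.flip n') x := by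
  induction x with
  | zero => simp
  | add x y hx hy => simp only [map_add, LinearMap.add_apply, hx, hy]
  | tmul s n => simp

theorem opR_smul_left (β : N →ₗ[ℂ] N' →ₗ[ℂ] N'') (r : R) (x : R ⊗[ℂ] N) (y : R ⊗[ℂ] N') :
    opR β (r • x) y = r • opR β x y := by
  induction x with
  | zero => simp
  | add x x' h h' => simp only [map_add, smul_add, LinearMap.add_apply, h, h']
  | tmul s n => rw [TensorProduct.smul_tmul', opR_tmul_left, opR_tmul_left, smul_eq_mul, mul_smul]

theorem opR_smul_right (β : N →ₗ[ℂ] N' →ₗ[ℂ] N'') (r : R) (x : R ⊗[ℂ] N) (y : R ⊗[ℂ] N') :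
    opR β x (r • y) = r • opR β x y := by
  induction x with
  | zero => simp
  | add x x' h h' => simp only [map_add, smul_add, LinearMap.add_apply, h, h']
  | tmul s n => rw [opR_tmul_left, opR_tmul_left, lTensor_lsmul, smul_comm]

theorem lTensor_opR {M : Type} [AddCommGroup M] [Module ℂ M] (β : N →ₗ[ℂ] N' →ₗ[ℂ] N'')
    (f : N'' →ₗ[ℂ] M) (x : R ⊗[ℂ] N) (y : R ⊗[ℂ] N') :
    LinearMap.lTensor R f (opR β x y) = opR (β.compr₂ f) x y := by
  induction x with
  | zero => simp
  | add x x' h h' => simp only [map_add, LinearMap.add_apply, h, h']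
  | tmul s n =>
    rw [opR_tmul_left, opR_tmul_left, lTensor_lsmul, ← LinearMap.lTensor_comp_apply]
    rfl

theorem opR_lTensor_right {M : Type} [AddCommGroup M] [Module ℂ M] (β : N →ₗ[ℂ] N' →ₗ[ℂ] N'')
    (f : M →ₗ[ℂ] N') (x : R ⊗[ℂ] N) (y : R ⊗[ℂ] M) :
    opR β x (LinearMap.lTensor R f y) = opR (β.compl₂ f) x y := by
  induction x with
  | zero => simp
  | add x x' h h' => simp only [map_add, LinearMap.add_apply, h, h']
  | tmul s n =>
    rw [opR_tmul_left, opR_tmul_left, ← LinearMap.lTensor_comp_apply]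
    rfl

theorem opR_lTensor_left {M : Type} [AddCommGroup M] [Module ℂ M] (β : N →ₗ[ℂ] N' →ₗ[ℂ] N'')
    (f : M →ₗ[ℂ] N) (x : R ⊗[ℂ] M) (y : R ⊗[ℂ] N') :
    opR β (LinearMap.lTensor R f x) y = opR (β ∘ₗ f) x y := by
  induction x with
  | zero => simp
  | add x x' h h' => simp only [map_add, LinearMap.add_apply, h, h']
  | tmul s n =>
    rw [LinearMap.lTensor_tmul, opR_tmul_left, opR_tmul_left]
    rfl

@[simp] theorem opR_zero_form (x : R ⊗[ℂ] N) (y : R ⊗[ℂ] N') :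
    opR (0 : N →ₗ[ℂ] N' →ₗ[ℂ] N'') x y = 0 := by
  induction x with
  | zero => simp
  | add x x' h h' => simp only [map_add, LinearMap.add_apply, h, h', add_zero]
  | tmul s n => rw [opR_tmul_left]; simp

theorem opR_add_form (β γ : N →ₗ[ℂ] N' →ₗ[ℂ] N'') (x : R ⊗[ℂ] N) (y : R ⊗[ℂ] N') :
    opR (β + γ) x y = opR β x y + opR γ x y := by
  induction x with
  | zero => simp
  | add x x' h h' => simp only [map_add, LinearMap.add_apply, h, h']; abel
  | tmul s n =>
    rw [opR_tmul_left, opR_tmul_left, opR_tmul_left, LinearMap.add_apply, LinearMap.lTensor_add,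
      LinearMap.add_apply, smul_add]

theorem opR_smul_form (t : ℂ) (β : N →ₗ[ℂ] N' →ₗ[ℂ] N'') (x : R ⊗[ℂ] N) (y : R ⊗[ℂ] N') :
    opR (t • β) x y = t • opR β x y := by
  induction x with
  | zero => simp
  | add x x' h h' => simp only [map_add, LinearMap.add_apply, h, h', smul_add]
  | tmul s n =>
    rw [opR_tmul_left, opR_tmul_left, LinearMap.smul_apply, LinearMap.lTensor_smul,
      LinearMap.smul_apply, smul_comm]

/-- Rebracketing of the action of two elements. -/
theorem opR_opR {M M' P : Type} [AddCommGroup M] [Module ℂ M] [AddCommGroup M'] [Module ℂ M']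
    [AddCommGroup P] [Module ℂ P] (β : N →ₗ[ℂ] M →ₗ[ℂ] P) (γ : N' →ₗ[ℂ] N'' →ₗ[ℂ] M)
    (β' : M' →ₗ[ℂ] N'' →ₗ[ℂ] P) (γ' : N →ₗ[ℂ] N' →ₗ[ℂ] M')
    (h : ∀ x y w, β x (γ y w) = β' (γ' x y) w) (x : R ⊗[ℂ] N) (y : R ⊗[ℂ] N') (w : R ⊗[ℂ] N'') :
    opR β x (opR γ y w) = opR β' (opR γ' x y) w := by
  induction x with
  | zero => simp
  | add x x' h h' => simp only [map_add, LinearMap.add_apply, h, h']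
  | tmul r n =>
    induction y with
    | zero => simp
    | add x x' h h' => simp only [map_add, LinearMap.add_apply, h, h']
    | tmul s n' =>
      rw [opR_tmul, opR_tmul_left, opR_tmul_left, opR_tmul_left, lTensor_lsmul, mul_smul,
        ← LinearMap.lTensor_comp_apply]
      have : β n ∘ₗ γ n' = β' (γ' n n') := LinearMap.ext fun w' => h n n' w'
      rw [this]

theorem lTensor_mem {I : Ideal R} (f : N →ₗ[ℂ] N') {y : R ⊗[ℂ] N}
    (hy : y ∈ I • (⊤ : Submodule R (R ⊗[ℂ] N))) :
    LinearMap.lTensor R f y ∈ I • (⊤ : Submodule R (R ⊗[ℂ] N')) := by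
  refine Submodule.smul_induction_on hy (fun r hr n _ => ?_) (fun x y hx hy => ?_)
  · rw [lTensor_lsmul]
    exact Submodule.smul_mem_smul hr trivial
  · rw [map_add]
    exact add_mem hx hy

theorem opR_mem {I J : Ideal R} (β : N →ₗ[ℂ] N' →ₗ[ℂ] N'') {x : R ⊗[ℂ] N} {y : R ⊗[ℂ] N'}
    (hx : x ∈ I • (⊤ : Submodule R (R ⊗[ℂ] N))) (hy : y ∈ J • (⊤ : Submodule R (R ⊗[ℂ] N'))) :
    opR β x y ∈ (I * J) • (⊤ : Submodule R (R ⊗[ℂ] N'')) := by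
  refine Submodule.smul_induction_on hx (fun r hr n _ => ?_) (fun x y hx hy => ?_)
  · refine Submodule.smul_induction_on hy (fun s hs n' _ => ?_) (fun x y hx hy => ?_)
    · rw [opR_smul_left, opR_smul_right, smul_smul]
      exact Submodule.smul_mem_smul (Ideal.mul_mem_mul hr hs) trivial
    · rw [map_add]
      exact add_mem hx hy
  · rw [map_add, LinearMap.add_apply]
    exact add_mem hx hy

theorem mem_top_smul (y : R ⊗[ℂ] N) : y ∈ (⊤ : Ideal R) • (⊤ : Submodule R (R ⊗[ℂ] N)) := by
  rw [Submodule.top_smul]; trivial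

theorem eq_zero_of_mem_pow {I : Ideal R} {n : ℕ} (hI : I ^ n = ⊥) {y : R ⊗[ℂ] N}
    (hy : ∀ k, y ∈ I ^ k • (⊤ : Submodule R (R ⊗[ℂ] N))) : y = 0 := by
  have := hy n
  rwa [hI, Submodule.bot_smul, Submodule.mem_bot] at this

/-- An endomorphism congruent to the identity modulo a nilpotent ideal is bijective. -/
theorem bijective_of_sub_mem {M : Type} [AddCommGroup M] [Module R M] {I : Ideal R} {n : ℕ}
    (hI : I ^ n = ⊥) (f : M →ₗ[R] M) (hf : ∀ x, f x - x ∈ I • (⊤ : Submodule R M)) :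
    Function.Bijective f := by
  let g : Module.End R M := 1 - f
  have hg : ∀ k x, (g ^ k) x ∈ I ^ k • (⊤ : Submodule R M) := by
    intro k
    induction k with
    | zero => intro x; rw [pow_zero, Ideal.one_eq_top, Submodule.top_smul]; trivial
    | succ k ih =>
      intro x
      rw [pow_succ' g, pow_succ I, Module.End.mul_apply, Submodule.mul_smul]
      refine Submodule.smul_induction_on (p := fun y => g y ∈ I ^ k • I • (⊤ : Submodule R M))
        (ih x) (fun r hr y _ => ?_) (fun x y hx hy => ?_)
      · rw [map_smul]
        refine Submodule.smul_mem_smul hr ?_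
        have := neg_mem (hf y)
        rwa [neg_sub] at this
      · rw [map_add]
        exact add_mem hx hy
  have hnil : IsNilpotent g := ⟨n, LinearMap.ext fun x => by
    have := hg n x
    rwa [hI, Submodule.bot_smul, Submodule.mem_bot] at this⟩
  have hu : IsUnit f := by
    have := hnil.isUnit_one_sub
    rwa [sub_sub_cancel] at this
  exact (Module.End.isUnit_iff f).1 hu

end Coefficients

/-! ## The augmentation ideal -/

section Augmentation
variable {K : CochainComplex (ModuleCat.{0} ℂ) ℕ} {L : DGLie K} {m : ℕ}

theorem DGLie.Rm.aug_mk (z : Form (Tot K)) (hz : z ∈ L.cocycles m) :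
    DGLie.Rm.aug (DGLie.Rm.mk z hz) = z (base 1) := rfl

theorem DGLie.Rm.mk_mul {z z' : Form (Tot K)} (hz : z ∈ L.cocycles m) (hz' : z' ∈ L.cocycles m) :
    DGLie.Rm.mk z hz * DGLie.Rm.mk z' hz' = DGLie.Rm.mk (z.conv z') (conv_mem hz hz') := rfl

theorem DGLie.Rm.aug_mul (r s : L.Rm m) :
    DGLie.Rm.aug (r * s) = DGLie.Rm.aug r * DGLie.Rm.aug s := by
  obtain ⟨z, hz, rfl⟩ := r.exists_rep
  obtain ⟨z', hz', rfl⟩ := s.exists_rep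
  rw [DGLie.Rm.mk_mul, aug_mk, aug_mk, aug_mk]
  simp [Form.conv]

theorem DGLie.Rm.aug_one : DGLie.Rm.aug (1 : L.Rm m) = 1 := by
  change Form.unit (Tot K) (base 1) = 1
  simp [Form.unit]

variable (L m) in
/-- The augmentation ideal of `R_m`. -/
def augIdeal : Ideal (L.Rm m) where
  carrier := {r | DGLie.Rm.aug r = 0}
  add_mem' := fun {r s} hr hs => by
    have hr : DGLie.Rm.aug r = 0 := hr
    have hs : DGLie.Rm.aug s = 0 := hs
    change DGLie.Rm.aug (r + s) = 0
    rw [map_add, hr, hs, add_zero]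
  zero_mem' := map_zero _
  smul_mem' := fun c r hr => by
    have hr : DGLie.Rm.aug r = 0 := hr
    change DGLie.Rm.aug (c * r) = 0
    rw [DGLie.Rm.aug_mul, hr, mul_zero]

theorem mem_augIdeal {r : L.Rm m} : r ∈ augIdeal L m ↔ DGLie.Rm.aug r = 0 := Iff.rfl

theorem sub_aug_mem {N : Type} [AddCommGroup N] [Module ℂ N] (y : L.Rm m ⊗[ℂ] N) :
    y - 1 ⊗ₜ slice DGLie.Rm.aug y ∈ augIdeal L m • (⊤ : Submodule (L.Rm m) (L.Rm m ⊗[ℂ] N)) := by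
  induction y with
  | zero => simp
  | add x y hx hy =>
    have h : x + y - 1 ⊗ₜ slice DGLie.Rm.aug (x + y) = (x - 1 ⊗ₜ slice DGLie.Rm.aug x) +
        (y - (1 : L.Rm m) ⊗ₜ slice DGLie.Rm.aug y) := by
      rw [map_add, TensorProduct.tmul_add]; abel
    rw [h]
    exact add_mem hx hy
  | tmul r n =>
    have h : r ⊗ₜ n - 1 ⊗ₜ slice DGLie.Rm.aug (r ⊗ₜ[ℂ] n) =
        (r - DGLie.Rm.aug r • (1 : L.Rm m)) • ((1 : L.Rm m) ⊗ₜ[ℂ] n) := by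
      rw [slice_tmul, TensorProduct.smul_tmul', smul_eq_mul, mul_one, TensorProduct.sub_tmul,
        TensorProduct.smul_tmul]
    rw [h]
    refine Submodule.smul_mem_smul ?_ trivial
    rw [mem_augIdeal, map_sub, map_smul, DGLie.Rm.aug_one, smul_eq_mul, mul_one, sub_self]

section Words
variable {V F : Type} [AddCommGroup V] [Module ℂ V] [AddCommGroup F] [Module ℂ F]

theorem prlen_contr_of_lenWords {j : ℕ} {w : Words V F} (hw : w ∈ lenWords V F j) :
    ∀ z : Form V, ∀ n, j ≤ n → prlen n (contr z w) = prlen n (z (base 1) • w) := by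
  induction j generalizing w with
  | zero => obtain ⟨e, rfl⟩ := hw; intro z n _; simp
  | succ j ih =>
    intro z n hn
    refine lenWords_ext (f := prlen n ∘ₗ contr z) (g := prlen n ∘ₗ (z (base 1) • LinearMap.id))
      (fun v t ht => ?_) hw
    have h : prlen n t = 0 := prlen_ne (by omega) ht
    simp only [LinearMap.comp_apply, contr_cons, map_add, ih ht _ n (by omega), map_smul, h]
    simp

theorem prlen_contr {P : V →ₗ[ℂ] V} {k : ℕ} {w : Words V F} (hw : w ∈ symUpTo P k) (z : Form V) :
    prlen k (contr z w) = prlen k (z (base 1) • w) := by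
  have := symUpTo_induction (p := LinearMap.eqLocus (prlen k ∘ₗ contr z)
    (prlen k ∘ₗ (z (base 1) • LinearMap.id))) (fun _ hj _ hw => LinearMap.mem_eqLocus.2
      (prlen_contr_of_lenWords (symWords_le_lenWords _ _ hw) z k hj)) hw
  exact LinearMap.mem_eqLocus.1 this

/-- Contraction with a form which vanishes on the empty word shortens words. -/
theorem contr_mem_lower {P : V →ₗ[ℂ] V} {k : ℕ} {w : Words V ℂ} (hw : w ∈ symUpTo P (k + 1))
    {z : Form V} (hz : z (base 1) = 0) : contr z w ∈ symUpTo P k :=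
  symUpTo_of_prlen (contr_mem z hw) (by rw [prlen_contr hw, hz, zero_smul, map_zero])

end Words

/-- Elements of powers of the augmentation ideal vanish on short words. -/
theorem augIdeal_pow (k : ℕ) {r : L.Rm m} (hr : r ∈ augIdeal L m ^ (k + 1)) :
    ∃ z hz, r = DGLie.Rm.mk z hz ∧ ∀ w ∈ symUpTo (parity K) k, z w = 0 := by
  induction k generalizing r with
  | zero =>
    rw [zero_add, pow_one] at hr
    obtain ⟨z, hz, rfl⟩ := r.exists_rep
    refine ⟨z, hz, rfl, fun w hw => ?_⟩
    have h1 := prlen_symUpTo hw 0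
    have h2 := sum_prlen hw
    rw [zero_add, Finset.sum_range_one] at h2
    rw [h2] at h1
    obtain ⟨t, rfl⟩ := h1
    have h3 : z (base 1) = 0 := hr
    have h4 : (base t : Words (Tot K) ℂ) = t • base 1 := by rw [← map_smul]; simp
    rw [h4, map_smul, h3, smul_zero]
  | succ k ih =>
    rw [pow_succ'] at hr
    refine Submodule.mul_induction_on hr (fun r hr s hs => ?_) ?_
    · obtain ⟨z, hz, rfl⟩ := r.exists_rep
      obtain ⟨z', hz', rfl, h'⟩ := ih hs
      exact ⟨_, _, DGLie.Rm.mk_mul hz hz', fun w hw => h' _ (contr_mem_lower hw hr)⟩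
    · rintro _ _ ⟨z, hz, rfl, h⟩ ⟨z', hz', rfl, h'⟩
      exact ⟨z + z', add_mem hz hz', rfl, fun w hw => by
        rw [LinearMap.add_apply, h w hw, h' w hw, add_zero]⟩

theorem augIdeal_nilpotent : augIdeal L m ^ (m + 1) = ⊥ := by
  rw [eq_bot_iff]
  intro r hr
  obtain ⟨z, hz, rfl, h⟩ := augIdeal_pow m hr
  exact DGLie.Rm.mk_eq (hz' := zero_mem _) h

end Augmentation

/-! ## Evaluation of cochains on the exponential of a tautological element -/

section Exponential
variable {K : CochainComplex (ModuleCat.{0} ℂ) ℕ} {L : DGLie K} {m : ℕ}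

theorem slice_smul {R N : Type} [CommRing R] [Algebra ℂ R] [AddCommGroup N] [Module ℂ N]
    (l : R →ₗ[ℂ] ℂ) (r : R) (y : R ⊗[ℂ] N) :
    slice l (r • y) = slice (l ∘ₗ LinearMap.mulLeft ℂ r) y := by
  induction y with
  | zero => simp
  | add x y hx hy => simp only [smul_add, map_add, hx, hy]
  | tmul s n => simp [TensorProduct.smul_tmul']

/-- Put the letters of an element with coefficients in `R_m` in front of words. -/
abbrev consR (ψ : L.Rm m ⊗[ℂ] K.X 1) :
    L.Rm m ⊗[ℂ] Words (Tot K) ℂ →ₗ[ℂ] L.Rm m ⊗[ℂ] Words (Tot K) ℂ := opR (cons ∘ₗ hom K 1) ψ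

theorem phiPow_succ (φ : L.Rm m ⊗[ℂ] K.X 1) (k : ℕ) :
    phiPow φ (k + 1) = consR φ (phiPow φ k) := rfl

/-- The element `1 + φ + φφ + ⋯` of `R_m ⊗ T(g)`. -/
def expo (φ : L.Rm m ⊗[ℂ] K.X 1) : L.Rm m ⊗[ℂ] Words (Tot K) ℂ :=
  ∑ k ∈ Finset.range (m + 1), phiPow φ k

theorem slice_consR_mem {S : Submodule ℂ (Words (Tot K) ℂ)} {y : L.Rm m ⊗[ℂ] Words (Tot K) ℂ}
    (hy : ∀ l : L.Rm m →ₗ[ℂ] ℂ, slice l y ∈ S) (ψ : L.Rm m ⊗[ℂ] K.X 1) (l : L.Rm m →ₗ[ℂ] ℂ) :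
    slice l (consR ψ y) ∈ Submodule.map₂ cons ⊤ S := by
  induction ψ with
  | zero => simp
  | add ψ ψ' h h' =>
    rw [consR, map_add, LinearMap.add_apply, map_add]
    exact add_mem h h'
  | tmul r v =>
    rw [opR_tmul_left, slice_smul, slice_lTensor]
    exact Submodule.apply_mem_map₂ _ trivial (hy _)

theorem swapHead_consR (φ ψ : L.Rm m ⊗[ℂ] K.X 1) (y : L.Rm m ⊗[ℂ] Words (Tot K) ℂ) :
    LinearMap.lTensor _ (swapHead (parity K)) (consR φ (consR ψ y)) = consR ψ (consR φ y) := by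
  induction φ with
  | zero => simp
  | add φ φ' h h' => simp only [map_add, LinearMap.add_apply, h, h']
  | tmul r v =>
    induction ψ with
    | zero => simp
    | add φ φ' h h' => simp only [map_add, LinearMap.add_apply, h, h']
    | tmul s u =>
      have h : (swapHead (parity K) ∘ₗ cons (hom K 1 v)) ∘ₗ cons (hom K 1 u) =
          (cons (hom K 1 u) ∘ₗ cons (hom K 1 v) : Words (Tot K) ℂ →ₗ[ℂ] _) :=
        LinearMap.ext fun w => by
          simp only [LinearMap.comp_apply, swapHead_cons_cons, parity, scale_hom]
          norm_num
          module
      simp only [opR_tmul_left, lTensor_lsmul, LinearMap.comp_apply,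
        ← LinearMap.lTensor_comp_apply, ← LinearMap.comp_assoc, h]
      rw [smul_comm]

theorem slice_phiPow (φ : L.Rm m ⊗[ℂ] K.X 1) (k : ℕ) (l : L.Rm m →ₗ[ℂ] ℂ) :
    slice l (phiPow φ k) ∈ symWords (parity K) k := by
  induction k generalizing l with
  | zero =>
    exact ⟨l 1, by simp [phiPow, ← map_smul]⟩
  | succ k ih =>
    have h := slice_consR_mem (fun l => ih l) φ l
    cases k with
    | zero => exact h
    | succ k =>
      refine ⟨h, ?_⟩
      refine LinearMap.mem_ker.2 ?_
      rw [LinearMap.sub_apply, LinearMap.id_apply, sub_eq_zero, ← slice_lTensor,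
        phiPow_succ, phiPow_succ, swapHead_consR]

theorem slice_expo (φ : L.Rm m ⊗[ℂ] K.X 1) (l : L.Rm m →ₗ[ℂ] ℂ) :
    slice l (expo φ) ∈ symUpTo (parity K) m := by
  rw [expo, map_sum]
  exact sum_mem fun k hk => symWords_le (by simpa [Nat.lt_succ_iff] using hk) (slice_phiPow φ k l)

section Nilpotent
variable {φ : L.Rm m ⊗[ℂ] K.X 1}

theorem IsTautological.mem (hφ : IsTautological φ) : φ ∈ augIdeal L m • (⊤ : Submodule (L.Rm m) _) := by
  have h : slice DGLie.Rm.aug φ = 0 := by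
    have key : (TensorProduct.lid ℂ (K.X 1)).toLinearMap ∘ₗ
        LinearMap.rTensor (K.X 1) (DGLie.Rm.aug : L.Rm m →ₗ[ℂ] ℂ) = slice DGLie.Rm.aug :=
      TensorProduct.ext' fun r n => by simp
    rw [← key, LinearMap.comp_apply, hφ.aug, map_zero]
  have := sub_aug_mem φ
  rwa [h, TensorProduct.tmul_zero, sub_zero] at this

variable (hφ : φ ∈ augIdeal L m • (⊤ : Submodule (L.Rm m) (L.Rm m ⊗[ℂ] K.X 1)))
include hφ

theorem consR_mem {k : ℕ} {y : L.Rm m ⊗[ℂ] Words (Tot K) ℂ}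
    (hy : y ∈ augIdeal L m ^ k • (⊤ : Submodule (L.Rm m) _)) :
    consR φ y ∈ augIdeal L m ^ (k + 1) • (⊤ : Submodule (L.Rm m) _) := by
  rw [pow_succ']
  exact opR_mem _ hφ hy

theorem phiPow_mem (k : ℕ) :
    phiPow φ k ∈ augIdeal L m ^ k • (⊤ : Submodule (L.Rm m) (L.Rm m ⊗[ℂ] Words (Tot K) ℂ)) := by
  induction k with
  | zero => rw [pow_zero, Ideal.one_eq_top]; exact mem_top_smul _
  | succ k ih => exact consR_mem hφ ih

theorem expo_eq : expo φ = 1 ⊗ₜ base 1 + consR φ (expo φ) := by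
  have h : phiPow φ (m + 1) = 0 := by
    have := phiPow_mem hφ (m + 1)
    rwa [augIdeal_nilpotent, Submodule.bot_smul, Submodule.mem_bot] at this
  have h1 : expo φ = ∑ k ∈ Finset.range (m + 2), phiPow φ k := by
    rw [Finset.sum_range_succ, h, add_zero]; rfl
  conv_lhs => rw [h1, Finset.sum_range_succ']
  rw [expo, map_sum, add_comm]
  rfl

theorem lTensor_headAct_expo {A A' : Type} [AddCommGroup A] [Module ℂ A] [AddCommGroup A']
    [Module ℂ A'] (a : Tot K →ₗ[ℂ] A →ₗ[ℂ] A') (c : Words (Tot K) ℂ →ₗ[ℂ] A) :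
    LinearMap.lTensor _ (headAct a c) (expo φ) =
      opR (a ∘ₗ hom K 1) φ (LinearMap.lTensor _ c (expo φ)) := by
  conv_lhs => rw [expo_eq hφ, map_add, LinearMap.lTensor_tmul, headAct_base, TensorProduct.tmul_zero,
    zero_add, lTensor_opR]
  rw [opR_lTensor_right]
  congr 3
  exact LinearMap.ext fun v => LinearMap.ext fun w => by simp

theorem lTensor_expo_sub_mem {A : Type} [AddCommGroup A] [Module ℂ A]
    (c : Words (Tot K) ℂ →ₗ[ℂ] A) : LinearMap.lTensor _ c (expo φ) - 1 ⊗ₜ c (base 1) ∈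
      augIdeal L m • (⊤ : Submodule (L.Rm m) (L.Rm m ⊗[ℂ] A)) := by
  rw [expo_eq hφ, map_add, LinearMap.lTensor_tmul, add_sub_cancel_left]
  refine lTensor_mem _ ?_
  have := opR_mem (cons ∘ₗ hom K 1) hφ (mem_top_smul (expo φ))
  rwa [Ideal.mul_top] at this

theorem lTensor_jacobiD_expo
    (hMC : LinearMap.lTensor (L.Rm m) (dTot K ∘ₗ hom K 1) φ + (1 / 2 : ℂ) •
      TensorProduct.map₂ (LinearMap.mul ℂ (L.Rm m)) (L.br.compl₁₂ (hom K 1) (hom K 1)) φ φ = 0) :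
    LinearMap.lTensor _ L.jacobiD (expo φ) = 0 := by
  let B : K.X 1 →ₗ[ℂ] Words (Tot K) ℂ →ₗ[ℂ] Words (Tot K) ℂ := combine L.half 0 ∘ₗ hom K 1
  have h1 : ∀ ψ y, LinearMap.lTensor (L.Rm m) L.jacobiD (consR ψ y) =
      opR cons (LinearMap.lTensor _ (dTot K ∘ₗ hom K 1) ψ) y + opR B ψ y +
        consR ψ (LinearMap.lTensor _ L.jacobiD y) := by
    intro ψ y
    rw [lTensor_opR, opR_lTensor_left, opR_lTensor_right]
    have : (cons ∘ₗ hom K 1).compr₂ L.jacobiD = cons ∘ₗ (dTot K ∘ₗ hom K 1) + B +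
        (cons ∘ₗ hom K 1).compl₂ L.jacobiD := LinearMap.ext fun v => LinearMap.ext fun w => by
      simp [jacobiD_cons, B, parity]
    rw [this]
    rw [opR_add_form, opR_add_form]
  have h2 : opR B φ (expo φ) = (1 / 2 : ℂ) • opR cons
      (opR (L.br.compl₁₂ (hom K 1) (hom K 1)) φ φ) (expo φ) := by
    conv_lhs => rw [expo_eq hφ, map_add, opR_one_right]
    have hB : B.flip (base 1) = 0 := LinearMap.ext fun v => by simp [B]
    rw [hB, LinearMap.lTensor_zero, LinearMap.zero_apply, zero_add,
      opR_opR B (cons ∘ₗ hom K 1) cons ((1 / 2 : ℂ) • L.br.compl₁₂ (hom K 1) (hom K 1))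
        (fun v u w => by simp [B, DGLie.half, parity])]
    rw [opR_smul_form, map_smul, LinearMap.smul_apply]
  have h3 : LinearMap.lTensor _ L.jacobiD (expo φ) =
      consR φ (LinearMap.lTensor _ L.jacobiD (expo φ)) := by
    conv_lhs => rw [expo_eq hφ, map_add, LinearMap.lTensor_tmul, jacobiD_base,
      TensorProduct.tmul_zero, zero_add, h1, h2]
    rw [← LinearMap.smul_apply, ← map_smul, ← LinearMap.add_apply, ← map_add]
    have : LinearMap.lTensor (L.Rm m) (dTot K ∘ₗ hom K 1) φ +
        (1 / 2 : ℂ) • opR (L.br.compl₁₂ (hom K 1) (hom K 1)) φ φ = 0 := hMC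
    rw [this, map_zero, LinearMap.zero_apply, zero_add]
  refine eq_zero_of_mem_pow augIdeal_nilpotent fun k => ?_
  induction k with
  | zero => rw [pow_zero, Ideal.one_eq_top]; exact mem_top_smul _
  | succ k ih =>
    rw [h3]
    exact consR_mem hφ ih

omit hφ in
theorem evalForm_smul (z : Form (Tot K)) (r : L.Rm m) (y : L.Rm m ⊗[ℂ] Words (Tot K) ℂ) :
    evalForm z (r • y) = r * evalForm z y := by
  induction y with
  | zero => simp
  | add x y hx hy => simp only [smul_add, map_add, hx, hy, mul_add]
  | tmul s w =>
    change z w • (r * s) = r * z w • s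
    rw [mul_smul_comm]

/-- The exponential is group-like. -/
theorem lTensor_contr_expo (z : Form (Tot K)) :
    LinearMap.lTensor _ (contr z) (expo φ) = evalForm z (expo φ) • expo φ := by
  have key : ∀ k, ∀ z : Form (Tot K), LinearMap.lTensor _ (contr z) (expo φ) -
      evalForm z (expo φ) • expo φ ∈ augIdeal L m ^ k • (⊤ : Submodule (L.Rm m) _) := by
    intro k
    induction k with
    | zero => intro z; rw [pow_zero, Ideal.one_eq_top]; exact mem_top_smul _
    | succ k ih =>
      intro z
      have h1 : LinearMap.lTensor _ (contr z) (expo φ) - evalForm z (expo φ) • expo φ =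
          LinearMap.lTensor _ (contr z) (consR φ (expo φ)) - z (base 1) • consR φ (expo φ) -
            evalForm z (consR φ (expo φ)) • expo φ := by
        have e1 : LinearMap.lTensor _ (contr z) (expo φ) = z (base 1) • (1 ⊗ₜ base 1) +
            LinearMap.lTensor _ (contr z) (consR φ (expo φ)) := by
          conv_lhs => rw [expo_eq hφ, map_add, LinearMap.lTensor_tmul, contr_base,
            TensorProduct.tmul_smul]
        have e2 : evalForm z (expo φ) = z (base 1) • 1 + evalForm z (consR φ (expo φ)) := by
          conv_lhs => rw [expo_eq hφ, map_add]
          rfl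
        have e3 : z (base 1) • expo φ = z (base 1) • (1 ⊗ₜ base 1) +
            z (base 1) • consR φ (expo φ) := by
          conv_lhs => rw [expo_eq hφ, smul_add]
        rw [e1, e2, add_smul, smul_assoc, one_smul, e3]
        abel
      rw [h1, pow_succ']
      refine Submodule.smul_induction_on (p := fun ψ =>
        LinearMap.lTensor _ (contr z) (consR ψ (expo φ)) - z (base 1) • consR ψ (expo φ) -
            evalForm z (consR ψ (expo φ)) • expo φ ∈
          (augIdeal L m * augIdeal L m ^ k) • (⊤ : Submodule (L.Rm m) _)) hφ
        (fun r hr ψ hψ => ?_) (fun ψ ψ' h h' => ?_)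
      · rw [opR_smul_left, lTensor_lsmul, smul_comm (z (base 1)), evalForm_smul, mul_smul r,
          ← smul_sub, ← smul_sub, Submodule.mul_smul]
        refine Submodule.smul_mem_smul hr ?_
        clear hψ
        induction ψ with
        | zero => simp
        | add ψ ψ' h h' =>
          have := add_mem h h'
          simp only [map_add, LinearMap.add_apply, smul_add, add_smul]
          convert this using 1
          abel
        | tmul s v =>
          have h2 : LinearMap.lTensor _ (contr z) (consR (s ⊗ₜ v) (expo φ)) -
              z (base 1) • consR (s ⊗ₜ v) (expo φ) - evalForm z (consR (s ⊗ₜ v) (expo φ)) • expo φ =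
              s • (LinearMap.lTensor _ (contr (z.shift (hom K 1 v))) (expo φ) -
                evalForm (z.shift (hom K 1 v)) (expo φ) • expo φ) := by
            have e1 : ∀ y : L.Rm m ⊗[ℂ] Words (Tot K) ℂ, LinearMap.lTensor _ (contr z)
                (LinearMap.lTensor _ (cons (hom K 1 v)) y) =
                z (base 1) • LinearMap.lTensor _ (cons (hom K 1 v)) y +
                  LinearMap.lTensor _ (contr (z.shift (hom K 1 v))) y := by
              intro y
              have : contr z ∘ₗ cons (hom K 1 v) = z (base 1) • cons (hom K 1 v) +
                  (contr (z.shift (hom K 1 v)) : Words (Tot K) ℂ →ₗ[ℂ] _) :=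
                LinearMap.ext fun w => by simp
              rw [← LinearMap.lTensor_comp_apply, this, LinearMap.lTensor_add,
                LinearMap.lTensor_smul]
              rfl
            have e2 : ∀ y : L.Rm m ⊗[ℂ] Words (Tot K) ℂ,
                evalForm z (LinearMap.lTensor _ (cons (hom K 1 v)) y) =
                  evalForm (z.shift (hom K 1 v)) y := by
              intro y
              induction y with
              | zero => simp
              | add x y hx hy => simp only [map_add, hx, hy]
              | tmul r w => rfl
            rw [opR_tmul_left, lTensor_lsmul, evalForm_smul, smul_sub, mul_smul]
            change s • LinearMap.lTensor _ (contr z)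
                (LinearMap.lTensor _ (cons (hom K 1 v)) (expo φ)) -
              z (base 1) • s • LinearMap.lTensor _ (cons (hom K 1 v)) (expo φ) -
              s • evalForm z (LinearMap.lTensor _ (cons (hom K 1 v)) (expo φ)) • expo φ = _
            rw [e1, e2, smul_add, smul_comm s (z (base 1))]
            abel
          rw [h2]
          exact Submodule.smul_mem _ _ (ih _)
      · have := add_mem h h'
        simp only [map_add, LinearMap.add_apply, smul_add, add_smul]
        convert this using 1
        abel
  exact sub_eq_zero.1 (eq_zero_of_mem_pow augIdeal_nilpotent fun k => key k z)

end Nilpotent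

section Evaluation
variable {φ : L.Rm m ⊗[ℂ] K.X 1} (hφ : IsTautological φ)
include hφ

theorem IsTautological.evalForm_expo (z : Form (Tot K)) (hz : z ∈ L.cocycles m) :
    evalForm z (expo φ) = DGLie.Rm.mk z hz := by
  rw [expo, map_sum, hφ.kodairaSpencer z hz]

theorem IsTautological.lTensor_cochB {A : Type} [AddCommGroup A] [Module ℂ A]
    {a : Tot K →ₗ[ℂ] A →ₗ[ℂ] A} (ha : ActZero L a) {c : Words (Tot K) ℂ →ₗ[ℂ] A}
    (hc : c ∈ cochB L m 0 0 a) : LinearMap.lTensor _ c (expo φ) = 0 := by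
  obtain ⟨b, -, hb⟩ := hc
  have h1 : LinearMap.lTensor _ (c - (b ∘ₗ L.jacobiD + headAct a b)) (expo φ) = 0 :=
    lTensor_eq_zero (S := symUpTo (parity K) m) (fun w hw => by
      rw [LinearMap.sub_apply, hb w hw, cochDPrev_apply]
      simp) (slice_expo φ)
  have h2 : a ∘ₗ hom K 1 = 0 := LinearMap.ext fun x => ha.zero 1 x one_ne_zero
  rw [LinearMap.lTensor_sub, LinearMap.lTensor_add, LinearMap.sub_apply, LinearMap.add_apply,
    LinearMap.lTensor_comp_apply, lTensor_jacobiD_expo hφ.mem hφ.maurerCartan,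
    lTensor_headAct_expo hφ.mem, h2] at h1
  simpa using h1

/-- The evaluation of cochains on the exponential of a tautological element. -/
def IsTautological.eval {A : Type} [AddCommGroup A] [Module ℂ A]
    {a : Tot K →ₗ[ℂ] A →ₗ[ℂ] A} (ha : ActZero L a) :
    CochH L m 0 0 a →ₗ[L.Rm m] L.Rm m ⊗[ℂ] A where
  toFun := Submodule.liftQ _ ((LinearMap.lTensorHom (L.Rm m)).flip (expo φ) ∘ₗ
    (cochZ L m 0 0 a).subtype) fun c hc => hφ.lTensor_cochB ha hc
  map_add' := map_add _
  map_smul' r x := by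
    obtain ⟨z, hz, rfl⟩ := r.exists_rep
    obtain ⟨c, hc, rfl⟩ := cls_rep x
    change LinearMap.lTensor _ (c ∘ₗ contr z) (expo φ) =
      DGLie.Rm.mk z hz • LinearMap.lTensor _ c (expo φ)
    rw [LinearMap.lTensor_comp_apply, lTensor_contr_expo hφ.mem, hφ.evalForm_expo z hz,
      lTensor_lsmul]

theorem IsTautological.eval_cls {A : Type} [AddCommGroup A] [Module ℂ A]
    {a : Tot K →ₗ[ℂ] A →ₗ[ℂ] A} (ha : ActZero L a) (c : Words (Tot K) ℂ →ₗ[ℂ] A)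
    (hc : c ∈ cochZ L m 0 0 a) :
    hφ.eval ha (cls _ c hc) = LinearMap.lTensor _ c (expo φ) := rfl

end Evaluation

/-- The differential `∂ + φ` from degree `p` to degree `p + 1`. -/
def tensD (φ : L.Rm m ⊗[ℂ] K.X 1) (E : DGMod L) (p : ℕ) :
    L.Rm m ⊗[ℂ] E.cx.X p →ₗ[L.Rm m] L.Rm m ⊗[ℂ] E.cx.X (p + 1) where
  toFun x := LinearMap.lTensor _ (E.cx.d p (p + 1)).hom x + opR (E.aComp p (p + 1) ∘ₗ hom K 1) φ x
  map_add' x y := by simp only [map_add]; abel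
  map_smul' r x := by simp only [lTensor_lsmul, opR_smul_right, smul_add, RingHom.id_apply]

theorem tensD_apply (φ : L.Rm m ⊗[ℂ] K.X 1) (E : DGMod L) (p : ℕ) (x : L.Rm m ⊗[ℂ] E.cx.X p) :
    tensD φ E p x =
      LinearMap.lTensor _ (E.cx.d p (p + 1)).hom x + opR (E.aComp p (p + 1) ∘ₗ hom K 1) φ x := rfl

theorem IsTautological.eval_LmD {φ : L.Rm m ⊗[ℂ] K.X 1} (hφ : IsTautological φ) (E : DGMod L)
    (p : ℕ) (x : LmX L m E p) : hφ.eval (actZero_aComp E (p + 1)) (LmD m E p x) =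
      tensD φ E p (hφ.eval (actZero_aComp E p) x) := by
  obtain ⟨c, hc, rfl⟩ := CochH.exists_rep x
  change LinearMap.lTensor _ (E.hd p c) (expo φ) = tensD φ E p (LinearMap.lTensor _ c (expo φ))
  have : E.hd p c = (E.cx.d p (p + 1)).hom ∘ₗ c + headAct (E.aComp p (p + 1)) c := rfl
  rw [this, LinearMap.lTensor_add, LinearMap.add_apply, LinearMap.lTensor_comp_apply,
    lTensor_headAct_expo hφ.mem, tensD_apply]

theorem IsTautological.eval_push {φ : L.Rm m ⊗[ℂ] K.X 1} (hφ : IsTautological φ) {E E' : DGMod L}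
    (f : E ⟶ E') (p : ℕ) (x : LmX L m E p) :
    hφ.eval (actZero_aComp E' p) (((LmFun L m p).map f).hom x) =
      LinearMap.lTensor _ (f.map.f p).hom (hφ.eval (actZero_aComp E p) x) := by
  obtain ⟨c, hc, rfl⟩ := CochH.exists_rep x
  change LinearMap.lTensor _ ((f.map.f p).hom ∘ₗ c) (expo φ) = _
  rw [LinearMap.lTensor_comp_apply]
  rfl

/-- The kernel of `∂ + φ` in degree `0`, in terms of the components of the action. -/
theorem mem_defKer (φ : L.Rm m ⊗[ℂ] K.X 1) (E : DGMod L) (x : L.Rm m ⊗[ℂ] E.cx.X 0) :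
    x ∈ defKer φ E ↔ tensD φ E 0 x = 0 := by
  have h : defD φ E (LinearMap.lTensor _ (hom E.cx 0) x) =
      LinearMap.lTensor _ (hom E.cx 1) (tensD φ E 0 x) := by
    have h1 : E.rep.act.compl₁₂ (hom K 1) (hom E.cx 0) =
        (E.aComp 0 1 ∘ₗ hom K 1).compr₂ (hom E.cx 1) :=
      LinearMap.ext fun v => LinearMap.ext fun e => (E.hom_aComp (i := 1) (by omega) v e).symm
    have h2 : dTot E.cx ∘ₗ hom E.cx 0 = hom E.cx 1 ∘ₗ (E.cx.d 0 1).hom :=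
      LinearMap.ext fun e => dTot_hom 0 e
    have h3 : tensD φ E 0 x = LinearMap.lTensor _ (E.cx.d 0 1).hom x +
      opR (E.aComp 0 1 ∘ₗ hom K 1) φ x := rfl
    rw [h3, map_add, lTensor_opR, ← h1, defD, LinearMap.add_apply,
      ← LinearMap.lTensor_comp_apply, ← LinearMap.lTensor_comp_apply, h2]
    congr 1
    exact opR_lTensor_right (E.rep.act ∘ₗ hom K 1) (hom E.cx 0) φ x
  change defD φ E (LinearMap.lTensor _ (hom E.cx 0) x) = 0 ↔ _
  rw [h]
  refine ⟨fun h0 => ?_, fun h0 => by rw [h0, map_zero]⟩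
  have h3 := congrArg (LinearMap.lTensor (L.Rm m) (comp E.cx 1)) h0
  have h4 : comp E.cx 1 ∘ₗ hom E.cx 1 = LinearMap.id := LinearMap.ext (comp_hom_self 1)
  rwa [map_zero, ← LinearMap.lTensor_comp_apply, h4, LinearMap.lTensor_id] at h3

end Exponential

/-! ## The tautological element of a contraction -/

section Deconcatenation
variable {V F : Type} [AddCommGroup V] [Module ℂ V] [AddCommGroup F] [Module ℂ F]

/-- The part with one letter of a word with trivial coefficients. -/
def letter : Words V ℂ →ₗ[ℂ] V := wcases 0 (LinearMap.smulRightₗ coeff)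

@[simp] theorem letter_base (t : ℂ) : letter (base t : Words V ℂ) = 0 := by simp [letter]

@[simp] theorem letter_cons (v : V) (w : Words V ℂ) : letter (cons v w) = coeff w • v := by
  simp [letter]

theorem letter_mapLetters (p : V →ₗ[ℂ] V) (w : Words V ℂ) :
    letter (mapLetters p w) = p (letter w) := by
  have h : coeff ∘ₗ mapLetters p = (coeff : Words V ℂ →ₗ[ℂ] ℂ) :=
    hom_ext (by simp) (by simp)
  have : letter ∘ₗ mapLetters p = p ∘ₗ letter := hom_ext (by simp) fun v w _ => by
    have := LinearMap.congr_fun h w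
    simp only [LinearMap.comp_apply] at this
    simp [this]
  exact LinearMap.congr_fun this w

/-- Deconcatenation of a word as an element of a tensor product. -/
theorem exists_deconc (w : Words V F) : ∃ t : Words V ℂ ⊗[ℂ] Words V F,
    (∀ y : Form V, contr y w = slice y t) ∧
      w = base (coeff w) + TensorProduct.lift (cons ∘ₗ letter) t := by
  refine words_induction (p := fun w => ∃ t : Words V ℂ ⊗[ℂ] Words V F,
    (∀ y : Form V, contr y w = slice y t) ∧
      w = base (coeff w) + TensorProduct.lift (cons ∘ₗ letter) t) ?_ ?_ ?_ ?_ w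
  · intro e
    exact ⟨base 1 ⊗ₜ base e, fun y => by simp, by simp⟩
  · rintro v w ⟨t, h1, h2⟩
    refine ⟨base 1 ⊗ₜ cons v w + LinearMap.rTensor _ (cons v) t, fun y => ?_, ?_⟩
    · have : ∀ t : Words V ℂ ⊗[ℂ] Words V F,
          slice (y.shift v) t = slice y (LinearMap.rTensor _ (cons v) t) := fun t => by
        induction t with
        | zero => simp
        | add x y hx hy => simp only [map_add, hx, hy]
        | tmul x y => rfl
      rw [contr_cons, h1, map_add, this]
      rfl
    · have : ∀ t : Words V ℂ ⊗[ℂ] Words V F, TensorProduct.lift (cons ∘ₗ letter)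
          (LinearMap.rTensor _ (cons v) t) = cons v (slice coeff t) := fun t => by
        induction t with
        | zero => simp
        | add x y hx hy => simp only [map_add, hx, hy]
        | tmul x y => simp
      have h3 : slice coeff t = w := by
        rw [← contr_unit w, h1]; rfl
      rw [map_add, this, h3]
      simp
  · exact ⟨0, by simp, by simp⟩
  · rintro w w' ⟨t, h1, h2⟩ ⟨t', h1', h2'⟩
    refine ⟨t + t', fun y => by rw [map_add, map_add, h1, h1'], ?_⟩
    rw [map_add, map_add, map_add]
    nth_rewrite 1 [h2, h2']
    abel

end Deconcatenation

section Tautological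
variable {K : CochainComplex (ModuleCat.{0} ℂ) ℕ} {T : Contraction K} {L : DGLie K} {m : ℕ}

theorem part_eq (i : ℕ) (v : Tot K) : part K i v = hom K i (comp K i v) := by
  refine tot_induction (p := fun v => part K i v = hom K i (comp K i v)) (fun j x => ?_)
    (fun x y hx hy => by simp only [map_add, hx, hy]) v
  by_cases h : j = i
  · subst h; simp [part, comp_hom_self]
  · simp [part, h, comp_hom_ne h]

theorem coeff_jacobiD (w : Words (Tot K) ℂ) : coeff (L.jacobiD w) = 0 := by
  have h0 : ∀ v, coeff ∘ₗ combine L.half (0 : Tot K →ₗ[ℂ] ℂ →ₗ[ℂ] ℂ) v = 0 := fun v =>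
    hom_ext (by simp) (by simp)
  have : coeff ∘ₗ L.jacobiD = 0 := hom_ext (by simp [jacobiD_base]) fun v w _ => by
    have := LinearMap.congr_fun (h0 v) w
    simp only [LinearMap.comp_apply] at this
    simp [jacobiD_cons, this]
  exact LinearMap.congr_fun this w

theorem letter_jacobiD (w : Words (Tot K) ℂ) :
    letter (L.jacobiD w) = dTot K (letter w) + headAct L.half letter w := by
  have h0 : ∀ v, letter ∘ₗ combine L.half (0 : Tot K →ₗ[ℂ] ℂ →ₗ[ℂ] ℂ) v = L.half v ∘ₗ letter :=
    fun v => hom_ext (by simp) (by simp)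
  have : letter ∘ₗ L.jacobiD = dTot K ∘ₗ letter + headAct L.half letter :=
    hom_ext (by simp [jacobiD_base]) fun v w _ => by
      have := LinearMap.congr_fun (h0 v) w
      simp only [LinearMap.comp_apply] at this
      simp [jacobiD_cons, this, coeff_jacobiD]
  exact LinearMap.congr_fun this w

/-- The value of an element of `R_m` on a harmonic cycle. -/
def pairing (w : T.core L m) : L.Rm m →ₗ[ℂ] ℂ :=
  Submodule.liftQ _ (LinearMap.applyₗ (w : Words (Tot K) ℂ) ∘ₗ (L.cocycles m).subtype)
    fun _ hz => actZero_zero.coboundary_core (mem_coboundaries_iff.1 hz) w.2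

@[simp] theorem pairing_mk (w : T.core L m) (z : Form (Tot K)) (hz : z ∈ L.cocycles m) :
    pairing w (DGLie.Rm.mk z hz) = z w := rfl

theorem pairing_mulLeft (w : T.core L m) (z : Form (Tot K)) (hz : z ∈ L.cocycles m) :
    pairing w ∘ₗ LinearMap.mulLeft ℂ (DGLie.Rm.mk z hz) = pairing ⟨contr z w, contr_core z w.2⟩ := by
  refine LinearMap.ext fun r => ?_
  obtain ⟨z', hz', rfl⟩ := r.exists_rep
  rfl

variable (T L m) in
/-- A basis of the harmonic cycles, with cocycles representing the dual basis. -/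
structure CoreBasis where
  /-- the number of elements -/
  n : ℕ
  /-- the basis -/
  c : Fin n → T.core L m
  /-- the dual basis -/
  z : Fin n → Form (Tot K)
  mem : ∀ i, z i ∈ L.cocycles m
  sum_eq : ∀ w : T.core L m, ∑ i, z i w • c i = w

variable (T L m) in
theorem exists_coreBasis : Nonempty (CoreBasis T L m) := by
  let b := Module.finBasis ℂ (T.core L m)
  choose z hz h using fun i => actZero_zero.exists_cocycle (L := L) (m := m) T (b.coord i)
  exact ⟨⟨_, b, z, fun i => mem_cocycles_iff.2 (hz i), fun w => by
    conv_rhs => rw [← b.sum_repr w]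
    exact Finset.sum_congr rfl fun i _ => by rw [h]; rfl⟩⟩

namespace CoreBasis
variable (B : CoreBasis T L m)

/-- The classes of the dual basis. -/
def r (i : Fin B.n) : L.Rm m := DGLie.Rm.mk (B.z i) (B.mem i)

/-- The letters of degree `1` in the elements of the basis. -/
def v (i : Fin B.n) : K.X 1 := comp K 1 (letter (B.c i : Words (Tot K) ℂ))

theorem sum_eq' {w : Words (Tot K) ℂ} (hw : w ∈ T.core L m) :
    ∑ i, B.z i w • (B.c i : Words (Tot K) ℂ) = w := by
  have := congrArg Subtype.val (B.sum_eq ⟨w, hw⟩)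
  simpa using this

theorem sum_apply {A : Type} [AddCommGroup A] [Module ℂ A] (f : Words (Tot K) ℂ →ₗ[ℂ] A)
    {w : Words (Tot K) ℂ} (hw : w ∈ T.core L m) : ∑ i, B.z i w • f (B.c i) = f w := by
  conv_rhs => rw [← B.sum_eq' hw]
  simp

theorem sum_pairing (r : L.Rm m) : ∑ i, pairing (B.c i) r • B.r i = r := by
  obtain ⟨z, hz, rfl⟩ := r.exists_rep
  have h1 : ∑ i, pairing (B.c i) (DGLie.Rm.mk z hz) • B.r i =
      DGLie.Rm.mk (∑ i, z (B.c i) • B.z i) (sum_mem fun i _ => Submodule.smul_mem _ _ (B.mem i)) := by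
    have : (L.coboundaries m).submoduleOf (L.cocycles m) ≤
      (L.coboundaries m).submoduleOf (L.cocycles m) := le_rfl
    change ∑ i, z (B.c i) • (Submodule.mkQ _ (⟨B.z i, B.mem i⟩ : L.cocycles m)) =
      Submodule.mkQ ((L.coboundaries m).submoduleOf (L.cocycles m)) _
    simp only [← map_smul, ← map_sum]
    congr 1
    exact Subtype.ext (by simp)
  rw [h1]
  refine cls_eq.2 (mem_coboundaries_iff.2 (actZero_zero.mem_cochB T (sub_mem
    (mem_cocycles_iff.1 (sum_mem fun i _ => Submodule.smul_mem _ _ (B.mem i)))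
    (mem_cocycles_iff.1 hz)) fun w hw => ?_))
  rw [LinearMap.sub_apply, sub_eq_zero, ← B.sum_apply z hw, LinearMap.sum_apply]
  exact Finset.sum_congr rfl fun i _ => by
    rw [LinearMap.smul_apply, smul_eq_mul, smul_eq_mul, mul_comm]

section
variable {N : Type} [AddCommGroup N] [Module ℂ N]

theorem sum_slice (y : L.Rm m ⊗[ℂ] N) : ∑ i, B.r i ⊗ₜ[ℂ] slice (pairing (B.c i)) y = y := by
  induction y with
  | zero => simp
  | add x y hx hy =>
    simp only [map_add, TensorProduct.tmul_add, Finset.sum_add_distrib, hx, hy]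
  | tmul r n =>
    conv_rhs => rw [← B.sum_pairing r, TensorProduct.sum_tmul]
    exact Finset.sum_congr rfl fun i _ => by rw [slice_tmul, TensorProduct.smul_tmul]

include B in
theorem ext {y y' : L.Rm m ⊗[ℂ] N}
    (h : ∀ w : T.core L m, slice (pairing w) y = slice (pairing w) y') : y = y' := by
  rw [← B.sum_slice y, ← B.sum_slice y']
  exact Finset.sum_congr rfl fun i _ => by rw [h]

end

include B in
theorem ext_ring {r s : L.Rm m} (h : ∀ w : T.core L m, pairing w r = pairing w s) : r = s := by
  rw [← B.sum_pairing r, ← B.sum_pairing s]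
  exact Finset.sum_congr rfl fun i _ => by rw [h]

theorem hom_v (i : Fin B.n) : hom K 1 (B.v i) = letter (B.c i : Words (Tot K) ℂ) := by
  rw [v, ← part_eq, ← letter_mapLetters, core_part_one (B.c i).2]

/-- The deconcatenation of a harmonic cycle. -/
theorem expansion {w : Words (Tot K) ℂ} (hw : w ∈ T.core L m) :
    w = base (coeff w) + ∑ i, cons (hom K 1 (B.v i)) (contr (B.z i) w) := by
  obtain ⟨t, h1, h2⟩ := exists_deconc w
  have h3 : t = ∑ i, (B.c i : Words (Tot K) ℂ) ⊗ₜ contr (B.z i) w := by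
    rw [← sub_eq_zero]
    refine eq_zero_of_slice fun y => ?_
    have h4 : contr y w = contr (∑ i, y (B.c i) • B.z i) w :=
      contr_congr_core (fun w hw => by
        rw [← B.sum_apply y hw, LinearMap.sum_apply]
        exact Finset.sum_congr rfl fun i _ => by
          rw [LinearMap.smul_apply, smul_eq_mul, smul_eq_mul, mul_comm]) hw
    have h5 : contr (∑ i, y (B.c i) • B.z i) w = ∑ i, y (B.c i) • contr (B.z i) w := by
      simp only [contr, LinearMap.flip_apply, map_sum, map_smul, LinearMap.sum_apply,
        LinearMap.smul_apply]
    rw [map_sub, ← h1, h4, h5, map_sum, sub_eq_zero]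
    rfl
  conv_lhs => rw [h2, h3, map_sum]
  congr 1
  exact Finset.sum_congr rfl fun i _ => by rw [B.hom_v]; rfl

/-- The tautological element. -/
def phi : L.Rm m ⊗[ℂ] K.X 1 := ∑ i, B.r i ⊗ₜ B.v i

theorem opR_phi {N N' : Type} [AddCommGroup N] [Module ℂ N] [AddCommGroup N'] [Module ℂ N']
    (β : K.X 1 →ₗ[ℂ] N →ₗ[ℂ] N') (y : L.Rm m ⊗[ℂ] N) (w : T.core L m) :
    slice (pairing w) (opR β B.phi y) =
      ∑ i, β (B.v i) (slice (pairing ⟨contr (B.z i) w, contr_core _ w.2⟩) y) := by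
  rw [phi, map_sum, LinearMap.sum_apply, map_sum]
  refine Finset.sum_congr rfl fun i _ => ?_
  rw [opR_tmul_left, slice_smul, slice_lTensor, r, pairing_mulLeft]

theorem slice_phi (w : T.core L m) :
    slice (pairing w) B.phi = comp K 1 (letter (w : Words (Tot K) ℂ)) := by
  rw [phi, map_sum]
  exact B.sum_apply (comp K 1 ∘ₗ letter) w.2

theorem slice_phiPow (k : ℕ) (w : T.core L m) :
    slice (pairing w) (phiPow B.phi k) = prlen k (w : Words (Tot K) ℂ) := by
  have hp : ∀ k (w : T.core L m), prlen k (w : Words (Tot K) ℂ) = prlen k (base (coeff (w :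
      Words (Tot K) ℂ))) + ∑ i, prlen k (cons (hom K 1 (B.v i)) (contr (B.z i) w)) := fun k w => by
    conv_lhs => rw [B.expansion w.2, map_add, map_sum]
  induction k generalizing w with
  | zero =>
    rw [hp]
    have h1 : pairing w (1 : L.Rm m) = coeff (w : Words (Tot K) ℂ) := rfl
    rw [phiPow, slice_tmul, h1, ← map_smul]
    simp
  | succ k ih =>
    rw [hp, phiPow_succ, consR, B.opR_phi]
    simp [ih]

theorem slice_expo (w : T.core L m) :
    slice (pairing w) (expo B.phi) = (w : Words (Tot K) ℂ) := by
  rw [expo, map_sum]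
  simp only [B.slice_phiPow]
  exact sum_prlen (mem_core.1 w.2).1

theorem pairing_evalForm (z : Form (Tot K)) (w : T.core L m) (y : L.Rm m ⊗[ℂ] Words (Tot K) ℂ) :
    pairing w (evalForm z y) = z (slice (pairing w) y) := by
  induction y with
  | zero => simp
  | add x y hx hy => simp only [map_add, hx, hy]
  | tmul r t =>
    change pairing w (z t • r) = z (pairing w r • t)
    rw [map_smul, map_smul, smul_eq_mul, smul_eq_mul, mul_comm]

theorem isTautological : IsTautological B.phi where
  aug := by
    have h : ∑ i, B.z i (base 1) • B.v i = 0 := by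
      have := B.sum_apply (comp K 1 ∘ₗ letter) (base_mem_core 1)
      simpa [v] using this
    rw [phi, map_sum]
    have h2 : ∀ i, LinearMap.rTensor (K.X 1) DGLie.Rm.aug (B.r i ⊗ₜ[ℂ] B.v i) =
        (1 : ℂ) ⊗ₜ[ℂ] (B.z i (base 1) • B.v i) := fun i => by
      rw [TensorProduct.tmul_smul, TensorProduct.smul_tmul', smul_eq_mul, mul_one]; rfl
    simp only [h2, ← TensorProduct.tmul_sum, h, TensorProduct.tmul_zero]
  maurerCartan := by
    refine B.ext fun w => ?_
    have h1 : slice (pairing w) (TensorProduct.map₂ (LinearMap.mul ℂ (L.Rm m))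
        (L.br.compl₁₂ (hom K 1) (hom K 1)) B.phi B.phi) =
        ∑ i, L.br (hom K 1 (B.v i)) (letter (contr (B.z i) (w : Words (Tot K) ℂ))) := by
      refine (B.opR_phi _ _ w).trans (Finset.sum_congr rfl fun i _ => ?_)
      rw [B.slice_phi]
      simp only [LinearMap.compl₁₂_apply]
      rw [← part_eq, ← letter_mapLetters, core_part_one (contr_core _ w.2)]
    have h2 := letter_jacobiD (L := L) (w : Words (Tot K) ℂ)
    rw [(mem_core.1 w.2).2.2.2, map_zero] at h2
    have h3 : headAct L.half letter (w : Words (Tot K) ℂ) =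
        (1 / 2 : ℂ) • ∑ i, L.br (hom K 1 (B.v i)) (letter (contr (B.z i) (w : Words (Tot K) ℂ))) := by
      conv_lhs => rw [B.expansion w.2, map_add, map_sum, headAct_base, zero_add]
      rw [Finset.smul_sum]
      exact Finset.sum_congr rfl fun i _ => by simp [DGLie.half, parity]
    rw [map_add, map_smul, h1, slice_lTensor, B.slice_phi, ← h3, LinearMap.comp_apply, ← part_eq,
      ← letter_mapLetters, core_part_one w.2, ← h2, map_zero]
  kodairaSpencer z hz := by
    refine B.ext_ring fun w => ?_
    rw [← map_sum]
    change pairing w (evalForm z (expo B.phi)) = _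
    rw [pairing_evalForm, B.slice_expo, pairing_mk]

theorem eval_bijective {A : Type} [AddCommGroup A] [Module ℂ A] {a : Tot K →ₗ[ℂ] A →ₗ[ℂ] A}
    (ha : ActZero L a) : Function.Bijective (B.isTautological.eval ha) := by
  have key : ∀ (c : Words (Tot K) ℂ →ₗ[ℂ] A) (hc : c ∈ cochZ L m 0 0 a) (w : T.core L m),
      slice (pairing w) (B.isTautological.eval ha (cls _ c hc)) = c w := fun c hc w => by
    rw [IsTautological.eval_cls, slice_lTensor, B.slice_expo]
  constructor
  · rw [injective_iff_map_eq_zero]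
    intro x hx
    obtain ⟨c, hc, rfl⟩ := CochH.exists_rep x
    refine (cls_eq (hc' := zero_mem _)).2 ?_
    rw [sub_zero]
    refine ha.mem_cochB T hc fun w hw => ?_
    rw [← key c hc ⟨w, hw⟩, hx, map_zero]
  · intro y
    obtain ⟨c, hc, h⟩ := ha.exists_cocycle (m := m) T
      { toFun := fun w => ∑ i, B.z i w • slice (pairing (B.c i)) y
        map_add' := fun w w' => by simp [add_smul, Finset.sum_add_distrib]
        map_smul' := fun t w => by simp [mul_smul, Finset.smul_sum] }
    refine ⟨cls _ c hc, B.ext fun w => ?_⟩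
    rw [key, h]
    conv_rhs => rw [← B.sum_slice y, map_sum]
    rfl

end CoreBasis

/-- Evaluation on the exponential of a tautological element is bijective. -/
theorem IsTautological.eval_bijective (T : Contraction K) {φ : L.Rm m ⊗[ℂ] K.X 1}
    (hφ : IsTautological φ) {A : Type} [AddCommGroup A] [Module ℂ A] {a : Tot K →ₗ[ℂ] A →ₗ[ℂ] A} (ha : ActZero L a) :
    Function.Bijective (hφ.eval ha) := by
  obtain ⟨B⟩ := exists_coreBasis T L m
  let e := LinearEquiv.ofBijective _ (B.eval_bijective ha)
  have h : Function.Bijective (hφ.eval ha ∘ₗ e.symm.toLinearMap) := by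
    refine bijective_of_sub_mem augIdeal_nilpotent _ fun x => ?_
    obtain ⟨y, rfl⟩ := e.surjective x
    rw [LinearMap.comp_apply, LinearEquiv.coe_coe, e.symm_apply_apply]
    obtain ⟨c, hc, rfl⟩ := CochH.exists_rep y
    change LinearMap.lTensor _ c (expo φ) - LinearMap.lTensor _ c (expo B.phi) ∈ _
    have := sub_mem (lTensor_expo_sub_mem hφ.mem c) (lTensor_expo_sub_mem B.isTautological.mem c)
    rwa [sub_sub_sub_cancel_right] at this
  have h2 : ⇑(hφ.eval ha) = (hφ.eval ha ∘ₗ e.symm.toLinearMap) ∘ e := by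
    funext x; simp
  rw [h2]
  exact h.comp e.bijective

/-! ### The kernel of the differential of `L_m` in degree `0` -/

/-- The map between terms of the complexes `L_m` induced by a map of modules. -/
def LmX.push {E E' : DGMod L} (f : E ⟶ E') (p : ℕ) : LmX L m E p →ₗ[L.Rm m] LmX L m E' p :=
  ((LmFun L m p).map f).hom

theorem LmX.push_id (E : DGMod L) (p : ℕ) (x : LmX L m E p) : LmX.push (𝟙 E) p x = x :=
  LinearMap.congr_fun (congrArg ModuleCat.Hom.hom ((LmFun L m p).map_id E)) x

theorem LmX.push_comp {E E' E'' : DGMod L} (f : E ⟶ E') (g : E' ⟶ E'') (p : ℕ)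
    (x : LmX L m E p) : LmX.push (f ≫ g) p x = LmX.push g p (LmX.push f p x) :=
  LinearMap.congr_fun (congrArg ModuleCat.Hom.hom ((LmFun L m p).map_comp f g)) x

theorem LmD_push {E E' : DGMod L} (f : E ⟶ E') (p : ℕ) (x : LmX L m E p) :
    LmD m E' p (LmX.push f p x) = LmX.push f (p + 1) (LmD m E p x) :=
  LinearMap.congr_fun (congrArg ModuleCat.Hom.hom ((LmDiff L m p).naturality f)) x

/-- The map between kernels induced by a map of modules. -/
def LmKer.push {E E' : DGMod L} (f : E ⟶ E') :
    LinearMap.ker (LmD m E 0) →ₗ[L.Rm m] LinearMap.ker (LmD m E' 0) :=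
  (LmX.push f 0).restrict fun x hx => by
    rw [LinearMap.mem_ker] at hx ⊢
    rw [LmD_push, hx, map_zero]

variable (L m) in
/-- The functor sending a module to the kernel of the first differential of `L_m`. -/
def LmKer : DGMod L ⥤ ModuleCat.{0} (L.Rm m) where
  obj E := ModuleCat.of _ (LinearMap.ker (LmD m E 0))
  map f := ModuleCat.ofHom (LmKer.push f)
  map_id E := ModuleCat.hom_ext (LinearMap.ext fun x => Subtype.ext (LmX.push_id E 0 x.1))
  map_comp f g := ModuleCat.hom_ext (LinearMap.ext fun x =>
    Subtype.ext (LmX.push_comp f g 0 x.1))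

variable (T) in
/-- The deformation defined by a tautological element in terms of the complex `L_m`. -/
def LmKerIso {φ : L.Rm m ⊗[ℂ] K.X 1} (hφ : IsTautological φ) : LmKer L m ≅ defFun φ :=
  NatIso.ofComponents (fun E => (LinearEquiv.ofBijective
    ((hφ.eval (actZero_aComp E 0)).restrict (p := LinearMap.ker (LmD m E 0)) (q := defKer φ E)
      fun x hx => by
        rw [LinearMap.mem_ker] at hx
        rw [mem_defKer, ← hφ.eval_LmD, hx, map_zero])
    ⟨fun x y h => Subtype.ext ((hφ.eval_bijective T (actZero_aComp E 0)).1
        (congrArg Subtype.val h)), fun y => by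
      obtain ⟨x, hx⟩ := (hφ.eval_bijective T (actZero_aComp E 0)).2 y.1
      refine ⟨⟨x, ?_⟩, Subtype.ext hx⟩
      rw [LinearMap.mem_ker]
      refine (hφ.eval_bijective T (actZero_aComp E 1)).1 ?_
      have := (mem_defKer φ E y.1).1 y.2
      rw [map_zero]
      rw [← hx, ← hφ.eval_LmD] at this
      exact this⟩).toModuleIso) fun {E E'} f => by
    ext x
    exact Subtype.ext (hφ.eval_push f 0 x.1)

end Tautological

/-! ## The cohomology of `K_m` in degree `0` -/

section Coefficients
variable {V F F' : Type} [AddCommGroup V] [Module ℂ V] [AddCommGroup F] [Module ℂ F]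
  [AddCommGroup F'] [Module ℂ F']

/-- Words with coefficients from words with trivial coefficients. -/
def coeffs : Words V ℂ ⊗[ℂ] F →ₗ[ℂ] Words V F :=
  TensorProduct.lift (LinearMap.mk₂ ℂ (fun w e => mapCoeff (LinearMap.toSpanSingleton ℂ F e) w)
    (fun w w' e => map_add _ _ _) (fun t w e => map_smul _ _ _)
    (fun w e e' => by
      have : mapCoeff (LinearMap.toSpanSingleton ℂ F (e + e')) =
          mapCoeff (LinearMap.toSpanSingleton ℂ F e) +
            (mapCoeff (LinearMap.toSpanSingleton ℂ F e') : Words V ℂ →ₗ[ℂ] _) :=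
        hom_ext (fun t => by simp [mapCoeff_base])
          (fun v w h => by simp only [mapCoeff_cons, h, LinearMap.add_apply, map_add])
      rw [this]; rfl)
    (fun t w e => by
      have : mapCoeff (LinearMap.toSpanSingleton ℂ F (t • e)) =
          t • (mapCoeff (LinearMap.toSpanSingleton ℂ F e) : Words V ℂ →ₗ[ℂ] _) :=
        hom_ext (fun s => by
          simp only [mapCoeff_base, LinearMap.toSpanSingleton_apply, LinearMap.smul_apply,
            ← map_smul, smul_comm s t])
          (fun v w h => by simp only [mapCoeff_cons, h, LinearMap.smul_apply, map_smul])
      rw [this]; rfl))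

theorem coeffs_tmul (w : Words V ℂ) (e : F) :
    coeffs (w ⊗ₜ e) = mapCoeff (LinearMap.toSpanSingleton ℂ F e) w := rfl

theorem mapCoeff_comp (g : F' →ₗ[ℂ] F) {F'' : Type} [AddCommGroup F''] [Module ℂ F'']
    (f : F →ₗ[ℂ] F'') (w : Words V F') : mapCoeff f (mapCoeff g w) = mapCoeff (f ∘ₗ g) w := by
  have : mapCoeff f ∘ₗ mapCoeff g = (mapCoeff (f ∘ₗ g) : Words V F' →ₗ[ℂ] _) :=
    hom_ext (fun t => by simp [mapCoeff_base]) (fun v w h => by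
      simp only [LinearMap.comp_apply] at h
      simp only [LinearMap.comp_apply, mapCoeff_cons, h])
  exact LinearMap.congr_fun this w

theorem coeff_mapCoeff (f : F →ₗ[ℂ] F') (w : Words V F) : coeff (mapCoeff f w) = f (coeff w) := by
  have : coeff ∘ₗ mapCoeff f = f ∘ₗ (coeff : Words V F →ₗ[ℂ] F) :=
    hom_ext (fun t => by simp [mapCoeff_base]) (fun v w h => by simp [mapCoeff_cons])
  exact LinearMap.congr_fun this w

theorem mapCoeff_coeffs (f : F →ₗ[ℂ] F') (t : Words V ℂ ⊗[ℂ] F) :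
    mapCoeff f (coeffs t) = coeffs (LinearMap.lTensor _ f t) := by
  induction t with
  | zero => simp
  | add x y hx hy => simp only [map_add, hx, hy]
  | tmul w e =>
    rw [coeffs_tmul, mapCoeff_comp, LinearMap.lTensor_tmul, coeffs_tmul]
    congr 2
    exact LinearMap.ext fun t => by simp

theorem coeff_contr_coeffs (y : Form V) (t : Words V ℂ ⊗[ℂ] F) :
    coeff (contr y (coeffs t)) = slice y t := by
  induction t with
  | zero => simp
  | add x y hx hy => simp only [map_add, hx, hy]
  | tmul w e =>
    rw [coeffs_tmul, ← mapCoeff_contr, coeff_mapCoeff, coeff_contr_form]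
    simp

theorem coeffs_surjective : Function.Surjective (coeffs : Words V ℂ ⊗[ℂ] F →ₗ[ℂ] Words V F) := by
  intro w
  refine words_induction (p := fun w => ∃ t, coeffs t = w) (fun e => ⟨base 1 ⊗ₜ e, ?_⟩) ?_
    ⟨0, by simp⟩ ?_ w
  · simp [coeffs_tmul, mapCoeff_base]
  · rintro v w ⟨t, rfl⟩
    refine ⟨LinearMap.rTensor _ (cons v) t, ?_⟩
    induction t with
    | zero => simp
    | add x y hx hy => simp only [map_add, hx, hy]
    | tmul w e => simp [coeffs_tmul, mapCoeff_cons]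
  · rintro w w' ⟨t, rfl⟩ ⟨t', rfl⟩
    exact ⟨t + t', map_add _ _ _⟩

theorem coeffs_injective : Function.Injective (coeffs : Words V ℂ ⊗[ℂ] F →ₗ[ℂ] Words V F) := by
  rw [injective_iff_map_eq_zero]
  intro t ht
  refine eq_zero_of_slice fun y => ?_
  rw [← coeff_contr_coeffs, ht]
  simp

theorem words_ext {w w' : Words V F}
    (h : ∀ y : Form V, coeff (contr y w) = coeff (contr y w')) : w = w' := by
  obtain ⟨t, rfl⟩ := coeffs_surjective w
  obtain ⟨t', rfl⟩ := coeffs_surjective w'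
  congr 1
  rw [← sub_eq_zero]
  refine eq_zero_of_slice fun y => ?_
  rw [map_sub, ← coeff_contr_coeffs, ← coeff_contr_coeffs, h, sub_self]

theorem mapLetters_mapCoeff (p : V →ₗ[ℂ] V) (f : F →ₗ[ℂ] F') (w : Words V F) :
    mapLetters p (mapCoeff f w) = mapCoeff f (mapLetters p w) := by
  have : mapLetters p ∘ₗ mapCoeff f = mapCoeff f ∘ₗ (mapLetters p : Words V F →ₗ[ℂ] _) :=
    hom_ext (fun t => by simp [mapCoeff_base]) (fun v w h => by
      simp only [LinearMap.comp_apply] at h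
      simp [mapCoeff_cons, h])
  exact LinearMap.congr_fun this w

end Coefficients

section CoreModule
variable {K : CochainComplex (ModuleCat.{0} ℂ) ℕ} {T : Contraction K} {L : DGLie K} {m : ℕ}

/-- The action of `R_m` on the harmonic cycles. -/
def coreAct : L.Rm m →ₗ[ℂ] T.core L m →ₗ[ℂ] T.core L m :=
  Submodule.liftQ _
    { toFun := fun z : L.cocycles m => (contr z.1).restrict (p := T.core L m) (q := T.core L m)
        fun _ hw => contr_core z.1 hw
      map_add' := fun z z' => LinearMap.ext fun w => Subtype.ext (by exact contr_add z.1 z'.1 w.1)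
      map_smul' := fun t z => LinearMap.ext fun w => Subtype.ext (by exact contr_smul t z.1 w.1) }
    fun z hz => LinearMap.ext fun w => Subtype.ext <| by
      have := contr_congr_core (y := z.1) (z := 0) (fun w hw =>
        actZero_zero.coboundary_core (mem_coboundaries_iff.1 hz) hw) w.2
      rw [contr_zero] at this
      exact this

instance : Module (L.Rm m) (T.core L m) where
  smul r w := coreAct r w
  one_smul w := Subtype.ext (contr_unit _)
  mul_smul r s w := by
    obtain ⟨z, hz, rfl⟩ := r.exists_rep
    obtain ⟨z', hz', rfl⟩ := s.exists_rep
    exact Subtype.ext ((contr_conv z z' _).trans (contr_comm_core _ _ w.2))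
  smul_zero r := map_zero _
  smul_add r := map_add _
  add_smul r s w := LinearMap.congr_fun (map_add coreAct r s) w
  zero_smul w := LinearMap.congr_fun (map_zero coreAct) w

theorem core_smul (z : Form (Tot K)) (hz : z ∈ L.cocycles m) (w : T.core L m) :
    DGLie.Rm.mk z hz • w = ⟨contr z w, contr_core z w.2⟩ := rfl

instance : IsScalarTower ℂ (L.Rm m) (T.core L m) where
  smul_assoc t r w := LinearMap.congr_fun (map_smul coreAct t r) w

instance : SMulCommClass ℂ (L.Rm m) (T.core L m) where
  smul_comm t r w := (map_smul (coreAct r) t w).symm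

theorem coeff_smul (w : T.core L m) (r : L.Rm m) :
    coeff ((r • w : T.core L m) : Words (Tot K) ℂ) = pairing w r := by
  obtain ⟨z, hz, rfl⟩ := r.exists_rep
  exact coeff_contr_form z w

/-- The differential of the tensor product of an `R_m`-module with a differential graded module,
twisted by the tautological element. -/
def CoreBasis.tensD (B : CoreBasis T L m) (M : Type) [AddCommGroup M] [Module ℂ M]
    [Module (L.Rm m) M] [IsScalarTower ℂ (L.Rm m) M] [SMulCommClass ℂ (L.Rm m) M] (E : DGMod L)
    (p : ℕ) : M ⊗[ℂ] E.cx.X p →ₗ[L.Rm m] M ⊗[ℂ] E.cx.X (p + 1) where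
  toFun t := LinearMap.lTensor M (E.cx.d p (p + 1)).hom t +
    ∑ i, B.r i • LinearMap.lTensor M (E.aComp p (p + 1) (hom K 1 (B.v i))) t
  map_add' t t' := by simp only [map_add, smul_add, Finset.sum_add_distrib]; abel
  map_smul' r t := by
    simp only [lTensor_lsmul, smul_add, Finset.smul_sum, RingHom.id_apply, smul_comm r]

theorem CoreBasis.tensD_apply (B : CoreBasis T L m) (M : Type) [AddCommGroup M] [Module ℂ M]
    [Module (L.Rm m) M] [IsScalarTower ℂ (L.Rm m) M] [SMulCommClass ℂ (L.Rm m) M] (E : DGMod L)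
    (p : ℕ) (t : M ⊗[ℂ] E.cx.X p) : B.tensD M E p t =
      LinearMap.lTensor M (E.cx.d p (p + 1)).hom t +
        ∑ i, B.r i • LinearMap.lTensor M (E.aComp p (p + 1) (hom K 1 (B.v i))) t := rfl

theorem CoreBasis.tensD_ring (B : CoreBasis T L m) (E : DGMod L) (p : ℕ)
    (t : L.Rm m ⊗[ℂ] E.cx.X p) : B.tensD (L.Rm m) E p t = JacobiModuli.tensD B.phi E p t := by
  rw [B.tensD_apply, JacobiModuli.tensD_apply, phi, map_sum, LinearMap.sum_apply]
  congr 1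
  exact Finset.sum_congr rfl fun i _ => by rw [opR_tmul_left]; rfl

variable (T L m) in
/-- Harmonic cycles with coefficients as words. -/
def coreWords (F : Type) [AddCommGroup F] [Module ℂ F] :
    T.core L m ⊗[ℂ] F →ₗ[ℂ] Words (Tot K) F :=
  coeffs ∘ₗ LinearMap.rTensor F (T.core L m).subtype

section
variable {F F' : Type} [AddCommGroup F] [Module ℂ F] [AddCommGroup F'] [Module ℂ F']

theorem coreWords_tmul (w : T.core L m) (e : F) : coreWords T L m F (w ⊗ₜ e) =
    mapCoeff (LinearMap.toSpanSingleton ℂ F e) (w : Words (Tot K) ℂ) := rfl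

theorem coreWords_injective : Function.Injective (coreWords T L m F) :=
  coeffs_injective.comp (Module.Flat.rTensor_preserves_injective_linearMap _
    (Submodule.subtype_injective _))

theorem coreWords_mem (t : T.core L m ⊗[ℂ] F) : coreWords T L m F t ∈ symUpTo (parity K) m := by
  induction t with
  | zero => simp
  | add x y hx hy => rw [map_add]; exact add_mem hx hy
  | tmul w e => exact mapCoeff_symUpTo _ _ _ (mem_core.1 w.2).1

theorem coreWords_pr (t : T.core L m ⊗[ℂ] F) :
    mapLetters T.pr (coreWords T L m F t) = coreWords T L m F t := by
  induction t with
  | zero => simp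
  | add x y hx hy => rw [map_add, map_add, hx, hy]
  | tmul w e => rw [coreWords_tmul, mapLetters_mapCoeff, (mem_core.1 w.2).2.1]

theorem mapCoeff_coreWords (f : F →ₗ[ℂ] F') (t : T.core L m ⊗[ℂ] F) :
    mapCoeff f (coreWords T L m F t) = coreWords T L m F' (LinearMap.lTensor _ f t) := by
  rw [coreWords, coreWords, LinearMap.comp_apply, LinearMap.comp_apply, mapCoeff_coeffs]
  congr 1
  rw [← LinearMap.comp_apply, LinearMap.lTensor_comp_rTensor, ← LinearMap.rTensor_comp_lTensor]
  rfl

theorem coreWords_smul (z : Form (Tot K)) (hz : z ∈ L.cocycles m) (t : T.core L m ⊗[ℂ] F) :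
    coreWords T L m F (DGLie.Rm.mk z hz • t) = contr z (coreWords T L m F t) := by
  induction t with
  | zero => simp
  | add x y hx hy => rw [smul_add, map_add, map_add, map_add, hx, hy]
  | tmul w e =>
    rw [TensorProduct.smul_tmul', core_smul, coreWords_tmul, coreWords_tmul, mapCoeff_contr]

end

namespace CoreBasis
variable (B : CoreBasis T L m)

/-- The coefficients of a tensor over the basis. -/
theorem sum_tensor {F : Type} [AddCommGroup F] [Module ℂ F] (t : T.core L m ⊗[ℂ] F) :
    ∑ i, B.c i ⊗ₜ[ℂ] slice (B.z i ∘ₗ (T.core L m).subtype) t = t := by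
  induction t with
  | zero => simp
  | add x y hx hy =>
    simp only [map_add, TensorProduct.tmul_add, Finset.sum_add_distrib, hx, hy]
  | tmul w n =>
    conv_rhs => rw [← B.sum_eq w, TensorProduct.sum_tmul]
    exact Finset.sum_congr rfl fun i _ => by rw [slice_tmul, TensorProduct.smul_tmul]; rfl

theorem coeff_jacobiD_mapCoeff (E : DGMod L) (f : ℂ →ₗ[ℂ] Tot E.cx) (u : Words (Tot K) ℂ) :
    coeff (E.jacobiD (mapCoeff f u)) =
      dTot E.cx (f (coeff u)) + E.rep.act (parity K (letter u)) (f 1) := by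
  have h0 : ∀ v, coeff ∘ₗ combine L.half (E.rep.act ∘ₗ parity K) v =
      E.rep.act (parity K v) ∘ₗ coeff := fun v => hom_ext (by simp) (by simp)
  have : coeff ∘ₗ E.jacobiD ∘ₗ mapCoeff f = dTot E.cx ∘ₗ f ∘ₗ coeff +
      E.rep.act.flip (f 1) ∘ₗ parity K ∘ₗ letter := by
    refine hom_ext (fun t => ?_) (fun v w _ => ?_)
    · simp [mapCoeff_base, DGMod.jacobiD, barD_base]
    · have h1 := LinearMap.congr_fun (h0 v) (mapCoeff f w)
      simp only [LinearMap.comp_apply] at h1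
      have h2 : f (coeff w) = coeff w • f 1 := by rw [← map_smul]; simp
      simp only [LinearMap.comp_apply, mapCoeff_cons, DGMod.jacobiD, barD_cons, map_add, coeff_cons,
        h1, coeff_mapCoeff, h2]
      simp
  exact LinearMap.congr_fun this u

theorem letter_contr (y : Form (Tot K)) (w : T.core L m) :
    letter (contr y (w : Words (Tot K) ℂ)) =
      ∑ i, y (contr (B.z i) (w : Words (Tot K) ℂ)) • hom K 1 (B.v i) := by
  rw [← B.sum_apply letter (contr_core y w.2)]
  exact Finset.sum_congr rfl fun i _ => by rw [B.hom_v, form_contr_comm _ _ w.2]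

/-- The differential of `K_m` on harmonic cycles with coefficients of degree `0`. -/
theorem jacobiD_coreWords (E : DGMod L) (t : T.core L m ⊗[ℂ] E.cx.X 0) :
    E.jacobiD (coreWords T L m _ (LinearMap.lTensor _ (hom E.cx 0) t)) =
      coreWords T L m _ (LinearMap.lTensor _ (hom E.cx 1) (B.tensD _ E 0 t)) := by
  induction t with
  | zero => simp
  | add x y hx hy => simp only [map_add, hx, hy]
  | tmul w e =>
    set f := LinearMap.toSpanSingleton ℂ (Tot E.cx) (hom E.cx 0 e)
    have hf : f 1 = hom E.cx 0 e := by simp [f]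
    have hW : mapLetters (part K 1) (mapCoeff f (w : Words (Tot K) ℂ)) = mapCoeff f w := by
      rw [mapLetters_mapCoeff, core_part_one w.2]
    rw [LinearMap.lTensor_tmul, coreWords_tmul]
    refine words_ext fun y => ?_
    have h1 := contr_barD (parity K) (dTot K) L.half (dTot E.cx) (E.rep.act ∘ₗ parity K) y
      (mapCoeff f (w : Words (Tot K) ℂ))
    rw [contr_parity_of_part_one y hW, ← mapCoeff_contr, ← mapCoeff_contr] at h1
    have h2 : y (barD (parity K) (dTot K) L.half (0 : ℂ →ₗ[ℂ] ℂ) 0 (w : Words (Tot K) ℂ)) = 0 := by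
      have := (mem_core.1 w.2).2.2.2
      rw [DGLie.jacobiD] at this
      rw [this, map_zero]
    have h3 := congrArg coeff h1
    rw [map_add, coeff_mapCoeff, coeff_contr_form, LinearMap.comp_apply, h2, map_zero, zero_add] at h3
    have h4 : E.jacobiD = barD (parity K) (dTot K) L.half (dTot E.cx) (E.rep.act ∘ₗ parity K) := rfl
    rw [h4, h3, ← h4, coeff_jacobiD_mapCoeff, coeff_contr_form, B.letter_contr, hf]
    have h5 : ∀ x : Words (Tot K) ℂ, coeff (contr y (mapCoeff (LinearMap.toSpanSingleton ℂ
        (Tot E.cx) (hom E.cx 1 ((E.cx.d 0 1).hom e))) x)) = y x • hom E.cx 1 ((E.cx.d 0 1).hom e) :=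
      fun x => by rw [← mapCoeff_contr, coeff_mapCoeff, coeff_contr_form]; rfl
    rw [B.tensD_apply, LinearMap.lTensor_tmul, map_add, map_add, map_add, map_add, map_sum, map_sum,
      map_sum, map_sum]
    congr 1
    · refine Eq.trans ?_ (h5 w).symm
      have : f (y w) = y w • f 1 := by rw [← map_smul]; simp
      rw [this, hf, map_smul, dTot_hom]
    · rw [map_sum, map_sum, LinearMap.sum_apply]
      refine Finset.sum_congr rfl fun i _ => ?_
      have h6 : parity K (hom K 1 (B.v i)) = hom K 1 (B.v i) := by simp [parity]
      rw [map_smul, map_smul, LinearMap.smul_apply, h6, LinearMap.lTensor_tmul,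
        TensorProduct.smul_tmul', LinearMap.lTensor_tmul, coreWords_tmul, ← mapCoeff_contr,
        coeff_mapCoeff, r, core_smul, coeff_contr_form]
      have h7 := E.hom_aComp (i := 1) (p := 0) (q := 1) (by omega) (B.v i) e
      rw [← h7]
      rfl

end CoreBasis
end CoreModule

/-! ## Homomorphisms from the dual of `R_m` to the cohomology of `K_m` -/

section HarmonicRepresentatives
variable {K : CochainComplex (ModuleCat.{0} ℂ) ℕ} {T : Contraction K} {L : DGLie K} {m : ℕ}

theorem derivWords_mapCoeff {V F F' : Type} [AddCommGroup V] [Module ℂ V] [AddCommGroup F]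
    [Module ℂ F] [AddCommGroup F'] [Module ℂ F'] (n : V →ₗ[ℂ] V) {ν : F' →ₗ[ℂ] F'}
    {f : F →ₗ[ℂ] F'} (h : ∀ e, ν (f e) = 0) (w : Words V F) :
    derivWords n ν (mapCoeff f w) = mapCoeff f (derivWords n 0 w) := by
  have : derivWords n ν ∘ₗ mapCoeff f = mapCoeff f ∘ₗ (derivWords n 0 : Words V F →ₗ[ℂ] _) :=
    hom_ext (fun e => by simp [mapCoeff_base, derivWords_base, h]) (fun v w h => by
      simp only [LinearMap.comp_apply] at h
      simp [mapCoeff_cons, derivWords_cons, h])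
  exact LinearMap.congr_fun this w

theorem coreWords_totDeg (E : DGMod L) (t : T.core L m ⊗[ℂ] E.cx.X 0) :
    E.totDeg (coreWords T L m _ (LinearMap.lTensor _ (hom E.cx 0) t)) = 0 := by
  induction t with
  | zero => simp
  | add x y hx hy => simp only [map_add, hx, hy, add_zero]
  | tmul w e =>
    rw [LinearMap.lTensor_tmul, coreWords_tmul, DGMod.totDeg, derivWords_mapCoeff]
    · have := (mem_core.1 w.2).2.2.1
      rw [wordDeg] at this
      rw [this, map_zero]
    · intro t
      simp [degree]

theorem lTensor_hom_injective {M : Type} [AddCommGroup M] [Module ℂ M]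
    (C : CochainComplex (ModuleCat.{0} ℂ) ℕ) (i : ℕ) :
    Function.Injective (LinearMap.lTensor M (hom C i)) :=
  Module.Flat.lTensor_preserves_injective_linearMap _ fun _ _ h => hom_injective h

theorem pr_wordD_fixed (E : DGMod L) {w : Words (Tot K) (Tot E.cx)}
    (hw : mapLetters T.pr w = w) : mapLetters T.pr (E.jacobiD w) = E.jacobiD w :=
  T.pr_wordD _ _ hw

variable (T) in
/-- Up to a boundary, a chain with harmonic boundary is harmonic. -/
theorem exists_harmonic_rep (E : DGMod L) {ρ : ℂ} {w : Words (Tot K) (Tot E.cx)}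
    (hw : w ∈ symUpTo (parity K) m) (hd : E.totDeg w = ρ • w)
    (hQ : mapLetters T.pr (E.jacobiD w) = E.jacobiD w) :
    ∃ u ∈ symUpTo (parity K) m, E.totDeg u = (ρ - 1) • u ∧
      mapLetters T.pr (w - E.jacobiD u) = w - E.jacobiD u :=
  T.t_isHtpy.exists_harmonic T.t_weight E.rep.isRep E.rep.isGraded
    (fun _ _ hw => pr_wordD_fixed E hw) hw hd hQ

theorem jacobiD_jacobiD (E : DGMod L) {w : Words (Tot K) (Tot E.cx)}
    (hw : w ∈ symUpTo (parity K) m) : E.jacobiD (E.jacobiD w) = 0 :=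
  E.rep.isRep.wordD_wordD hw

theorem totDeg_jacobiD (E : DGMod L) (w : Words (Tot K) (Tot E.cx)) :
    E.totDeg (E.jacobiD w) = E.jacobiD (E.totDeg w) + E.jacobiD w :=
  E.rep.isGraded.wordD w

/-- Harmonic boundaries vanish. -/
theorem eq_zero_of_harmonic_boundary (E : DGMod L) {w : Words (Tot K) (Tot E.cx)}
    (hw : w ∈ E.bounds m) (hpr : mapLetters T.pr w = w) : w = 0 := by
  obtain ⟨u, ⟨hu, hN⟩, rfl⟩ := hw
  have hN : E.totDeg u + u = 0 := hN
  have hN' : E.totDeg u = (-1 : ℂ) • u := by rw [neg_one_smul]; exact eq_neg_of_add_eq_zero_left hN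
  obtain ⟨u', hu', hd', hpr'⟩ := exists_harmonic_rep T E hu hN' hpr
  have hd : E.totDeg (u - E.jacobiD u') = ((-1 : ℤ) : ℂ) • (u - E.jacobiD u') := by
    rw [map_sub, totDeg_jacobiD, hd', hN', map_smul]
    push_cast
    module
  have h0 : u - E.jacobiD u' = 0 := by
    have h := nonneg_words (p := T.pr) T.part_zero_pr (nonneg_of_degree E.cx) (u - E.jacobiD u')
    rw [hpr'] at h
    exact eq_zero_of_nonneg h (by norm_num) hd
  rw [sub_eq_zero.1 h0, jacobiD_jacobiD E hu']

theorem part_zero_dTot (M : CochainComplex (ModuleCat.{0} ℂ) ℕ) (e : Tot M) :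
    part M 0 (dTot M e) = 0 := by
  have : part M 0 ∘ₗ dTot M = 0 := tot_ext fun i x => by simp [part]
  exact LinearMap.congr_fun this e

theorem part_zero_act (E : DGMod L) (v : Tot K) (e : Tot E.cx) :
    part E.cx 0 (E.rep.act (part K 1 v) e) = 0 := by
  have : (E.rep.act ∘ₗ part K 1).compr₂ (part E.cx 0) = 0 := tot_ext fun i x => by
    refine tot_ext fun j y => ?_
    by_cases hi : i = 1
    · subst hi
      obtain ⟨e', he⟩ := E.rep.act_deg 1 j x y
      simp [part, ← he]
    · simp [part, hi]
  exact LinearMap.congr_fun (LinearMap.congr_fun this v) e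

/-- The components of a harmonic cycle with coefficients. -/
theorem mapCoeff_mem_core (E : DGMod L) {y : Words (Tot K) (Tot E.cx)} (hy : y ∈ E.cycles m)
    (hpr : mapLetters T.pr y = y) (h1 : mapLetters (part K 1) y = y)
    (h0 : mapCoeff (part E.cx 0) y = y) (f : Tot E.cx →ₗ[ℂ] ℂ) : mapCoeff f y ∈ T.core L m := by
  have hl : mapLetters (part K 1) (mapCoeff f y) = mapCoeff f y := by rw [mapLetters_mapCoeff, h1]
  refine mem_core.2 ⟨mapCoeff_symUpTo _ _ _ hy.1.1, by rw [mapLetters_mapCoeff, hpr],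
    wordDeg_of_part_one hl, ?_⟩
  have key : mapCoeff (f ∘ₗ part E.cx 0) ∘ₗ E.jacobiD ∘ₗ mapLetters (part K 1) =
      L.jacobiD ∘ₗ mapCoeff (f ∘ₗ part E.cx 0) ∘ₗ mapLetters (part K 1) := by
    have h2 : ∀ v, mapCoeff (f ∘ₗ part E.cx 0) ∘ₗ
        combine L.half (E.rep.act ∘ₗ parity K) (part K 1 v) =
        combine L.half 0 (part K 1 v) ∘ₗ mapCoeff (f ∘ₗ part E.cx 0) := fun v =>
      hom_ext (fun e => by simp [mapCoeff_base, parity_part_one, part_zero_act])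
        (fun u w _ => by simp [mapCoeff_cons])
    refine hom_ext (fun e => ?_) (fun v w h => ?_)
    · simp [mapCoeff_base, DGMod.jacobiD, barD_base, jacobiD_base, part_zero_dTot]
    · have h3 := LinearMap.congr_fun (h2 v) (mapLetters (part K 1) w)
      simp only [LinearMap.comp_apply] at h h3
      simp only [LinearMap.comp_apply, mapLetters_cons, mapCoeff_cons, jacobiD_cons, ← h, ← h3]
      simp only [DGMod.jacobiD, barD_cons, map_add, mapCoeff_cons]
  have h4 := LinearMap.congr_fun key y
  have hD : E.jacobiD y = 0 := hy.2
  simp only [LinearMap.comp_apply, h1, hD, map_zero] at h4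
  rw [← mapCoeff_comp, h0] at h4
  exact h4.symm

namespace CoreBasis
variable (B : CoreBasis T L m)

theorem mem_cycles {E : DGMod L} {t : T.core L m ⊗[ℂ] E.cx.X 0}
    (ht : B.tensD (T.core L m) E 0 t = 0) :
    coreWords T L m _ (LinearMap.lTensor _ (hom E.cx 0) t) ∈ E.cycles m :=
  ⟨⟨coreWords_mem _, coreWords_totDeg E t⟩, by
    change E.jacobiD _ = 0
    rw [B.jacobiD_coreWords, ht, map_zero, map_zero]⟩

theorem exists_coreWords {E : DGMod L} {y : Words (Tot K) (Tot E.cx)} (hy : y ∈ E.cycles m)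
    (hpr : mapLetters T.pr y = y) : ∃ t : T.core L m ⊗[ℂ] E.cx.X 0,
      B.tensD (T.core L m) E 0 t = 0 ∧
        coreWords T L m _ (LinearMap.lTensor _ (hom E.cx 0) t) = y := by
  have h2 : mapCoeff (part E.cx 0) (mapLetters (part K 1) y) = y :=
    mapLetters_part_one (T := T) (nonneg_of_degree E.cx) hpr hy.1.2
  have h0 : mapCoeff (part E.cx 0) y = y := by
    nth_rewrite 1 [← h2]
    rw [mapCoeff_comp]
    have : part E.cx 0 ∘ₗ part E.cx 0 = part E.cx 0 := LinearMap.ext (part_part 0)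
    rw [this, h2]
  have h1 : mapLetters (part K 1) y = y := by
    nth_rewrite 1 [← h2]
    rw [mapLetters_mapCoeff, mapLetters_fixed (part_part 1), h2]
  have ht : coreWords T L m _ (LinearMap.lTensor _ (hom E.cx 0)
      (∑ i, B.c i ⊗ₜ[ℂ] comp E.cx 0 (coeff (contr (B.z i) y)))) = y := by
    refine words_ext fun x => ?_
    refine (Module.forall_dual_apply_eq_zero_iff ℂ _).1 (fun f => ?_) |> sub_eq_zero.1
    have e1 : ∀ i, hom E.cx 0 (comp E.cx 0 (coeff (contr (B.z i) y))) = coeff (contr (B.z i) y) :=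
      fun i => by rw [← part_eq, ← coeff_mapCoeff, mapCoeff_contr, h0]
    rw [map_sub, sub_eq_zero, coeff_contr f x y,
      ← B.sum_apply x (mapCoeff_mem_core E hy hpr h1 h0 f)]
    simp only [map_sum, LinearMap.lTensor_tmul, e1]
    refine Finset.sum_congr rfl fun i _ => ?_
    rw [coreWords_tmul, ← mapCoeff_contr, coeff_mapCoeff, coeff_contr_form,
      LinearMap.toSpanSingleton_apply, map_smul, coeff_contr, smul_eq_mul, smul_eq_mul, mul_comm]
  refine ⟨_, ?_, ht⟩
  have hD : E.jacobiD y = 0 := hy.2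
  rw [← ht, B.jacobiD_coreWords] at hD
  exact lTensor_hom_injective _ _ (coreWords_injective (hD.trans (by simp)))

/-- The harmonic description of the cohomology of `K_m`. -/
def toKH (E : DGMod L) : LinearMap.ker (B.tensD (T.core L m) E 0) →ₗ[L.Rm m] KH m E where
  toFun t := cls (E.bounds m) (coreWords T L m _ (LinearMap.lTensor _ (hom E.cx 0) t.1))
    (B.mem_cycles t.2)
  map_add' t t' := by
    refine (cls_eq (hc' := add_mem (B.mem_cycles t.2) (B.mem_cycles t'.2))).2 ?_
    change coreWords T L m _ (LinearMap.lTensor _ (hom E.cx 0) (t.1 + t'.1)) - _ ∈ _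
    rw [map_add, map_add, sub_self]
    exact zero_mem _
  map_smul' r t := by
    obtain ⟨z, hz, rfl⟩ := r.exists_rep
    have h : coreWords T L m _ (LinearMap.lTensor _ (hom E.cx 0) (DGLie.Rm.mk z hz • t.1)) =
        contr z (coreWords T L m _ (LinearMap.lTensor _ (hom E.cx 0) t.1)) := by
      rw [lTensor_lsmul, coreWords_smul]
    have h0 : B.tensD (T.core L m) E 0 (DGLie.Rm.mk z hz • t.1) = 0 := by
      rw [map_smul, LinearMap.mem_ker.1 t.2, smul_zero]
    have hm : contr z (coreWords T L m _ (LinearMap.lTensor _ (hom E.cx 0) t.1)) ∈ E.cycles m := by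
      rw [← h]; exact B.mem_cycles h0
    refine (cls_eq (hc := B.mem_cycles h0) (hc' := hm)).2 ?_
    rw [h, sub_self]
    exact zero_mem _

theorem toKH_bijective (E : DGMod L) : Function.Bijective (B.toKH E) := by
  constructor
  · intro t t' ht
    have h1 := (cls_eq (hc := B.mem_cycles t.2) (hc' := B.mem_cycles t'.2)).1 ht
    rw [← map_sub, ← map_sub (LinearMap.lTensor (T.core L m) (hom E.cx 0)) t.1 t'.1] at h1
    have h2 := eq_zero_of_harmonic_boundary E h1 (coreWords_pr (T := T) _)
    have h3 := coreWords_injective (T := T) (L := L) (m := m) (h2.trans (map_zero _).symm)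
    exact Subtype.ext (sub_eq_zero.1 (lTensor_hom_injective _ _ (h3.trans (map_zero _).symm)))
  · intro x
    obtain ⟨y, hy, rfl⟩ := KH.exists_rep x
    have hD : E.jacobiD y = 0 := hy.2
    have hN : E.totDeg y = 0 := hy.1.2
    obtain ⟨u, hu, hd, hpr⟩ := exists_harmonic_rep T E (ρ := 0) hy.1.1 (by rw [zero_smul, hN])
      (by rw [hD, map_zero])
    have hB : E.jacobiD u ∈ E.bounds m := ⟨u, ⟨hu, by
      change E.totDeg u + u = 0
      rw [hd]; module⟩, rfl⟩
    have hy' : y - E.jacobiD u ∈ E.cycles m := by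
      refine ⟨⟨sub_mem hy.1.1 (L.wordD_symUpTo hu), ?_⟩, ?_⟩
      · change E.totDeg _ = 0
        rw [map_sub, totDeg_jacobiD, hN, hd, map_smul]
        module
      · change E.jacobiD _ = 0
        rw [map_sub, jacobiD_jacobiD E hu, hD, sub_zero]
    obtain ⟨t, ht, h⟩ := B.exists_coreWords hy' hpr
    refine ⟨⟨t, ht⟩, cls_eq.2 ?_⟩
    change coreWords T L m _ (LinearMap.lTensor _ (hom E.cx 0) t) - y ∈ _
    rw [h, sub_sub_cancel_left]
    exact neg_mem hB

theorem tensD_push {M : Type} [AddCommGroup M] [Module ℂ M] [Module (L.Rm m) M]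
    [IsScalarTower ℂ (L.Rm m) M] [SMulCommClass ℂ (L.Rm m) M] {E E' : DGMod L} (f : E ⟶ E') (p : ℕ)
    (t : M ⊗[ℂ] E.cx.X p) : B.tensD M E' p (LinearMap.lTensor _ (f.map.f p).hom t) =
      LinearMap.lTensor _ (f.map.f (p + 1)).hom (B.tensD M E p t) := by
  have h1 : (E'.cx.d p (p + 1)).hom ∘ₗ (f.map.f p).hom =
      (f.map.f (p + 1)).hom ∘ₗ (E.cx.d p (p + 1)).hom :=
    congrArg ModuleCat.Hom.hom (f.map.comm p (p + 1))
  have h2 : ∀ i, E'.aComp p (p + 1) (hom K 1 (B.v i)) ∘ₗ (f.map.f p).hom =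
      (f.map.f (p + 1)).hom ∘ₗ E.aComp p (p + 1) (hom K 1 (B.v i)) := fun i =>
    LinearMap.ext fun e => (DGMod.aComp_push f p (p + 1) _ e).symm
  simp only [B.tensD_apply, map_add, map_sum, lTensor_lsmul, ← LinearMap.lTensor_comp_apply, h1, h2]

/-- The map between kernels induced by a map of modules. -/
def kerPush {E E' : DGMod L} (f : E ⟶ E') : LinearMap.ker (B.tensD (T.core L m) E 0) →ₗ[L.Rm m]
    LinearMap.ker (B.tensD (T.core L m) E' 0) :=
  LinearMap.restrict
    { toFun := LinearMap.lTensor (T.core L m) (f.map.f 0).hom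
      map_add' := map_add _
      map_smul' := lTensor_lsmul _ } fun t ht => by
    rw [LinearMap.mem_ker] at ht ⊢
    exact (B.tensD_push f 0 t).trans (by rw [ht, map_zero])

theorem toKH_push {E E' : DGMod L} (f : E ⟶ E') (t : LinearMap.ker (B.tensD (T.core L m) E 0)) :
    KH.push f (B.toKH E t) = B.toKH E' (B.kerPush f t) := by
  have h : mapCoeff (totMap f.map) (coreWords T L m _ (LinearMap.lTensor _ (hom E.cx 0) t.1)) =
      coreWords T L m _ (LinearMap.lTensor _ (hom E'.cx 0) (B.kerPush f t).1) := by
    have h1 : totMap f.map ∘ₗ hom E.cx 0 = hom E'.cx 0 ∘ₗ (f.map.f 0).hom :=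
      LinearMap.ext fun e => totMap_hom _ _ _
    rw [mapCoeff_coreWords, ← LinearMap.lTensor_comp_apply, h1, LinearMap.lTensor_comp_apply]
    rfl
  refine (cls_eq (hc := h ▸ B.mem_cycles (B.kerPush f t).2)).2 ?_
  change mapCoeff (totMap f.map) (coreWords T L m _ (LinearMap.lTensor _ (hom E.cx 0) t.1)) - _ ∈ _
  rw [h, sub_self]
  exact zero_mem _

end CoreBasis
end HarmonicRepresentatives

section HomCore
variable {K : CochainComplex (ModuleCat.{0} ℂ) ℕ} {T : Contraction K} {L : DGLie K} {m : ℕ}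

/-- An element of `R_m ⊗ N` as a homomorphism from the harmonic cycles. -/
def theta {N : Type} [AddCommGroup N] [Module ℂ N] (x : L.Rm m ⊗[ℂ] N) :
    T.core L m →ₗ[L.Rm m] T.core L m ⊗[ℂ] N where
  toFun w := LinearMap.rTensor N ((LinearMap.toSpanSingleton (L.Rm m) _ w).restrictScalars ℂ) x
  map_add' w w' := by
    induction x with
    | zero => simp
    | add x y hx hy => simp only [map_add, hx, hy]; abel
    | tmul r n => simp [TensorProduct.add_tmul]
  map_smul' r w := by
    induction x with
    | zero => simp
    | add x y hx hy => simp only [map_add, hx, hy, smul_add]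
    | tmul s n => simp [TensorProduct.smul_tmul', smul_comm s r]

section
variable {N : Type} [AddCommGroup N] [Module ℂ N]

@[simp] theorem theta_tmul (r : L.Rm m) (n : N) (w : T.core L m) :
    theta (r ⊗ₜ[ℂ] n) w = (r • w) ⊗ₜ n := by simp [theta]

@[simp] theorem theta_zero (w : T.core L m) : theta (0 : L.Rm m ⊗[ℂ] N) w = 0 := by simp [theta]

theorem theta_add (x y : L.Rm m ⊗[ℂ] N) (w : T.core L m) :
    theta (x + y) w = theta x w + theta y w := by simp [theta]

theorem theta_sum {ι : Type} (s : Finset ι) (x : ι → L.Rm m ⊗[ℂ] N) (w : T.core L m) :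
    theta (∑ i ∈ s, x i) w = ∑ i ∈ s, theta (x i) w := by simp [theta]

theorem theta_smul (r : L.Rm m) (x : L.Rm m ⊗[ℂ] N) (w : T.core L m) :
    theta (r • x) w = r • theta x w := by
  induction x with
  | zero => simp
  | add x y hx hy => rw [smul_add, theta_add, theta_add, hx, hy, smul_add]
  | tmul s n => simp [TensorProduct.smul_tmul', mul_smul]

theorem theta_lTensor {N' : Type} [AddCommGroup N'] [Module ℂ N'] (f : N →ₗ[ℂ] N')
    (x : L.Rm m ⊗[ℂ] N) (w : T.core L m) :
    theta (LinearMap.lTensor _ f x) w = LinearMap.lTensor _ f (theta x w) := by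
  induction x with
  | zero => simp
  | add x y hx hy => rw [map_add, theta_add, theta_add, hx, hy, map_add]
  | tmul s n => simp

theorem slice_theta (x : L.Rm m ⊗[ℂ] N) (w : T.core L m) :
    slice (coeff ∘ₗ (T.core L m).subtype) (theta x w) = slice (pairing w) x := by
  induction x with
  | zero => simp
  | add x y hx hy => rw [theta_add, map_add, map_add, hx, hy]
  | tmul s n => rw [theta_tmul, slice_tmul, slice_tmul, ← coeff_smul]; rfl

end

namespace CoreBasis
variable (B : CoreBasis T L m)

theorem theta_tensD (E : DGMod L) (p : ℕ) (x : L.Rm m ⊗[ℂ] E.cx.X p) (w : T.core L m) :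
    theta (B.tensD _ E p x) w = B.tensD _ E p (theta x w) := by
  simp only [B.tensD_apply, theta_add, theta_sum, theta_smul, theta_lTensor]

variable {N : Type} [AddCommGroup N] [Module ℂ N]

include B in
theorem theta_injective {x y : L.Rm m ⊗[ℂ] N} (h : ∀ w : T.core L m, theta x w = theta y w) :
    x = y := B.ext fun w => by rw [← slice_theta, h, slice_theta]

theorem slice_smul_tensor (z : Form (Tot K)) (hz : z ∈ L.cocycles m) (t : T.core L m ⊗[ℂ] N) :
    slice (coeff ∘ₗ (T.core L m).subtype) (DGLie.Rm.mk z hz • t) =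
      slice (z ∘ₗ (T.core L m).subtype) t := by
  induction t with
  | zero => simp
  | add x y hx hy => rw [smul_add, map_add, map_add, hx, hy]
  | tmul w n =>
    rw [TensorProduct.smul_tmul', slice_tmul, slice_tmul, core_smul]
    congr 1
    exact coeff_contr_form z _

include B in
theorem theta_surjective (F : T.core L m →ₗ[L.Rm m] T.core L m ⊗[ℂ] N) :
    ∃ x : L.Rm m ⊗[ℂ] N, theta x = F := by
  have key : ∀ F G : T.core L m →ₗ[L.Rm m] T.core L m ⊗[ℂ] N,
      (∀ w, slice (coeff ∘ₗ (T.core L m).subtype) (F w) =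
        slice (coeff ∘ₗ (T.core L m).subtype) (G w)) → F = G := fun F G h => by
    refine LinearMap.ext fun w => ?_
    rw [← B.sum_tensor (F w), ← B.sum_tensor (G w)]
    refine Finset.sum_congr rfl fun i _ => ?_
    rw [← slice_smul_tensor (B.z i) (B.mem i), ← slice_smul_tensor (B.z i) (B.mem i), ← map_smul F,
      ← map_smul G, h]
  refine ⟨∑ i, B.r i ⊗ₜ slice (coeff ∘ₗ (T.core L m).subtype) (F (B.c i)), key _ _ fun w => ?_⟩
  rw [slice_theta, map_sum]
  have : ∀ f : T.core L m →ₗ[ℂ] N, ∑ i, B.z i w • f (B.c i) = f w := fun f => by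
    conv_rhs => rw [← B.sum_eq w, map_sum]
    exact Finset.sum_congr rfl fun i _ => (map_smul f _ _).symm
  exact this (slice (coeff ∘ₗ (T.core L m).subtype) ∘ₗ F.restrictScalars ℂ)

/-- The harmonic cycles as cycles with trivial coefficients. -/
def coreTriv : T.core L m →ₗ[L.Rm m] LinearMap.ker (B.tensD (T.core L m) (trivMod L) 0) where
  toFun w := ⟨w ⊗ₜ[ℂ] (1 : ℂ), by
    have : Subsingleton ((trivMod L).cx.X 1) := ModuleCat.subsingleton_of_isZero
      (HomologicalComplex.isZero_single_obj_X _ _ _ _ one_ne_zero)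
    have : Subsingleton (T.core L m ⊗[ℂ] (trivMod L).cx.X 1) := inferInstance
    exact Subsingleton.elim _ _⟩
  map_add' w w' := Subtype.ext (TensorProduct.add_tmul _ _ _)
  map_smul' r w := Subtype.ext (TensorProduct.smul_tmul' _ _ _).symm

theorem coreTriv_bijective : Function.Bijective B.coreTriv := by
  have h : ∀ w, TensorProduct.rid ℂ (T.core L m) (B.coreTriv w).1 = w := fun w =>
    (TensorProduct.rid_tmul _ _).trans (one_smul _ _)
  constructor
  · intro w w' hw
    rw [← h w, ← h w', hw]
  · intro t
    refine ⟨TensorProduct.rid ℂ (T.core L m) t.1, Subtype.ext ?_⟩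
    exact (TensorProduct.rid ℂ (T.core L m)).injective (h _)

/-- The harmonic cycles are dual to `R_m`. -/
def coreEquiv : T.core L m ≃ₗ[L.Rm m] coR L m :=
  (LinearEquiv.ofBijective _ B.coreTriv_bijective).trans
    (LinearEquiv.ofBijective _ (B.toKH_bijective (trivMod L)))

/-- The cohomology of `K_m` in terms of harmonic cycles. -/
def khEquiv (E : DGMod L) : LinearMap.ker (B.tensD (T.core L m) E 0) ≃ₗ[L.Rm m] KH m E :=
  LinearEquiv.ofBijective _ (B.toKH_bijective E)

/-- The elements of degree `0` of the kernel of `∂ + φ` as homomorphisms. -/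
def thetaKer (E : DGMod L) (x : defKer B.phi E) :
    T.core L m →ₗ[L.Rm m] LinearMap.ker (B.tensD (T.core L m) E 0) :=
  (theta x.1).codRestrict _ fun w => by
    rw [LinearMap.mem_ker, ← B.theta_tensD, B.tensD_ring, (mem_defKer _ _ _).1 x.2, theta_zero]

/-- The elements of degree `0` of the kernel of `∂ + φ` as homomorphisms from the dual of `R_m`
to the cohomology of `K_m`. -/
def defKerHom (E : DGMod L) : defKer B.phi E →ₗ[L.Rm m] (coR L m →ₗ[L.Rm m] KH m E) where
  toFun x := (B.khEquiv E).toLinearMap ∘ₗ B.thetaKer E x ∘ₗ B.coreEquiv.symm.toLinearMap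
  map_add' x y := LinearMap.ext fun u => by
    have : B.thetaKer E (x + y) (B.coreEquiv.symm u) =
      B.thetaKer E x (B.coreEquiv.symm u) + B.thetaKer E y (B.coreEquiv.symm u) :=
      Subtype.ext (theta_add _ _ _)
    exact (congrArg (B.khEquiv E) this).trans (map_add _ _ _)
  map_smul' r x := LinearMap.ext fun u => by
    have : B.thetaKer E (r • x) (B.coreEquiv.symm u) = r • B.thetaKer E x (B.coreEquiv.symm u) :=
      Subtype.ext (theta_smul _ _ _)
    exact (congrArg (B.khEquiv E) this).trans (map_smul _ _ _)

theorem defKerHom_bijective (E : DGMod L) : Function.Bijective (B.defKerHom E) := by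
  constructor
  · intro x y h
    refine Subtype.ext (B.theta_injective fun w => ?_)
    have h1 := LinearMap.congr_fun h (B.coreEquiv w)
    have h2 := (B.khEquiv E).injective h1
    change B.thetaKer E x (B.coreEquiv.symm (B.coreEquiv w)) =
      B.thetaKer E y (B.coreEquiv.symm (B.coreEquiv w)) at h2
    rw [LinearEquiv.symm_apply_apply] at h2
    exact congrArg Subtype.val h2
  · intro F
    let G := (B.khEquiv E).symm.toLinearMap ∘ₗ F ∘ₗ B.coreEquiv.toLinearMap
    obtain ⟨x, hx⟩ := B.theta_surjective
      ((LinearMap.ker (B.tensD (T.core L m) E 0)).subtype ∘ₗ G)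
    have hk : x ∈ defKer B.phi E := by
      rw [mem_defKer, ← B.tensD_ring]
      refine B.theta_injective fun w => ?_
      rw [B.theta_tensD, hx, theta_zero]
      exact (G w).2
    refine ⟨⟨x, hk⟩, LinearMap.ext fun u => ?_⟩
    have h1 : B.thetaKer E ⟨x, hk⟩ (B.coreEquiv.symm u) = G (B.coreEquiv.symm u) :=
      Subtype.ext (LinearMap.congr_fun hx _)
    change B.khEquiv E (B.thetaKer E ⟨x, hk⟩ (B.coreEquiv.symm u)) = F u
    rw [h1]
    change B.khEquiv E ((B.khEquiv E).symm (F (B.coreEquiv (B.coreEquiv.symm u)))) = F u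
    rw [LinearEquiv.apply_symm_apply, LinearEquiv.apply_symm_apply]

/-- The deformation by the tautological element as a module of homomorphisms. -/
def defFunIso : defFun B.phi ≅
    KHfun L m ⋙ (linearCoyoneda (L.Rm m) (ModuleCat.{0} (L.Rm m))).obj (op (coR L m)) :=
  NatIso.ofComponents (fun E => ((LinearEquiv.ofBijective _ (B.defKerHom_bijective E)).trans
      (ModuleCat.homLinearEquiv (S := L.Rm m) (M := coR L m)
        (N := (KHfun L m).obj E)).symm).toModuleIso) fun {E E'} f => by
    ext x
    refine ModuleCat.hom_ext (LinearMap.ext fun u => ?_)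
    have h : B.thetaKer E' (defKer.push B.phi f x) (B.coreEquiv.symm u) =
        B.kerPush f (B.thetaKer E x (B.coreEquiv.symm u)) := Subtype.ext (theta_lTensor _ _ _)
    change B.toKH E' (B.thetaKer E' (defKer.push B.phi f x) (B.coreEquiv.symm u)) =
      KH.push f (B.toKH E (B.thetaKer E x (B.coreEquiv.symm u)))
    rw [h, B.toKH_push]

end CoreBasis
end HomCore

/-! ## Criteria for sheaves -/

section Gluing
variable {X : TopCat.{0}} {R : Type} [CommRing R]

theorem res_res (P : (Opens X)ᵒᵖ ⥤ ModuleCat.{0} R) {U V W : (Opens X)ᵒᵖ} (h : U ⟶ V) (h' : V ⟶ W)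
    (h'' : U ⟶ W) (x : P.obj U) : P.map h' (P.map h x) = P.map h'' x := by
  rw [Subsingleton.elim h'' (h ≫ h'), P.map_comp]
  rfl

theorem res_self (P : (Opens X)ᵒᵖ ⥤ ModuleCat.{0} R) {U : (Opens X)ᵒᵖ} (h : U ⟶ U)
    (x : P.obj U) : P.map h x = x := by
  rw [Subsingleton.elim h (𝟙 U), P.map_id]
  rfl

/-- Sections of a sheaf which agree locally are equal. -/
theorem eq_of_locally_eq (F : Sh X R) {U : Opens X} {s t : F.obj.obj (op U)}
    (h : ∀ p ∈ U, ∃ (V : Opens X) (hV : V ≤ U), p ∈ V ∧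
      F.obj.map (homOfLE hV).op s = F.obj.map (homOfLE hV).op t) : s = t := by
  choose V hV hp he using h
  exact TopCat.Sheaf.eq_of_locally_eq' F (fun p : U => V p p.2) U (fun p => homOfLE (hV p p.2))
    (fun p hpU => Opens.mem_iSup.2 ⟨⟨p, hpU⟩, hp p hpU⟩) s t fun p => he p p.2

/-- A presheaf which embeds into a product of sheaves, with an image given by local conditions, is
a sheaf. -/
theorem isSheaf_of_embedding {S : Type} [CommRing S] (P : (Opens X)ᵒᵖ ⥤ ModuleCat.{0} R)
    {κ : Type} (F : κ → Sh X S) (e : ∀ U : Opens X, P.obj (op U) → ∀ k, (F k).obj.obj (op U))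
    (he : ∀ U, Function.Injective (e U))
    (nat : ∀ {U V : Opens X} (h : V ≤ U) (x : P.obj (op U)) (k : κ),
      e V (P.map (homOfLE h).op x) k = (F k).obj.map (homOfLE h).op (e U x k))
    (loc : ∀ (U : Opens X) (y : ∀ k, (F k).obj.obj (op U)), (∀ p ∈ U, ∃ (V : Opens X) (hV : V ≤ U),
      p ∈ V ∧ ∃ x : P.obj (op V), ∀ k, e V x k = (F k).obj.map (homOfLE hV).op (y k)) →
      ∃ x, e U x = y) : Presheaf.IsSheaf (Opens.grothendieckTopology X) P := by
  refine (TopCat.Presheaf.isSheaf_iff_isSheafUniqueGluing P).2 fun ι U sf hs => ?_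
  have hex : ∀ k, ∃ t : (F k).obj.obj (op (iSup U)), ∀ i,
      (F k).obj.map (Opens.leSupr U i).op t = e (U i) (sf i) k := fun k => by
    obtain ⟨t, ht, -⟩ := TopCat.Sheaf.existsUnique_gluing (F k) U (fun i => e (U i) (sf i) k)
      (fun i j => ((nat inf_le_left (sf i) k).symm.trans
        (congrArg (fun x => e _ x k) (hs i j))).trans (nat inf_le_right (sf j) k))
    exact ⟨t, ht⟩
  choose t ht using hex
  obtain ⟨x, hx⟩ := loc (iSup U) t fun p hp => by
    obtain ⟨i, hi⟩ := Opens.mem_iSup.1 hp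
    exact ⟨U i, le_iSup U i, hi, sf i, fun k => (ht k i).symm⟩
  refine ⟨x, fun i => he _ (funext fun k => ?_), fun x' hx' => he _ (funext fun k => ?_)⟩
  · exact (nat (le_iSup U i) x k).trans ((congrArg (fun y => (F k).obj.map _ (y k)) hx).trans (ht k i))
  · refine TopCat.Sheaf.eq_of_locally_eq (F k) U _ _ fun i => ?_
    refine (nat (le_iSup U i) x' k).symm.trans ?_
    refine (congrArg (fun y => e (U i) y k) (hx' i)).trans ?_
    rw [hx]
    exact (ht k i).symm

end Gluing

section Coordinates
variable {M N : Type} [AddCommGroup M] [Module ℂ M] [AddCommGroup N] [Module ℂ N]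
  [Module.Finite ℂ M]

variable (M N) in
/-- The coordinates of the elements of `M ⊗ N` in a basis of `M`. -/
def coords (x : M ⊗[ℂ] N) (i : Fin (Module.finrank ℂ M)) : N :=
  slice ((Module.finBasis ℂ M).coord i) x

theorem sum_coords (x : M ⊗[ℂ] N) : ∑ i, Module.finBasis ℂ M i ⊗ₜ[ℂ] coords M N x i = x := by
  induction x with
  | zero => simp [coords]
  | add x y hx hy =>
    conv_rhs => rw [← hx, ← hy]
    simp only [coords, map_add, TensorProduct.tmul_add, Finset.sum_add_distrib]
  | tmul u n =>
    conv_rhs => rw [← (Module.finBasis ℂ M).sum_repr u]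
    simp only [coords, slice_tmul, TensorProduct.sum_tmul, TensorProduct.tmul_smul,
      TensorProduct.smul_tmul', Module.Basis.coord_apply]

theorem coords_sum (y : Fin (Module.finrank ℂ M) → N) :
    coords M N (∑ i, Module.finBasis ℂ M i ⊗ₜ[ℂ] y i) = y := by
  funext i
  simp only [coords, map_sum, slice_tmul, Module.Basis.coord_apply, Module.Basis.repr_self]
  rw [Finset.sum_eq_single i] <;> simp +contextual

theorem coords_bijective : Function.Bijective (coords M N) :=
  ⟨fun x y h => by rw [← sum_coords x, h, sum_coords], fun y => ⟨_, coords_sum y⟩⟩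

theorem coords_zero (i : Fin (Module.finrank ℂ M)) : coords M N 0 i = 0 := map_zero _

theorem coords_lTensor {N' : Type} [AddCommGroup N'] [Module ℂ N'] (f : N →ₗ[ℂ] N') (x : M ⊗[ℂ] N)
    (i : Fin (Module.finrank ℂ M)) : coords M N' (LinearMap.lTensor M f x) i = f (coords M N x i) :=
  slice_lTensor _ _ _

end Coordinates

section SheafOfHarmonicCycles
variable {X : TopCat.{0}} {g : LieSheaf X} {G : SoftLieResolution g} {T : Contraction G.gcx} {m : ℕ}

/-- The presheaf of modules obtained by applying a functor to the sections of a resolved module. -/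
abbrev sections (H : DGMod G.glie ⥤ ModuleCat.{0} (G.Rm m)) (E : AdmMod G) :
    (Opens X)ᵒᵖ ⥤ ModuleCat.{0} (G.Rm m) := (secMods G).obj E ⋙ H

theorem CoreBasis.tensD_res (B : CoreBasis T G.glie m) {M : Type} [AddCommGroup M] [Module ℂ M]
    [Module (G.Rm m) M] [IsScalarTower ℂ (G.Rm m) M] [SMulCommClass ℂ (G.Rm m) M] (E : AdmMod G)
    {U V : (Opens X)ᵒᵖ} (h : U ⟶ V) (p : ℕ) (t : M ⊗[ℂ] sec (E.cx.X p) U) :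
    (B.tensD M (E.secMod V) p (LinearMap.lTensor M (rsec (E.cx.X p) h) t) :
      M ⊗[ℂ] sec (E.cx.X (p + 1)) V) = LinearMap.lTensor M (rsec (E.cx.X (p + 1)) h)
        (B.tensD M (E.secMod U) p t : M ⊗[ℂ] sec (E.cx.X (p + 1)) U) :=
  B.tensD_push (((secMods G).obj E).map h) p t

theorem CoreBasis.khEquiv_symm_push {K : CochainComplex (ModuleCat.{0} ℂ) ℕ} {T : Contraction K}
    {L : DGLie K} (B : CoreBasis T L m) {E E' : DGMod L} (f : E ⟶ E') (x : KH m E) :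
    ((B.khEquiv E').symm (KH.push f x)).1 =
      LinearMap.lTensor (T.core L m) (f.map.f 0).hom ((B.khEquiv E).symm x).1 := by
  obtain ⟨t, rfl⟩ := (B.khEquiv E).surjective x
  have h : KH.push f (B.khEquiv E t) = B.khEquiv E' (B.kerPush f t) := B.toKH_push f t
  rw [h, LinearEquiv.symm_apply_apply, LinearEquiv.symm_apply_apply]
  rfl

/-- The cohomology of `K_m` with coefficients in the sections of a resolved module is a sheaf. -/
theorem CoreBasis.isSheaf_KH (B : CoreBasis T G.glie m) (E : AdmMod G) :
    Presheaf.IsSheaf (Opens.grothendieckTopology X) (sections (KHfun G.glie m) E) := by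
  refine isSheaf_of_embedding (S := ℂ) (κ := Fin (Module.finrank ℂ (T.core G.glie m))) _
    (fun _ => E.cx.X 0)
    (fun U x => coords (T.core G.glie m) (sec (E.cx.X 0) (op U))
      ((B.khEquiv (E.secMod (op U))).symm x).1)
    (fun U x y h => (B.khEquiv _).symm.injective (Subtype.ext (coords_bijective.1 h)))
    (fun {U V} h x k => (congrArg (fun t => coords (T.core G.glie m) (sec (E.cx.X 0) (op V)) t k)
      (B.khEquiv_symm_push (((secMods G).obj E).map (homOfLE h).op) x)).trans
        (coords_lTensor (rsec (E.cx.X 0) (homOfLE h).op) _ k))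
    fun U y hy => ?_
  obtain ⟨t, rfl⟩ := coords_bijective.2 y
  have ht : B.tensD (T.core G.glie m) (E.secMod (op U)) 0 t = 0 := by
    refine coords_bijective.1 (funext fun k => eq_of_locally_eq (E.cx.X 1) fun p hp => ?_)
    obtain ⟨V, hV, hpV, x, hx⟩ := hy p hp
    refine ⟨V, hV, hpV, ?_⟩
    have h1 : ((B.khEquiv (E.secMod (op V))).symm x).1 =
        LinearMap.lTensor (T.core G.glie m) (rsec (E.cx.X 0) (homOfLE hV).op) t :=
      coords_bijective.1 (funext fun k => (hx k).trans (coords_lTensor _ _ _).symm)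
    have h2 := B.tensD_res E (homOfLE hV).op 0 t
    rw [← h1, LinearMap.mem_ker.1 ((B.khEquiv (E.secMod (op V))).symm x).2] at h2
    refine ((coords_lTensor (rsec (E.cx.X 1) (homOfLE hV).op) _ k).symm.trans
      (congrArg (fun t => coords (T.core G.glie m) (sec (E.cx.X 1) (op V)) t k) h2.symm)).trans ?_
    exact (coords_zero k).trans ((congrArg (rsec (E.cx.X 1) (homOfLE hV).op)
      (coords_zero k)).trans (map_zero _)).symm
  exact ⟨B.khEquiv (E.secMod (op U)) ⟨t, ht⟩, by rw [LinearEquiv.symm_apply_apply]⟩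

variable (G) in
/-- If the presheaf of sections is a sheaf, then it is its own sheafification. -/
def sheafifySections (H : DGMod G.glie ⥤ ModuleCat.{0} (G.Rm m))
    (h : ∀ E, Presheaf.IsSheaf (Opens.grothendieckTopology X) (sections H E)) :
    secMods G ⋙ (Functor.whiskeringRight _ _ _).obj H ≅ shFun G H ⋙ sheafToPresheaf _ _ :=
  NatIso.ofComponents (fun E => isoSheafify (Opens.grothendieckTopology X) (h E)) fun {E E'} f => by
    simp only [isoSheafify_hom]
    exact toSheafify_naturality _ _

/-- The sheaf `M_m(g, E)` is a sheafification of modules of homomorphisms. -/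
def CoreBasis.moduliIso (B : CoreBasis T G.glie m) : moduliSheaf G m ≅ deformation G B.phi :=
  (Functor.isoWhiskerRight (sheafifySections G (KHfun G.glie m) B.isSheaf_KH).symm
    ((Functor.whiskeringRight _ _ _).obj ((linearCoyoneda (G.Rm m) (ModuleCat.{0} (G.Rm m))).obj
      (op (coR G.glie m))) ⋙ presheafToSheaf _ _)) ≪≫
    Functor.isoWhiskerLeft (secMods G) (Functor.isoWhiskerRight
      ((Functor.whiskeringRight _ _ _).mapIso B.defFunIso.symm) (presheafToSheaf _ _))

/-- Isomorphic functors have isomorphic sheafifications. -/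
def shIso {H H' : DGMod G.glie ⥤ ModuleCat.{0} (G.Rm m)} (α : H ≅ H') : shFun G H ≅ shFun G H' :=
  Functor.isoWhiskerLeft (secMods G) (Functor.isoWhiskerRight
    ((Functor.whiskeringRight _ _ _).mapIso α) (presheafToSheaf _ _))

end SheafOfHarmonicCycles

/-! ## Local primitives of cochains -/

section Primitives
variable {K : CochainComplex (ModuleCat.{0} ℂ) ℕ} {T : Contraction K} {L : DGLie K} {m : ℕ}

theorem CoreBasis.headAct_core (B : CoreBasis T L m) {A A' : Type} [AddCommGroup A] [Module ℂ A]
    [AddCommGroup A'] [Module ℂ A'] (a : Tot K →ₗ[ℂ] A →ₗ[ℂ] A') (c : Words (Tot K) ℂ →ₗ[ℂ] A)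
    {w : Words (Tot K) ℂ} (hw : w ∈ T.core L m) :
    headAct a c w = ∑ i, a (hom K 1 (B.v i)) (c (contr (B.z i) w)) := by
  conv_lhs => rw [B.expansion hw]
  simp

theorem der_of_letters {V F : Type} [AddCommGroup V] [Module ℂ V] [AddCommGroup F] [Module ℂ F]
    (P : V →ₗ[ℂ] V) {δ p : V →ₗ[ℂ] V} (hp : ∀ v, δ (p v) = 0) (w : Words V F) :
    der P δ 0 (mapLetters p w) = 0 := by
  have : der P δ 0 ∘ₗ mapLetters p = (0 : Words V F →ₗ[ℂ] _) :=
    hom_ext (by simp) fun v w h => by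
      simp only [LinearMap.comp_apply, LinearMap.zero_apply] at h
      simp [hp, h]
  exact LinearMap.congr_fun this w

/-- Linear equations on a subspace of finite dimension, modulo another subspace, are finitely many
equations. -/
theorem exists_test {W : Type} [AddCommGroup W] [Module ℂ W] (Z Q : Submodule ℂ W) (hQ : Q.FG) :
    ∃ (n : ℕ) (w : Fin n → W), (∀ i, w i ∈ Q) ∧ ∀ {A A' : Type} [AddCommGroup A] [Module ℂ A]
      [AddCommGroup A'] [Module ℂ A'] (f : W →ₗ[ℂ] A) (d : A' →ₗ[ℂ] A) (y : Fin n → A'),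
      (∀ w ∈ Z, f w = 0) → (∀ i, d (y i) = f (w i)) →
        ∃ g : W →ₗ[ℂ] A', (∀ w ∈ Z, g w = 0) ∧ ∀ w ∈ Q, d (g w) = f w := by
  have hfin : Module.Finite ℂ (Q.map Z.mkQ) := Module.Finite.iff_fg.2 (hQ.map _)
  let b := Module.finBasis ℂ (Q.map Z.mkQ)
  choose w hw hwb using fun i => (b i).2
  refine ⟨_, w, hw, fun {A A'} _ _ _ _ f d y hf hy => ?_⟩
  obtain ⟨g, hg⟩ := LinearMap.exists_extend (b.constr ℂ y)
  refine ⟨g ∘ₗ Z.mkQ, fun w hw => ?_, fun u hu => ?_⟩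
  · rw [LinearMap.comp_apply, (Submodule.Quotient.mk_eq_zero Z).2 hw |> (id : Z.mkQ w = 0 → _),
      map_zero]
  · have h : d ∘ₗ g ∘ₗ (Q.map Z.mkQ).subtype =
        Z.liftQ f (fun w hw => hf w hw) ∘ₗ (Q.map Z.mkQ).subtype := by
      rw [hg]
      refine b.ext fun i => ?_
      rw [LinearMap.comp_apply, Module.Basis.constr_basis, hy, LinearMap.comp_apply,
        Submodule.subtype_apply, ← hwb]
      rfl
    exact LinearMap.congr_fun h ⟨Z.mkQ u, u, hu, rfl⟩

section TotalComplex
variable {M : CochainComplex (ModuleCat.{0} ℂ) ℕ}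

theorem tot_eq {e e' : Tot M} (h : ∀ i, comp M i e = comp M i e') : e = e' :=
  DirectSum.ext_component ℂ h

theorem comp_scale (c : ℕ → ℂ) (i : ℕ) (e : Tot M) : comp M i (scale M c e) = c i • comp M i e := by
  refine tot_induction (p := fun e => comp M i (scale M c e) = c i • comp M i e) (fun j x => ?_)
    (fun x y hx hy => by simp only [map_add, hx, hy, smul_add]) e
  by_cases h : j = i
  · subst h; simp
  · simp [comp_hom_ne h]

theorem part_of_degree {e : Tot M} {j : ℕ} (h : degree M e = (j : ℂ) • e) : part M j e = e := by
  refine tot_eq fun i => ?_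
  have h1 := congrArg (comp M i) h
  rw [degree, comp_scale, map_smul] at h1
  rw [part, comp_scale]
  by_cases hi : i = j
  · simp [hi]
  · rw [if_neg hi, zero_smul]
    have : ((i : ℂ) - j) • comp M i e = 0 := by rw [sub_smul, h1, sub_self]
    exact ((smul_eq_zero.1 this).resolve_left (sub_ne_zero.2 (Nat.cast_injective.ne hi))).symm

theorem eq_zero_of_degree {e : Tot M} {n : ℤ} (hn : n < 0) (h : degree M e = (n : ℂ) • e) : e = 0 :=
  eq_zero_of_nonneg (nonneg_of_degree M e) hn h

theorem degree_part (j : ℕ) (e : Tot M) : degree M (part M j e) = (j : ℂ) • part M j e := by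
  refine tot_eq fun i => ?_
  rw [degree, comp_scale, map_smul, part, comp_scale]
  by_cases hi : i = j
  · simp [hi]
  · simp [hi]

theorem comp_dTot (i : ℕ) (e : Tot M) :
    comp M (i + 1) (dTot M e) = (M.d i (i + 1)).hom (comp M i e) := by
  refine tot_induction (p := fun e => comp M (i + 1) (dTot M e) =
    (M.d i (i + 1)).hom (comp M i e)) (fun j x => ?_)
    (fun x y hx hy => by simp only [map_add, hx, hy]) e
  rw [dTot_hom]
  by_cases h : j = i
  · subst h; rw [comp_hom_self, comp_hom_self]
  · rw [comp_hom_ne (by omega), comp_hom_ne h, map_zero]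

theorem dTot_part (i : ℕ) (e : Tot M) : dTot M (part M i e) = part M (i + 1) (dTot M e) := by
  rw [part_eq, part_eq, dTot_hom, comp_dTot]

theorem exists_sum_part (e : Tot M) : ∃ s : Finset ℕ, ∑ i ∈ s, part M i e = e := by
  classical
  suffices ∃ s : Finset ℕ, ∀ t, s ⊆ t → ∑ i ∈ t, part M i e = e from
    let ⟨s, hs⟩ := this; ⟨s, hs s subset_rfl⟩
  refine tot_induction (p := fun e => ∃ s : Finset ℕ, ∀ t, s ⊆ t → ∑ i ∈ t, part M i e = e)
    (fun j x => ⟨{j}, fun t ht => ?_⟩) ?_ e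
  · rw [Finset.sum_eq_single j (fun i _ hi => by simp [part, hi.symm])
      (fun h => absurd (ht (Finset.mem_singleton_self j)) h)]
    simp [part]
  · rintro x y ⟨s, hs⟩ ⟨s', hs'⟩
    refine ⟨s ∪ s', fun t ht => ?_⟩
    simp only [map_add, Finset.sum_add_distrib, hs t (Finset.union_subset_left ht),
      hs' t (Finset.union_subset_right ht)]

/-- Primitives of a homogeneous cochain can be chosen homogeneous. -/
theorem exists_homogeneous {ρ : ℤ} {f g : Words (Tot K) ℂ →ₗ[ℂ] Tot M}
    (hf : HasDeg (degree M) ρ f) {Z Q : Submodule ℂ (Words (Tot K) ℂ)}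
    (hZ : ∀ w ∈ Z, wordDeg K w ∈ Z) (hQ : ∀ w ∈ Q, wordDeg K w ∈ Q) (hg : ∀ w ∈ Z, g w = 0)
    (hd : ∀ w ∈ Q, dTot M (g w) = f w) (h0 : ∀ w ∈ Q, part M 0 (f w) = 0) :
    ∃ c : Words (Tot K) ℂ →ₗ[ℂ] Tot M, HasDeg (degree M) ((ρ : ℂ) - 1) c ∧ (∀ w ∈ Z, c w = 0) ∧
      ∀ w ∈ Q, dTot M (c w) = f w := by
  obtain ⟨c, hc⟩ := (isDeg_wordDeg (K := K)).exists_glue fun n =>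
    if 0 ≤ n + ρ - 1 then part M (n + ρ - 1).toNat ∘ₗ g else 0
  refine ⟨c, isDeg_wordDeg.ext fun n w hw => ?_, fun w hw => ?_, fun w hw => ?_⟩
  · simp only [LinearMap.add_apply, LinearMap.comp_apply, LinearMap.smul_apply, hw, map_smul,
      hc n w hw]
    split_ifs with h
    · rw [LinearMap.comp_apply, degree_part, ← add_smul]
      congr 1
      have : (((n + ρ - 1).toNat : ℤ) : ℂ) = ((n + ρ - 1 : ℤ) : ℂ) := by rw [Int.toNat_of_nonneg h]
      push_cast at this
      rw [this]
      ring
    · simp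
  · refine isDeg_wordDeg.induction_stable (S := Z) (T := LinearMap.ker c) hZ (fun n w hw hn => ?_) hw
    rw [LinearMap.mem_ker, hc n w hn]
    split_ifs
    · simp [hg w hw]
    · rfl
  · refine LinearMap.mem_eqLocus.1 (isDeg_wordDeg.induction_stable (S := Q)
      (T := LinearMap.eqLocus (dTot M ∘ₗ c) f) hQ (fun n w hw hn => ?_) hw)
    rw [LinearMap.mem_eqLocus, LinearMap.comp_apply, hc n w hn]
    have h1 : degree M (f w) = ((n + ρ : ℤ) : ℂ) • f w := by
      rw [hf.apply, hn, map_smul]; push_cast; module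
    split_ifs with h
    · rw [LinearMap.comp_apply, dTot_part, hd w hw]
      refine part_of_degree ?_
      rw [h1]
      congr 1
      have : (((n + ρ - 1).toNat : ℤ) : ℂ) = ((n + ρ - 1 : ℤ) : ℂ) := by rw [Int.toNat_of_nonneg h]
      push_cast at this ⊢
      rw [this]
      ring
    · rw [LinearMap.zero_apply, map_zero]
      rcases lt_or_eq_of_le (show n + ρ ≤ 0 by omega) with h2 | h2
      · exact (eq_zero_of_degree h2 h1).symm
      · rw [← h0 w hw]
        refine part_of_degree ?_
        rw [h1, h2]; simp

end TotalComplex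

section Push
variable {E E' : DGMod L} (f : E ⟶ E')

theorem totMap_cd (ε : ℂ) (c : Words (Tot K) ℂ →ₗ[ℂ] Tot E.cx) (w : Words (Tot K) ℂ) :
    totMap f.map (L.cd ε (dTot E.cx) E.rep.act c w) =
      L.cd ε (dTot E'.cx) E'.rep.act (totMap f.map ∘ₗ c) w := by
  have h : totMap f.map ∘ₗ headAct (E.rep.act ∘ₗ parityPow (parity K) (-ε)) c =
      headAct (E'.rep.act ∘ₗ parityPow (parity K) (-ε)) (totMap f.map ∘ₗ c) :=
    hom_ext (by simp) (by simp [f.comm])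
  rw [L.cd_apply, L.cd_apply, map_add, map_sub, map_smul]
  exact congrArg₂ (· + ·) (congrArg₂ (· - ·) (LinearMap.congr_fun (totMap_dTot f.map) _) rfl)
    (LinearMap.congr_fun h w)

theorem HasDeg.push {ρ : ℂ} {c : Words (Tot K) ℂ →ₗ[ℂ] Tot E.cx} (h : HasDeg (degree E.cx) ρ c) :
    HasDeg (degree E'.cx) ρ (totMap f.map ∘ₗ c) := by
  have h1 : totMap f.map ∘ₗ degree E.cx = degree E'.cx ∘ₗ totMap f.map := totMap_scale _ _
  rw [HasDeg, ← LinearMap.comp_assoc, ← h1, LinearMap.comp_assoc, h, LinearMap.comp_add,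
    LinearMap.comp_smul, LinearMap.comp_assoc]

end Push

theorem HasDeg.sub {A : Type} [AddCommGroup A] [Module ℂ A] {ν : A →ₗ[ℂ] A} {ρ : ℂ}
    {c c' : Words (Tot K) ℂ →ₗ[ℂ] A} (h : HasDeg ν ρ c) (h' : HasDeg ν ρ c') :
    HasDeg ν ρ (c - c') := by
  rw [HasDeg] at h h' ⊢
  rw [LinearMap.comp_sub, LinearMap.sub_comp, h, h', smul_sub]; abel

theorem HasDeg.add {A : Type} [AddCommGroup A] [Module ℂ A] {ν : A →ₗ[ℂ] A} {ρ : ℂ}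
    {c c' : Words (Tot K) ℂ →ₗ[ℂ] A} (h : HasDeg ν ρ c) (h' : HasDeg ν ρ c') :
    HasDeg ν ρ (c + c') := by
  rw [HasDeg] at h h' ⊢
  rw [LinearMap.comp_add, LinearMap.add_comp, h, h', smul_add]; abel

theorem IsHtpy.hasDeg_step {A : Type} [AddCommGroup A] [Module ℂ A] {s : Tot K →ₗ[ℂ] Tot K}
    (H : IsHtpy (parity K) (dTot K) s) (hs : ∀ v, weight K (s v) = s (weight K v) - s v)
    {ν : A →ₗ[ℂ] A} {ρ : ℂ} {e : Words (Tot K) ℂ →ₗ[ℂ] A} (hd : HasDeg ν ρ e) (ε : ℂ) (k : ℕ) :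
    HasDeg ν (ρ - 1) (ε • e ∘ₗ htpy ℂ (parity K) (dTot K) s k ∘ₗ prlen k) := by
  refine LinearMap.ext fun w => ?_
  have h6 := hd.apply (htpy ℂ (parity K) (dTot K) s k (prlen k w))
  have h7 := H.weight_htpy hs (0 : ℂ →ₗ[ℂ] ℂ) k (prlen k w)
  rw [← prlen_derivWords] at h7
  simp only [LinearMap.smul_apply, LinearMap.comp_apply, LinearMap.add_apply, map_smul]
  rw [h6, wordDeg, h7, map_sub]
  module

end Primitives

section LocalPrimitives
variable {K : CochainComplex (ModuleCat.{0} ℂ) ℕ} {T : Contraction K} {L : DGLie K} {m : ℕ}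
  {X : TopCat.{0}} (𝓔 : (Opens X)ᵒᵖ ⥤ DGMod L)

/-- A presheaf of complexes is locally exact in positive degrees. -/
def LocExact : Prop := ∀ (U : Opens X) (i : ℕ) (x : (𝓔.obj (op U)).cx.X (i + 1)),
  ((𝓔.obj (op U)).cx.d (i + 1) (i + 1 + 1)).hom x = 0 → ∀ p ∈ U, ∃ (V : Opens X) (hV : V ≤ U),
    p ∈ V ∧ ∃ y, ((𝓔.obj (op V)).cx.d i (i + 1)).hom y =
      ((𝓔.map (homOfLE hV).op).map.f (i + 1)).hom x

/-- The restriction of elements of the total space. -/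
abbrev resT {U V : Opens X} (h : V ≤ U) : Tot (𝓔.obj (op U)).cx →ₗ[ℂ] Tot (𝓔.obj (op V)).cx :=
  totMap (𝓔.map (homOfLE h).op).map

variable {𝓔}

theorem resT_resT {U V W : Opens X} (h : V ≤ U) (h' : W ≤ V) (e : Tot (𝓔.obj (op U)).cx) :
    resT 𝓔 h' (resT 𝓔 h e) = resT 𝓔 (h'.trans h) e := by
  have : (homOfLE (h'.trans h)).op = (homOfLE h).op ≫ (homOfLE h').op := rfl
  simp only [resT]
  rw [← LinearMap.comp_apply, ← totMap_comp, this, 𝓔.map_comp]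
  rfl

theorem resT_dTot {U V : Opens X} (h : V ≤ U) (e : Tot (𝓔.obj (op U)).cx) :
    resT 𝓔 h (dTot _ e) = dTot _ (resT 𝓔 h e) := LinearMap.congr_fun (totMap_dTot _) e

theorem LocExact.tot (hex : LocExact 𝓔) {U : Opens X} {p : X} (hp : p ∈ U)
    {e : Tot (𝓔.obj (op U)).cx} (hd : dTot _ e = 0) (h0 : part _ 0 e = 0) :
    ∃ (V : Opens X) (hV : V ≤ U), p ∈ V ∧ ∃ y, dTot _ y = resT 𝓔 hV e := by
  classical
  suffices ∀ s : Finset ℕ, ∃ (V : Opens X) (hV : V ≤ U), p ∈ V ∧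
      ∃ y, dTot _ y = resT 𝓔 hV (∑ i ∈ s, part _ i e) by
    obtain ⟨s, hs⟩ := exists_sum_part e
    simpa only [hs] using this s
  intro s
  induction s using Finset.induction_on with
  | empty => exact ⟨U, le_rfl, hp, 0, by simp⟩
  | insert j s hj ih =>
    obtain ⟨V, hV, hpV, y, hy⟩ := ih
    have h1 : ∃ (W : Opens X) (hW : W ≤ U), p ∈ W ∧ ∃ y, dTot _ y = resT 𝓔 hW (part _ j e) := by
      cases j with
      | zero => exact ⟨U, le_rfl, hp, 0, by rw [h0, map_zero, map_zero]⟩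
      | succ j =>
        have h2 := comp_dTot (j + 1) e
        rw [hd, map_zero] at h2
        obtain ⟨W, hW, hpW, z, hz⟩ := hex U j (comp _ (j + 1) e) h2.symm p hp
        refine ⟨W, hW, hpW, hom _ j z, ?_⟩
        rw [part_eq, dTot_hom, hz, totMap_hom]
    obtain ⟨W, hW, hpW, z, hz⟩ := h1
    refine ⟨V ⊓ W, inf_le_left.trans hV, ⟨hpV, hpW⟩,
      resT 𝓔 inf_le_left y + resT 𝓔 inf_le_right z, ?_⟩
    rw [Finset.sum_insert hj, map_add, map_add, ← resT_dTot, ← resT_dTot, hy, hz, resT_resT,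
      resT_resT, add_comm]

theorem exists_open_forall {n : ℕ} {U : Opens X} {p : X} (hp : p ∈ U) (P : Fin n → Opens X → Prop)
    (mono : ∀ i V W, W ≤ V → P i V → P i W) (h : ∀ i, ∃ V ≤ U, p ∈ V ∧ P i V) :
    ∃ V ≤ U, p ∈ V ∧ ∀ i, P i V := by
  choose V hV hpV hP using h
  refine ⟨U ⊓ Finset.univ.inf V, inf_le_left, ⟨hp, ?_⟩, fun i => mono i _ _
    (inf_le_right.trans (Finset.inf_le (Finset.mem_univ i))) (hP i)⟩
  rw [SetLike.mem_coe, ← SetLike.mem_coe, Opens.coe_finset_inf, Finset.inf_set_eq_iInter]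
  exact Set.mem_iInter₂.2 fun i _ => hpV i

theorem LocExact.tot_family (hex : LocExact 𝓔) {n : ℕ} {U : Opens X} {p : X} (hp : p ∈ U)
    {e : Fin n → Tot (𝓔.obj (op U)).cx} (hd : ∀ i, dTot _ (e i) = 0) (h0 : ∀ i, part _ 0 (e i) = 0) :
    ∃ (V : Opens X) (hV : V ≤ U), p ∈ V ∧ ∃ y : Fin n → _, ∀ i, dTot _ (y i) = resT 𝓔 hV (e i) := by
  obtain ⟨V, hV, hpV, h⟩ := exists_open_forall hp
    (fun i V => ∃ hV : V ≤ U, ∃ y, dTot _ y = resT 𝓔 hV (e i))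
    (fun i V W hW ⟨hV, y, hy⟩ => ⟨hW.trans hV, resT 𝓔 hW y, by rw [← resT_dTot, hy, resT_resT]⟩)
    (fun i => let ⟨V, hV, hpV, h⟩ := hex.tot hp (hd i) (h0 i); ⟨V, hV, hpV, hV, h⟩)
  choose hV' y hy using h
  exact ⟨V, hV, hpV, y, hy⟩

/-- Cocycles have local primitives under conditions on their values on a space `S` of words; the
primitive vanishes on `Z`. -/
theorem exists_local_primitive (hex : LocExact 𝓔) {S Z : Submodule ℂ (Words (Tot K) ℂ)}
    (hZd : ∀ w ∈ Z, wordDeg K w ∈ Z)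
    (hZS : ∀ k ≤ m, ∀ w ∈ Z, htpy ℂ (parity K) (dTot K) T.s k (prlen k w) ∈ S)
    {ε : ℂ} (hε : ε = 1 ∨ ε = -1) {ρ : ℤ}
    (hS : ∀ (E : DGMod L) (c : Words (Tot K) ℂ →ₗ[ℂ] Tot E.cx),
      HasDeg (degree E.cx) ((ρ : ℂ) - 1) c → (∀ w ∈ Z, c w = 0) →
      ∀ w ∈ S, L.cd (-ε) (dTot E.cx) E.rep.act c w = 0)
    (hST : ∀ (E : DGMod L) (e : Words (Tot K) ℂ →ₗ[ℂ] Tot E.cx),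
      (∀ w ∈ symUpTo (parity K) m, L.cd ε (dTot E.cx) E.rep.act e w = 0) →
      (∀ w ∈ S, e w = 0) → ∀ w ∈ Z, e w = 0)
    (hS0 : ∀ (E : DGMod L) (e : Words (Tot K) ℂ →ₗ[ℂ] Tot E.cx), HasDeg (degree E.cx) (ρ : ℂ) e →
      (∀ w ∈ S, e w = 0) → ∀ w ∈ symUpTo (parity K) m,
      part E.cx 0 (e (mapLetters (harm (dTot K) T.s) w)) = 0)
    {U : Opens X} {p : X} (hp : p ∈ U) {e : Words (Tot K) ℂ →ₗ[ℂ] Tot (𝓔.obj (op U)).cx}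
    (hd : HasDeg (degree _) (ρ : ℂ) e)
    (hc : ∀ w ∈ symUpTo (parity K) m, L.cd ε (dTot _) (𝓔.obj (op U)).rep.act e w = 0)
    (h0 : ∀ w ∈ S, e w = 0) :
    ∃ (V : Opens X) (hV : V ≤ U), p ∈ V ∧ ∃ b : Words (Tot K) ℂ →ₗ[ℂ] Tot (𝓔.obj (op V)).cx,
      HasDeg (degree _) ((ρ : ℂ) - 1) b ∧ (∀ w ∈ Z, b w = 0) ∧ ∀ w ∈ symUpTo (parity K) m,
        resT 𝓔 hV (e w) = L.cd (-ε) (dTot _) (𝓔.obj (op V)).rep.act b w := by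
  have hε' : -ε = 1 ∨ -ε = -1 := by rcases hε with rfl | rfl <;> norm_num
  suffices key : ∀ n ≤ m + 1, ∃ (V : Opens X) (hV : V ≤ U), p ∈ V ∧
      ∃ b : Words (Tot K) ℂ →ₗ[ℂ] Tot (𝓔.obj (op V)).cx,
      HasDeg (degree _) ((ρ : ℂ) - 1) b ∧ (∀ w ∈ Z, b w = 0) ∧ ∀ k < n,
        ∀ w ∈ symWords (parity K) k,
        resT 𝓔 hV (e w) = L.cd (-ε) (dTot _) (𝓔.obj (op V)).rep.act b w by
    obtain ⟨V, hV, hpV, b, hb, hbZ, h⟩ := key (m + 1) le_rfl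
    exact ⟨V, hV, hpV, b, hb, hbZ, fun w hw => LinearMap.mem_eqLocus.1 (symUpTo_induction
      (p := LinearMap.eqLocus (resT 𝓔 hV ∘ₗ e) (L.cd (-ε) (dTot _) (𝓔.obj (op V)).rep.act b))
      (fun k hk w hw => h k (by omega) w hw) hw)⟩
  -- the difference of a cocycle and a coboundary, with its properties
  have diff : ∀ (E : DGMod L) (e c : Words (Tot K) ℂ →ₗ[ℂ] Tot E.cx),
      HasDeg (degree _) (ρ : ℂ) e →
      (∀ w ∈ symUpTo (parity K) m, L.cd ε (dTot _) E.rep.act e w = 0) → (∀ w ∈ S, e w = 0) →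
      HasDeg (degree _) ((ρ : ℂ) - 1) c → (∀ w ∈ Z, c w = 0) →
      HasDeg (degree _) (ρ : ℂ) (e - L.cd (-ε) (dTot _) E.rep.act c) ∧
      (∀ w ∈ symUpTo (parity K) m,
        L.cd ε (dTot _) E.rep.act (e - L.cd (-ε) (dTot _) E.rep.act c) w = 0) ∧
      ∀ w ∈ S, (e - L.cd (-ε) (dTot _) E.rep.act c) w = 0 := by
    intro E e c h1 h2 h3 h4 h5
    refine ⟨h1.sub ?_, fun w hw => ?_, fun w hw => ?_⟩
    · have := h4.cd (L := L) E.rep.isGraded (ε := -ε)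
      rwa [sub_add_cancel] at this
    · have h6 := E.rep.isRep.cd_cd hε' c hw
      rw [neg_neg] at h6
      rw [map_sub, LinearMap.sub_apply, h2 w hw, h6, sub_zero]
    · rw [LinearMap.sub_apply, h3 w hw, hS E c h4 h5 w hw, sub_zero]
  intro n
  induction n with
  | zero => exact fun _ => ⟨U, le_rfl, hp, 0, by simp [HasDeg], by simp, by simp⟩
  | succ k ih =>
    intro hk
    obtain ⟨V, hV, hpV, b, hb, hbZ, h⟩ := ih (by omega)
    obtain ⟨d1, d2, d3⟩ := diff _ (resT 𝓔 hV ∘ₗ e) b (hd.push _) (fun w hw => by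
      rw [← totMap_cd, hc w hw, map_zero]) (fun w hw => by
      rw [LinearMap.comp_apply, h0 w hw, map_zero]) hb hbZ
    set e' := resT 𝓔 hV ∘ₗ e - L.cd (-ε) (dTot _) (𝓔.obj (op V)).rep.act b with he'
    have d4 : ∀ j < k, ∀ w ∈ symWords (parity K) j, e' w = 0 := fun j hj w hw => by
      rw [he', LinearMap.sub_apply, LinearMap.comp_apply, h j hj w hw, sub_self]
    let Z' : Submodule ℂ (Words (Tot K) ℂ) := Z ⊔ ⨆ j ∈ Finset.range k, symWords (parity K) j
    let Q : Submodule ℂ (Words (Tot K) ℂ) :=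
      (symWords (parity K) k).map (mapLetters (harm (dTot K) T.s))
    have hZZ' : ∀ w ∈ Z, w ∈ Z' := fun w hw => Submodule.mem_sup_left hw
    have hlow : ∀ j < k, symWords (parity K) j ≤ Z' := fun j hj =>
      le_sup_of_le_right (le_iSup₂_of_le j (Finset.mem_range.2 hj) le_rfl)
    have hQfg : Q.FG := by
      have := Module.Finite.iff_fg.2 (map_lenWords_fg T.fin k)
      exact Module.Finite.iff_fg.1 (Submodule.finiteDimensional_of_le
        (Submodule.map_mono (symWords_le_lenWords (parity K) k)))
    have hQd : ∀ w ∈ Q, wordDeg K w ∈ Q := by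
      rintro _ ⟨w, hw, rfl⟩
      refine ⟨wordDeg K w, derivWords_symWords parity_parity weight_parity 0 hw, ?_⟩
      rw [wordDeg, derivWords_mapLetters 0 (T.isHtpy.weight_harm T.weight_s)]
    have hZ'd : ∀ w ∈ Z', wordDeg K w ∈ Z' := by
      have : Z' ≤ Z'.comap (wordDeg K) := sup_le (fun w hw => hZZ' _ (hZd w hw)) (iSup₂_le fun j hj w hw => hlow j (Finset.mem_range.1 hj)
          (derivWords_symWords parity_parity weight_parity 0 hw))
      exact this
    have hQder : ∀ w ∈ Q, der (parity K) (dTot K) 0 w = 0 := by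
      rintro _ ⟨w, -, rfl⟩
      exact der_of_letters _ (fun v => by rw [← T.isHtpy.harm_d, T.harm_closed]) w
    have hQm : ∀ w ∈ Q, w ∈ symWords (parity K) k := by
      rintro _ ⟨w, hw, rfl⟩
      exact T.isHtpy.Q_symWords hw
    obtain ⟨n, u, hu, test⟩ := exists_test Z' Q hQfg
    have hpart : ∀ w ∈ Q, part _ 0 (e' w) = 0 := by
      rintro _ ⟨w, hw, rfl⟩
      exact hS0 _ e' d1 d3 w (symWords_le (by omega) hw)
    obtain ⟨W, hW, hpW, y, hy⟩ := hex.tot_family hpV (e := fun i => e' (u i)) (fun i => by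
      have h1 := d2 (u i) (symWords_le (by omega) (hQm _ (hu i)))
      rw [cd_of_lower d4 (hQm _ (hu i)), hQder _ (hu i), map_zero, smul_zero, sub_zero] at h1
      exact h1) (fun i => hpart _ (hu i))
    have hZ' : ∀ w ∈ Z', (resT 𝓔 hW ∘ₗ e') w = 0 := by
      have : Z' ≤ LinearMap.ker (resT 𝓔 hW ∘ₗ e') := sup_le (fun w hw => by
        rw [LinearMap.mem_ker, LinearMap.comp_apply, hST _ e' d2 d3 w hw, map_zero])
        (iSup₂_le fun j hj w hw => by
          rw [LinearMap.mem_ker, LinearMap.comp_apply, d4 j (Finset.mem_range.1 hj) w hw, map_zero])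
      exact this
    obtain ⟨g, hg, hgQ⟩ := test (resT 𝓔 hW ∘ₗ e') (dTot _) y hZ' hy
    obtain ⟨c, hcd, hcZ, hcQ⟩ := exists_homogeneous (d1.push (𝓔.map (homOfLE hW).op)) hZ'd hQd hg hgQ
      (fun w hw => by
        have h1 : resT 𝓔 hW (part _ 0 (e' w)) = part _ 0 (resT 𝓔 hW (e' w)) :=
          LinearMap.congr_fun (totMap_scale _ _) _
        exact h1.symm.trans (by rw [hpart w hw, map_zero]))
    obtain ⟨f1, f2, f3⟩ := diff _ (resT 𝓔 hW ∘ₗ e') c (d1.push _) (fun w hw => by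
      rw [← totMap_cd, d2 w hw, map_zero]) (fun w hw => by
      rw [LinearMap.comp_apply, d3 w hw, map_zero]) hcd
      (fun w hw => hcZ w (hZZ' w hw))
    set e'' := resT 𝓔 hW ∘ₗ e' - L.cd (-ε) (dTot _) (𝓔.obj (op W)).rep.act c with he''
    have hclow : ∀ j < k, ∀ w ∈ symWords (parity K) j, c w = 0 := fun j hj w hw =>
      hcZ w (hlow j hj hw)
    have f4 : ∀ j < k, ∀ w ∈ symWords (parity K) j, e'' w = 0 := fun j hj w hw => by
      rw [he'', LinearMap.sub_apply, cd_lower hclow hj hw, hZ' w (hlow j hj hw), sub_zero]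
    have f5 : ∀ w ∈ Q, e'' w = 0 := fun w hw => by
      rw [he'', LinearMap.sub_apply, cd_of_lower hclow (hQm w hw), hQder w hw, hcQ w hw]
      simp
    let b₂ := ε • e'' ∘ₗ htpy ℂ (parity K) (dTot K) T.s k ∘ₗ prlen k
    have hb₂ : ∀ j < k, ∀ w ∈ symWords (parity K) j, b₂ w = 0 := fun j hj w hw => by
      simp [b₂, prlen_ne hj.ne' (symWords_le_lenWords _ _ hw)]
    refine ⟨W, hW.trans hV, hpW, resT 𝓔 hW ∘ₗ b + c + b₂, ((hb.push _).add hcd).add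
      (T.isHtpy.hasDeg_step T.weight_s f1 ε k), fun w hw => ?_, fun j hj w hw => ?_⟩
    · rw [LinearMap.add_apply, LinearMap.add_apply, LinearMap.comp_apply, hbZ w hw,
        hcZ w (hZZ' w hw)]
      simp [b₂, f3 _ (hZS k (by omega) w hw)]
    · have h1 : L.cd (-ε) (dTot _) (𝓔.obj (op W)).rep.act b₂ w = e'' w := by
        rcases Nat.lt_succ_iff_lt_or_eq.1 hj with hj | rfl
        · rw [cd_lower hb₂ hj hw, f4 j hj w hw]
        · rw [htpy_step T.isHtpy hε (fun w hw => f2 w (symWords_le (by omega) hw)) f4 hw,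
            f5 _ ⟨w, hw, rfl⟩, sub_zero]
      rw [map_add, map_add, LinearMap.add_apply, LinearMap.add_apply, h1, ← totMap_cd, he'',
        LinearMap.sub_apply, he', LinearMap.comp_apply, LinearMap.sub_apply, map_sub,
        LinearMap.comp_apply, resT_resT]
      abel

end LocalPrimitives

/-! ## The transposed complex and the complex `L_m` -/

section Transposed
variable {K : CochainComplex (ModuleCat.{0} ℂ) ℕ} (T : Contraction K) {L : DGLie K} {m : ℕ}

theorem comp_zero_act (E : DGMod L) (v : Tot K) (e : Tot E.cx) :
    comp E.cx 0 (E.rep.act v e) = E.aComp 0 0 v (comp E.cx 0 e) := by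
  have : E.rep.act.compr₂ (comp E.cx 0) = (E.aComp 0 0).compl₂ (comp E.cx 0) :=
    tot_ext fun i x => tot_ext fun j y => by
      change comp E.cx 0 (E.rep.act (hom K i x) (hom E.cx j y)) =
        E.aComp 0 0 (hom K i x) (comp E.cx 0 (hom E.cx j y))
      by_cases hj : j = 0
      · subst hj; rw [comp_hom_self]; rfl
      · obtain ⟨e', he⟩ := E.rep.act_deg i j x y
        rw [← he, comp_hom_ne (by omega), comp_hom_ne hj, map_zero]
  exact LinearMap.congr_fun (LinearMap.congr_fun this v) e

theorem comp_zero_dTot (M : CochainComplex (ModuleCat.{0} ℂ) ℕ) (e : Tot M) :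
    comp M 0 (dTot M e) = 0 := by
  have h := congrArg (comp M 0) (part_zero_dTot M e)
  rwa [part, comp_scale, if_pos rfl, one_smul, map_zero] at h

theorem comp_zero_headAct (E : DGMod L) (p : Tot K →ₗ[ℂ] Tot K)
    (c : Words (Tot K) ℂ →ₗ[ℂ] Tot E.cx) (w : Words (Tot K) ℂ) :
    comp E.cx 0 (headAct (E.rep.act ∘ₗ p) c w) =
      headAct (E.aComp 0 0 ∘ₗ p) (comp E.cx 0 ∘ₗ c) w := by
  have : comp E.cx 0 ∘ₗ headAct (E.rep.act ∘ₗ p) c =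
      headAct (E.aComp 0 0 ∘ₗ p) (comp E.cx 0 ∘ₗ c) :=
    hom_ext (by simp) (by simp [comp_zero_act])
  exact LinearMap.congr_fun this w

theorem comp_zero_cd (E : DGMod L) (ε : ℂ) (c : Words (Tot K) ℂ →ₗ[ℂ] Tot E.cx)
    (w : Words (Tot K) ℂ) : comp E.cx 0 (L.cd ε (dTot E.cx) E.rep.act c w) =
      L.cd ε 0 (E.aComp 0 0) (comp E.cx 0 ∘ₗ c) w := by
  rw [L.cd_apply, L.cd_apply, map_add, map_sub, comp_zero_dTot, comp_zero_headAct, map_smul]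
  rfl

theorem hasDeg_zero_iff {A : Type} [AddCommGroup A] [Module ℂ A] {ν : A →ₗ[ℂ] A}
    {c : Words (Tot K) ℂ →ₗ[ℂ] A} : HasDeg ν 0 c ↔ ν ∘ₗ c = c ∘ₗ wordDeg K := by
  rw [HasDeg, zero_smul, add_zero]

theorem hasDeg_neg_one_iff {A : Type} [AddCommGroup A] [Module ℂ A] {ν : A →ₗ[ℂ] A}
    {c : Words (Tot K) ℂ →ₗ[ℂ] A} : HasDeg ν (-1) c ↔ ν ∘ₗ c = c ∘ₗ wordDeg K - c := by
  rw [HasDeg, neg_one_smul, sub_eq_add_neg]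

theorem HasDeg.comp_zero {M : CochainComplex (ModuleCat.{0} ℂ) ℕ} {ρ : ℂ}
    {c : Words (Tot K) ℂ →ₗ[ℂ] Tot M} (h : HasDeg (degree M) ρ c) :
    HasDeg (0 : M.X 0 →ₗ[ℂ] M.X 0) ρ (comp M 0 ∘ₗ c) := by
  refine LinearMap.ext fun w => ?_
  have h1 := congrArg (comp M 0) (h.apply w)
  rw [degree, comp_scale, Nat.cast_zero, zero_smul, map_add, map_smul] at h1
  exact h1

theorem HasDeg.hom_zero {M : CochainComplex (ModuleCat.{0} ℂ) ℕ} {ρ : ℂ}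
    {c : Words (Tot K) ℂ →ₗ[ℂ] M.X 0} (h : HasDeg (0 : M.X 0 →ₗ[ℂ] M.X 0) ρ c) :
    HasDeg (degree M) ρ (hom M 0 ∘ₗ c) := by
  refine LinearMap.ext fun w => ?_
  have h1 := congrArg (hom M 0) (h.apply w)
  rw [LinearMap.zero_apply, map_zero, map_add, map_smul] at h1
  refine Eq.trans ?_ h1
  simp [degree]

theorem HasDeg.hom_comp_zero {M : CochainComplex (ModuleCat.{0} ℂ) ℕ}
    {c : Words (Tot K) ℂ →ₗ[ℂ] Tot M} (h : HasDeg (degree M) 0 c) {w : Words (Tot K) ℂ}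
    (hw : wordDeg K w = 0) : hom M 0 (comp M 0 (c w)) = c w := by
  rw [← part_eq]
  refine part_of_degree ?_
  rw [h.apply, hw]; simp

theorem LmD_cls (E : DGMod L) (p : ℕ) {c : Words (Tot K) ℂ →ₗ[ℂ] E.cx.X p}
    (hc : c ∈ cochZ L m 0 0 (E.aComp p p)) :
    ∃ h, LmD m E p (cls _ c hc) = cls (cochB L m 0 0 (E.aComp (p + 1) (p + 1))) (E.hd p c) h :=
  ⟨_, rfl⟩

variable {T} in
theorem CoreBasis.headAct_core_hom (B : CoreBasis T L m) (E : DGMod L)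
    (z : Words (Tot K) ℂ →ₗ[ℂ] E.cx.X 0) {w : Words (Tot K) ℂ} (hw : w ∈ T.core L m) :
    headAct (E.rep.act ∘ₗ parity K) (hom E.cx 0 ∘ₗ z) w =
      hom E.cx 1 (headAct (E.aComp 0 1) z w) := by
  rw [B.headAct_core _ _ hw, B.headAct_core _ _ hw, map_sum]
  refine Finset.sum_congr rfl fun i _ => ?_
  rw [E.hom_aComp (by omega)]
  simp [parity]

/-- The component of degree `0` of a cocycle of the transposed complex. -/
def tKH.comp (E : DGMod L) : CochH L m (degree E.cx) (dTot E.cx) E.rep.act →ₗ[L.Rm m] LmX L m E 0 :=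
  CochH.map (LinearMap.compRight ℂ (JacobiModuli.comp E.cx 0))
    (fun c hc => ⟨hasDeg_zero_iff.1 (hasDeg_zero_iff.2 hc.1).comp_zero, fun w hw => by
      have h := congrArg (JacobiModuli.comp E.cx 0) (hc.2 w hw)
      rwa [← L.cd_one, comp_zero_cd, map_zero, L.cd_one] at h⟩)
    (fun c _ ⟨b, hb, h⟩ => ⟨JacobiModuli.comp E.cx 0 ∘ₗ b,
      hasDeg_neg_one_iff.1 (hasDeg_neg_one_iff.2 hb).comp_zero, fun w hw => by
        have h1 := congrArg (JacobiModuli.comp E.cx 0) (h w hw)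
        rwa [← L.cd_neg_one, comp_zero_cd, L.cd_neg_one] at h1⟩)
    (fun z _ c w _ => rfl)

include T in
theorem tKH.comp_mem (E : DGMod L) (x : CochH L m (degree E.cx) (dTot E.cx) E.rep.act) :
    LmD m E 0 (tKH.comp E x) = 0 := by
  obtain ⟨B⟩ := exists_coreBasis T L m
  obtain ⟨c, hc, rfl⟩ := x.exists_rep
  have hd : HasDeg (degree E.cx) 0 c := hasDeg_zero_iff.2 hc.1
  obtain ⟨h, h'⟩ := LmD_cls (m := m) E 0 (c := JacobiModuli.comp E.cx 0 ∘ₗ c)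
    ⟨hasDeg_zero_iff.1 hd.comp_zero, fun w hw => by
      have h := congrArg (JacobiModuli.comp E.cx 0) (hc.2 w hw)
      rwa [← L.cd_one, comp_zero_cd, map_zero, L.cd_one] at h⟩
  refine h'.trans ((cls_eq (hc' := zero_mem _)).2 ?_)
  rw [sub_zero]
  refine (actZero_aComp E 1).mem_cochB T h fun w hw => hom_injective (M := E.cx) ?_
  obtain ⟨h1, -, h3, h4⟩ := mem_core.1 hw
  have h5 : c w = hom E.cx 0 (JacobiModuli.comp E.cx 0 (c w)) := (hd.hom_comp_zero h3).symm
  have h6 : headAct (E.rep.act ∘ₗ parity K) c w =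
      headAct (E.rep.act ∘ₗ parity K) (hom E.cx 0 ∘ₗ JacobiModuli.comp E.cx 0 ∘ₗ c) w := by
    rw [B.headAct_core _ _ hw, B.headAct_core _ _ hw]
    refine Finset.sum_congr rfl fun i _ => congrArg _ ?_
    exact (hd.hom_comp_zero (mem_core.1 (contr_core _ hw)).2.2.1).symm
  have h7 := hc.2 w h1
  rw [cochD_apply, h4, map_zero, sub_zero, h6, B.headAct_core_hom E _ hw, h5, dTot_hom,
    ← map_add] at h7
  exact h7.trans (map_zero _).symm

variable (L m) in
/-- The map of the cohomology of the transposed complex to the kernel of the first differential of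
the complex `L_m`. -/
def tKHtoLmKer : tKH L m ⟶ LmKer L m where
  app E := ModuleCat.ofHom ((tKH.comp E).codRestrict _ fun x => tKH.comp_mem T E x)
  naturality E E' f := by
    refine ModuleCat.hom_ext (LinearMap.ext fun x => Subtype.ext ?_)
    obtain ⟨c, hc, rfl⟩ := CochH.exists_rep x
    refine cls_eq.2 (cochB_of_zero fun w _ => ?_)
    change comp E'.cx 0 (totMap f.map (c w)) - (f.map.f 0).hom (comp E.cx 0 (c w)) = 0
    rw [comp_totMap, sub_self]

/-! ### Conditions on words for the existence of local primitives -/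

variable (m) in
/-- The words of degree `0` in letters of the subcomplex. -/
def Contraction.zeroWords : Submodule ℂ (Words (Tot K) ℂ) :=
  symUpTo (parity K) m ⊓ LinearMap.ker (mapLetters T.pr - LinearMap.id) ⊓ LinearMap.ker (wordDeg K)

variable {T}

theorem mem_zeroWords {w : Words (Tot K) ℂ} : w ∈ T.zeroWords m ↔ w ∈ symUpTo (parity K) m ∧
    mapLetters T.pr w = w ∧ wordDeg K w = 0 := by
  simp only [Contraction.zeroWords, Submodule.mem_inf, LinearMap.mem_ker, LinearMap.sub_apply,
    LinearMap.id_apply, sub_eq_zero, and_assoc]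

theorem part_one_pr (v : Tot K) : part K 1 (T.pr (part K 1 v)) = T.pr (part K 1 v) := by
  refine tot_induction (p := fun v => part K 1 (T.pr (part K 1 v)) = T.pr (part K 1 v))
    (fun j x => ?_) (fun x y hx hy => by simp only [map_add, hx, hy]) v
  by_cases h : j = 1
  · subst h
    obtain ⟨y, hy⟩ := T.s_mem 0 x
    have h1 : part K 1 (hom K 1 x) = hom K 1 x := by simp [part]
    rw [h1, T.pr_one, ← hy, dTot_hom, ← map_sub]
    simp [part]
  · simp [part, h]

theorem mapLetters_mem_zeroWords {w : Words (Tot K) ℂ} (hw : w ∈ symUpTo (parity K) m) :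
    mapLetters (T.pr ∘ₗ part K 1) w ∈ T.zeroWords m := by
  have hP : ∀ v, (T.pr ∘ₗ part K 1) (parity K v) = parity K ((T.pr ∘ₗ part K 1) v) := fun v => by
    have : part K 1 (parity K v) = parity K (part K 1 v) := scale_comm _ _ _
    simp only [LinearMap.comp_apply, this, T.pr_parity]
  refine mem_zeroWords.2 ⟨symUpTo_induction (p := (symUpTo (parity K) m).comap _)
    (fun k hk w hw => symWords_le hk (mapLetters_symWords parity_parity hP hw)) hw, ?_, ?_⟩
  · rw [mapLetters_comp]
    rw [show T.pr ∘ₗ T.pr ∘ₗ part K 1 = T.pr ∘ₗ part K 1 from LinearMap.ext fun v => T.pr_pr _]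
  · refine wordDeg_of_part_one ?_
    rw [mapLetters_comp]
    rw [show part K 1 ∘ₗ T.pr ∘ₗ part K 1 = T.pr ∘ₗ part K 1 from
      LinearMap.ext fun v => part_one_pr v]

theorem mapLetters_of_zeroWords {w : Words (Tot K) ℂ} (hw : w ∈ T.zeroWords m) :
    mapLetters (T.pr ∘ₗ part K 1) w = w := by
  obtain ⟨-, h1, h2⟩ := mem_zeroWords.1 hw
  rw [← mapLetters_comp, part_one_of_core h1 h2, h1]

theorem s_pr (v : Tot K) : T.s (T.pr v) = T.pr (T.s v) := by
  refine tot_induction (p := fun v => T.s (T.pr v) = T.pr (T.s v)) (fun j x => ?_)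
    (fun x y hx hy => by simp only [map_add, hx, hy]) v
  match j with
  | 0 => rw [T.pr_zero, T.s_zero, map_zero, map_zero]
  | 1 =>
    obtain ⟨y, hy⟩ := T.s_mem 0 x
    rw [T.pr_one, map_sub, T.isHtpy.sds, sub_self, ← hy, T.pr_zero]
  | 2 =>
    obtain ⟨y, hy⟩ := T.s_mem 1 x
    rw [T.pr_of_two_le le_rfl, ← hy, T.pr_one, hy, T.isHtpy.ss, map_zero, sub_zero]
  | j + 3 =>
    obtain ⟨y, hy⟩ := T.s_mem (j + 2) x
    rw [T.pr_of_two_le (by omega), ← hy, T.pr_of_two_le (by omega)]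

theorem pr_htpy (i : ℕ) (w : Words (Tot K) ℂ) :
    mapLetters T.pr (htpy ℂ (parity K) (dTot K) T.s i w) =
      htpy ℂ (parity K) (dTot K) T.s i (mapLetters T.pr w) := by
  have h1 : ∀ w : Words (Tot K) ℂ, mapLetters T.pr (der (parity K) T.s 0 w) =
      der (parity K) T.s 0 (mapLetters T.pr w) := fun w => by
    have : mapLetters T.pr ∘ₗ der (parity K) T.s 0 =
        der (parity K) T.s 0 ∘ₗ (mapLetters T.pr : Words (Tot K) ℂ →ₗ[ℂ] _) :=
      hom_ext (by simp) fun v w h => by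
        simp only [LinearMap.comp_apply] at h
        simp [h, s_pr, T.pr_parity]
    exact LinearMap.congr_fun this w
  have h2 : ∀ w : Words (Tot K) ℂ, mapLetters T.pr (lapW ℂ (dTot K) T.s w) =
      lapW ℂ (dTot K) T.s (mapLetters T.pr w) := fun w =>
    (derivWords_mapLetters 0 (fun v => by
      simp only [lap_apply, map_add, ← s_pr, T.pr_dTot]) w).symm
  induction i with
  | zero => simp [htpy]
  | succ i ih => rw [htpy_succ, htpy_succ, map_add, ih, map_smul, h1, htpyT_comm h2]

theorem pr_harm (v : Tot K) : T.pr (harm (dTot K) T.s v) = harm (dTot K) T.s v := by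
  have h1 : dTot K (harm (dTot K) T.s v) = 0 := by rw [← T.isHtpy.harm_d, T.harm_closed]
  have h2 : part K 1 (harm (dTot K) T.s v) = harm (dTot K) T.s (part K 1 v) := by
    have h3 : ∀ v, weight K (harm (dTot K) T.s v) = harm (dTot K) T.s (weight K v) :=
      T.isHtpy.weight_harm T.weight_s
    refine tot_induction (p := fun v => part K 1 (harm (dTot K) T.s v) =
      harm (dTot K) T.s (part K 1 v)) (fun j x => ?_)
      (fun x y hx hy => by simp only [map_add, hx, hy]) v
    have h4 := h3 (hom K j x)
    rw [weight_hom, map_smul] at h4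
    have h5 : degree K (harm (dTot K) T.s (hom K j x)) = (j : ℂ) • harm (dTot K) T.s (hom K j x) := by
      refine tot_eq fun i => ?_
      have h6 := congrArg (comp K i) h4
      rw [weight, comp_scale, map_smul] at h6
      rw [degree, comp_scale, map_smul]
      simp only [sub_smul, one_smul] at h6
      exact sub_left_injective h6
    by_cases hj : j = 1
    · subst hj
      rw [part_of_degree h5]; simp [part]
    · rw [show part K 1 (hom K j x) = 0 by simp [part, hj], map_zero, ← part_of_degree h5]
      refine tot_eq fun i => ?_
      rw [part, part, comp_scale, comp_scale]
      by_cases hi : i = 1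
      · rw [if_neg (fun h : i = j => hj (h.symm.trans hi)), zero_smul, smul_zero, map_zero]
      · rw [if_neg hi, zero_smul, map_zero]
  rw [Contraction.pr, harm_apply, h1, map_zero, add_zero, Contraction.t, LinearMap.comp_apply, h2,
    T.isHtpy.s_harm, map_zero, sub_zero]

theorem pr_mapLetters_harm (w : Words (Tot K) ℂ) :
    mapLetters T.pr (mapLetters (harm (dTot K) T.s) w) = mapLetters (harm (dTot K) T.s) w := by
  rw [mapLetters_comp]
  rw [show T.pr ∘ₗ harm (dTot K) T.s = harm (dTot K) T.s from LinearMap.ext fun v => pr_harm v]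

theorem part_zero_of_degree {M : CochainComplex (ModuleCat.{0} ℂ) ℕ} {e : Tot M} {n : ℤ}
    (hn : n ≠ 0) (h : degree M e = (n : ℂ) • e) : part M 0 e = 0 := by
  have h1 := congrArg (comp M 0) h
  rw [degree, comp_scale, Nat.cast_zero, zero_smul, map_smul] at h1
  rw [part_eq, (smul_eq_zero.1 h1.symm).resolve_left (by exact_mod_cast hn), map_zero]

/-- The part of degree `0` of the values on harmonic words of a homogeneous cochain. -/
theorem part_zero_harmonic {M : CochainComplex (ModuleCat.{0} ℂ) ℕ} {ρ : ℤ}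
    {e : Words (Tot K) ℂ →ₗ[ℂ] Tot M} (hd : HasDeg (degree M) ρ e)
    (h : ∀ w ∈ symUpTo (parity K) m, wordDeg K w = ((-ρ : ℤ) : ℂ) • w →
      mapLetters T.pr w = w → e w = 0) {w : Words (Tot K) ℂ} (hw : w ∈ symUpTo (parity K) m) :
    part M 0 (e (mapLetters (harm (dTot K) T.s) w)) = 0 := by
  refine isDeg_wordDeg.induction_stable (S := symUpTo (parity K) m)
    (T := LinearMap.ker (part M 0 ∘ₗ e ∘ₗ mapLetters (harm (dTot K) T.s)))
    (fun w hw => symUpTo_wordDeg hw) (fun n w hw hn => ?_) hw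
  rw [LinearMap.mem_ker, LinearMap.comp_apply, LinearMap.comp_apply]
  have h1 : wordDeg K (mapLetters (harm (dTot K) T.s) w) =
      (n : ℂ) • mapLetters (harm (dTot K) T.s) w := by
    rw [wordDeg, derivWords_mapLetters 0 (T.isHtpy.weight_harm T.weight_s)]
    change mapLetters _ (wordDeg K w) = _
    rw [hn, map_smul]
  by_cases hρ : n = -ρ
  · subst hρ
    rw [h _ (T.isHtpy.Q_symUpTo hw) h1 (pr_mapLetters_harm w), map_zero]
  · refine part_zero_of_degree (n := n + ρ) (by omega) ?_
    rw [hd.apply, h1, map_smul]; push_cast; module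

end Transposed

section LocalBijectivity
variable {K : CochainComplex (ModuleCat.{0} ℂ) ℕ} {T : Contraction K} {L : DGLie K} {m : ℕ}
  {X : TopCat.{0}} {𝓔 : (Opens X)ᵒᵖ ⥤ DGMod L}

theorem exists_local_primitive_zero (T : Contraction K) (hex : LocExact 𝓔) {U : Opens X} {p : X}
    (hp : p ∈ U)
    {e : Words (Tot K) ℂ →ₗ[ℂ] Tot (𝓔.obj (op U)).cx} (hd : HasDeg (degree _) 0 e)
    (hc : ∀ w ∈ symUpTo (parity K) m, L.cd 1 (dTot _) (𝓔.obj (op U)).rep.act e w = 0)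
    (h0 : ∀ w ∈ T.zeroWords m, e w = 0) :
    ∃ (V : Opens X) (hV : V ≤ U), p ∈ V ∧ ∃ b : Words (Tot K) ℂ →ₗ[ℂ] Tot (𝓔.obj (op V)).cx,
      HasDeg (degree _) (-1) b ∧ ∀ w ∈ symUpTo (parity K) m,
        resT 𝓔 hV (e w) = L.cd (-1) (dTot _) (𝓔.obj (op V)).rep.act b w := by
  have h := exists_local_primitive (T := T) (m := m) hex (S := T.zeroWords m)
    (Z := (T.zeroWords m).map L.jacobiD) ?_ ?_ (Or.inl rfl) (ρ := 0) ?_ ?_ ?_ hp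
    (by simpa using hd) hc h0
  · obtain ⟨V, hV, hpV, b, hb, -, h⟩ := h
    exact ⟨V, hV, hpV, b, by simpa using hb, h⟩
  · rintro _ ⟨w, hw, rfl⟩
    refine ⟨w, hw, ?_⟩
    rw [wordDeg_jacobiD, (mem_zeroWords.1 hw).2.2]
    simp
  · rintro k hk _ ⟨w, hw, rfl⟩
    obtain ⟨h1, h2, h3⟩ := mem_zeroWords.1 hw
    have h4 : L.jacobiD w ∈ symUpTo (parity K) m := L.jacobiD_symUpTo h1
    have h5 : mapLetters T.pr (L.jacobiD w) = L.jacobiD w := by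
      rw [L.jacobiD_eq]; exact T.pr_wordD 0 0 h2
    refine mem_zeroWords.2 ⟨T.isHtpy.htpy_symUpTo k (symWords_le hk (prlen_symUpTo h4 k)) |>
      (symUpTo_mono le_rfl ·), ?_, ?_⟩
    · rw [pr_htpy, ← prlen_mapLetters, h5]
    · have h6 := T.isHtpy.weight_htpy T.weight_s (0 : ℂ →ₗ[ℂ] ℂ) k (prlen k (L.jacobiD w))
      rw [← prlen_derivWords] at h6
      change wordDeg K _ = htpy ℂ _ _ _ k (prlen k (wordDeg K _)) - _ at h6
      rw [h6, wordDeg_jacobiD, h3, map_zero, zero_add, sub_self]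
  · intro E c hcd hcZ w hw
    have h1 : ∀ w, wordDeg K w = 0 → c w = 0 := fun w hw =>
      eq_zero_of_degree (n := -1) (by norm_num) (by rw [hcd.apply, hw]; simp)
    have h2 := mapLetters_of_zeroWords hw
    rw [L.cd_apply, h1 w (mem_zeroWords.1 hw).2.2, hcZ _ ⟨w, hw, rfl⟩,
      ← part_one_of_core (mem_zeroWords.1 hw).2.1 (mem_zeroWords.1 hw).2.2, headAct_mapLetters]
    have h3 : c ∘ₗ mapLetters (part K 1) = 0 := LinearMap.ext fun t =>
      h1 _ (wordDeg_of_part_one (mapLetters_fixed (part_part 1) t))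
    rw [h3]; simp
  · rintro E e hc hS _ ⟨w, hw, rfl⟩
    have h1 := hc w (mem_zeroWords.1 hw).1
    have h2 : headAct (E.rep.act ∘ₗ parityPow (parity K) (-1)) e w = 0 := by
      have h3 := headAct_mapLetters (E.rep.act ∘ₗ parityPow (parity K) (-1)) e (T.pr ∘ₗ part K 1) w
      rw [mapLetters_of_zeroWords hw] at h3
      refine h3.trans (headAct_eq_zero_of (P := parity K) (m := m) (fun t ht => ?_) ?_)
      · exact hS _ (mapLetters_mem_zeroWords ht)
      · exact (mem_zeroWords.1 hw).1
    rw [L.cd_apply, hS w hw, h2] at h1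
    simpa using h1
  · intro E e hd hS w hw
    refine part_zero_harmonic hd (fun w hw h1 h2 => hS w (mem_zeroWords.2 ⟨hw, h2, ?_⟩)) hw
    simpa using h1

theorem exists_local_primitive_one (T : Contraction K) (hex : LocExact 𝓔) {U : Opens X} {p : X}
    (hp : p ∈ U)
    {e : Words (Tot K) ℂ →ₗ[ℂ] Tot (𝓔.obj (op U)).cx} (hd : HasDeg (degree _) 1 e)
    (hc : ∀ w ∈ symUpTo (parity K) m, L.cd (-1) (dTot _) (𝓔.obj (op U)).rep.act e w = 0)
    (h0 : ∀ w ∈ T.core L m, e w = 0) :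
    ∃ (V : Opens X) (hV : V ≤ U), p ∈ V ∧ ∃ b : Words (Tot K) ℂ →ₗ[ℂ] Tot (𝓔.obj (op V)).cx,
      HasDeg (degree _) 0 b ∧ (∀ w ∈ T.core L m, b w = 0) ∧ ∀ w ∈ symUpTo (parity K) m,
        resT 𝓔 hV (e w) = L.cd 1 (dTot _) (𝓔.obj (op V)).rep.act b w := by
  obtain ⟨B⟩ := exists_coreBasis T L m
  have h := exists_local_primitive (T := T) (m := m) hex (S := T.core L m) (Z := T.core L m)
    ?_ ?_ (Or.inr rfl) (ρ := 1) ?_ (fun E e _ h => h) ?_ hp (by simpa using hd) hc h0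
  · obtain ⟨V, hV, hpV, b, hb, hbZ, h⟩ := h
    exact ⟨V, hV, hpV, b, by simpa using hb, hbZ, by simpa using h⟩
  · intro w hw
    rw [(mem_core.1 hw).2.2.1]; exact zero_mem _
  · intro k _ w hw
    rw [htpy_eq_zero (T := T) (by rw [← prlen_mapLetters, (mem_core.1 hw).2.1])
      (by rw [← prlen_mapLetters, core_part_one hw])]
    exact zero_mem _
  · intro E c hcd hcZ w hw
    rw [L.cd_apply, hcZ w hw, (mem_core.1 hw).2.2.2, B.headAct_core _ _ hw]
    simp [hcZ _ (contr_core _ hw)]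
  · intro E e hd hS w hw
    refine part_zero_harmonic hd (fun w hw h1 h2 => ?_) hw
    rw [pr_words_neg h2 (n := -1) (by norm_num) h1, map_zero]

theorem tKHtoLmKer_injective (hex : LocExact 𝓔) {U : Opens X} {x : (tKH L m).obj (𝓔.obj (op U))}
    (hx : (tKHtoLmKer T L m).app _ x = 0) {p : X} (hp : p ∈ U) :
    ∃ (V : Opens X) (hV : V ≤ U), p ∈ V ∧ (tKH L m).map (𝓔.map (homOfLE hV).op) x = 0 := by
  obtain ⟨c, hc, rfl⟩ := CochH.exists_rep x
  have hcd : HasDeg (degree _) 0 c := hasDeg_zero_iff.2 hc.1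
  obtain ⟨b₀, hb₀, h⟩ : comp _ 0 ∘ₗ c ∈ cochB L m 0 0 ((𝓔.obj (op U)).aComp 0 0) := by
    have := (cls_eq (hc' := zero_mem _)).1 (congrArg Subtype.val hx)
    rwa [sub_zero] at this
  have hb₁ : HasDeg (degree _) (-1) (hom (𝓔.obj (op U)).cx 0 ∘ₗ b₀) :=
    (hasDeg_neg_one_iff.2 hb₀).hom_zero
  have hk := hb₁.cd (L := L) (𝓔.obj (op U)).rep.isGraded (ε := -1)
  rw [neg_add_cancel] at hk
  have hed := hcd.sub hk
  obtain ⟨V, hV, hpV, b, hb, hbe⟩ := exists_local_primitive_zero (m := m) T hex hp hed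
    (fun w hw => by
      have h2 := (𝓔.obj (op U)).rep.isRep.cd_cd (Or.inr rfl) (hom (𝓔.obj (op U)).cx 0 ∘ₗ b₀) hw
      rw [neg_neg] at h2
      rw [map_sub, LinearMap.sub_apply, h2, sub_zero, L.cd_one]
      exact hc.2 w hw)
    (fun w hw => by
      obtain ⟨h1, -, h3⟩ := mem_zeroWords.1 hw
      have h4 : comp (𝓔.obj (op U)).cx 0 ∘ₗ hom (𝓔.obj (op U)).cx 0 ∘ₗ b₀ = b₀ :=
        LinearMap.ext fun w => comp_hom_self (M := (𝓔.obj (op U)).cx) 0 (b₀ w)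
      have h5 : comp (𝓔.obj (op U)).cx 0 (c w) = _ := h w h1
      rw [← hed.hom_comp_zero h3, LinearMap.sub_apply, map_sub, comp_zero_cd, h4, h5,
        L.cd_neg_one, sub_self, map_zero])
  refine ⟨V, hV, hpV, ?_⟩
  refine (cls_eq (hc' := zero_mem _)).2 ?_
  rw [sub_zero]
  refine ⟨resT 𝓔 hV ∘ₗ hom _ 0 ∘ₗ b₀ + b, hasDeg_neg_one_iff.1 ((hb₁.push _).add hb),
    fun w hw => ?_⟩
  have h1 := hbe w hw
  rw [LinearMap.sub_apply, map_sub, totMap_cd, sub_eq_iff_eq_add] at h1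
  rw [← L.cd_neg_one, map_add, LinearMap.add_apply, add_comm]
  exact h1

theorem tKHtoLmKer_surjective (hex : LocExact 𝓔) {U : Opens X} (y : (LmKer L m).obj (𝓔.obj (op U)))
    {p : X} (hp : p ∈ U) : ∃ (V : Opens X) (hV : V ≤ U), p ∈ V ∧
      ∃ x, (tKHtoLmKer T L m).app _ x = (LmKer L m).map (𝓔.map (homOfLE hV).op) y := by
  obtain ⟨B⟩ := exists_coreBasis T L m
  obtain ⟨y, hy⟩ := y
  obtain ⟨z, hz, rfl⟩ := CochH.exists_rep y
  have hzd : HasDeg (degree _) 0 (hom (𝓔.obj (op U)).cx 0 ∘ₗ z) :=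
    (hasDeg_zero_iff.2 hz.1).hom_zero
  have hk := hzd.cd (L := L) (𝓔.obj (op U)).rep.isGraded (ε := 1)
  rw [zero_add] at hk
  have hB : (𝓔.obj (op U)).hd 0 z ∈ cochB L m 0 0 ((𝓔.obj (op U)).aComp 1 1) := by
    have := (cls_eq (hc' := zero_mem _)).1 (LinearMap.mem_ker.1 hy)
    rwa [sub_zero] at this
  obtain ⟨V, hV, hpV, b, hb, hbZ, hbe⟩ := exists_local_primitive_one (m := m) T hex hp hk
    (fun w hw => (𝓔.obj (op U)).rep.isRep.cd_cd (Or.inl rfl) _ hw) (fun w hw => by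
      have h1 := (actZero_aComp (𝓔.obj (op U)) 1).coboundary_core hB hw
      rw [L.cd_apply, parityPow_neg_one, B.headAct_core_hom _ _ hw, (mem_core.1 hw).2.2.2, map_zero,
        smul_zero, sub_zero, LinearMap.comp_apply, dTot_hom, ← map_add]
      exact (congrArg (hom _ 1) h1).trans (map_zero _))
  have hc : resT 𝓔 hV ∘ₗ hom _ 0 ∘ₗ z - b ∈
      cochZ L m (degree _) (dTot _) (𝓔.obj (op V)).rep.act :=
    ⟨hasDeg_zero_iff.1 ((hzd.push _).sub hb), fun w hw => by
      rw [← L.cd_one, map_sub, LinearMap.sub_apply, ← hbe w hw, totMap_cd, sub_self]⟩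
  refine ⟨V, hV, hpV, cls _ _ hc, Subtype.ext (cls_eq.2 ?_)⟩
  refine (actZero_aComp (𝓔.obj (op V)) 0).mem_cochB T (sub_mem ?_ ?_) fun w hw => ?_
  · exact ⟨hasDeg_zero_iff.1 ((hzd.push _).sub hb).comp_zero, fun w hw => by
      have h := congrArg (JacobiModuli.comp _ 0) (hc.2 w hw)
      rwa [← L.cd_one, comp_zero_cd, map_zero, L.cd_one] at h⟩
  · obtain ⟨h, -⟩ := CochH.push_cls (m := m) (L := L) (ν' := 0) (d' := 0)
      (a' := (𝓔.obj (op V)).aComp 0 0) ((𝓔.map (homOfLE hV).op).map.f 0).hom (by simp) (by simp)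
      (fun x e => DGMod.aComp_push _ 0 0 x e) z hz
    exact h
  · change comp _ 0 (resT 𝓔 hV (hom _ 0 (z w)) - b w) - ((𝓔.map (homOfLE hV).op).map.f 0).hom (z w) = 0
    rw [hbZ w hw, sub_zero, totMap_hom, comp_hom_self, sub_self]

end LocalBijectivity

/-! ## Germs and exactness -/

section Germs
variable {X : TopCat.{0}} {R : Type} [CommRing R] {F G H : Sh X R}

/-- The restriction of a section to a smaller open set. -/
abbrev rs (F : Sh X R) {U V : Opens X} (h : V ≤ U) : sec F (op U) →ₗ[R] sec F (op V) :=
  rsec F (homOfLE h).op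

theorem rs_rs (F : Sh X R) {U V W : Opens X} (h : V ≤ U) (h' : W ≤ V) (s : sec F (op U)) :
    rs F h' (rs F h s) = rs F (h'.trans h) s := res_res F.obj _ _ _ s

/-- The map of sections over `U` induced by a map of sheaves. -/
abbrev mapS (f : F ⟶ G) (U : Opens X) : sec F (op U) →ₗ[R] sec G (op U) :=
  ((secFun R (op U)).map f).hom

theorem mapS_rs (f : F ⟶ G) {U V : Opens X} (h : V ≤ U) (s : sec F (op U)) :
    mapS f V (rs F h s) = rs G h (mapS f U s) :=
  LinearMap.congr_fun (congrArg ModuleCat.Hom.hom (f.hom.naturality (homOfLE h).op)) s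

theorem mapS_comp (f : F ⟶ G) (g : G ⟶ H) (U : Opens X) (s : sec F (op U)) :
    mapS (f ≫ g) U s = mapS g U (mapS f U s) := rfl

theorem mapS_comp_eq_zero {f : F ⟶ G} {g : G ⟶ H} (w : f ≫ g = 0) (U : Opens X)
    (s : sec F (op U)) : mapS g U (mapS f U s) = 0 := by
  rw [← mapS_comp, w]; rfl

/-- The stalk of a sheaf of modules. -/
abbrev Stalk (F : Sh X R) (x : X) : ModuleCat.{0} R := TopCat.Presheaf.stalk F.obj x

/-- The germ of a section at a point. -/
abbrev germ (F : Sh X R) {U : Opens X} {x : X} (hx : x ∈ U) : sec F (op U) →ₗ[R] Stalk F x :=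
  (TopCat.Presheaf.germ F.obj U x hx).hom

theorem germ_rs (F : Sh X R) {U V : Opens X} (h : V ≤ U) {x : X} (hx : x ∈ V)
    (s : sec F (op U)) : germ F hx (rs F h s) = germ F (h hx) s :=
  TopCat.Presheaf.germ_res_apply F.obj (homOfLE h) x hx s

theorem germ_eq_iff {U V : Opens X} {x : X} (hx : x ∈ U) (hx' : x ∈ V) {s : sec F (op U)}
    {t : sec F (op V)} : germ F hx s = germ F hx' t ↔
      ∃ (W : Opens X) (h : W ≤ U) (h' : W ≤ V), x ∈ W ∧ rs F h s = rs F h' t := by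
  refine ⟨fun h => ?_, fun ⟨W, h, h', hxW, e⟩ => ?_⟩
  · obtain ⟨W, hW, i, j, e⟩ := TopCat.Presheaf.germ_eq F.obj x hx hx' s t h
    exact ⟨W, i.le, j.le, hW, e⟩
  · rw [← germ_rs F h hxW, e, germ_rs]

theorem germ_eq_iff' {U : Opens X} {x : X} (hx : x ∈ U) {s t : sec F (op U)} :
    germ F hx s = germ F hx t ↔ ∃ (W : Opens X) (h : W ≤ U), x ∈ W ∧ rs F h s = rs F h t :=
  (germ_eq_iff hx hx).trans ⟨fun ⟨W, h, _, hx, e⟩ => ⟨W, h, hx, e⟩, fun ⟨W, h, hx, e⟩ =>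
    ⟨W, h, h, hx, e⟩⟩

theorem eq_of_germ_eq {U : Opens X} {s t : sec F (op U)}
    (h : ∀ x (hx : x ∈ U), germ F hx s = germ F hx t) : s = t :=
  eq_of_locally_eq F fun x hx => germ_eq_iff' hx |>.1 (h x hx)

theorem exists_germ (F : Sh X R) {x : X} (σ : Stalk F x) :
    ∃ (U : Opens X) (hx : x ∈ U) (s : sec F (op U)), germ F hx s = σ :=
  TopCat.Presheaf.exists_germ_eq F.obj σ

/-- The map of stalks induced by a map of sheaves. -/
abbrev stalkMap (f : F ⟶ G) (x : X) : Stalk F x →ₗ[R] Stalk G x :=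
  ((TopCat.Presheaf.stalkFunctor _ x).map f.hom).hom

theorem stalkMap_germ (f : F ⟶ G) {U : Opens X} {x : X} (hx : x ∈ U) (s : sec F (op U)) :
    stalkMap f x (germ F hx s) = germ G hx (mapS f U s) :=
  TopCat.Presheaf.stalkFunctor_map_germ_apply U x hx f.hom s

/-- A complex of sheaves is exact if and only if cycles are locally boundaries. -/
theorem exact_iff_locally {f : F ⟶ G} {g : G ⟶ H} {w : f ≫ g = 0} :
    (ShortComplex.mk f g w).Exact ↔ ∀ (U : Opens X) (s : sec G (op U)), mapS g U s = 0 →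
      ∀ p ∈ U, ∃ (V : Opens X) (hV : V ≤ U), p ∈ V ∧ ∃ t, mapS f V t = rs G hV s := by
  refine (TopCat.Sheaf.exact_iff_stalkFunctor_map_exact _).trans ⟨fun h U s hs p hp => ?_,
    fun h x => ?_⟩
  · obtain ⟨τ, hτ⟩ := (ShortComplex.moduleCat_exact_iff _).1 (h p) (germ G hp s)
      ((stalkMap_germ g hp s).trans ((congrArg (germ H hp) hs).trans (map_zero _)))
    obtain ⟨V, hV, t, rfl⟩ := exists_germ F τ
    obtain ⟨W, h1, h2, hW, e⟩ := (germ_eq_iff hV hp).1 ((stalkMap_germ f hV t).symm.trans hτ)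
    exact ⟨W, h2, hW, rs F h1 t, by rw [mapS_rs, e]⟩
  · refine (ShortComplex.moduleCat_exact_iff _).2 fun (σ : Stalk G x) hσ => ?_
    obtain ⟨U, hU, s, rfl⟩ := exists_germ G σ
    have h1 : germ H hU (mapS g U s) = germ H hU 0 := by
      rw [map_zero, ← stalkMap_germ]; exact hσ
    obtain ⟨V, hV, hx, e⟩ := (germ_eq_iff' hU).1 h1
    rw [map_zero, ← mapS_rs] at e
    obtain ⟨W, hW, hxW, t, ht⟩ := h V _ e x hx
    refine ⟨germ F hxW t, (stalkMap_germ f hxW t).trans ?_⟩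
    rw [ht, germ_rs, germ_rs]

theorem epi_iff_locally {f : F ⟶ G} : Epi f ↔ ∀ (U : Opens X) (s : sec G (op U)), ∀ p ∈ U,
    ∃ (V : Opens X) (hV : V ≤ U), p ∈ V ∧ ∃ t, mapS f V t = rs G hV s :=
  ((ShortComplex.exact_iff_epi (ShortComplex.mk f (0 : G ⟶ G) Limits.comp_zero) rfl).symm.trans
    exact_iff_locally).trans ⟨fun h U s => h U s rfl, fun h U s _ => h U s⟩

theorem mono_iff_locally {f : F ⟶ G} : Mono f ↔ ∀ (U : Opens X) (s : sec F (op U)),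
    mapS f U s = 0 → s = 0 :=
  ((ShortComplex.exact_iff_mono (ShortComplex.mk (0 : F ⟶ F) f Limits.zero_comp) rfl).symm.trans
    exact_iff_locally).trans ⟨fun h U s hs => eq_of_locally_eq F fun p hp => by
      obtain ⟨V, hV, hpV, t, ht⟩ := h U s hs p hp
      exact ⟨V, hV, hpV, ht.symm.trans (map_zero (rs F hV)).symm⟩, fun h U s hs p hp =>
        ⟨U, le_rfl, hp, 0, by rw [h U s hs, map_zero, map_zero]⟩⟩

theorem mapS_injective (f : F ⟶ G) [Mono f] (U : Opens X) : Function.Injective (mapS f U) :=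
  (injective_iff_map_eq_zero _).2 (mono_iff_locally.1 inferInstance U)

theorem stalkMap_injective (f : F ⟶ G) [Mono f] (x : X) : Function.Injective (stalkMap f x) := by
  refine (injective_iff_map_eq_zero _).2 fun σ hσ => ?_
  obtain ⟨U, hU, s, rfl⟩ := exists_germ F σ
  rw [stalkMap_germ, ← map_zero (germ G hU)] at hσ
  obtain ⟨V, hV, hx, e⟩ := (germ_eq_iff' hU).1 hσ
  rw [map_zero, ← mapS_rs] at e
  rw [← germ_rs F hV hx, mono_iff_locally.1 ‹_› V _ e, map_zero]

/-- A section which maps to zero comes from the kernel. -/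
theorem exists_of_exact {f : F ⟶ G} {g : G ⟶ H} {w : f ≫ g = 0}
    (h : (ShortComplex.mk f g w).Exact) [Mono f] (U : Opens X) {s : sec G (op U)}
    (hs : mapS g U s = 0) : ∃ t, mapS f U t = s := by
  choose V hV hp t ht using exact_iff_locally.1 h U s hs
  obtain ⟨u, hu, -⟩ := TopCat.Sheaf.existsUnique_gluing' F (fun p : U => V p p.2) U
    (fun p => homOfLE (hV p p.2)) (fun p hp' => Opens.mem_iSup.2 ⟨⟨p, hp'⟩, hp p hp'⟩)
    (fun p => t p p.2) (fun p q => mapS_injective f _ (by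
      have h1 : ∀ {A B : Opens X} (h : A ≤ B) (h' : B ≤ U) (t : sec F (op B)),
          mapS f B t = rs G h' s → mapS f A (rs F h t) = rs G (h.trans h') s := fun h h' t ht => by
        rw [mapS_rs, ht, rs_rs]
      exact (h1 inf_le_left (hV p p.2) _ (ht p p.2)).trans
        (h1 inf_le_right (hV q q.2) _ (ht q q.2)).symm))
  refine ⟨u, eq_of_locally_eq G fun p hp' => ⟨V p hp', hV p hp', hp p hp', ?_⟩⟩
  refine (mapS_rs f (hV p hp') u).symm.trans ?_
  exact (congrArg (mapS f _) (hu ⟨p, hp'⟩)).trans (ht p hp')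

end Germs

section Resolutions
variable {X : TopCat.{0}} {R : Type} [CommRing R] {F : Sh X R} {C : CochainComplex (Sh X R) ℕ}

theorem exactAt_iff_locally (i : ℕ) : C.ExactAt (i + 1) ↔ ∀ (U : Opens X)
    (s : sec (C.X (i + 1)) (op U)), mapS (C.d (i + 1) (i + 2)) U s = 0 →
      ∀ p ∈ U, ∃ (V : Opens X) (hV : V ≤ U), p ∈ V ∧
        ∃ t, mapS (C.d i (i + 1)) V t = rs (C.X (i + 1)) hV s :=
  (C.exactAt_iff' i (i + 1) (i + 2) (by simp) (by simp)).trans exact_iff_locally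

theorem isResolution_iff {i : F ⟶ C.X 0} : IsResolution i ↔ Mono i ∧
    (∃ w, (ShortComplex.mk i (C.d 0 1) w).Exact) ∧ ∀ n, C.ExactAt (n + 1) := by
  have key : ∀ h : i ≫ C.d 0 1 = 0, QuasiIso ((CochainComplex.fromSingle₀Equiv C F).symm ⟨i, h⟩) ↔
      (Mono i ∧ (ShortComplex.mk i (C.d 0 1) h).Exact) ∧ ∀ n, C.ExactAt (n + 1) := fun h => by
    rw [quasiIso_iff]
    have h0 : QuasiIsoAt ((CochainComplex.fromSingle₀Equiv C F).symm ⟨i, h⟩) 0 ↔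
        Mono i ∧ (ShortComplex.mk i (C.d 0 1) h).Exact := by
      rw [CochainComplex.quasiIsoAt₀_iff, ShortComplex.quasiIso_iff_of_zeros]
      · refine (ShortComplex.exact_and_mono_f_iff_of_iso
          (S₂ := ShortComplex.mk i (C.d 0 1) h) ?_).trans and_comm
        exact ShortComplex.isoMk (Iso.refl _) (Iso.refl _) (Iso.refl _)
          (by simp; exact (Category.id_comp _).trans (Category.comp_id _).symm)
          (by simp; exact (Category.id_comp _).trans (Category.comp_id _).symm)
      · rfl
      · rfl
      · exact C.shape _ _ (by simp)
    have h1 : ∀ n, QuasiIsoAt ((CochainComplex.fromSingle₀Equiv C F).symm ⟨i, h⟩) (n + 1) ↔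
        C.ExactAt (n + 1) := fun n => quasiIsoAt_iff_exactAt _ _
          (CochainComplex.exactAt_succ_single_obj _ _)
    refine ⟨fun H => ⟨h0.1 (H 0), fun n => (h1 n).1 (H (n + 1))⟩, fun H n => ?_⟩
    cases n with
    | zero => exact h0.2 H.1
    | succ n => exact (h1 n).2 (H.2 n)
  refine ⟨fun ⟨h, q⟩ => ?_, fun ⟨h1, ⟨h, h2⟩, h3⟩ => ⟨h, (key h).2 ⟨⟨h1, h2⟩, h3⟩⟩⟩
  obtain ⟨⟨h1, h2⟩, h3⟩ := (key h).1 q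
  exact ⟨h1, ⟨h, h2⟩, h3⟩

end Resolutions

/-! ## Soft sheaves -/

section Soft
variable {X : TopCat.{0}} {R : Type} [CommRing R] {F G H N : Sh X R}

/-- A family of germs which locally on `Z` is given by sections over open sets. -/
def IsSecOn (F : Sh X R) (Z : Set X) (s : ∀ x : X, Stalk F x) : Prop :=
  ∀ x ∈ Z, ∃ (U : Opens X) (t : sec F (op U)), x ∈ U ∧ ∀ y (hy : y ∈ U), y ∈ Z → germ F hy t = s y

theorem isSoft_iff : IsSoft F ↔ ∀ Z : Set X, IsClosed Z → ∀ s, IsSecOn F Z s →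
    ∃ t : sec F (op ⊤), ∀ x ∈ Z, germ F (Opens.mem_top x) t = s x := Iff.rfl

open Classical in
/-- The germs of a section, extended by zero. -/
def germAt (F : Sh X R) {U : Opens X} (t : sec F (op U)) (x : X) : Stalk F x :=
  if h : x ∈ U then germ F h t else 0

theorem germAt_of {U : Opens X} (t : sec F (op U)) {x : X} (h : x ∈ U) :
    germAt F t x = germ F h t := dif_pos h

theorem IsSecOn.mono {Z Z' : Set X} (h : Z' ⊆ Z) {s : ∀ x : X, Stalk F x} (hs : IsSecOn F Z s) :
    IsSecOn F Z' s := fun x hx => by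
  obtain ⟨U, t, hxU, ht⟩ := hs x (h hx)
  exact ⟨U, t, hxU, fun y hy hyZ => ht y hy (h hyZ)⟩

theorem IsSecOn.congr {Z : Set X} {s s' : ∀ x : X, Stalk F x} (hs : IsSecOn F Z s)
    (h : ∀ x ∈ Z, s x = s' x) : IsSecOn F Z s' := fun x hx => by
  obtain ⟨U, t, hxU, ht⟩ := hs x hx
  exact ⟨U, t, hxU, fun y hy hyZ => (ht y hy hyZ).trans (h y hyZ)⟩

theorem isSecOn_germAt {U : Opens X} (t : sec F (op U)) {Z : Set X} (h : Z ⊆ U) :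
    IsSecOn F Z (germAt F t) := fun _ hx => ⟨U, t, h hx, fun _ hy _ => (germAt_of t hy).symm⟩

theorem IsSecOn.sub {Z : Set X} {s s' : ∀ x : X, Stalk F x} (hs : IsSecOn F Z s)
    (hs' : IsSecOn F Z s') : IsSecOn F Z fun x => s x - s' x := fun x hx => by
  obtain ⟨U, t, hxU, ht⟩ := hs x hx
  obtain ⟨V, t', hxV, ht'⟩ := hs' x hx
  refine ⟨U ⊓ V, rs F inf_le_left t - rs F inf_le_right t', ⟨hxU, hxV⟩, fun y hy hyZ => ?_⟩
  rw [map_sub, germ_rs, germ_rs, ht y _ hyZ, ht' y _ hyZ]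

theorem IsSecOn.union {A B : Set X} (hA : IsClosed A) (hB : IsClosed B) {s : ∀ x : X, Stalk F x}
    (hsA : IsSecOn F A s) (hsB : IsSecOn F B s) : IsSecOn F (A ∪ B) s := by
  have key : ∀ {A B : Set X}, IsClosed B → IsSecOn F A s → IsSecOn F B s → ∀ x ∈ A,
      ∃ (U : Opens X) (t : sec F (op U)), x ∈ U ∧
        ∀ y (hy : y ∈ U), y ∈ A ∪ B → germ F hy t = s y := by
    intro A B hB hsA hsB x hx
    obtain ⟨U, t, hxU, ht⟩ := hsA x hx
    by_cases hxB : x ∈ B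
    · obtain ⟨V, t', hxV, ht'⟩ := hsB x hxB
      obtain ⟨W, h1, h2, hxW, e⟩ := (germ_eq_iff hxU hxV).1 ((ht x hxU hx).trans (ht' x hxV hxB).symm)
      refine ⟨W, rs F h1 t, hxW, fun y hy hyZ => hyZ.elim (fun hyA => ?_) fun hyB => ?_⟩
      · rw [germ_rs, ht y _ hyA]
      · rw [e, germ_rs, ht' y _ hyB]
    · refine ⟨U ⊓ ⟨Bᶜ, hB.isOpen_compl⟩, rs F inf_le_left t, ⟨hxU, hxB⟩, fun y hy hyZ => ?_⟩
      rw [germ_rs, ht y _ (hyZ.resolve_right hy.2)]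
  rintro x (hx | hx)
  · exact key hB hsA hsB x hx
  · rw [Set.union_comm]
    exact key hA hsB hsA x hx

/-- A family of germs which is locally given by sections is given by a section. -/
theorem exists_of_isSecOn_univ {s : ∀ x : X, Stalk F x} (hs : IsSecOn F Set.univ s) :
    ∃ t : sec F (op ⊤), ∀ x, germ F (Opens.mem_top x) t = s x := by
  choose U t hU ht using fun x => hs x trivial
  obtain ⟨u, hu, -⟩ := TopCat.Sheaf.existsUnique_gluing' F U ⊤ (fun x => homOfLE le_top)
    (fun x _ => Opens.mem_iSup.2 ⟨x, hU x⟩) t (fun x y => eq_of_germ_eq fun z hz =>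
      ((germ_rs F inf_le_left hz (t x)).trans (ht x z _ trivial)).trans
        ((germ_rs F inf_le_right hz (t y)).trans (ht y z _ trivial)).symm)
  exact ⟨u, fun x => (germ_rs F le_top (hU x) u).symm.trans
    ((congrArg (germ F (hU x)) (hu x)).trans (ht x x _ trivial))⟩

theorem exists_kernel_section {ι : N ⟶ G} {φ : G ⟶ H} {w : ι ≫ φ = 0}
    (h : (ShortComplex.mk ι φ w).Exact) [Mono ι] {Z : Set X} {s : ∀ x : X, Stalk G x}
    (hs : IsSecOn G Z s) (h0 : ∀ x ∈ Z, stalkMap φ x (s x) = 0) :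
    ∃ n, IsSecOn N Z n ∧ ∀ x ∈ Z, stalkMap ι x (n x) = s x := by
  have key : ∀ x ∈ Z, ∃ (U : Opens X) (t : sec N (op U)), x ∈ U ∧
      ∀ y (hy : y ∈ U), y ∈ Z → stalkMap ι y (germ N hy t) = s y := fun x hx => by
    obtain ⟨U, t, hxU, ht⟩ := hs x hx
    have h1 : germ H hxU (mapS φ U t) = germ H hxU 0 := by
      rw [map_zero, ← stalkMap_germ, ht x hxU hx, h0 x hx]
    obtain ⟨V, hV, hxV, e⟩ := (germ_eq_iff' hxU).1 h1
    rw [map_zero, ← mapS_rs] at e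
    obtain ⟨n, hn⟩ := exists_of_exact h V e
    refine ⟨V, n, hxV, fun y hy hyZ => ?_⟩
    rw [stalkMap_germ, hn, germ_rs, ht y _ hyZ]
  have hn : ∀ x, ∃ n : Stalk N x, x ∈ Z → stalkMap ι x n = s x := fun x => by
    by_cases hx : x ∈ Z
    · obtain ⟨U, t, hxU, ht⟩ := key x hx
      exact ⟨germ N hxU t, fun _ => ht x hxU hx⟩
    · exact ⟨0, fun h => absurd h hx⟩
  choose n hn using hn
  refine ⟨n, fun x hx => ?_, hn⟩
  obtain ⟨U, t, hxU, ht⟩ := key x hx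
  exact ⟨U, t, hxU, fun y hy hyZ => stalkMap_injective ι y ((ht y hy hyZ).trans (hn y hyZ).symm)⟩

theorem exists_closed_cover [T2Space X] [ParacompactSpace X] {Z : Set X} (hZ : IsClosed Z)
    {U : Z → Opens X} (hU : ∀ x, x.1 ∈ U x) : ∃ K : Z → Set X, (∀ i, IsClosed (K i)) ∧
      LocallyFinite K ∧ (∀ i, K i ⊆ U i) ∧ Z ⊆ ⋃ i, interior (K i) := by
  obtain ⟨v, hv, hZv, hf, hvU⟩ := precise_refinement_set hZ (fun i => (U i : Set X))
    (fun i => (U i).isOpen) fun x hx => Set.mem_iUnion.2 ⟨⟨x, hx⟩, hU _⟩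
  obtain ⟨k, hZk, hko, hk⟩ := exists_subset_iUnion_closure_subset hZ hv
    (fun x _ => hf.point_finite x) hZv
  exact ⟨fun i => closure (k i), fun i => isClosed_closure, hf.subset hk,
    fun i => (hk i).trans (hvU i), hZk.trans (Set.iUnion_mono fun i =>
      interior_maximal subset_closure (hko i))⟩

/-- Sections over closed sets lift along surjective maps of sheaves with soft kernel. -/
theorem exists_lift_isSecOn [T2Space X] [ParacompactSpace X] {ι : N ⟶ G} {φ : G ⟶ H}
    {w : ι ≫ φ = 0} (hex : (ShortComplex.mk ι φ w).Exact) [Mono ι] [Epi φ] (hN : IsSoft N)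
    {Z : Set X} (hZ : IsClosed Z) {s : ∀ x : X, Stalk H x} (hs : IsSecOn H Z s) :
    ∃ t, IsSecOn G Z t ∧ ∀ x ∈ Z, stalkMap φ x (t x) = s x := by
  have hloc : ∀ x : Z, ∃ (U : Opens X) (τ : sec G (op U)), x.1 ∈ U ∧
      ∀ y (hy : y ∈ U), y ∈ Z → stalkMap φ y (germ G hy τ) = s y := fun x => by
    obtain ⟨U, σ, hxU, hσ⟩ := hs x x.2
    obtain ⟨V, hV, hxV, τ, hτ⟩ := (epi_iff_locally (f := φ)).1 inferInstance U σ x hxU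
    exact ⟨V, τ, hxV, fun y hy hyZ => by rw [stalkMap_germ, hτ, germ_rs, hσ y _ hyZ]⟩
  choose U τ hU hτ using hloc
  obtain ⟨K, hKc, hKf, hKU, hZK⟩ := exists_closed_cover hZ hU
  let A : Set Z → Set X := fun J => Z ∩ ⋃ i : J, K i
  have hA : ∀ J, IsClosed (A J) := fun J =>
    hZ.inter ((hKf.comp_injective Subtype.val_injective).isClosed_iUnion fun i => hKc i)
  have hmem : ∀ {J : Set Z} {y : X} {i : Z}, y ∈ Z → i ∈ J → y ∈ K i → y ∈ A J :=
    fun hy hi h => ⟨hy, Set.mem_iUnion.2 ⟨⟨_, hi⟩, h⟩⟩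
  let Q : Type := {p : Set Z × ∀ x : X, Stalk G x //
    IsSecOn G (A p.1) p.2 ∧ ∀ y ∈ A p.1, stalkMap φ y (p.2 y) = s y}
  let r : Q → Q → Prop := fun p q => p.1.1 ⊆ q.1.1 ∧ ∀ y ∈ A p.1.1, p.1.2 y = q.1.2 y
  have hAm : ∀ {J J' : Set Z}, J ⊆ J' → A J ⊆ A J' := fun {J J'} h y hy => by
    obtain ⟨i, hi⟩ := Set.mem_iUnion.1 hy.2
    exact hmem hy.1 (h i.2) hi
  obtain ⟨⟨⟨J, t⟩, hJ1, hJ2⟩, hmax⟩ := exists_maximal_of_chains_bounded (r := r) (fun c hc => by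
    classical
    let J : Set Z := ⋃ a ∈ c, a.1.1
    let t : ∀ x : X, Stalk G x := fun x =>
      if h : ∃ a ∈ c, x ∈ A a.1.1 then h.choose.1.2 x else 0
    have ht : ∀ a ∈ c, ∀ x ∈ A a.1.1, a.1.2 x = t x := fun a ha x hx => by
      have h : ∃ a ∈ c, x ∈ A a.1.1 := ⟨a, ha, hx⟩
      have hb := h.choose_spec
      simp only [t, dif_pos h]
      by_cases hab : a = h.choose
      · rw [← hab]
      · rcases hc ha hb.1 hab with h1 | h1
        · exact h1.2 x hx
        · exact (h1.2 x hb.2).symm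
    have hsub : ∀ S : Set Z, S.Finite → S.Nonempty → S ⊆ J → ∃ a ∈ c, S ⊆ a.1.1 :=
        fun S hS hne => by
      refine Set.Finite.induction_on (motive := fun S _ => S.Nonempty → S ⊆ J → ∃ a ∈ c, S ⊆ a.1.1)
        S hS (fun h => absurd h (by simp)) ?_ hne
      rintro i S - - ih - hi
      obtain ⟨a, ha, hia⟩ := Set.mem_iUnion₂.1 (hi (Set.mem_insert i S))
      rcases S.eq_empty_or_nonempty with rfl | hS
      · exact ⟨a, ha, by simpa using hia⟩
      · obtain ⟨b, hb, hSb⟩ := ih hS ((Set.subset_insert i S).trans hi)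
        by_cases hab : a = b
        · subst hab; exact ⟨a, ha, Set.insert_subset hia hSb⟩
        · rcases hc ha hb hab with h1 | h1
          · exact ⟨b, hb, Set.insert_subset (h1.1 hia) hSb⟩
          · exact ⟨a, ha, Set.insert_subset hia (hSb.trans h1.1)⟩
    have hAJ : ∀ y ∈ A J, ∃ a ∈ c, y ∈ A a.1.1 := fun y hy => by
      obtain ⟨⟨i, hi⟩, hiy⟩ := Set.mem_iUnion.1 hy.2
      obtain ⟨a, ha, hia⟩ := Set.mem_iUnion₂.1 hi
      exact ⟨a, ha, hmem hy.1 hia hiy⟩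
    refine ⟨⟨⟨J, t⟩, fun x hx => ?_, fun y hy => ?_⟩, fun a ha =>
      ⟨Set.subset_biUnion_of_mem (u := fun a : Q => a.1.1) ha, ht a ha⟩⟩
    · obtain ⟨W, hW, hWf⟩ := hKf x
      obtain ⟨W', hW', hW'o, hxW'⟩ := mem_nhds_iff.1 hW
      obtain ⟨⟨i, hi⟩, hix⟩ := Set.mem_iUnion.1 hx.2
      obtain ⟨a, ha, hSa⟩ := hsub ({i | (K i ∩ W).Nonempty} ∩ J) (hWf.inter_of_left _)
        ⟨i, ⟨x, hix, hW' hxW'⟩, hi⟩ Set.inter_subset_right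
      have haA : ∀ y ∈ W', y ∈ A J → y ∈ A a.1.1 := fun y hy hyA => by
        obtain ⟨⟨j, hj⟩, hjy⟩ := Set.mem_iUnion.1 hyA.2
        exact hmem hyA.1 (hSa ⟨⟨y, hjy, hW' hy⟩, hj⟩) hjy
      obtain ⟨V, t', hxV, ht'⟩ := a.2.1 x (haA x hxW' hx)
      refine ⟨V ⊓ ⟨W', hW'o⟩, rs G inf_le_left t', ⟨hxV, hxW'⟩, fun y hy hyA => ?_⟩
      rw [germ_rs, ht' y _ (haA y hy.2 hyA), ht a ha y (haA y hy.2 hyA)]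
    · obtain ⟨a, ha, hay⟩ := hAJ y hy
      exact (congrArg (stalkMap φ y) (ht a ha y hay).symm).trans (a.2.2 y hay))
    (fun h1 h2 => ⟨h1.1.trans h2.1, fun y hy => (h1.2 y hy).trans (h2.2 y (hAm h1.1 hy))⟩)
  have hJ : ∀ i, i ∈ J := fun i => by
    classical
    have hBU : Z ∩ K i ⊆ U i := Set.inter_subset_right.trans (hKU i)
    have hd : IsSecOn G (A J ∩ (Z ∩ K i)) fun x => t x - germAt G (τ i) x :=
      (hJ1.mono Set.inter_subset_left).sub (isSecOn_germAt (τ i) (Set.inter_subset_right.trans hBU))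
    obtain ⟨n, hn1, hn2⟩ := exists_kernel_section hex hd fun x hx => by
      rw [map_sub, hJ2 x hx.1, germAt_of _ (hBU hx.2), hτ i x _ hx.2.1, sub_self]
    obtain ⟨u, hu⟩ := isSoft_iff.1 hN _ ((hA J).inter (hZ.inter (hKc i))) n hn1
    let v : sec G (op (U i)) := τ i + rs G le_top (mapS ι ⊤ u)
    have hv : ∀ y (hy : y ∈ U i), germ G hy v = germ G hy (τ i) + stalkMap ι y (germ N (Opens.mem_top y) u) := fun y hy => by
      rw [map_add, germ_rs, stalkMap_germ]
    let t' : ∀ x : X, Stalk G x := fun x => if x ∈ A J then t x else germAt G v x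
    have h1 : ∀ x ∈ A J, t x = t' x := fun x hx => (if_pos hx).symm
    have h2 : ∀ x ∈ Z ∩ K i, germAt G v x = t' x := fun x hx => by
      by_cases hxA : x ∈ A J
      · rw [← h1 x hxA, germAt_of _ (hBU hx), hv, hu x ⟨hxA, hx⟩, hn2 x ⟨hxA, hx⟩,
          germAt_of _ (hBU hx), add_sub_cancel]
      · exact (if_neg hxA).symm
    have hAi : A (insert i J) = A J ∪ (Z ∩ K i) := by
      ext y
      refine ⟨fun hy => ?_, fun hy => hy.elim (fun hy => hAm (Set.subset_insert i J) hy)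
        fun hy => hmem hy.1 (Set.mem_insert i J) hy.2⟩
      obtain ⟨⟨j, hj⟩, hjy⟩ := Set.mem_iUnion.1 hy.2
      rcases hj with rfl | hj
      · exact Or.inr ⟨hy.1, hjy⟩
      · exact Or.inl (hmem hy.1 hj hjy)
    have hq : IsSecOn G (A (insert i J)) t' ∧ ∀ y ∈ A (insert i J), stalkMap φ y (t' y) = s y := by
      rw [hAi]
      refine ⟨(hJ1.congr h1).union (hA J) (hZ.inter (hKc i)) ((isSecOn_germAt v hBU).congr h2), ?_⟩
      rintro y (hy | hy)
      · rw [← h1 y hy, hJ2 y hy]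
      · rw [← h2 y hy, germAt_of _ (hBU hy), hv, map_add, hτ i y _ hy.1, stalkMap_germ ι,
          stalkMap_germ φ, mapS_comp_eq_zero w, map_zero, add_zero]
    exact (hmax ⟨⟨insert i J, t'⟩, hq⟩ ⟨Set.subset_insert i J, h1⟩).1 (Set.mem_insert i J)
  have hAZ : A J = Z := Set.inter_eq_left.2 fun x hx => by
    obtain ⟨i, hi⟩ := Set.mem_iUnion.1 (hZK hx)
    have hi := interior_subset hi
    exact Set.mem_iUnion.2 ⟨⟨i, hJ i⟩, hi⟩
  simp only [hAZ] at hJ1 hJ2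
  exact ⟨t, hJ1, hJ2⟩

/-- Global sections lift along surjective maps of sheaves with soft kernel. -/
theorem mapS_surjective_of_soft [T2Space X] [ParacompactSpace X] {ι : N ⟶ G} {φ : G ⟶ H}
    {w : ι ≫ φ = 0} (hex : (ShortComplex.mk ι φ w).Exact) [Mono ι] [Epi φ] (hN : IsSoft N) :
    Function.Surjective (mapS φ ⊤) := fun s => by
  obtain ⟨t, ht, hts⟩ := exists_lift_isSecOn hex hN isClosed_univ
    (isSecOn_germAt s (fun _ _ => trivial))
  obtain ⟨u, hu⟩ := exists_of_isSecOn_univ ht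
  refine ⟨u, eq_of_germ_eq fun x hx => ?_⟩
  rw [← stalkMap_germ, ← germAt_of s hx, ← hts x trivial]
  exact congrArg (stalkMap φ x) (hu x)

/-- The quotient of a soft sheaf by a soft sheaf is soft. -/
theorem isSoft_quotient [T2Space X] [ParacompactSpace X] {ι : N ⟶ G} {φ : G ⟶ H}
    {w : ι ≫ φ = 0} (hex : (ShortComplex.mk ι φ w).Exact) [Mono ι] [Epi φ] (hN : IsSoft N)
    (hG : IsSoft G) : IsSoft H := isSoft_iff.2 fun Z hZ s hs => by
  obtain ⟨t, ht, hts⟩ := exists_lift_isSecOn hex hN hZ hs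
  obtain ⟨u, hu⟩ := isSoft_iff.1 hG Z hZ t ht
  exact ⟨mapS φ ⊤ u, fun x hx => by rw [← stalkMap_germ, hu x hx, hts x hx]⟩

end Soft

/-! ## The sheaf of families of elements of modules attached to the points -/

section Godement
variable {X : TopCat.{0}} {R : Type} [CommRing R] (I : X → ModuleCat.{0} R)

/-- The presheaf of families of elements of the modules `I x`. -/
def prodPresheaf : (Opens X)ᵒᵖ ⥤ ModuleCat.{0} R where
  obj U := ModuleCat.of R (∀ x : U.unop, I x)
  map {U V} h := ModuleCat.ofHom
    { toFun := fun s x => s ⟨x.1, h.unop.le x.2⟩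
      map_add' := fun _ _ => rfl
      map_smul' := fun _ _ => rfl }

theorem isSheaf_prodPresheaf :
    Presheaf.IsSheaf (Opens.grothendieckTopology X) (prodPresheaf I) := by
  refine (TopCat.Presheaf.isSheaf_iff_isSheafUniqueGluing _).2 fun ι U sf hs => ?_
  have hmem : ∀ x : (iSup U : Opens X), ∃ i, x.1 ∈ U i := fun x => Opens.mem_iSup.1 x.2
  choose i hi using hmem
  have key : ∀ (a b : ι) (x : X) (ha : x ∈ U a) (hb : x ∈ U b),
      (show ∀ x : U a, I x from sf a) ⟨x, ha⟩ = (show ∀ x : U b, I x from sf b) ⟨x, hb⟩ :=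
    fun a b x ha hb => congrFun (hs a b) (⟨x, ha, hb⟩ : (U a ⊓ U b : Opens X))
  refine ⟨fun x : (iSup U : Opens X) => (show ∀ y : U (i x), I y from sf (i x)) ⟨x.1, hi x⟩,
    fun a => funext fun x => key _ _ _ _ _, fun t ht => funext fun x => ?_⟩
  exact congrFun (ht (i x)) (⟨x.1, hi x⟩ : U (i x))

/-- The sheaf of families of elements of the modules `I x`. -/
def prodSheaf : Sh X R := ⟨prodPresheaf I, isSheaf_prodPresheaf I⟩

variable {I}

/-- The value of a section at a point. -/
def prodSheaf.val {U : Opens X} (s : sec (prodSheaf I) (op U)) {x : X} (hx : x ∈ U) : I x :=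
  (show ∀ x : U, I x from s) ⟨x, hx⟩

theorem prodSheaf.ext {U : Opens X} {s t : sec (prodSheaf I) (op U)}
    (h : ∀ x (hx : x ∈ U), val s hx = val t hx) : s = t := funext fun x => h x.1 x.2

theorem prodSheaf.val_rs {U V : Opens X} (h : V ≤ U) (s : sec (prodSheaf I) (op U)) {x : X}
    (hx : x ∈ V) : val (rs (prodSheaf I) h s) hx = val s (h hx) := rfl

variable (I) in
/-- The value of a germ at a point. -/
def prodSheaf.ev (x : X) : Stalk (prodSheaf I) x ⟶ I x :=
  Limits.colimit.desc ((TopologicalSpace.OpenNhds.inclusion x).op ⋙ prodPresheaf I)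
    { pt := I x
      ι :=
        { app := fun U => ModuleCat.ofHom
            { toFun := fun s => (show ∀ x : U.unop.1, I x from s) ⟨x, U.unop.2⟩
              map_add' := fun _ _ => rfl
              map_smul' := fun _ _ => rfl } } }

theorem prodSheaf.ev_germ {U : Opens X} {x : X} (hx : x ∈ U) (s : sec (prodSheaf I) (op U)) :
    ev I x (germ (prodSheaf I) hx s) = val s hx :=
  LinearMap.congr_fun (congrArg ModuleCat.Hom.hom (Limits.colimit.ι_desc _ _ :
    TopCat.Presheaf.germ (prodPresheaf I) U x hx ≫ ev I x = _)) s

/-- Maps to the sheaf of families are given by maps of the stalks. -/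
def prodSheaf.lift {F : Sh X R} (f : ∀ x, Stalk F x ⟶ I x) : F ⟶ prodSheaf I :=
  ⟨{ app := fun U => ModuleCat.ofHom
      { toFun := fun s (x : U.unop) => f x (germ F x.2 s)
        map_add' := fun s t => funext fun x => by simp
        map_smul' := fun c s => funext fun x => by simp }
     naturality := fun U V h => by
      refine ModuleCat.hom_ext (LinearMap.ext fun s => funext fun x => ?_)
      exact congrArg (f x) (germ_rs F h.unop.le x.2 s) }⟩

instance [∀ x, Injective (I x)] : Injective (prodSheaf I) where
  factors {F G} g f _ := by
    let st : ∀ {A B : Sh X R} (f : A ⟶ B) (x : X), Stalk A x ⟶ Stalk B x := fun f x =>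
      (TopCat.Presheaf.stalkFunctor _ x).map f.hom
    have hf : ∀ x, Mono (st f x) := fun x =>
      (ModuleCat.mono_iff_injective _).2 (stalkMap_injective f x)
    let e : ∀ x, Stalk G x ⟶ I x := fun x =>
      Injective.factorThru (st g x ≫ prodSheaf.ev I x) (st f x)
    refine ⟨prodSheaf.lift e, (sheafToPresheaf _ _).map_injective (NatTrans.ext (funext fun U =>
      ModuleCat.hom_ext (LinearMap.ext fun (s : sec F U) =>
        prodSheaf.ext (U := U.unop) fun x hx => ?_)))⟩
    have h1 := LinearMap.congr_fun (congrArg ModuleCat.Hom.hom (Injective.comp_factorThru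
      (st g x ≫ prodSheaf.ev I x) (st f x))) (germ F hx s)
    have h2 : e x (stalkMap f x (germ F hx s)) = prodSheaf.ev I x (stalkMap g x (germ F hx s)) := h1
    rw [stalkMap_germ, stalkMap_germ, prodSheaf.ev_germ] at h2
    exact h2

theorem isSoft_prodSheaf [T2Space X] [ParacompactSpace X] : IsSoft (prodSheaf I) :=
    isSoft_iff.2 fun Z hZ s hs => by
  classical
  choose U τ hU hτ using fun x : Z => hs x x.2
  obtain ⟨K, hKc, hKf, hKU, hZK⟩ := exists_closed_cover hZ hU
  let v : ∀ x : (⊤ : Opens X), I x := fun x => if h : ∃ i, x.1 ∈ K i then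
    prodSheaf.val (τ h.choose) (hKU _ h.choose_spec) else 0
  refine ⟨v, fun x hx => ?_⟩
  obtain ⟨W, hW, hWf⟩ := hKf x
  obtain ⟨i₀, hi₀⟩ := Set.mem_iUnion.1 (hZK hx)
  have hxU : x ∈ U i₀ := hKU _ (interior_subset hi₀)
  have h1 : ∀ i, ∃ V : Opens X, x ∈ V ∧ ∀ y ∈ V, y ∈ K i → ∀ (hy : y ∈ U i₀) (hy' : y ∈ U i),
      prodSheaf.val (τ i) hy' = prodSheaf.val (τ i₀) hy := fun i => by
    by_cases hi : x ∈ K i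
    · obtain ⟨V, h1, h2, hxV, e⟩ := (germ_eq_iff (hKU i hi) hxU).1
        ((hτ i x (hKU i hi) hx).trans (hτ i₀ x hxU hx).symm)
      refine ⟨V, hxV, fun y hy _ hyU hyU' => ?_⟩
      have h3 := congrArg (fun t => prodSheaf.val t hy) e
      simpa only [prodSheaf.val_rs] using h3
    · exact ⟨⟨(K i)ᶜ, (hKc i).isOpen_compl⟩, hi, fun y hy hy' => absurd hy' hy⟩
  choose V hxV hV using h1
  have hO : (⋂ i ∈ {i | (K i ∩ W).Nonempty}, (V i : Set X)) ∩ (W ∩ interior (K i₀)) ∈ nhds x :=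
    Filter.inter_mem ((Filter.biInter_mem hWf).2 fun i _ => (V i).isOpen.mem_nhds (hxV i))
      (Filter.inter_mem hW (isOpen_interior.mem_nhds hi₀))
  obtain ⟨O, hO', hOo, hxO⟩ := mem_nhds_iff.1 hO
  have hOU : (⟨O, hOo⟩ : Opens X) ≤ U i₀ := fun y hy => hKU i₀ (interior_subset (hO' hy).2.2)
  refine Eq.trans ((germ_eq_iff (Opens.mem_top x) hxU).2 ⟨⟨O, hOo⟩, le_top, hOU, hxO,
    prodSheaf.ext fun y hy => ?_⟩) (hτ i₀ x hxU hx)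
  have h2 : ∃ i, y ∈ K i := ⟨i₀, interior_subset (hO' hy).2.2⟩
  have h3 : y ∈ V h2.choose := Set.mem_iInter₂.1 (hO' hy).1 h2.choose
    ⟨y, h2.choose_spec, (hO' hy).2.1⟩
  have h4 : v ⟨y, trivial⟩ = prodSheaf.val (τ h2.choose) (hKU _ h2.choose_spec) := dif_pos h2
  exact h4.trans (hV _ y h3 h2.choose_spec (hOU hy) _)

/-- Every sheaf of modules is a subsheaf of an injective soft sheaf. -/
theorem exists_mono_injective_soft [T2Space X] [ParacompactSpace X] (F : Sh X R) :
    ∃ (P : Sh X R) (f : F ⟶ P), Mono f ∧ Injective P ∧ IsSoft P := by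
  refine ⟨prodSheaf fun x => Injective.under (Stalk F x),
    prodSheaf.lift fun x => Injective.ι (Stalk F x), mono_iff_locally.2 fun U s hs => ?_,
    inferInstance, isSoft_prodSheaf⟩
  refine eq_of_germ_eq fun x hx => (ModuleCat.mono_iff_injective (Injective.ι (Stalk F x))).1
    inferInstance ?_
  rw [map_zero, map_zero]
  exact congrArg (fun t => prodSheaf.val t hx) hs

end Godement

/-! ## Cohomology and soft resolutions -/

section Cohomology
variable {X : TopCat.{0}} {R : Type} [CommRing R]

variable (X R) in
/-- The constant sheaf with value the ring of coefficients. -/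
abbrev constSh : Sh X R :=
  (constantSheaf (Opens.grothendieckTopology X) (ModuleCat.{0} R)).obj (ModuleCat.of R R)

/-- The adjunction between constant sheaves and global sections. -/
abbrev constAdj : constantSheaf (Opens.grothendieckTopology X) (ModuleCat.{0} R) ⊣ secFun R (op ⊤) :=
  constantSheafAdj _ _ (Limits.isTerminalTop : Limits.IsTerminal (⊤ : Opens X))

/-- The global section `1` of the constant sheaf. -/
def constOne : sec (constSh X R) (op ⊤) := constAdj.unit.app (ModuleCat.of R R) (1 : R)

/-- The global section of `F` defined by a map from the constant sheaf. -/
def evOne (F : Sh X R) : (constSh X R ⟶ F) →ₗ[R] sec F (op ⊤) where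
  toFun f := mapS f ⊤ constOne
  map_add' _ _ := rfl
  map_smul' _ _ := rfl

theorem evOne_bijective (F : Sh X R) : Function.Bijective (evOne F) := by
  have h : ∀ f, evOne F f = constAdj.homEquiv _ F f (1 : R) := fun f => by
    rw [Adjunction.homEquiv_unit]; rfl
  refine ⟨fun f g hfg => ?_, fun s => ?_⟩
  · rw [h, h] at hfg
    exact (constAdj.homEquiv _ F).injective (ModuleCat.hom_ext (LinearMap.ext_ring hfg))
  · obtain ⟨f, hf⟩ := (constAdj.homEquiv _ F).surjective
      (ModuleCat.ofHom (LinearMap.toSpanSingleton R (sec F (op ⊤)) s))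
    refine ⟨f, (h f).trans ((congrArg (fun g => g.hom (1 : R)) hf).trans ?_)⟩
    exact one_smul R s

theorem evOne_comp {F G : Sh X R} (f : constSh X R ⟶ F) (g : F ⟶ G) :
    evOne G (f ≫ g) = mapS g ⊤ (evOne F f) := rfl

/-- A short exact sequence of sheaves. -/
theorem shortExact_of {F G H : Sh X R} {f : F ⟶ G} {g : G ⟶ H} {w : f ≫ g = 0} [Mono f] [Epi g]
    (h : (ShortComplex.mk f g w).Exact) : (ShortComplex.mk f g w).ShortExact :=
  ShortComplex.ShortExact.mk' h inferInstance inferInstance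

theorem comp_extClass_eq_zero {A F G H : Sh X R} {f : F ⟶ G} {g : G ⟶ H} {w : f ≫ g = 0}
    (hS : (ShortComplex.mk f g w).ShortExact) (y : A ⟶ G) :
    (Abelian.Ext.mk₀ (y ≫ g)).comp hS.extClass (zero_add 1) = 0 := by
  rw [← Abelian.Ext.mk₀_comp_mk₀_assoc, hS.comp_extClass, Abelian.Ext.comp_zero]

/-- The cohomology of soft sheaves vanishes in positive degrees. -/
theorem subsingleton_of_soft [T2Space X] [ParacompactSpace X] (n : ℕ) {F : Sh X R}
    (hF : IsSoft F) : Subsingleton (Abelian.Ext.{0} (constSh X R) F (n + 1)) := by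
  induction n generalizing F with
  | zero =>
    obtain ⟨P, f, _, _, hP⟩ := exists_mono_injective_soft F
    have hS := shortExact_of (w := Limits.cokernel.condition f) (ShortComplex.exact_cokernel f)
    refine subsingleton_of_forall_eq 0 fun x => ?_
    obtain ⟨y, hy⟩ := Abelian.Ext.covariant_sequence_exact₁ _ hS x
      (Abelian.Ext.eq_zero_of_injective _) (zero_add 1)
    obtain ⟨g, rfl⟩ := (Abelian.Ext.mk₀_bijective _ _).2 y
    obtain ⟨t, ht⟩ := mapS_surjective_of_soft hS.exact hF (evOne _ g)
    obtain ⟨g', rfl⟩ := (evOne_bijective P).2 t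
    rw [← hy, ← (evOne_bijective _).1 ((evOne_comp g' _).trans ht)]
    exact comp_extClass_eq_zero hS g'
  | succ n ih =>
    obtain ⟨P, f, _, _, hP⟩ := exists_mono_injective_soft F
    have hS := shortExact_of (w := Limits.cokernel.condition f) (ShortComplex.exact_cokernel f)
    refine subsingleton_of_forall_eq 0 fun x => ?_
    obtain ⟨y, hy⟩ := Abelian.Ext.covariant_sequence_exact₁ _ hS x
      (Abelian.Ext.eq_zero_of_injective _) rfl
    have := ih (isSoft_quotient hS.exact hF hP)
    rw [← hy, Subsingleton.elim y 0, Abelian.Ext.zero_comp]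

variable {F G H : Sh X R} {f : F ⟶ G} {g : G ⟶ H} {w : f ≫ g = 0}

/-- The connecting map between the cohomology groups. -/
def connecting (hS : (ShortComplex.mk f g w).ShortExact) (n : ℕ) :
    Hcoh H n →ₗ[R] Hcoh F (n + 1) where
  toFun x := Abelian.Ext.comp (show Abelian.Ext.{0} _ H n from x) hS.extClass rfl
  map_add' _ _ := Abelian.Ext.add_comp _ _ _ _
  map_smul' _ _ := Abelian.Ext.smul_comp _ _ _ _

theorem connecting_surjective (hS : (ShortComplex.mk f g w).ShortExact) (n : ℕ)
    (hG : Subsingleton (Hcoh G (n + 1))) : Function.Surjective (connecting hS n) := fun x =>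
  Abelian.Ext.covariant_sequence_exact₁ _ hS x (hG.elim _ _) rfl

theorem connecting_injective (hS : (ShortComplex.mk f g w).ShortExact) (n : ℕ)
    (hG : Subsingleton (Hcoh G n)) : Function.Injective (connecting hS n) := by
  refine (injective_iff_map_eq_zero _).2 fun x hx => ?_
  obtain ⟨y, hy⟩ := Abelian.Ext.covariant_sequence_exact₃ _ hS x rfl hx
  have h0 : y = 0 := hG.elim y 0
  rw [← hy, h0, Abelian.Ext.zero_comp]
  rfl

variable (F) in
/-- The cohomology in degree `0` is the module of global sections. -/
def hcohZero : Hcoh F 0 ≃ₗ[R] sec F (op ⊤) :=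
  (Abelian.Ext.linearEquiv₀ (R := R) (X := constSh X R) (Y := F)).trans
    (LinearEquiv.ofBijective (evOne F) (evOne_bijective F))

theorem connecting_hcohZero_symm_eq_zero (hS : (ShortComplex.mk f g w).ShortExact)
    (z : sec H (op ⊤)) : connecting hS 0 ((hcohZero H).symm z) = 0 ↔ ∃ y, mapS g ⊤ y = z := by
  obtain ⟨x, rfl⟩ := (hcohZero H).surjective z
  rw [LinearEquiv.symm_apply_apply]
  have hx : ∀ x : constSh X R ⟶ H, hcohZero H (Abelian.Ext.mk₀ x : Hcoh H 0) = evOne H x :=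
    fun x => congrArg (evOne H) ((Abelian.Ext.linearEquiv₀ (R := R)).apply_symm_apply x)
  refine ⟨fun h => ?_, fun ⟨y, hy⟩ => ?_⟩
  · obtain ⟨y, rfl⟩ := Abelian.Ext.covariant_sequence_exact₃ _ hS x rfl h
    obtain ⟨y, rfl⟩ := (Abelian.Ext.mk₀_bijective _ _).2 y
    refine ⟨evOne G y, ?_⟩
    rw [Abelian.Ext.mk₀_comp_mk₀]
    exact (hx (y ≫ g)).symm
  · obtain ⟨x, rfl⟩ := (Abelian.Ext.mk₀_bijective _ _).2 x
    obtain ⟨y, rfl⟩ := (evOne_bijective G).2 y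
    rw [hx, ← evOne_comp] at hy
    rw [← (evOne_bijective H).1 hy]
    exact comp_extClass_eq_zero hS y

end Cohomology

section Homology
variable {R : Type} [CommRing R]

theorem exists_homology_projection (S : ShortComplex (ModuleCat.{0} R)) :
    ∃ π : LinearMap.ker S.g.hom →ₗ[R] S.homology, Function.Surjective π ∧
      ∀ x, π x = 0 ↔ ∃ y, S.f y = x.1 := by
  refine ⟨S.moduleCatHomologyIso.toLinearEquiv.symm.toLinearMap ∘ₗ Submodule.mkQ _,
    S.moduleCatHomologyIso.toLinearEquiv.symm.surjective.comp (Submodule.mkQ_surjective _),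
    fun x => (S.moduleCatHomologyIso.toLinearEquiv.symm.map_eq_zero_iff).trans
      ((Submodule.Quotient.mk_eq_zero (LinearMap.range S.moduleCatToCycles)).trans ?_)⟩
  exact ⟨fun ⟨y, hy⟩ => ⟨y, congrArg Subtype.val hy⟩, fun ⟨y, hy⟩ => ⟨y, Subtype.ext hy⟩⟩

theorem exists_homology_succ (D : CochainComplex (ModuleCat.{0} R) ℕ) (n : ℕ) :
    ∃ π : LinearMap.ker (D.d (n + 1) (n + 2)).hom →ₗ[R] D.homology (n + 1),
      Function.Surjective π ∧ ∀ x, π x = 0 ↔ ∃ y, D.d n (n + 1) y = x.1 := by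
  obtain ⟨π, h1, h2⟩ := exists_homology_projection (D.sc' n (n + 1) (n + 2))
  let e := (D.homologyIsoSc' n (n + 1) (n + 2) (by simp) (by simp)).toLinearEquiv.symm
  exact ⟨e.toLinearMap ∘ₗ π, e.surjective.comp h1, fun x => e.map_eq_zero_iff.trans (h2 x)⟩

theorem exists_homology_zero (D : CochainComplex (ModuleCat.{0} R) ℕ) :
    Nonempty (LinearMap.ker (D.d 0 1).hom ≃ₗ[R] D.homology 0) := by
  obtain ⟨π, h1, h2⟩ := exists_homology_projection (D.sc' 0 0 1)
  let e := (D.homologyIsoSc' 0 0 1 (by simp) (by simp)).toLinearEquiv.symm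
  refine ⟨LinearEquiv.ofBijective (e.toLinearMap ∘ₗ π) ⟨(injective_iff_map_eq_zero _).2
    fun x hx => ?_, e.surjective.comp h1⟩⟩
  obtain ⟨y, hy⟩ := (h2 x).1 (e.map_eq_zero_iff.1 hx)
  have h3 : D.d 0 0 = 0 := D.shape _ _ (by simp)
  refine Subtype.ext (hy.symm.trans ?_)
  change D.d 0 0 y = 0
  rw [h3]; rfl

end Homology

section SoftResolutions
variable {X : TopCat.{0}} {R : Type} [CommRing R] {C : CochainComplex (Sh X R) ℕ}

/-- The sheaf of cocycles of degree `k + 1`. -/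
theorem exists_cocycles {k : ℕ} {F : Sh X R} (i : F ⟶ C.X k) (w : i ≫ C.d k (k + 1) = 0)
    (hi : (ShortComplex.mk i (C.d k (k + 1)) w).Exact) (hex : C.ExactAt (k + 1)) :
    ∃ (Z : Sh X R) (ι : Z ⟶ C.X (k + 1)) (g : C.X k ⟶ Z) (_ : Mono ι) (_ : g ≫ ι = C.d k (k + 1))
      (wg : i ≫ g = 0) (_ : (ShortComplex.mk i g wg).Exact ∧ Epi g)
      (hZ : ι ≫ C.d (k + 1) (k + 2) = 0), (ShortComplex.mk ι (C.d (k + 1) (k + 2)) hZ).Exact := by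
  let ι := Limits.kernel.ι (C.d (k + 1) (k + 2))
  let g := Limits.kernel.lift (C.d (k + 1) (k + 2)) (C.d k (k + 1)) (C.d_comp_d _ _ _)
  have hg : g ≫ ι = C.d k (k + 1) := Limits.kernel.lift_ι _ _ _
  have wg : i ≫ g = 0 := by
    rw [← cancel_mono ι, Category.assoc, hg, w, Limits.zero_comp]
  refine ⟨_, ι, g, inferInstance, hg, wg, ⟨exact_iff_locally.2 fun U s hs =>
    exact_iff_locally.1 hi U s ?_, epi_iff_locally.2 fun U s p hp => ?_⟩,
    Limits.kernel.condition _, ShortComplex.exact_kernel _⟩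
  · rw [← hg, mapS_comp, hs, map_zero]
  · obtain ⟨V, hV, hpV, t, ht⟩ := (exactAt_iff_locally k).1 hex U (mapS ι U s)
      (mapS_comp_eq_zero (Limits.kernel.condition _) U s) p hp
    refine ⟨V, hV, hpV, t, mapS_injective ι V ?_⟩
    rw [← mapS_comp, hg, ht, mapS_rs]

variable [T2Space X] [ParacompactSpace X]

theorem hcoh_succ_iso (hC : ∀ i, IsSoft (C.X i)) (n : ℕ) : ∀ (k : ℕ) (F : Sh X R)
    (i : F ⟶ C.X k) (w : i ≫ C.d k (k + 1) = 0), (ShortComplex.mk i (C.d k (k + 1)) w).Exact →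
    Mono i → (∀ j, C.ExactAt (k + j + 1)) →
      Nonempty (Hcoh F (n + 1) ≃ₗ[R] (secCx C (op ⊤)).homology (k + n + 1)) := by
  induction n with
  | zero =>
    intro k F i w hi _ hex
    obtain ⟨Z, ι, g, hι, hg, wg, ⟨hS, _⟩, hZ, hZe⟩ := exists_cocycles i w hi (hex 0)
    obtain ⟨π, h1, h2⟩ := exists_homology_succ (secCx C (op ⊤)) k
    let e : sec Z (op ⊤) →ₗ[R] LinearMap.ker ((secCx C (op ⊤)).d (k + 1) (k + 2)).hom :=
      (mapS ι ⊤).codRestrict _ fun z => mapS_comp_eq_zero hZ ⊤ z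
    let a : sec Z (op ⊤) →ₗ[R] Hcoh F 1 :=
      connecting (shortExact_of hS) 0 ∘ₗ (hcohZero Z).symm.toLinearMap
    have ha : Function.Surjective a := (connecting_surjective (shortExact_of hS) 0
      (subsingleton_of_soft 0 (hC k))).comp (hcohZero Z).symm.surjective
    have hb : Function.Surjective (π ∘ₗ e) := h1.comp fun x => by
      obtain ⟨z, hz⟩ := exists_of_exact hZe ⊤ (LinearMap.mem_ker.1 x.2)
      exact ⟨z, Subtype.ext hz⟩
    have hab : LinearMap.ker a = LinearMap.ker (π ∘ₗ e) := by
      ext z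
      refine (connecting_hcohZero_symm_eq_zero (shortExact_of hS) z).trans ?_
      refine Iff.trans (exists_congr fun y => ?_) (h2 (e z)).symm
      refine (mapS_injective ι ⊤).eq_iff.symm.trans ?_
      rw [← mapS_comp, hg]
      rfl
    exact ⟨((a.quotKerEquivOfSurjective ha).symm ≪≫ₗ Submodule.quotEquivOfEq _ _ hab) ≪≫ₗ
      (π ∘ₗ e).quotKerEquivOfSurjective hb⟩
  | succ n ih =>
    intro k F i w hi _ hex
    obtain ⟨Z, ι, g, hι, hg, wg, ⟨hS, _⟩, hZ, hZe⟩ := exists_cocycles i w hi (hex 0)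
    obtain ⟨e⟩ := ih (k + 1) Z ι hZ hZe hι fun j => by
      have := hex (j + 1)
      rwa [← add_assoc, add_right_comm k] at this
    have hc : Function.Bijective (connecting (shortExact_of hS) (n + 1)) :=
      ⟨connecting_injective _ _ (subsingleton_of_soft n (hC k)),
        connecting_surjective _ _ (subsingleton_of_soft (n + 1) (hC k))⟩
    rw [show k + (n + 1) + 1 = k + 1 + n + 1 by omega]
    exact ⟨(LinearEquiv.ofBijective _ hc).symm ≪≫ₗ e⟩

/-- The cohomology of a sheaf is computed by the global sections of soft resolutions. -/
theorem hcoh_iso {F : Sh X R} {i : F ⟶ C.X 0} (hi : IsResolution i) (hC : ∀ i, IsSoft (C.X i)) :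
    ∀ n, Nonempty (Hcoh F n ≃ₗ[R] (secCx C (op ⊤)).homology n) := by
  obtain ⟨_, ⟨w, h⟩, hex⟩ := isResolution_iff.1 hi
  rintro (_ | n)
  · obtain ⟨e⟩ := exists_homology_zero (secCx C (op ⊤))
    let f : sec F (op ⊤) →ₗ[R] LinearMap.ker ((secCx C (op ⊤)).d 0 1).hom :=
      (mapS i ⊤).codRestrict _ fun z => mapS_comp_eq_zero w ⊤ z
    have hf : Function.Bijective f := ⟨fun x y hxy => mapS_injective i ⊤ (congrArg Subtype.val hxy),
      fun x => by
        obtain ⟨z, hz⟩ := exists_of_exact h ⊤ (LinearMap.mem_ker.1 x.2)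
        exact ⟨z, Subtype.ext hz⟩⟩
    exact ⟨(hcohZero F ≪≫ₗ LinearEquiv.ofBijective f hf) ≪≫ₗ e⟩
  · obtain ⟨e⟩ := hcoh_succ_iso hC n 0 F i w h ‹_› fun j => by
      rw [zero_add]; exact hex j
    rw [zero_add] at e
    exact ⟨e⟩

end SoftResolutions

/-! ## Local exactness of the complex `L_m` -/

section Filtration
variable {R : Type} [CommRing R] [Algebra ℂ R] {N N' : Type} [AddCommGroup N] [Module ℂ N]
  [AddCommGroup N'] [Module ℂ N']

/-- A projection to a complement of a smaller ideal in a larger one. -/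
theorem exists_graded_proj {I J : Ideal R} (h : J ≤ I) : ∃ π : R →ₗ[ℂ] R, (∀ r, π r ∈ I) ∧
    (∀ r ∈ J, π r = 0) ∧ ∀ r ∈ I, r - π r ∈ J := by
  obtain ⟨q, hq, hq'⟩ := exists_proj (I.restrictScalars ℂ)
  obtain ⟨p, hp, hp'⟩ := exists_proj (J.restrictScalars ℂ)
  refine ⟨(LinearMap.id - p) ∘ₗ q, fun r => I.sub_mem (hq r) (h (hp (q r))), fun r hr => ?_,
    fun r hr => ?_⟩
  · rw [LinearMap.comp_apply, hq' r (h hr), LinearMap.sub_apply, hp' r hr, LinearMap.id_apply,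
      sub_self]
  · rw [LinearMap.comp_apply, hq' r hr, LinearMap.sub_apply, LinearMap.id_apply, sub_sub_cancel]
    exact hp r

theorem tmul_mem_smul {I : Ideal R} {r : R} (hr : r ∈ I) (n : N) :
    r ⊗ₜ[ℂ] n ∈ I • (⊤ : Submodule R (R ⊗[ℂ] N)) := by
  have : r ⊗ₜ[ℂ] n = r • ((1 : R) ⊗ₜ[ℂ] n) := by rw [TensorProduct.smul_tmul', smul_eq_mul, mul_one]
  rw [this]
  exact Submodule.smul_mem_smul hr trivial

/-- Additive conditions on the elements of `I • (R ⊗ N)` are checked on tensors. -/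
theorem smul_top_induction {I : Ideal R} {p : R ⊗[ℂ] N → Prop} (h0 : p 0)
    (ht : ∀ r ∈ I, ∀ n : N, p (r ⊗ₜ[ℂ] n)) (ha : ∀ x y, p x → p y → p (x + y)) {x : R ⊗[ℂ] N}
    (hx : x ∈ I • (⊤ : Submodule R (R ⊗[ℂ] N))) : p x := by
  refine Submodule.smul_induction_on hx (fun r hr y hy => ?_) ha
  clear hy
  induction y with
  | zero => rwa [smul_zero]
  | add x y hx hy => rw [smul_add]; exact ha _ _ hx hy
  | tmul s n =>
    rw [TensorProduct.smul_tmul']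
    exact ht _ (I.mul_mem_right s hr) n

variable {I J : Ideal R} {π : R →ₗ[ℂ] R}

theorem rTensor_mem_smul (h : ∀ r, π r ∈ I) (x : R ⊗[ℂ] N) :
    LinearMap.rTensor N π x ∈ I • (⊤ : Submodule R (R ⊗[ℂ] N)) := by
  induction x with
  | zero => rw [map_zero]; exact zero_mem _
  | add x y hx hy => rw [map_add]; exact add_mem hx hy
  | tmul r n => exact tmul_mem_smul (h r) n

theorem rTensor_eq_zero (h : ∀ r ∈ J, π r = 0) {x : R ⊗[ℂ] N}
    (hx : x ∈ J • (⊤ : Submodule R (R ⊗[ℂ] N))) : LinearMap.rTensor N π x = 0 :=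
  smul_top_induction (p := fun x => LinearMap.rTensor N π x = 0) (map_zero _)
    (fun r hr n => by rw [LinearMap.rTensor_tmul, h r hr, TensorProduct.zero_tmul])
    (fun x y hx hy => by rw [map_add, hx, hy, add_zero]) hx

theorem sub_rTensor_mem (h : ∀ r ∈ I, r - π r ∈ J) {x : R ⊗[ℂ] N}
    (hx : x ∈ I • (⊤ : Submodule R (R ⊗[ℂ] N))) :
    x - LinearMap.rTensor N π x ∈ J • (⊤ : Submodule R (R ⊗[ℂ] N)) :=
  smul_top_induction (p := fun x => x - LinearMap.rTensor N π x ∈ J • (⊤ : Submodule R (R ⊗[ℂ] N)))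
    (by rw [map_zero, sub_zero]; exact zero_mem _)
    (fun r hr n => by
      rw [LinearMap.rTensor_tmul, ← TensorProduct.sub_tmul]
      exact tmul_mem_smul (h r hr) n)
    (fun x y hx hy => by rw [map_add, add_sub_add_comm]; exact add_mem hx hy) hx

theorem rTensor_lTensor_comm (f : N →ₗ[ℂ] N') (x : R ⊗[ℂ] N) :
    LinearMap.rTensor N' π (LinearMap.lTensor R f x) =
      LinearMap.lTensor R f (LinearMap.rTensor N π x) := by
  induction x with
  | zero => simp
  | add x y hx hy => simp only [map_add, hx, hy]
  | tmul r n => simp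

end Filtration

section LocalExactness
variable {K : CochainComplex (ModuleCat.{0} ℂ) ℕ} {T : Contraction K} {L : DGLie K} {m : ℕ}
  {X : TopCat.{0}} {𝓔 : (Opens X)ᵒᵖ ⥤ DGMod L}

theorem CoreBasis.finite_ring (B : CoreBasis T L m) : Module.Finite ℂ (L.Rm m) := by
  refine Module.Finite.of_injective (LinearMap.pi fun i => pairing (B.c i))
    ((injective_iff_map_eq_zero _).2 fun r hr => B.ext_ring fun w => ?_)
  obtain ⟨z, hz, rfl⟩ := r.exists_rep
  have h : ∀ i, z (B.c i) = 0 := fun i => congrFun hr i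
  have h2 : (w : Words (Tot K) ℂ) = ∑ i, B.z i w • (B.c i : Words (Tot K) ℂ) := by
    conv_lhs => rw [← B.sum_eq w]
    simp
  rw [pairing_mk, map_zero, h2, map_sum]
  exact Finset.sum_eq_zero fun i _ => by rw [map_smul, h, smul_zero]

/-- The restriction of elements with coefficients in `R_m`. -/
abbrev resR (𝓔 : (Opens X)ᵒᵖ ⥤ DGMod L) (m p : ℕ) {U V : Opens X} (h : V ≤ U) :
    L.Rm m ⊗[ℂ] (𝓔.obj (op U)).cx.X p →ₗ[ℂ] L.Rm m ⊗[ℂ] (𝓔.obj (op V)).cx.X p :=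
  LinearMap.lTensor (L.Rm m) ((𝓔.map (homOfLE h).op).map.f p).hom

theorem resR_resR {p : ℕ} {U V W : Opens X} (h : V ≤ U) (h' : W ≤ V)
    (t : L.Rm m ⊗[ℂ] (𝓔.obj (op U)).cx.X p) :
    resR 𝓔 m p h' (resR 𝓔 m p h t) = resR 𝓔 m p (h'.trans h) t := by
  rw [← LinearMap.comp_apply, ← LinearMap.lTensor_comp]
  have : 𝓔.map (homOfLE (h'.trans h)).op = 𝓔.map (homOfLE h).op ≫ 𝓔.map (homOfLE h').op := by
    rw [← 𝓔.map_comp]; rfl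
  change _ = LinearMap.lTensor _ ((𝓔.map (homOfLE (h'.trans h)).op).map.f p).hom t
  rw [this]
  rfl

theorem CoreBasis.tensD_resR (B : CoreBasis T L m) {p : ℕ} {U V : Opens X} (h : V ≤ U)
    (t : L.Rm m ⊗[ℂ] (𝓔.obj (op U)).cx.X p) :
    JacobiModuli.tensD B.phi (𝓔.obj (op V)) p (resR 𝓔 m p h t) =
      resR 𝓔 m (p + 1) h (JacobiModuli.tensD B.phi (𝓔.obj (op U)) p t) := by
  rw [← B.tensD_ring, ← B.tensD_ring]
  exact B.tensD_push (𝓔.map (homOfLE h).op) p t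

theorem CoreBasis.tensD_tensD (B : CoreBasis T L m) (E : DGMod L) (p : ℕ)
    (t : L.Rm m ⊗[ℂ] E.cx.X p) :
    JacobiModuli.tensD B.phi E (p + 1) (JacobiModuli.tensD B.phi E p t) = 0 := by
  obtain ⟨x, rfl⟩ := (B.isTautological.eval_bijective T (actZero_aComp E p)).2 t
  rw [← B.isTautological.eval_LmD, ← B.isTautological.eval_LmD, LmD_LmD, map_zero]

/-- Closed elements with coefficients are locally exact for the untwisted differential. -/
theorem LocExact.lTensor (hex : LocExact 𝓔) [Module.Finite ℂ (L.Rm m)] {U : Opens X} {q : X}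
    (hq : q ∈ U) (p : ℕ) {t : L.Rm m ⊗[ℂ] (𝓔.obj (op U)).cx.X (p + 1)}
    (ht : LinearMap.lTensor (L.Rm m) ((𝓔.obj (op U)).cx.d (p + 1) (p + 1 + 1)).hom t = 0) :
    ∃ (V : Opens X) (hV : V ≤ U), q ∈ V ∧ ∃ y,
      LinearMap.lTensor (L.Rm m) ((𝓔.obj (op V)).cx.d p (p + 1)).hom y = resR 𝓔 m (p + 1) hV t := by
  have hc : ∀ i, ((𝓔.obj (op U)).cx.d (p + 1) (p + 1 + 1)).hom (coords _ _ t i) = 0 := fun i => by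
    rw [← coords_lTensor, ht, coords_zero]
  obtain ⟨V, hVU, hqV, h⟩ := exists_open_forall hq
    (fun i V => ∃ hV : V ≤ U, ∃ y, ((𝓔.obj (op V)).cx.d p (p + 1)).hom y =
      ((𝓔.map (homOfLE hV).op).map.f (p + 1)).hom (coords _ _ t i))
    (fun i V W hW ⟨hV, y, hy⟩ => by
      refine ⟨hW.trans hV, ((𝓔.map (homOfLE hW).op).map.f p).hom y, ?_⟩
      have h1 := LinearMap.congr_fun (congrArg ModuleCat.Hom.hom
        ((𝓔.map (homOfLE hW).op).map.comm p (p + 1))) y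
      refine h1.trans ((congrArg ((𝓔.map (homOfLE hW).op).map.f (p + 1)).hom hy).trans ?_)
      have h2 : 𝓔.map (homOfLE (hW.trans hV)).op = 𝓔.map (homOfLE hV).op ≫ 𝓔.map (homOfLE hW).op := by
        rw [← 𝓔.map_comp]; rfl
      rw [h2]; rfl)
    (fun i => let ⟨V, hV, hpV, h⟩ := hex U p _ (hc i) q hq; ⟨V, hV, hpV, hV, h⟩)
  choose _ y hy using h
  refine ⟨V, hVU, hqV, ∑ i, Module.finBasis ℂ (L.Rm m) i ⊗ₜ y i, coords_bijective.1 (funext fun i => ?_)⟩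
  rw [coords_lTensor, coords_sum, coords_lTensor]
  exact hy i

theorem CoreBasis.exists_local_step (B : CoreBasis T L m) (hex : LocExact 𝓔) {U : Opens X} {q : X}
    (hq : q ∈ U) (p k : ℕ) {t : L.Rm m ⊗[ℂ] (𝓔.obj (op U)).cx.X (p + 1)}
    (htk : t ∈ augIdeal L m ^ k • (⊤ : Submodule (L.Rm m) (L.Rm m ⊗[ℂ] (𝓔.obj (op U)).cx.X (p + 1))))
    (ht : JacobiModuli.tensD B.phi (𝓔.obj (op U)) (p + 1) t = 0) :
    ∃ (V : Opens X) (hV : V ≤ U), q ∈ V ∧ ∃ y, resR 𝓔 m (p + 1) hV t -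
      JacobiModuli.tensD B.phi (𝓔.obj (op V)) p y ∈ augIdeal L m ^ (k + 1) •
        (⊤ : Submodule (L.Rm m) (L.Rm m ⊗[ℂ] (𝓔.obj (op V)).cx.X (p + 1))) := by
  have := B.finite_ring
  obtain ⟨π, h1, h2, h3⟩ := exists_graded_proj (Ideal.pow_le_pow_right (I := augIdeal L m)
    (Nat.le_succ k))
  have hφ : B.phi ∈ augIdeal L m • (⊤ : Submodule (L.Rm m) (L.Rm m ⊗[ℂ] K.X 1)) := by
    have h := sub_aug_mem B.phi
    have h' : slice DGLie.Rm.aug B.phi = 0 := by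
      have h4 := congrArg (TensorProduct.lid ℂ (K.X 1)) B.isTautological.aug
      have h5 : ∀ x : L.Rm m ⊗[ℂ] K.X 1, TensorProduct.lid ℂ (K.X 1)
          (LinearMap.rTensor (K.X 1) DGLie.Rm.aug x) = slice DGLie.Rm.aug x := fun x => by
        induction x with
        | zero => simp
        | add x y hx hy => simp only [map_add, hx, hy]
        | tmul r n => simp
      rw [← h5, h4, map_zero]
    rwa [h', TensorProduct.tmul_zero, sub_zero] at h
  have hopR : ∀ (E : DGMod L) (p : ℕ) {t : L.Rm m ⊗[ℂ] E.cx.X p},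
      t ∈ augIdeal L m ^ k • (⊤ : Submodule (L.Rm m) (L.Rm m ⊗[ℂ] E.cx.X p)) →
      opR (E.aComp p (p + 1) ∘ₗ hom K 1) B.phi t ∈ augIdeal L m ^ (k + 1) •
        (⊤ : Submodule (L.Rm m) (L.Rm m ⊗[ℂ] E.cx.X (p + 1))) := fun E p t ht => by
    rw [pow_succ']
    exact opR_mem _ hφ ht
  have hd : LinearMap.lTensor (L.Rm m) ((𝓔.obj (op U)).cx.d (p + 1) (p + 1 + 1)).hom
      (LinearMap.rTensor _ π t) = 0 := by
    rw [← rTensor_lTensor_comm]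
    rw [JacobiModuli.tensD_apply, add_eq_zero_iff_eq_neg] at ht
    rw [ht]
    exact rTensor_eq_zero h2 (neg_mem (hopR _ _ htk))
  obtain ⟨V, hV, hqV, y, hy⟩ := hex.lTensor hq p hd
  refine ⟨V, hV, hqV, LinearMap.rTensor _ π y, ?_⟩
  rw [JacobiModuli.tensD_apply, ← rTensor_lTensor_comm, hy, ← rTensor_lTensor_comm, ← sub_sub]
  have htV := lTensor_mem (((𝓔.map (homOfLE hV).op).map.f (p + 1)).hom) htk
  have h4 := sub_rTensor_mem h3 htV
  have h5 := rTensor_eq_zero h2 h4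
  rw [map_sub, sub_eq_zero] at h5
  refine sub_mem ?_ (hopR _ _ (rTensor_mem_smul h1 y))
  rw [← h5]
  exact h4

/-- The complex of the modules `R_m ⊗ E^p` is locally exact. -/
theorem CoreBasis.tensD_locExact (B : CoreBasis T L m) (hex : LocExact 𝓔) {U : Opens X} {q : X}
    (hq : q ∈ U) (p : ℕ) {t : L.Rm m ⊗[ℂ] (𝓔.obj (op U)).cx.X (p + 1)}
    (ht : JacobiModuli.tensD B.phi (𝓔.obj (op U)) (p + 1) t = 0) :
    ∃ (V : Opens X) (hV : V ≤ U), q ∈ V ∧ ∃ y,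
      JacobiModuli.tensD B.phi (𝓔.obj (op V)) p y = resR 𝓔 m (p + 1) hV t := by
  have key : ∀ k : ℕ, ∃ (V : Opens X) (hV : V ≤ U), q ∈ V ∧ ∃ y, resR 𝓔 m (p + 1) hV t -
      JacobiModuli.tensD B.phi (𝓔.obj (op V)) p y ∈ augIdeal L m ^ k •
        (⊤ : Submodule (L.Rm m) (L.Rm m ⊗[ℂ] (𝓔.obj (op V)).cx.X (p + 1))) := fun k => by
    induction k with
    | zero => exact ⟨U, le_rfl, hq, 0, by rw [pow_zero, Ideal.one_eq_top]; exact mem_top_smul _⟩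
    | succ k ih =>
      obtain ⟨V, hV, hqV, y, hy⟩ := ih
      obtain ⟨W, hW, hqW, z, hz⟩ := B.exists_local_step hex hqV p k hy (by
        rw [map_sub, B.tensD_resR, ht, map_zero, B.tensD_tensD, sub_zero])
      refine ⟨W, hW.trans hV, hqW, resR 𝓔 m p hW y + z, ?_⟩
      rwa [map_sub, resR_resR, ← B.tensD_resR, sub_sub, ← map_add] at hz
  obtain ⟨V, hV, hqV, y, hy⟩ := key (m + 1)
  rw [augIdeal_nilpotent, Submodule.bot_smul, Submodule.mem_bot, sub_eq_zero] at hy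
  exact ⟨V, hV, hqV, y, hy.symm⟩

/-- The complex `L_m` is locally exact. -/
theorem LmD_locExact (T : Contraction K) (hex : LocExact 𝓔) {U : Opens X} {q : X} (hq : q ∈ U)
    (p : ℕ) {x : LmX L m (𝓔.obj (op U)) (p + 1)} (hx : LmD m _ (p + 1) x = 0) :
    ∃ (V : Opens X) (hV : V ≤ U), q ∈ V ∧ ∃ y, LmD m (𝓔.obj (op V)) p y =
      LmX.push (𝓔.map (homOfLE hV).op) (p + 1) x := by
  obtain ⟨B⟩ := exists_coreBasis T L m
  obtain ⟨V, hV, hqV, t, ht⟩ := B.tensD_locExact hex hq p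
    (t := B.isTautological.eval (actZero_aComp _ (p + 1)) x)
    (by rw [← B.isTautological.eval_LmD, hx, map_zero])
  obtain ⟨y, rfl⟩ := (B.isTautological.eval_bijective T (actZero_aComp (𝓔.obj (op V)) p)).2 t
  refine ⟨V, hV, hqV, y, (B.isTautological.eval_bijective T (actZero_aComp _ _)).1 ?_⟩
  rw [B.isTautological.eval_LmD, ht]
  exact (B.isTautological.eval_push _ _ x).symm

end LocalExactness

section GlobalSections
variable {X : TopCat.{0}} {g : LieSheaf X} {G : SoftLieResolution g}

theorem locExact_secMods (E : AdmMod G) : LocExact ((secMods G).obj E) := fun U i x hx p hp =>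
  (exactAt_iff_locally i).1 ((isResolution_iff.1 E.isResolution).2.2 i) U x hx p hp

/-- The finiteness of the cohomology of a sheaf of Lie algebras gives a contraction of the complex
of global sections of a soft resolution to a finite-dimensional complex. -/
theorem exists_contraction_gcx [T2Space X] [ParacompactSpace X] (G : SoftLieResolution g)
    (hfin : ∀ i, Module.Finite ℂ (Hcoh g.sh i))
    (hvan : ∃ n : ℕ, ∀ i, n < i → Subsingleton (Hcoh g.sh i))
    (h0 : ∀ s : sec g.sh (op ⊤), s = 0) : Nonempty (Contraction G.gcx) := by
  have he := hcoh_iso G.isResolution G.isSoft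
  obtain ⟨_, ⟨w, h⟩, -⟩ := isResolution_iff.1 G.isResolution
  refine exists_contraction (fun x hx => ?_) (fun i => ?_) ?_
  · obtain ⟨s, rfl⟩ := exists_of_exact h ⊤ hx
    rw [h0 s, map_zero]
    rfl
  · obtain ⟨e⟩ := he (i + 1)
    have := hfin (i + 1)
    have hf : Module.Finite ℂ (G.gcx.homology (i + 1)) := Module.Finite.equiv e
    obtain ⟨π, h1, h2⟩ := exists_homology_succ G.gcx i
    obtain ⟨σ, hσ⟩ := π.exists_rightInverse_of_surjective (LinearMap.range_eq_top.2 h1)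
    refine ⟨LinearMap.range (Submodule.subtype _ ∘ₗ σ), Module.Finite.iff_fg.1 inferInstance,
      fun x hx => ?_⟩
    obtain ⟨y, hy⟩ := (h2 (⟨x, hx⟩ - σ (π ⟨x, hx⟩))).1 (by
      rw [map_sub, sub_eq_zero]; exact (LinearMap.congr_fun hσ _).symm)
    exact Submodule.mem_sup.2 ⟨_, ⟨π ⟨x, hx⟩, rfl⟩, _, ⟨y, hy⟩, add_sub_cancel _ _⟩
  · obtain ⟨n, hn⟩ := hvan
    refine ⟨n, fun i hi x hx => ?_⟩
    obtain ⟨e⟩ := he (i + 1)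
    have := hn (i + 1) (by omega)
    obtain ⟨π, h1, h2⟩ := exists_homology_succ G.gcx i
    exact (h2 ⟨x, hx⟩).1 (e.symm.injective (Subsingleton.elim _ _))

end GlobalSections

/-! ## Sheafification -/

section Sheafification
variable {X : TopCat.{0}} {R : Type} [CommRing R] {P Q P' : (Opens X)ᵒᵖ ⥤ ModuleCat.{0} R}

/-- The sheaf associated with a presheaf. -/
abbrev shf (P : (Opens X)ᵒᵖ ⥤ ModuleCat.{0} R) : Sh X R := (presheafToSheaf _ _).obj P

/-- The map of sheaves associated with a map of presheaves. -/
abbrev shfMap (a : P ⟶ Q) : shf P ⟶ shf Q := (presheafToSheaf _ _).map a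

variable (P) in
/-- The section of the associated sheaf defined by a section of a presheaf. -/
def tos (U : Opens X) : P.obj (op U) →ₗ[R] sec (shf P) (op U) :=
  ((toSheafify (Opens.grothendieckTopology X) P).app (op U)).hom

theorem tos_rs {U V : Opens X} (h : V ≤ U) (x : P.obj (op U)) :
    tos P V (P.map (homOfLE h).op x) = rs (shf P) h (tos P U x) :=
  LinearMap.congr_fun (congrArg ModuleCat.Hom.hom
    ((toSheafify (Opens.grothendieckTopology X) P).naturality (homOfLE h).op)) x

theorem mapS_tos (a : P ⟶ Q) {U : Opens X} (x : P.obj (op U)) :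
    mapS (shfMap a) U (tos P U x) = tos Q U (a.app (op U) x) :=
  (LinearMap.congr_fun (congrArg ModuleCat.Hom.hom (NatTrans.congr_app
    (toSheafify_naturality (Opens.grothendieckTopology X) a) (op U))) x).symm

theorem locally_eq_of_tos_eq {U : Opens X} {x y : P.obj (op U)} (h : tos P U x = tos P U y) {p : X}
    (hp : p ∈ U) : ∃ (V : Opens X) (hV : V ≤ U), p ∈ V ∧
      P.map (homOfLE hV).op x = P.map (homOfLE hV).op y := by
  obtain ⟨V, f, hf, hV⟩ := Presheaf.equalizerSieve_mem (Opens.grothendieckTopology X)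
    (toSheafify (Opens.grothendieckTopology X) P) x y h p hp
  exact ⟨V, f.le, hV, hf⟩

theorem exists_tos {U : Opens X} (s : sec (shf P) (op U)) {p : X} (hp : p ∈ U) :
    ∃ (V : Opens X) (hV : V ≤ U), p ∈ V ∧ ∃ x, tos P V x = rs (shf P) hV s := by
  obtain ⟨V, f, ⟨x, hx⟩, hV⟩ := Presheaf.imageSieve_mem (Opens.grothendieckTopology X)
    (toSheafify (Opens.grothendieckTopology X) P) s p hp
  exact ⟨V, f.le, hV, x, hx⟩

/-- A complex of presheaves which is locally exact becomes exact after sheafification. -/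
theorem exact_shfMap {a : P ⟶ Q} {b : Q ⟶ P'} (w : shfMap a ≫ shfMap b = 0)
    (h : ∀ (U : Opens X) (x : Q.obj (op U)), b.app (op U) x = 0 → ∀ p ∈ U, ∃ (V : Opens X)
      (hV : V ≤ U), p ∈ V ∧ ∃ y, a.app (op V) y = Q.map (homOfLE hV).op x) :
    (ShortComplex.mk (shfMap a) (shfMap b) w).Exact := by
  refine exact_iff_locally.2 fun U s hs p hp => ?_
  obtain ⟨V, hV, hpV, x, hx⟩ := exists_tos s hp
  obtain ⟨W, hW, hpW, e⟩ := locally_eq_of_tos_eq (x := b.app (op V) x) (y := 0) (by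
    rw [← mapS_tos, hx, mapS_rs, hs, map_zero, map_zero]) hpV
  obtain ⟨W', hW', hpW', y, hy⟩ := h W (Q.map (homOfLE hW).op x) (by
    refine (LinearMap.congr_fun (congrArg ModuleCat.Hom.hom (b.naturality (homOfLE hW).op)) x).trans
      (e.trans (map_zero _))) p hpW
  refine ⟨W', hW'.trans (hW.trans hV), hpW', tos P W' y, ?_⟩
  rw [mapS_tos, hy, tos_rs, tos_rs, hx, rs_rs, rs_rs]

theorem mono_shfMap {a : P ⟶ Q} (h : ∀ (U : Opens X) (x : P.obj (op U)), a.app (op U) x = 0 →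
    ∀ p ∈ U, ∃ (V : Opens X) (hV : V ≤ U), p ∈ V ∧ P.map (homOfLE hV).op x = 0) :
    Mono (shfMap a) := by
  refine (ShortComplex.exact_iff_mono (ShortComplex.mk (shfMap (0 : P ⟶ P)) (shfMap a)
    (by rw [← Functor.map_comp, Limits.zero_comp, Functor.map_zero])) (Functor.map_zero _ _ _)).1
    (exact_shfMap _ fun U x hx p hp => ?_)
  obtain ⟨V, hV, hpV, e⟩ := h U x hx p hp
  exact ⟨V, hV, hpV, 0, e.symm⟩

theorem epi_shfMap {a : P ⟶ Q} (h : ∀ (U : Opens X) (x : Q.obj (op U)), ∀ p ∈ U,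
    ∃ (V : Opens X) (hV : V ≤ U), p ∈ V ∧ ∃ y, a.app (op V) y = Q.map (homOfLE hV).op x) :
    Epi (shfMap a) :=
  (ShortComplex.exact_iff_epi (ShortComplex.mk (shfMap a) (shfMap (0 : Q ⟶ Q))
    (by rw [← Functor.map_comp, Limits.comp_zero, Functor.map_zero])) (Functor.map_zero _ _ _)).1
    (exact_shfMap _ fun U x _ p hp => h U x p hp)

end Sheafification

section SoftProducts
variable {X : TopCat.{0}} {R S : Type} [CommRing R] [CommRing S] {n : ℕ}

/-- A sheaf which is a product of finitely many soft sheaves is soft. -/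
theorem isSoft_of_bijective (F : Sh X R) (F' : Fin n → Sh X S) (hF' : ∀ k, IsSoft (F' k))
    (e : ∀ U : Opens X, sec F (op U) → ∀ k, sec (F' k) (op U)) (he : ∀ U, Function.Bijective (e U))
    (nat : ∀ {U V : Opens X} (h : V ≤ U) (x : sec F (op U)) (k : Fin n),
      e V (rs F h x) k = rs (F' k) h (e U x k)) : IsSoft F := by
  have hgerm : ∀ {U V : Opens X} {x : X} (hx : x ∈ U) (hx' : x ∈ V) (t : sec F (op U))
      (t' : sec F (op V)), germ F hx t = germ F hx' t' ↔
        ∀ k, germ (F' k) hx (e U t k) = germ (F' k) hx' (e V t' k) := by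
    intro U V x hx hx' t t'
    refine ⟨fun h k => ?_, fun h => ?_⟩
    · obtain ⟨W, h1, h2, hW, e⟩ := (germ_eq_iff hx hx').1 h
      exact (germ_eq_iff hx hx').2 ⟨W, h1, h2, hW, by rw [← nat, e, nat]⟩
    · have : ∀ k, ∃ W : Opens X, x ∈ W ∧ ∃ (h1 : W ≤ U) (h2 : W ≤ V),
          rs (F' k) h1 (e U t k) = rs (F' k) h2 (e V t' k) := fun k => by
        obtain ⟨W, h1, h2, hW, e⟩ := (germ_eq_iff hx hx').1 (h k)
        exact ⟨W, hW, h1, h2, e⟩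
      choose W hW h1 h2 hk using this
      obtain ⟨O, hO, hOW⟩ : ∃ O : Opens X, x ∈ O ∧ ∀ k, O ≤ W k :=
        ⟨⟨⋂ k, W k, isOpen_iInter_of_finite fun k => (W k).isOpen⟩,
          Set.mem_iInter.2 hW, fun k => Set.iInter_subset _ k⟩
      refine (germ_eq_iff hx hx').2 ⟨O ⊓ (U ⊓ V), inf_le_right.trans inf_le_left,
        inf_le_right.trans inf_le_right, ⟨hO, hx, hx'⟩, (he _).1 (funext fun k => ?_)⟩
      have h3 := congrArg (rs (F' k) (inf_le_left.trans (hOW k) : O ⊓ (U ⊓ V) ≤ W k)) (hk k)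
      rw [rs_rs, rs_rs] at h3
      rw [nat, nat, h3]
  intro Z hZ s hs
  choose V hV r hr using fun x => exists_germ F (s x)
  have hs' : ∀ k, ∃ t : sec (F' k) (op ⊤), ∀ x ∈ Z, germ (F' k) (Opens.mem_top x) t =
      germ (F' k) (hV x) (e _ (r x) k) := fun k => by
    refine hF' k Z hZ _ fun x hx => ?_
    obtain ⟨U, t, hxU, ht⟩ := hs x hx
    exact ⟨U, e U t k, hxU, fun y hy hyZ =>
      (hgerm hy (hV y) t (r y)).1 ((ht y hy hyZ).trans (hr y).symm) k⟩
  choose t ht using hs'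
  obtain ⟨u, hu⟩ := (he ⊤).2 t
  refine ⟨u, fun x hx => Eq.trans ?_ (hr x)⟩
  exact (hgerm (Opens.mem_top x) (hV x) u (r x)).2 fun k => by rw [hu]; exact ht k x hx

end SoftProducts

/-! ## Comparison of the sheaves -/

section Comparison
variable {X : TopCat.{0}} {g : LieSheaf X} {G : SoftLieResolution g} {m : ℕ}

theorem isIso_tKHtoLmKer (T : Contraction G.gcx) (E : AdmMod G) :
    IsIso ((shMap G (tKHtoLmKer T G.glie m)).app E) := by
  let a : sections (tKH G.glie m) E ⟶ sections (LmKer G.glie m) E :=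
    Functor.whiskerLeft _ (tKHtoLmKer T G.glie m)
  have h1 : Mono (shfMap a) := mono_shfMap fun U x hx p hp => by
    obtain ⟨V, hV, hpV, h⟩ := tKHtoLmKer_injective (T := T) (locExact_secMods E) hx hp
    exact ⟨V, hV, hpV, h⟩
  have h2 : Epi (shfMap a) := epi_shfMap fun U x p hp => by
    obtain ⟨V, hV, hpV, y, h⟩ := tKHtoLmKer_surjective (T := T) (locExact_secMods E) x hp
    exact ⟨V, hV, hpV, y, h⟩
  exact isIso_of_mono_of_epi (shfMap a)

/-- The sheaf `ℋ^0(ᵗK_m)` in terms of the complex `L_m`. -/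
def transposedIso (T : Contraction G.gcx) (m : ℕ) : transposedSheaf G m ≅ shFun G (LmKer G.glie m) :=
  NatIso.ofComponents (fun E => @asIso _ _ _ _ ((shMap G (tKHtoLmKer T G.glie m)).app E)
    (isIso_tKHtoLmKer T E))
    fun f => (shMap G (tKHtoLmKer T G.glie m)).naturality f

theorem LmComplex_d (E : AdmMod G) (p : ℕ) : ((LmComplex G m).obj E).d p (p + 1) =
    (shMap G (LmDiff G.glie m p)).app E :=
  CochainComplex.of_d (fun p => (shFun G (LmFun G.glie m p)).obj E)
    (fun p => (shMap G (LmDiff G.glie m p)).app E) p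

/-- The complex of sheaves `L_m` is exact in positive degrees. -/
theorem exactAt_LmComplex (T : Contraction G.gcx) (E : AdmMod G) (p : ℕ) :
    ((LmComplex G m).obj E).ExactAt (p + 1) := by
  refine (HomologicalComplex.exactAt_iff' _ p (p + 1) (p + 1 + 1) (by simp) (by simp)).2 ?_
  have h := exact_shfMap (P := sections (LmFun G.glie m p) E)
    (Q := sections (LmFun G.glie m (p + 1)) E) (P' := sections (LmFun G.glie m (p + 1 + 1)) E)
    (a := Functor.whiskerLeft _ (LmDiff G.glie m p)) (b := Functor.whiskerLeft _ (LmDiff G.glie m (p + 1)))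
    (shMap_LmDiff G m E p) fun U x hx q hq => LmD_locExact T (locExact_secMods E) hq p hx
  have key : ∀ (d : ((LmComplex G m).obj E).X p ⟶ ((LmComplex G m).obj E).X (p + 1))
      (d' : ((LmComplex G m).obj E).X (p + 1) ⟶ ((LmComplex G m).obj E).X (p + 1 + 1))
      (_ : d = (shMap G (LmDiff G.glie m p)).app E)
      (_ : d' = (shMap G (LmDiff G.glie m (p + 1))).app E) (w : d ≫ d' = 0),
      (ShortComplex.mk d d' w).Exact := by
    rintro _ _ rfl rfl w
    exact h
  exact key _ _ (LmComplex_d E p) (LmComplex_d E (p + 1)) _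

variable (G m) in
/-- The inclusion of the kernel of the first differential of `L_m`. -/
def LmKer.ι : LmKer G.glie m ⟶ LmFun G.glie m 0 where
  app E := ModuleCat.ofHom (LinearMap.ker (LmD m E 0)).subtype

variable (G m) in
/-- The augmentation of the complex of sheaves `L_m`. -/
def LmComplex.aug (E : AdmMod G) :
    (shFun G (LmKer G.glie m)).obj E ⟶ ((LmComplex G m).obj E).X 0 := (shMap G (LmKer.ι G m)).app E

instance (E : AdmMod G) : Mono (LmComplex.aug G m E) :=
  mono_shfMap (P := sections (LmKer G.glie m) E) (Q := sections (LmFun G.glie m 0) E)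
    (a := Functor.whiskerLeft _ (LmKer.ι G m)) fun U _ hx _ hp =>
      ⟨U, le_rfl, hp, (congrArg _ (Subtype.ext hx)).trans (map_zero _)⟩

theorem LmComplex.aug_comp (E : AdmMod G) :
    (shMap G (LmKer.ι G m)).app E ≫ (shMap G (LmDiff G.glie m 0)).app E = 0 := by
  rw [← NatTrans.comp_app, ← shMap_comp]
  have : LmKer.ι G m ≫ LmDiff G.glie m 0 = 0 := by
    ext E x
    exact x.2
  rw [this, shMap_zero]
  rfl

theorem LmComplex.aug_d (E : AdmMod G) : aug G m E ≫ ((LmComplex G m).obj E).d 0 1 = 0 :=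
  (congrArg (fun d => aug G m E ≫ d) (LmComplex_d E 0)).trans (aug_comp E)

theorem LmComplex.exact_aug (E : AdmMod G) :
    (ShortComplex.mk (aug G m E) (((LmComplex G m).obj E).d 0 1) (aug_d E)).Exact := by
  have h := exact_shfMap (P := sections (LmKer G.glie m) E) (Q := sections (LmFun G.glie m 0) E)
    (P' := sections (LmFun G.glie m 1) E) (a := Functor.whiskerLeft _ (LmKer.ι G m))
    (b := Functor.whiskerLeft _ (LmDiff G.glie m 0)) (aug_comp E)
    fun U x hx q hq => ⟨U, le_rfl, hq, ⟨x, hx⟩, (res_self (sections (LmFun G.glie m 0) E) _ x).symm⟩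
  have key : ∀ (d : ((LmComplex G m).obj E).X 0 ⟶ ((LmComplex G m).obj E).X 1)
      (_ : d = (shMap G (LmDiff G.glie m 0)).app E) (w : aug G m E ≫ d = 0),
      (ShortComplex.mk (aug G m E) d w).Exact := by
    rintro _ rfl w
    exact h
  exact key _ (LmComplex_d E 0) _

/-- The augmentation of `L_m` as a map to its cohomology. -/
def LmComplex.augHomology (E : AdmMod G) :
    (shFun G (LmKer G.glie m)).obj E ⟶ ((LmComplex G m).obj E).homology 0 :=
  ((LmComplex G m).obj E).liftCycles (aug G m E) 1 (by simp) (aug_d E) ≫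
    ((LmComplex G m).obj E).homologyπ 0

instance LmComplex.isIso_augHomology (E : AdmMod G) : IsIso (LmComplex.augHomology (m := m) E) := by
  have h1 : IsIso (((LmComplex G m).obj E).homologyπ 0) :=
    ((LmComplex G m).obj E).isIso_homologyπ 0 0 (by simp) (by simp)
  have h2 : IsIso (((LmComplex G m).obj E).liftCycles (LmComplex.aug G m E) 1 (by simp)
      (LmComplex.aug_d E)) := by
    have hm : Mono (ShortComplex.mk (LmComplex.aug G m E) (((LmComplex G m).obj E).d 0 1)
      (LmComplex.aug_d E)).f := inferInstanceAs (Mono (LmComplex.aug G m E))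
    have h3 := (LmComplex.exact_aug (m := m) E).lift_f (((LmComplex G m).obj E).iCycles 0) (by simp)
    refine ⟨(LmComplex.exact_aug E).lift (((LmComplex G m).obj E).iCycles 0) (by simp), ?_, ?_⟩
    · rw [← cancel_mono (LmComplex.aug G m E)]
      dsimp only at h3
      rw [Category.assoc, h3, HomologicalComplex.liftCycles_i, Category.id_comp]
    · rw [← cancel_mono (((LmComplex G m).obj E).iCycles 0)]
      rw [Category.assoc, HomologicalComplex.liftCycles_i, Category.id_comp]
      exact h3
  exact IsIso.comp_isIso

variable (G m) in
/-- The cohomology of `L_m` in degree `0`. -/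
def LmComplex.homologyZeroIso :
    LmComplex G m ⋙ HomologicalComplex.homologyFunctor _ _ 0 ≅ shFun G (LmKer G.glie m) :=
  (NatIso.ofComponents (fun E => @asIso _ _ _ _ (augHomology E) (isIso_augHomology E)) fun {E E'} f => by
    change _ ≫ augHomology E' = augHomology E ≫ HomologicalComplex.homologyMap _ 0
    rw [augHomology, augHomology, Category.assoc, HomologicalComplex.homologyπ_naturality,
      ← Category.assoc, ← Category.assoc]
    congr 1
    rw [← cancel_mono (((LmComplex G m).obj E').iCycles 0), Category.assoc, Category.assoc,
      HomologicalComplex.cyclesMap_i, HomologicalComplex.liftCycles_i,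
      HomologicalComplex.liftCycles_i_assoc]
    exact (shMap G (LmKer.ι G m)).naturality f).symm

/-- The sheaves of the complex `L_m` are soft. -/
theorem isSoft_LmComplex (T : Contraction G.gcx) (E : AdmMod G) (p : ℕ) :
    IsSoft (((LmComplex G m).obj E).X p) := by
  obtain ⟨B⟩ := exists_coreBasis T G.glie m
  have := B.finite_ring
  let P := sections (LmFun G.glie m p) E
  let e : ∀ U : Opens X, P.obj (op U) → Fin (Module.finrank ℂ (G.Rm m)) →
      sec (E.cx.X p) (op U) := fun U x =>
    coords (G.Rm m) (sec (E.cx.X p) (op U)) (B.isTautological.eval (actZero_aComp (E.secMod (op U)) p) x)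
  have he : ∀ U, Function.Bijective (e U) := fun U =>
    coords_bijective.comp (B.isTautological.eval_bijective T (actZero_aComp (E.secMod (op U)) p))
  have nat : ∀ {U V : Opens X} (h : V ≤ U) (x : P.obj (op U)) k,
      e V (P.map (homOfLE h).op x) k = rs (E.cx.X p) h (e U x k) := fun {U V} h x k =>
    (congrArg (fun t => coords (G.Rm m) (sec (E.cx.X p) (op V)) t k)
      (B.isTautological.eval_push (((secMods G).obj E).map (homOfLE h).op) p x)).trans
        (coords_lTensor (rsec (E.cx.X p) (homOfLE h).op) _ k)
  have hP : Presheaf.IsSheaf (Opens.grothendieckTopology X) P :=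
    isSheaf_of_embedding P (fun _ => E.cx.X p) e (fun U => (he U).1) nat fun U y _ => (he U).2 y
  have hb : ∀ U : Opens X, Function.Bijective (tos P U) := fun U => by
    have := isIso_toSheafify (Opens.grothendieckTopology X) hP
    exact ConcreteCategory.bijective_of_isIso
      ((toSheafify (Opens.grothendieckTopology X) P).app (op U))
  let τ : ∀ U : Opens X, P.obj (op U) ≃ₗ[G.Rm m] sec (shf P) (op U) := fun U =>
    LinearEquiv.ofBijective (tos P U) (hb U)
  refine isSoft_of_bijective (shf P) (fun _ => E.cx.X p) (fun _ => E.isSoft p)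
    (fun U s => e U ((τ U).symm s))
    (fun U => (he U).comp (τ U).symm.bijective) fun {U V} h s k => ?_
  obtain ⟨x, rfl⟩ := (τ U).surjective s
  rw [LinearEquiv.symm_apply_apply, ← nat]
  exact congrArg (fun y => e V y k) ((LinearEquiv.symm_apply_eq (τ V)).2 (tos_rs h x).symm)

theorem isResolution_LmComplex (T : Contraction G.gcx) (E : AdmMod G) {F : Sh X (G.Rm m)}
    (α : F ≅ (shFun G (LmKer G.glie m)).obj E) : IsResolution (α.hom ≫ LmComplex.aug G m E) := by
  have w : (α.hom ≫ LmComplex.aug G m E) ≫ ((LmComplex G m).obj E).d 0 1 = 0 := by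
    rw [Category.assoc, LmComplex.aug_d, Limits.comp_zero]
  refine isResolution_iff.2 ⟨mono_comp _ _, ⟨w, ?_⟩, exactAt_LmComplex T E⟩
  exact ShortComplex.exact_of_iso (ShortComplex.isoMk
    (S₁ := ShortComplex.mk (LmComplex.aug G m E) _ (LmComplex.aug_d E))
    (S₂ := ShortComplex.mk (α.hom ≫ LmComplex.aug G m E) _ w)
    α.symm (Iso.refl _) (Iso.refl _) (by simp) (by simp)) (LmComplex.exact_aug E)

variable (m) in
/-- The sheaf `M_m` in terms of the complex `L_m`. -/
theorem nonempty_moduliIso (T : Contraction G.gcx) :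
    Nonempty (moduliSheaf G m ≅ shFun G (LmKer G.glie m)) := by
  obtain ⟨B⟩ := exists_coreBasis T G.glie m
  exact ⟨B.moduliIso ≪≫ (shIso (LmKerIso T B.isTautological)).symm⟩

end Comparison

end
end JacobiModuli

theorem theorem5p1 (X : TopCat.{0}) [T2Space X] [ParacompactSpace X]
    (g : JacobiModuli.LieSheaf X) (G : JacobiModuli.SoftLieResolution g)
    (hfin : ∀ i, Module.Finite ℂ (JacobiModuli.Hcoh g.sh i))
    (hvan : ∃ n : ℕ, ∀ i, n < i → Subsingleton (JacobiModuli.Hcoh g.sh i))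
    (h0 : ∀ s : JacobiModuli.sec g.sh (op ⊤), s = 0) (m : ℕ) :
    (∃ φ : G.Rm m ⊗[ℂ] G.gcx.X 1, JacobiModuli.IsTautological φ) ∧
    (∀ φ : G.Rm m ⊗[ℂ] G.gcx.X 1, JacobiModuli.IsTautological φ →
      Nonempty (JacobiModuli.deformation G φ ≅ JacobiModuli.moduliSheaf G m)) ∧
    Nonempty (JacobiModuli.moduliSheaf G m ≅ JacobiModuli.transposedSheaf G m) ∧
    (∀ (E : JacobiModuli.AdmMod G) (i : ℕ), 0 < i →
      ((JacobiModuli.LmComplex G m).obj E).ExactAt i) ∧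
    Nonempty (JacobiModuli.LmComplex G m ⋙ HomologicalComplex.homologyFunctor _ _ 0 ≅
      JacobiModuli.moduliSheaf G m) ∧
    ∀ (E : JacobiModuli.AdmMod G) (i : ℕ),
      Nonempty (JacobiModuli.Hcoh ((JacobiModuli.moduliSheaf G m).obj E) i ≃ₗ[G.Rm m]
        (JacobiModuli.secCx ((JacobiModuli.LmComplex G m).obj E) (op ⊤)).homology i) := by
  open JacobiModuli in
  obtain ⟨T⟩ := exists_contraction_gcx G hfin hvan h0
  obtain ⟨B⟩ := exists_coreBasis T G.glie m
  obtain ⟨e⟩ := nonempty_moduliIso m T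
  refine ⟨⟨B.phi, B.isTautological⟩, fun φ hφ => ⟨shIso (LmKerIso T hφ).symm ≪≫ e.symm⟩,
    ⟨e ≪≫ (transposedIso T m).symm⟩, fun E i hi => ?_,
    ⟨LmComplex.homologyZeroIso G m ≪≫ e.symm⟩, fun E => ?_⟩
  · obtain ⟨p, rfl⟩ := Nat.exists_eq_add_of_lt hi
    rw [zero_add]
    exact exactAt_LmComplex T E p
  · exact hcoh_iso (isResolution_LmComplex T E (e.app E)) (isSoft_LmComplex T E)
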